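/- Let $k$ be a field and $H$ a Hopf algebra over $k$, with comultiplication $\Delta(h)=h^{(1)}\otimes h^{(2)}$ and counit $\varepsilon$; $\otimes=\otimes_k$. A Hopf bimodule is an $H$-bimodule $M$ which is also an $H$-bicomodule such that both coactions $M\to H\otimes M$, $M\to M\otimes H$ are bimodule maps ($H$ acting diagonally on $H\otimes M$ and $M\otimes H$). Let $\mathcal H$ be the category of Hopf bimodules (with maps of bimodules and bicomodules); $H$ with multiplication and comultiplication is an object of $\mathcal H$. **Extensions.** For $n\ge 1$ an extension of degree $n$ of $M$ by $N$ is an exact sequence $E: 0\to N\xrightarrow{i_E} E_{n-1}\to\cdots\to E_0\xrightarrow{p_E} M\to 0$ in $\mathcal H$. With morphisms of exact sequences that are the identity on $M$ and $N$ the extensions form a category, and $\mathrm{Ext}^n_{\mathcal H}(M,N)$ is its set of connected components; $\mathrm{Ext}^0_{\mathcal H}(M,N)=\mathrm{Hom}_{\mathcal H}(M,N)$. Let $-E$ be $E$ with $p_E$ replaced by $-p_E$ (it represents the opposite of $[E]$ for the Baer sum). For extensions $E$ of $M$ by $L$ of degree $m$ and $F$ of $L$ by $N$ of degree $n$, the Yoneda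 product $E\sharp F$ is the extension $0\to N\to F_{n-1}\to\cdots\to F_0\xrightarrow{i_Ep_F}E_{m-1}\to\cdots\to E_0\to M\to 0$ of degree $m+n$; it induces $\sharp:\mathrm{Ext}^m_{\mathcal H}(M,L)\times \mathrm{Ext}^n_{\mathcal H}(L,N)\to\mathrm{Ext}^{m+n}_{\mathcal H}(M,N)$. The product of two elements of degree $0$ is composition. For $\varphi\in\mathrm{Hom}_{\mathcal H}(H,H)$ and $E$ an extension of degree $n$ of $H$ by $H$, the two products of $\varphi$ and $[E]$ are: the class of any extension $E'$ to which $E$ admits a morphism of exact sequences that is the identity at the right end and $\varphi$ at the left end; and the class of any extension $E''$ which admits a morphism of exact sequences to $E$ that is $\varphi$ at the right end and the identity at the left end. **The cohomology $H_b^*(H,H)$.** For $X,Y\in\mathcal H$ let $X\mathbin{\underline{\otimes}}Y$ be $X\otimes Y$ with the actions $h(x\otimes y)h'=hx\otimes yh'$ and the codiagonal coactions, and let $X\mathbin{\overline{\otimes}}Y$ be $X\otimes Y$ with the diagonal actions and the coactions given by the left coaction of $X$ and the right coaction of $Y$. For $M,N\in\mathcal H$ put $\mathrm{Bar}_a(M)=M\mathbin{\underline{\otimes}}H^{\underline{\otimes}(a+1)}$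 and $\mathrm{Cob}^s(N)=H^{\overline{\otimes}(s+1)}\mathbin{\overline{\otimes}}N$ ($a,s\ge 0$), with the differentials $$d(m\otimes h_0\otimes\cdots\otimes h_a)=mh_0\otimes h_1\otimes\cdots\otimes h_a+\sum_{i=1}^{a}(-1)^i\,m\otimes h_0\otimes\cdots\otimes h_{i-1}h_i\otimes\cdots\otimes h_a,$$ $$\delta(h_1\otimes\cdots\otimes h_{s+1}\otimes x)=\sum_{i=1}^{s+1}(-1)^{i-1}h_1\otimes\cdots\otimes\Delta(h_i)\otimes\cdots\otimes h_{s+1}\otimes x+(-1)^{s+1}h_1\otimes\cdots\otimes h_{s+1}\otimes x_{(-1)}\otimes x_{(0)}.$$ The $n$-cochains are the families $f=(f_{a,s})_{a+s=n}$ with $f_{a,s}\in\mathrm{Hom}_{\mathcal H}(\mathrm{Bar}_a(M),\mathrm{Cob}^s(N))$, the differential is $(Df)_{a,s}=f_{a-1,s}\circ d+(-1)^a\,\delta\circ f_{a,s-1}$, and $H_b^n(M,N)$ is the $n$-th cohomology of this total complex. The space $\mathrm{Hom}_{\mathcal H}(\mathrm{Bar}_a(M),\mathrm{Cob}^s(N))$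 is identified with the space of left $H$-linear and right $H$-colinear maps $M\otimes H^{\otimes a}\to H^{\otimes s}\otimes N$ by $f\mapsto\bigl(m\otimes t\mapsto(\varepsilon\otimes 1)f(m\otimes t\otimes 1)\bigr)$. In these terms the cup product of $f:M\otimes H^{\otimes a}\to H^{\otimes s}\otimes L$ and $g:L\otimes H^{\otimes b}\to H^{\otimes r}\otimes N$ is the map $M\otimes H^{\otimes (a+b)}\to H^{\otimes(s+r)}\otimes N$ $$(f\smile g)(m\otimes h_1\otimes\cdots\otimes h_{a+b})=(-1)^{sb}\,(1^{\otimes s}\otimes g)\Bigl(f(m\otimes h_1\otimes\cdots\otimes h_a)\cdot\bigl(\Delta^{(s-1)}(h_{a+1}^{(1)}\cdots h_{a+b}^{(1)})\otimes1\bigr)\otimes h_{a+1}^{(2)}\otimes\cdots\otimes h_{a+b}^{(2)}\Bigr),$$ extended bilinearly to families. **Theorem.** 1. For all extensions $E$ of degree $m\ge1$ and $F$ of degree $n\ge1$ of $H$ by $H$ in $\mathcal H$, the classes of $F\sharp E$ and of $(-1)^{mn}\,E\sharp F$ in $\mathrm{Ext}^{m+n}_{\mathcal H}(H,H)$ coincide.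 2. Consequently the Yoneda product on $\mathrm{Ext}^*_{\mathcal H}(H,H)$ is graded-commutative: $y\sharp x=(-1)^{mn}x\sharp y$ for $x$ of degree $m$ and $y$ of degree $n$; if $m=0$ or $n=0$ this says that any two elements of $\mathrm{Hom}_{\mathcal H}(H,H)$ commute, and that the two products of an element of $\mathrm{Hom}_{\mathcal H}(H,H)$ and the class of an extension coincide. 3. For all $p,q\ge0$ the cup product of cochains induces a bilinear product $\smile:H_b^p(H,H)\times H_b^q(H,H)\to H_b^{p+q}(H,H)$, and this product is graded-commutative: $y\smile x=(-1)^{pq}\,x\smile y$ for $x\in H_b^p(H,H)$ and $y\in H_b^q(H,H)$. -/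

import Mathlib

open TensorProduct

universe u v

noncomputable section

namespace HopfBimod

section TensorLemmas

variable {k : Type*} [CommSemiring k]
  {A B C A' B' C' A'' B'' C'' X Y : Type*}
  [AddCommMonoid A] [AddCommMonoid B] [AddCommMonoid C]
  [AddCommMonoid A'] [AddCommMonoid B'] [AddCommMonoid C']
  [AddCommMonoid A''] [AddCommMonoid B''] [AddCommMonoid C''] [AddCommMonoid X] [AddCommMonoid Y]
  [Module k A] [Module k B] [Module k C] [Module k A'] [Module k B'] [Module k C']
  [Module k A''] [Module k B''] [Module k C''] [Module k X] [Module k Y]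

/-- Two bilinear maps on tensor products which agree on pure tensors agree. -/
theorem bilin_ext {f g : A ⊗[k] B →ₗ[k] A' ⊗[k] B' →ₗ[k] X}
    (h : ∀ a b a' b', f (a ⊗ₜ b) (a' ⊗ₜ b') = g (a ⊗ₜ b) (a' ⊗ₜ b'))
    (s : A ⊗[k] B) (t : A' ⊗[k] B') : f s t = g s t := by
  have : f = g := by
    apply TensorProduct.ext'
    intro a b
    apply TensorProduct.ext'
    intro a' b'
    exact h a b a' b'
  rw [this]

theorem map_map₂ {Z W Z' W' : Type*} [AddCommMonoid Z] [AddCommMonoid W] [AddCommMonoid Z']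
    [AddCommMonoid W'] [Module k Z] [Module k W] [Module k Z'] [Module k W']
    {a : A →ₗ[k] A' →ₗ[k] A''} {b : B →ₗ[k] B' →ₗ[k] B''}
    {f : A'' →ₗ[k] X} {g : B'' →ₗ[k] Y}
    {f₁ : A →ₗ[k] Z} {f₂ : A' →ₗ[k] Z'} {g₁ : B →ₗ[k] W} {g₂ : B' →ₗ[k] W'}
    {a' : Z →ₗ[k] Z' →ₗ[k] X} {b' : W →ₗ[k] W' →ₗ[k] Y}
    (hf : ∀ x y, f (a x y) = a' (f₁ x) (f₂ y)) (hg : ∀ x y, g (b x y) = b' (g₁ x) (g₂ y))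
    (s : A ⊗[k] B) (t : A' ⊗[k] B') :
    map f g (map₂ a b s t) = map₂ a' b' (map f₁ g₁ s) (map f₂ g₂ t) :=
  bilin_ext (f := (map₂ a b).compr₂ (map f g))
    (g := (map₂ a' b').compl₁₂ (map f₁ g₁) (map f₂ g₂)) (by simp [hf, hg]) s t

theorem assoc_map₂ (a : A →ₗ[k] A' →ₗ[k] A'') (b : B →ₗ[k] B' →ₗ[k] B'')
    (c : C →ₗ[k] C' →ₗ[k] C'') (s : (A ⊗[k] B) ⊗[k] C) (t : (A' ⊗[k] B') ⊗[k] C') :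
    TensorProduct.assoc k A'' B'' C'' (map₂ (map₂ a b) c s t) =
      map₂ a (map₂ b c) (TensorProduct.assoc k A B C s) (TensorProduct.assoc k A' B' C' t) := by
  induction s with
  | zero => simp
  | add _ _ h h' => simp only [map_add, LinearMap.add_apply, h, h']
  | tmul x z =>
    induction t with
    | zero => simp
    | add _ _ h h' => simp only [map_add, h, h']
    | tmul x' z' =>
      induction x with
      | zero => simp
      | add _ _ h h' => simp only [TensorProduct.add_tmul, map_add, LinearMap.add_apply, h, h']
      | tmul x y =>
        induction x' with
        | zero => simp
        | add _ _ h h' => simp only [TensorProduct.add_tmul, map_add, h, h']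
        | tmul x' y' => simp

theorem assoc_symm_map₂ (a : A →ₗ[k] A' →ₗ[k] A'') (b : B →ₗ[k] B' →ₗ[k] B'')
    (c : C →ₗ[k] C' →ₗ[k] C'') (s : A ⊗[k] (B ⊗[k] C)) (t : A' ⊗[k] (B' ⊗[k] C')) :
    (TensorProduct.assoc k A'' B'' C'').symm (map₂ a (map₂ b c) s t) =
      map₂ (map₂ a b) c ((TensorProduct.assoc k A B C).symm s)
        ((TensorProduct.assoc k A' B' C').symm t) := by
  rw [LinearEquiv.symm_apply_eq, assoc_map₂]
  simp

theorem map₂_map₂_left {Z W P Q S T : Type*} [AddCommMonoid Z] [AddCommMonoid W]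
    [Module k Z] [Module k W]
    [AddCommMonoid P] [AddCommMonoid Q] [AddCommMonoid S] [AddCommMonoid T]
    [Module k P] [Module k Q] [Module k S] [Module k T]
    {c : A →ₗ[k] A' →ₗ[k] A''} {d : B →ₗ[k] B' →ₗ[k] B''}
    {a : A'' →ₗ[k] Z →ₗ[k] P} {b : B'' →ₗ[k] W →ₗ[k] Q}
    {a' : A' →ₗ[k] Z →ₗ[k] S} {b' : B' →ₗ[k] W →ₗ[k] T}
    {c' : A →ₗ[k] S →ₗ[k] P} {d' : B →ₗ[k] T →ₗ[k] Q}
    (h₁ : ∀ x y z, a (c x y) z = c' x (a' y z)) (h₂ : ∀ x y z, b (d x y) z = d' x (b' y z))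
    (u : A ⊗[k] B) (s : A' ⊗[k] B') (t : Z ⊗[k] W) :
    map₂ a b (map₂ c d u s) t = map₂ c' d' u (map₂ a' b' s t) := by
  induction t with
  | zero => simp
  | add _ _ h h' => simp only [map_add, h, h']
  | tmul z w =>
    exact bilin_ext (f := (map₂ c d).compr₂ ((map₂ a b).flip (z ⊗ₜ w)))
      (g := (map₂ c' d').compl₂ ((map₂ a' b').flip (z ⊗ₜ w))) (by simp [h₁, h₂]) u s

theorem map₂_map₂_right {Z W P Q S T : Type*} [AddCommMonoid Z] [AddCommMonoid W]
    [Module k Z] [Module k W]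
    [AddCommMonoid P] [AddCommMonoid Q] [AddCommMonoid S] [AddCommMonoid T]
    [Module k P] [Module k Q] [Module k S] [Module k T]
    {c : A →ₗ[k] A' →ₗ[k] A''} {d : B →ₗ[k] B' →ₗ[k] B''}
    {a : Z →ₗ[k] A'' →ₗ[k] P} {b : W →ₗ[k] B'' →ₗ[k] Q}
    {a' : Z →ₗ[k] A' →ₗ[k] S} {b' : W →ₗ[k] B' →ₗ[k] T}
    {c' : A →ₗ[k] S →ₗ[k] P} {d' : B →ₗ[k] T →ₗ[k] Q}
    (h₁ : ∀ x y z, a z (c x y) = c' x (a' z y)) (h₂ : ∀ x y z, b z (d x y) = d' x (b' z y))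
    (u : A ⊗[k] B) (s : A' ⊗[k] B') (t : Z ⊗[k] W) :
    map₂ a b t (map₂ c d u s) = map₂ c' d' u (map₂ a' b' t s) := by
  induction t with
  | zero => simp
  | add _ _ h h' => simp only [map_add, LinearMap.add_apply, h, h']
  | tmul z w =>
    exact bilin_ext (f := (map₂ c d).compr₂ (map₂ a b (z ⊗ₜ w)))
      (g := (map₂ c' d').compl₂ (map₂ a' b' (z ⊗ₜ w))) (by simp [h₁, h₂]) u s

theorem mul_eq_map₂ {R S : Type*} [CommSemiring R] [Semiring S] [Algebra R S] (x y : S ⊗[R] S) :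
    x * y = map₂ (LinearMap.mul R S) (LinearMap.mul R S) x y :=
  bilin_ext (f := LinearMap.mul R (S ⊗[R] S)) (by simp) _ _

theorem mul_eq_map₂_flip {R S : Type*} [CommSemiring R] [Semiring S] [Algebra R S]
    (x y : S ⊗[R] S) :
    x * y = map₂ (LinearMap.mul R S).flip (LinearMap.mul R S).flip y x :=
  bilin_ext (f := (LinearMap.mul R (S ⊗[R] S)).flip) (by simp) _ _

end TensorLemmas

end HopfBimod

/-- A Hopf bimodule over a Hopf algebra `H` over a field `k`: an `H`-bimodule and an
`H`-bicomodule whose two coactions are morphisms of bimodules, `H` acting diagonally on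
`H ⊗ M` and on `M ⊗ H`.  Here `actL h m = h m` and `actR h m = m h`. -/
structure HopfBimod (k : Type u) (H : Type v) [Field k] [Ring H] [HopfAlgebra k H] where
  carrier : Type v
  [acg : AddCommGroup carrier]
  [mod : Module k carrier]
  actL : H →ₗ[k] carrier →ₗ[k] carrier
  actR : H →ₗ[k] carrier →ₗ[k] carrier
  coactL : carrier →ₗ[k] H ⊗[k] carrier
  coactR : carrier →ₗ[k] carrier ⊗[k] H
  one_actL : ∀ m, actL 1 m = m
  mul_actL : ∀ a b m, actL (a * b) m = actL a (actL b m)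
  one_actR : ∀ m, actR 1 m = m
  mul_actR : ∀ a b m, actR (a * b) m = actR b (actR a m)
  act_comm : ∀ a b m, actL a (actR b m) = actR b (actL a m)
  counit_coactL : ∀ m, TensorProduct.lid k carrier
    (map Coalgebra.counit LinearMap.id (coactL m)) = m
  coassocL : ∀ m, TensorProduct.assoc k H H carrier
    (map Coalgebra.comul LinearMap.id (coactL m)) = map LinearMap.id coactL (coactL m)
  counit_coactR : ∀ m, TensorProduct.rid k carrier
    (map LinearMap.id Coalgebra.counit (coactR m)) = m
  coassocR : ∀ m, TensorProduct.assoc k carrier H H (map coactR LinearMap.id (coactR m)) =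
    map LinearMap.id Coalgebra.comul (coactR m)
  coact_comm : ∀ m, TensorProduct.assoc k H carrier H (map coactL LinearMap.id (coactR m)) =
    map LinearMap.id coactR (coactL m)
  /-- `(h m)₍₋₁₎ ⊗ (h m)₍₀₎ = h⁽¹⁾ m₍₋₁₎ ⊗ h⁽²⁾ m₍₀₎` -/
  coactL_actL : ∀ h m, coactL (actL h m) =
    map₂ (LinearMap.mul k H) actL (Coalgebra.comul h) (coactL m)
  /-- `(m h)₍₋₁₎ ⊗ (m h)₍₀₎ = m₍₋₁₎ h⁽¹⁾ ⊗ m₍₀₎ h⁽²⁾` -/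
  coactL_actR : ∀ h m, coactL (actR h m) =
    map₂ (LinearMap.mul k H).flip actR (Coalgebra.comul h) (coactL m)
  /-- `(h m)₍₀₎ ⊗ (h m)₍₁₎ = h⁽¹⁾ m₍₀₎ ⊗ h⁽²⁾ m₍₁₎` -/
  coactR_actL : ∀ h m, coactR (actL h m) =
    map₂ actL (LinearMap.mul k H) (Coalgebra.comul h) (coactR m)
  /-- `(m h)₍₀₎ ⊗ (m h)₍₁₎ = m₍₀₎ h⁽¹⁾ ⊗ m₍₁₎ h⁽²⁾` -/
  coactR_actR : ∀ h m, coactR (actR h m) =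
    map₂ actR (LinearMap.mul k H).flip (Coalgebra.comul h) (coactR m)

attribute [instance] HopfBimod.acg HopfBimod.mod

namespace HopfBimod

variable {k : Type u} {H : Type v} [Field k] [Ring H] [HopfAlgebra k H]

/-- The space of Hopf bimodule morphisms, as a subspace of the space of linear maps. -/
def homs (M N : HopfBimod k H) : Submodule k (M.carrier →ₗ[k] N.carrier) where
  carrier := {f | (∀ h m, f (M.actL h m) = N.actL h (f m)) ∧
    (∀ h m, f (M.actR h m) = N.actR h (f m)) ∧
    (∀ m, N.coactL (f m) = map LinearMap.id f (M.coactL m)) ∧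
    (∀ m, N.coactR (f m) = map f LinearMap.id (M.coactR m))}
  add_mem' := by
    rintro f g ⟨h1, h2, h3, h4⟩ ⟨h1', h2', h3', h4'⟩
    refine ⟨?_, ?_, ?_, ?_⟩ <;>
      simp_all [map_add_left, map_add_right]
  zero_mem' := by
    simp [map_zero_left, map_zero_right]
  smul_mem' := by
    rintro c f ⟨h1, h2, h3, h4⟩
    refine ⟨?_, ?_, ?_, ?_⟩ <;>
      simp_all [map_smul_left, map_smul_right]

/-- Hopf bimodule morphisms `M → N`. -/
abbrev Hom (M N : HopfBimod k H) : Type v := homs M N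

variable {M N L X Y X' Y' : HopfBimod k H}

/-- The identity morphism. -/
def Hom.id (M : HopfBimod k H) : Hom M M := ⟨LinearMap.id, by simp [homs]⟩

/-- The composition `g ∘ f`. -/
def Hom.comp (g : Hom N L) (f : Hom M N) : Hom M L :=
  ⟨g.1 ∘ₗ f.1, by
    obtain ⟨f, h1, h2, h3, h4⟩ := f
    obtain ⟨g, h1', h2', h3', h4'⟩ := g
    refine ⟨?_, ?_, ?_, ?_⟩
    · simp [h1, h1']
    · simp [h2, h2']
    · intro m
      simp only [LinearMap.comp_apply, h3', h3]
      rw [← LinearMap.comp_apply, ← map_comp, LinearMap.id_comp]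
    · intro m
      simp only [LinearMap.comp_apply, h4', h4]
      rw [← LinearMap.comp_apply, ← map_comp, LinearMap.id_comp]⟩

variable (k H) in
/-- `H` as a Hopf bimodule over itself, with the multiplication and the comultiplication. -/
abbrev regular : HopfBimod k H where
  carrier := H
  actL := LinearMap.mul k H
  actR := (LinearMap.mul k H).flip
  coactL := Coalgebra.comul
  coactR := Coalgebra.comul
  one_actL := by simp
  mul_actL := by simp [mul_assoc]
  one_actR := by simp
  mul_actR := by simp [mul_assoc]
  act_comm := by simp [mul_assoc]
  counit_coactL m := by
    have := Coalgebra.rTensor_counit_comul (R := k) m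
    simp [LinearMap.rTensor] at this
    simp [this]
  coassocL m := Coalgebra.coassoc_apply m
  counit_coactR m := by
    have := Coalgebra.lTensor_counit_comul (R := k) m
    simp [LinearMap.lTensor] at this
    simp [this]
  coassocR m := Coalgebra.coassoc_apply m
  coact_comm m := Coalgebra.coassoc_apply m
  coactL_actL h m := by
    simp only [LinearMap.mul_apply', Bialgebra.comul_mul]
    exact mul_eq_map₂ _ _
  coactL_actR h m := by
    simp only [LinearMap.mul_apply', Bialgebra.comul_mul, LinearMap.flip_apply]
    exact mul_eq_map₂_flip _ _
  coactR_actL h m := by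
    simp only [LinearMap.mul_apply', Bialgebra.comul_mul]
    exact mul_eq_map₂ _ _
  coactR_actR h m := by
    simp only [LinearMap.mul_apply', Bialgebra.comul_mul, LinearMap.flip_apply]
    exact mul_eq_map₂_flip _ _

/-- The Hopf bimodule `X ⊗̲ Y`: the vector space `X ⊗ Y` with the regular actions
`h (x ⊗ y) = h x ⊗ y`, `(x ⊗ y) h = x ⊗ y h` and the codiagonal coactions
`x ⊗ y ↦ x₍₋₁₎ y₍₋₁₎ ⊗ x₍₀₎ ⊗ y₍₀₎`, `x ⊗ y ↦ x₍₀₎ ⊗ y₍₀₎ ⊗ x₍₁₎ y₍₁₎`. -/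
abbrev codiag (X Y : HopfBimod k H) : HopfBimod k H where
  carrier := X.carrier ⊗[k] Y.carrier
  actL := LinearMap.rTensorHom Y.carrier ∘ₗ X.actL
  actR := LinearMap.lTensorHom X.carrier ∘ₗ Y.actR
  coactL := lift ((map₂ (LinearMap.mul k H)
    (TensorProduct.mk k X.carrier Y.carrier)).compl₁₂ X.coactL Y.coactL)
  coactR := lift ((map₂ (TensorProduct.mk k X.carrier Y.carrier)
    (LinearMap.mul k H)).compl₁₂ X.coactR Y.coactR)
  one_actL m := by
    have : X.actL 1 = LinearMap.id := LinearMap.ext X.one_actL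
    simp [this]
  mul_actL a b m := by
    have : X.actL (a * b) = X.actL a ∘ₗ X.actL b := LinearMap.ext (X.mul_actL a b)
    simp [this, LinearMap.rTensor_comp_apply]
  one_actR m := by
    have : Y.actR 1 = LinearMap.id := LinearMap.ext Y.one_actR
    simp [this]
  mul_actR a b m := by
    have : Y.actR (a * b) = Y.actR b ∘ₗ Y.actR a := LinearMap.ext (Y.mul_actR a b)
    simp [this, LinearMap.lTensor_comp_apply]
  act_comm a b m := by
    induction m with
    | zero => simp
    | add _ _ h h' => simp only [map_add, h, h']
    | tmul x y => simp
  counit_coactL m := by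
    induction m with
    | zero => simp
    | add _ _ h h' => simp only [map_add, h, h']
    | tmul x y =>
      simp only [lift.tmul, LinearMap.compl₁₂_apply]
      rw [map_map₂ (f₁ := Coalgebra.counit) (f₂ := Coalgebra.counit) (g₁ := LinearMap.id)
        (g₂ := LinearMap.id) (a' := LinearMap.mul k k)
        (b' := TensorProduct.mk k X.carrier Y.carrier) (by simp) (by simp)]
      conv_rhs => rw [← X.counit_coactL x, ← Y.counit_coactL y]
      exact bilin_ext
        (f := (map₂ (LinearMap.mul k k) (TensorProduct.mk k X.carrier Y.carrier)).compr₂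
          (TensorProduct.lid k _).toLinearMap)
        (g := (TensorProduct.mk k X.carrier Y.carrier).compl₁₂ (TensorProduct.lid k _).toLinearMap
          (TensorProduct.lid k _).toLinearMap)
        (by simp [smul_smul, mul_comm]) _ _
  coassocL m := by
    induction m with
    | zero => simp
    | add _ _ h h' => simp only [map_add, h, h']
    | tmul x y =>
      simp only [lift.tmul, LinearMap.compl₁₂_apply]
      rw [map_map₂ (f₁ := Coalgebra.comul) (f₂ := Coalgebra.comul) (g₁ := LinearMap.id)
        (g₂ := LinearMap.id) (a' := map₂ (LinearMap.mul k H) (LinearMap.mul k H))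
        (b' := TensorProduct.mk k X.carrier Y.carrier) (by simp [mul_eq_map₂]) (by simp),
        assoc_map₂, X.coassocL, Y.coassocL]
      symm
      exact map_map₂ (f₁ := LinearMap.id) (f₂ := LinearMap.id) (by simp) (by simp) _ _
  counit_coactR m := by
    induction m with
    | zero => simp
    | add _ _ h h' => simp only [map_add, h, h']
    | tmul x y =>
      simp only [lift.tmul, LinearMap.compl₁₂_apply]
      rw [map_map₂ (g₁ := Coalgebra.counit) (g₂ := Coalgebra.counit) (f₁ := LinearMap.id)
        (f₂ := LinearMap.id) (b' := LinearMap.mul k k)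
        (a' := TensorProduct.mk k X.carrier Y.carrier) (by simp) (by simp)]
      conv_rhs => rw [← X.counit_coactR x, ← Y.counit_coactR y]
      exact bilin_ext
        (f := (map₂ (TensorProduct.mk k X.carrier Y.carrier) (LinearMap.mul k k)).compr₂
          (TensorProduct.rid k _).toLinearMap)
        (g := (TensorProduct.mk k X.carrier Y.carrier).compl₁₂ (TensorProduct.rid k _).toLinearMap
          (TensorProduct.rid k _).toLinearMap)
        (by simp [smul_smul, mul_comm]) _ _
  coassocR m := by
    induction m with
    | zero => simp
    | add _ _ h h' => simp only [map_add, h, h']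
    | tmul x y =>
      simp only [lift.tmul, LinearMap.compl₁₂_apply]
      rw [map_map₂ (f₁ := X.coactR) (f₂ := Y.coactR) (g₁ := LinearMap.id)
        (g₂ := LinearMap.id)
        (a' := map₂ (TensorProduct.mk k X.carrier Y.carrier) (LinearMap.mul k H))
        (b' := LinearMap.mul k H) (by simp) (by simp), assoc_map₂,
        X.coassocR, Y.coassocR]
      symm
      exact map_map₂ (f₁ := LinearMap.id) (f₂ := LinearMap.id) (by simp)
        (by simp [mul_eq_map₂]) _ _
  coact_comm m := by
    induction m with
    | zero => simp
    | add _ _ h h' => simp only [map_add, h, h']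
    | tmul x y =>
      simp only [lift.tmul, LinearMap.compl₁₂_apply]
      rw [map_map₂ (f₁ := X.coactL) (f₂ := Y.coactL) (g₁ := LinearMap.id)
        (g₂ := LinearMap.id)
        (a' := map₂ (LinearMap.mul k H) (TensorProduct.mk k X.carrier Y.carrier))
        (b' := LinearMap.mul k H) (by simp) (by simp), assoc_map₂,
        X.coact_comm, Y.coact_comm]
      symm
      exact map_map₂ (f₁ := LinearMap.id) (f₂ := LinearMap.id) (by simp) (by simp) _ _
  coactL_actL h m := by
    induction m with
    | zero => simp
    | add _ _ h h' => simp only [map_add, h, h']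
    | tmul x y =>
      simp only [lift.tmul, LinearMap.compl₁₂_apply, LinearMap.comp_apply,
        LinearMap.coe_rTensorHom, LinearMap.rTensor_tmul, X.coactL_actL]
      exact map₂_map₂_left (by simp [mul_assoc]) (by simp) _ _ _
  coactL_actR h m := by
    induction m with
    | zero => simp
    | add _ _ h h' => simp only [map_add, h, h']
    | tmul x y =>
      simp only [lift.tmul, LinearMap.compl₁₂_apply, LinearMap.comp_apply,
        LinearMap.coe_lTensorHom, LinearMap.lTensor_tmul, Y.coactL_actR]
      exact map₂_map₂_right (by simp [mul_assoc]) (by simp) _ _ _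
  coactR_actL h m := by
    induction m with
    | zero => simp
    | add _ _ h h' => simp only [map_add, h, h']
    | tmul x y =>
      simp only [lift.tmul, LinearMap.compl₁₂_apply, LinearMap.comp_apply,
        LinearMap.coe_rTensorHom, LinearMap.rTensor_tmul, X.coactR_actL]
      exact map₂_map₂_left (by simp) (by simp [mul_assoc]) _ _ _
  coactR_actR h m := by
    induction m with
    | zero => simp
    | add _ _ h h' => simp only [map_add, h, h']
    | tmul x y =>
      simp only [lift.tmul, LinearMap.compl₁₂_apply, LinearMap.comp_apply,
        LinearMap.coe_lTensorHom, LinearMap.lTensor_tmul, Y.coactR_actR]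
      exact map₂_map₂_right (by simp) (by simp [mul_assoc]) _ _ _

/-- The Hopf bimodule `X ⊗̄ Y`: the vector space `X ⊗ Y` with the diagonal actions
`h (x ⊗ y) = h⁽¹⁾ x ⊗ h⁽²⁾ y`, `(x ⊗ y) h = x h⁽¹⁾ ⊗ y h⁽²⁾` and the regular coactions
`x ⊗ y ↦ x₍₋₁₎ ⊗ x₍₀₎ ⊗ y`, `x ⊗ y ↦ x ⊗ y₍₀₎ ⊗ y₍₁₎`. -/
abbrev diag (X Y : HopfBimod k H) : HopfBimod k H where
  carrier := X.carrier ⊗[k] Y.carrier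
  actL := map₂ X.actL Y.actL ∘ₗ Coalgebra.comul
  actR := map₂ X.actR Y.actR ∘ₗ Coalgebra.comul
  coactL := (TensorProduct.assoc k H X.carrier Y.carrier).toLinearMap ∘ₗ
    map X.coactL LinearMap.id
  coactR := (TensorProduct.assoc k X.carrier Y.carrier H).symm.toLinearMap ∘ₗ
    map LinearMap.id Y.coactR
  one_actL m := by
    induction m with
    | zero => simp
    | add _ _ h h' => simp only [map_add, h, h']
    | tmul x y => simp [Algebra.TensorProduct.one_def, X.one_actL, Y.one_actL]
  mul_actL a b m := by
    simp only [LinearMap.comp_apply, Bialgebra.comul_mul, mul_eq_map₂]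
    exact map₂_map₂_left (c := LinearMap.mul k H) (d := LinearMap.mul k H) (a := X.actL)
      (b := Y.actL) (a' := X.actL) (b' := Y.actL) (c' := X.actL) (d' := Y.actL)
      (by simp [X.mul_actL]) (by simp [Y.mul_actL]) _ _ m
  one_actR m := by
    induction m with
    | zero => simp
    | add _ _ h h' => simp only [map_add, h, h']
    | tmul x y => simp [Algebra.TensorProduct.one_def, X.one_actR, Y.one_actR]
  mul_actR a b m := by
    simp only [LinearMap.comp_apply, Bialgebra.comul_mul, mul_eq_map₂_flip]
    exact map₂_map₂_left (c := (LinearMap.mul k H).flip) (d := (LinearMap.mul k H).flip)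
      (a := X.actR) (b := Y.actR) (a' := X.actR) (b' := Y.actR) (c' := X.actR) (d' := Y.actR)
      (by simp [X.mul_actR]) (by simp [Y.mul_actR]) _ _ m
  act_comm a b m := by
    simp only [LinearMap.comp_apply]
    exact map₂_map₂_right (c := X.actR) (d := Y.actR) (a := X.actL) (b := Y.actL)
      (a' := X.actL) (b' := Y.actL) (c' := X.actR) (d' := Y.actR)
      (by simp [X.act_comm]) (by simp [Y.act_comm]) _ m _
  counit_coactL m := by
    induction m with
    | zero => simp
    | add _ _ h h' => simp only [map_add, h, h']
    | tmul x y =>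
      conv_rhs => rw [← X.counit_coactL x]
      simp only [LinearMap.comp_apply, map_tmul, LinearEquiv.coe_coe]
      induction X.coactL x with
      | zero => simp
      | add _ _ h h' => simp only [map_add, TensorProduct.add_tmul, h, h']
      | tmul c x => simp [TensorProduct.smul_tmul']
  coassocL m := by
    induction m with
    | zero => simp
    | add _ _ h h' => simp only [map_add, h, h']
    | tmul x y =>
      have h := congr(TensorProduct.map LinearMap.id
        (TensorProduct.assoc k H X.carrier Y.carrier).toLinearMap
        (TensorProduct.assoc k H (H ⊗[k] X.carrier) Y.carrier ($(X.coassocL x) ⊗ₜ[k] y)))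
      simp only [LinearMap.comp_apply, map_tmul, LinearEquiv.coe_coe]
      refine Eq.trans ?_ (h.trans ?_)
      · induction X.coactL x with
        | zero => simp
        | add _ _ h h' => simp only [map_add, TensorProduct.add_tmul, h, h']
        | tmul c x =>
          simp only [map_tmul, TensorProduct.assoc_tmul, LinearMap.id_apply]
          induction Coalgebra.comul (R := k) c with
          | zero => simp
          | add _ _ h h' => simp only [map_add, TensorProduct.add_tmul, h, h']
          | tmul c x => simp
      · induction X.coactL x with
        | zero => simp
        | add _ _ h h' => simp only [map_add, TensorProduct.add_tmul, h, h']
        | tmul c x => simp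
  counit_coactR m := by
    induction m with
    | zero => simp
    | add _ _ h h' => simp only [map_add, h, h']
    | tmul x y =>
      conv_rhs => rw [← Y.counit_coactR y]
      simp only [LinearMap.comp_apply, map_tmul, LinearEquiv.coe_coe]
      induction Y.coactR y with
      | zero => simp
      | add _ _ h h' => simp only [map_add, TensorProduct.tmul_add, h, h']
      | tmul c x => simp
  coassocR m := by
    induction m with
    | zero => simp
    | add _ _ h h' => simp only [map_add, h, h']
    | tmul x y =>
      have h := congr((TensorProduct.assoc k X.carrier Y.carrier (H ⊗[k] H)).symm
        (x ⊗ₜ[k] $(Y.coassocR y)))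
      simp only [LinearMap.comp_apply, map_tmul, LinearEquiv.coe_coe]
      refine Eq.trans ?_ (h.trans ?_)
      · induction Y.coactR y with
        | zero => simp
        | add _ _ h h' => simp only [map_add, TensorProduct.tmul_add, h, h']
        | tmul y c =>
          simp only [map_tmul, TensorProduct.assoc_symm_tmul, LinearMap.comp_apply,
            LinearEquiv.coe_coe, LinearMap.id_apply]
          induction Y.coactR y with
          | zero => simp
          | add _ _ h h' =>
            simp only [map_add, TensorProduct.add_tmul, TensorProduct.tmul_add, h, h']
          | tmul c x => simp
      · induction Y.coactR y with
        | zero => simp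
        | add _ _ h h' => simp only [map_add, TensorProduct.tmul_add, h, h']
        | tmul c x => simp
  coact_comm m := by
    induction m with
    | zero => simp
    | add _ _ h h' => simp only [map_add, h, h']
    | tmul x y =>
      have h := bilin_ext
        (f := (TensorProduct.mk k (H ⊗[k] X.carrier) (Y.carrier ⊗[k] H)).compr₂
          ((map LinearMap.id (TensorProduct.assoc k X.carrier Y.carrier H).symm.toLinearMap) ∘ₗ
            (TensorProduct.assoc k H X.carrier (Y.carrier ⊗[k] H)).toLinearMap))
        (g := (TensorProduct.mk k (H ⊗[k] X.carrier) (Y.carrier ⊗[k] H)).compr₂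
          ((TensorProduct.assoc k H (X.carrier ⊗[k] Y.carrier) H).toLinearMap ∘ₗ
            (map (TensorProduct.assoc k H X.carrier Y.carrier).toLinearMap LinearMap.id) ∘ₗ
              (TensorProduct.assoc k (H ⊗[k] X.carrier) Y.carrier H).symm.toLinearMap))
        (by simp) (X.coactL x) (Y.coactR y)
      simp only [LinearMap.comp_apply, map_tmul, LinearEquiv.coe_coe]
      refine Eq.trans ?_ (h.symm.trans ?_)
      · induction Y.coactR y with
        | zero => simp
        | add _ _ h h' => simp only [map_add, TensorProduct.tmul_add, h, h']
        | tmul y c => simp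
      · induction X.coactL x with
        | zero => simp
        | add _ _ h h' => simp only [map_add, LinearMap.add_apply, TensorProduct.add_tmul, h, h']
        | tmul c x => simp
  coactL_actL h m := by
    simp only [LinearMap.comp_apply, LinearEquiv.coe_coe]
    rw [map_map₂ (f₁ := Coalgebra.comul) (f₂ := X.coactL) (g₁ := LinearMap.id)
      (g₂ := LinearMap.id) (a' := map₂ (LinearMap.mul k H) X.actL) (b' := Y.actL)
      X.coactL_actL (by simp), assoc_map₂, show TensorProduct.assoc k H H H
        (map Coalgebra.comul LinearMap.id (Coalgebra.comul h)) = _ from Coalgebra.coassoc_apply h]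
    generalize TensorProduct.assoc k H X.carrier Y.carrier (map X.coactL LinearMap.id m) = t
    exact bilin_ext (f := (map₂ (LinearMap.mul k H) (map₂ X.actL Y.actL)).comp
      (LinearMap.lTensor H Coalgebra.comul)) (by simp) _ _
  coactL_actR h m := by
    simp only [LinearMap.comp_apply, LinearEquiv.coe_coe]
    rw [map_map₂ (f₁ := Coalgebra.comul) (f₂ := X.coactL) (g₁ := LinearMap.id)
      (g₂ := LinearMap.id) (a' := map₂ (LinearMap.mul k H).flip X.actR) (b' := Y.actR)
      X.coactL_actR (by simp), assoc_map₂, show TensorProduct.assoc k H H H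
        (map Coalgebra.comul LinearMap.id (Coalgebra.comul h)) = _ from Coalgebra.coassoc_apply h]
    generalize TensorProduct.assoc k H X.carrier Y.carrier (map X.coactL LinearMap.id m) = t
    exact bilin_ext (f := (map₂ (LinearMap.mul k H).flip (map₂ X.actR Y.actR)).comp
      (LinearMap.lTensor H Coalgebra.comul)) (by simp) _ _
  coactR_actL h m := by
    simp only [LinearMap.comp_apply, LinearEquiv.coe_coe]
    rw [map_map₂ (f₁ := LinearMap.id) (f₂ := LinearMap.id) (g₁ := Coalgebra.comul)
      (g₂ := Y.coactR) (a' := X.actL) (b' := map₂ Y.actL (LinearMap.mul k H))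
      (by simp) Y.coactR_actL, assoc_symm_map₂, show (TensorProduct.assoc k H H H).symm
        (map LinearMap.id Coalgebra.comul (Coalgebra.comul h)) = _
        from Coalgebra.coassoc_symm_apply h]
    generalize (TensorProduct.assoc k X.carrier Y.carrier H).symm (map LinearMap.id Y.coactR m) = t
    exact bilin_ext (f := (map₂ (map₂ X.actL Y.actL) (LinearMap.mul k H)).comp
      (LinearMap.rTensor H Coalgebra.comul)) (by simp) _ _
  coactR_actR h m := by
    simp only [LinearMap.comp_apply, LinearEquiv.coe_coe]
    rw [map_map₂ (f₁ := LinearMap.id) (f₂ := LinearMap.id) (g₁ := Coalgebra.comul)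
      (g₂ := Y.coactR) (a' := X.actR) (b' := map₂ Y.actR (LinearMap.mul k H).flip)
      (by simp) Y.coactR_actR, assoc_symm_map₂, show (TensorProduct.assoc k H H H).symm
        (map LinearMap.id Coalgebra.comul (Coalgebra.comul h)) = _
        from Coalgebra.coassoc_symm_apply h]
    generalize (TensorProduct.assoc k X.carrier Y.carrier H).symm (map LinearMap.id Y.coactR m) = t
    exact bilin_ext (f := (map₂ (map₂ X.actR Y.actR) (LinearMap.mul k H).flip).comp
      (LinearMap.rTensor H Coalgebra.comul)) (by simp) _ _

/-- The morphism `f ⊗ g : X ⊗̲ Y → X' ⊗̲ Y'`. -/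
def codiagMap (f : Hom X X') (g : Hom Y Y') : Hom (codiag X Y) (codiag X' Y') :=
  ⟨map f.1 g.1, by
    obtain ⟨f, h1, h2, h3, h4⟩ := f
    obtain ⟨g, h1', h2', h3', h4'⟩ := g
    refine ⟨?_, ?_, ?_, ?_⟩
    · intro h m
      induction m using TensorProduct.induction_on with
      | zero => simp
      | add _ _ h h' => simp only [map_add, h, h']
      | tmul x y => simp [codiag, h1]
    · intro h m
      induction m using TensorProduct.induction_on with
      | zero => simp
      | add _ _ h h' => simp only [map_add, h, h']
      | tmul x y => simp [codiag, h2']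
    · intro m
      induction m using TensorProduct.induction_on with
      | zero => simp
      | add _ _ h h' => simp only [map_add, h, h']
      | tmul x y =>
        simp only [codiag, map_tmul, lift.tmul, LinearMap.compl₁₂_apply, h3, h3']
        symm
        exact map_map₂ (f₁ := LinearMap.id) (f₂ := LinearMap.id) (by simp) (by simp) _ _
    · intro m
      induction m using TensorProduct.induction_on with
      | zero => simp
      | add _ _ h h' => simp only [map_add, h, h']
      | tmul x y =>
        simp only [codiag, map_tmul, lift.tmul, LinearMap.compl₁₂_apply, h4, h4']
        symm
        exact map_map₂ (g₁ := LinearMap.id) (g₂ := LinearMap.id) (by simp) (by simp) _ _⟩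

/-- The morphism `f ⊗ g : X ⊗̄ Y → X' ⊗̄ Y'`. -/
def diagMap (f : Hom X X') (g : Hom Y Y') : Hom (diag X Y) (diag X' Y') :=
  ⟨map f.1 g.1, by
    obtain ⟨f, h1, h2, h3, h4⟩ := f
    obtain ⟨g, h1', h2', h3', h4'⟩ := g
    refine ⟨?_, ?_, ?_, ?_⟩
    · intro h m
      simp only [diag, LinearMap.comp_apply]
      generalize Coalgebra.comul (R := k) h = u
      exact (map_map₂ (f₁ := LinearMap.id) (g₁ := LinearMap.id) h1 h1' u m).trans (by simp)
    · intro h m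
      simp only [diag, LinearMap.comp_apply]
      generalize Coalgebra.comul (R := k) h = u
      exact (map_map₂ (f₁ := LinearMap.id) (g₁ := LinearMap.id) h2 h2' u m).trans (by simp)
    · intro m
      induction m using TensorProduct.induction_on with
      | zero => simp
      | add _ _ h h' => simp only [map_add, h, h']
      | tmul x y =>
        simp only [diag, map_tmul, LinearMap.comp_apply, h3, LinearEquiv.coe_coe,
          LinearMap.id_apply]
        induction X.coactL x with
        | zero => simp
        | add _ _ h h' => simp only [map_add, TensorProduct.add_tmul, h, h']
        | tmul c x => simp
    · intro m
      induction m using TensorProduct.induction_on with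
      | zero => simp
      | add _ _ h h' => simp only [map_add, h, h']
      | tmul x y =>
        simp only [diag, map_tmul, LinearMap.comp_apply, h4', LinearEquiv.coe_coe,
          LinearMap.id_apply]
        induction Y.coactR y with
        | zero => simp
        | add _ _ h h' => simp only [map_add, TensorProduct.tmul_add, h, h']
        | tmul c x => simp⟩

/-- The right action `X ⊗̲ H → X`, `x ⊗ h ↦ x h`. -/
def actHom (X : HopfBimod k H) : Hom (codiag X (regular k H)) X :=
  ⟨lift X.actR.flip, by
    refine ⟨?_, ?_, ?_, ?_⟩
    · intro h m
      induction m using TensorProduct.induction_on with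
      | zero => simp
      | add _ _ h h' => simp only [map_add, h, h']
      | tmul x y => simp [codiag, X.act_comm]
    · intro h m
      induction m using TensorProduct.induction_on with
      | zero => simp
      | add _ _ h h' => simp only [map_add, h, h']
      | tmul x y => simp [codiag, regular, X.mul_actR]
    · intro m
      induction m using TensorProduct.induction_on with
      | zero => simp
      | add _ _ h h' => simp only [map_add, h, h']
      | tmul x y =>
        simp only [codiag, lift.tmul, LinearMap.compl₁₂_apply, LinearMap.flip_apply,
          X.coactL_actR]
        symm
        exact bilin_ext (f := (map₂ (LinearMap.mul k H) (TensorProduct.mk k X.carrier H)).compr₂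
            (map LinearMap.id (lift X.actR.flip)))
          (g := (map₂ (LinearMap.mul k H).flip X.actR).flip) (by simp) _ _
    · intro m
      induction m using TensorProduct.induction_on with
      | zero => simp
      | add _ _ h h' => simp only [map_add, h, h']
      | tmul x y =>
        simp only [codiag, lift.tmul, LinearMap.compl₁₂_apply, LinearMap.flip_apply,
          X.coactR_actR]
        symm
        exact bilin_ext (f := (map₂ (TensorProduct.mk k X.carrier H) (LinearMap.mul k H)).compr₂
            (map (lift X.actR.flip) LinearMap.id))
          (g := (map₂ X.actR (LinearMap.mul k H).flip).flip) (by simp) _ _⟩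

/-- The left coaction `X → H ⊗̄ X`, `x ↦ x₍₋₁₎ ⊗ x₍₀₎`. -/
def coactHom (X : HopfBimod k H) : Hom X (diag (regular k H) X) :=
  ⟨X.coactL, by
    refine ⟨?_, ?_, ?_, ?_⟩
    · exact X.coactL_actL
    · exact X.coactL_actR
    · exact X.coassocL
    · intro m
      simp only [diag, LinearMap.comp_apply, LinearEquiv.coe_coe]
      rw [LinearEquiv.symm_apply_eq]
      exact (X.coact_comm m).symm⟩

/-- The morphism `X ⊗̲ H → X ⊗̲ H ⊗̲ H`, `x ⊗ h ↦ x ⊗ 1 ⊗ h`. -/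
def insertOne (X : HopfBimod k H) :
    Hom (codiag X (regular k H)) (codiag (codiag X (regular k H)) (regular k H)) :=
  ⟨map ((TensorProduct.mk k X.carrier H).flip 1) LinearMap.id, by
    refine ⟨?_, ?_, ?_, ?_⟩
    · intro h m
      induction m using TensorProduct.induction_on with
      | zero => simp
      | add _ _ h h' => simp only [map_add, h, h']
      | tmul x y => simp [codiag]
    · intro h m
      induction m using TensorProduct.induction_on with
      | zero => simp
      | add _ _ h h' => simp only [map_add, h, h']
      | tmul x y => simp [codiag]
    · intro m
      induction m using TensorProduct.induction_on with
      | zero => simp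
      | add _ _ h h' => simp only [map_add, h, h']
      | tmul x y =>
        simp only [map_tmul, lift.tmul, LinearMap.compl₁₂_apply, LinearMap.flip_apply,
          TensorProduct.mk_apply, Bialgebra.comul_one, Algebra.TensorProduct.one_def,
          LinearMap.id_apply]
        exact bilin_ext
          (f := (map₂ (LinearMap.mul k H) (TensorProduct.mk k (X.carrier ⊗[k] H) H)).comp
            ((map₂ (LinearMap.mul k H) (TensorProduct.mk k X.carrier H)).flip (1 ⊗ₜ 1)))
          (g := (map₂ (LinearMap.mul k H) (TensorProduct.mk k X.carrier H)).compr₂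
            (map LinearMap.id (map ((TensorProduct.mk k X.carrier H).flip 1) LinearMap.id)))
          (by simp) _ _
    · intro m
      induction m using TensorProduct.induction_on with
      | zero => simp
      | add _ _ h h' => simp only [map_add, h, h']
      | tmul x y =>
        simp only [map_tmul, lift.tmul, LinearMap.compl₁₂_apply, LinearMap.flip_apply,
          TensorProduct.mk_apply, Bialgebra.comul_one, Algebra.TensorProduct.one_def,
          LinearMap.id_apply]
        exact bilin_ext
          (f := (map₂ (TensorProduct.mk k (X.carrier ⊗[k] H) H) (LinearMap.mul k H)).comp
            ((map₂ (TensorProduct.mk k X.carrier H) (LinearMap.mul k H)).flip (1 ⊗ₜ 1)))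
          (g := (map₂ (TensorProduct.mk k X.carrier H) (LinearMap.mul k H)).compr₂
            (map (map ((TensorProduct.mk k X.carrier H).flip 1) LinearMap.id) LinearMap.id))
          (by simp) _ _⟩

/-- The map `H ⊗ X → X`, `h ⊗ x ↦ ε(h) x`. -/
def counitMap (X : HopfBimod k H) : H ⊗[k] X.carrier →ₗ[k] X.carrier :=
  (TensorProduct.lid k X.carrier).toLinearMap ∘ₗ map Coalgebra.counit LinearMap.id

theorem counitMap_actL (X : HopfBimod k H) (h : H) (t : H ⊗[k] X.carrier) :
    counitMap X (map₂ (LinearMap.mul k H) X.actL (Coalgebra.comul h) t) =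
      X.actL h (counitMap X t) := by
  have e : map Coalgebra.counit LinearMap.id (Coalgebra.comul (R := k) h) = 1 ⊗ₜ[k] h :=
    Coalgebra.rTensor_counit_comul h
  rw [counitMap, LinearMap.comp_apply, map_map₂ (f₁ := Coalgebra.counit) (f₂ := Coalgebra.counit)
    (g₁ := LinearMap.id) (g₂ := LinearMap.id) (a' := LinearMap.mul k k) (b' := X.actL)
    (by simp) (by simp), e]
  induction t with
  | zero => simp
  | add _ _ h h' => simp only [map_add, h, h']
  | tmul c x => simp

theorem counitMap_actR (X : HopfBimod k H) (h : H) (t : H ⊗[k] X.carrier) :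
    counitMap X (map₂ (LinearMap.mul k H).flip X.actR (Coalgebra.comul h) t) =
      X.actR h (counitMap X t) := by
  have e : map Coalgebra.counit LinearMap.id (Coalgebra.comul (R := k) h) = 1 ⊗ₜ[k] h :=
    Coalgebra.rTensor_counit_comul h
  rw [counitMap, LinearMap.comp_apply, map_map₂ (f₁ := Coalgebra.counit) (f₂ := Coalgebra.counit)
    (g₁ := LinearMap.id) (g₂ := LinearMap.id) (a' := (LinearMap.mul k k).flip) (b' := X.actR)
    (by simp [mul_comm]) (by simp), e]
  induction t with
  | zero => simp
  | add _ _ h h' => simp only [map_add, h, h']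
  | tmul c x => simp

/-- The morphism `H ⊗̄ H ⊗̄ X → H ⊗̄ X`, `h ⊗ h' ⊗ x ↦ ε(h') h ⊗ x`. -/
def dropCounit (X : HopfBimod k H) :
    Hom (diag (regular k H) (diag (regular k H) X)) (diag (regular k H) X) :=
  ⟨map LinearMap.id (counitMap X), by
    refine ⟨?_, ?_, ?_, ?_⟩
    · intro h m
      simp only [LinearMap.comp_apply]
      generalize Coalgebra.comul (R := k) h = u
      refine (map_map₂ (f₁ := LinearMap.id) (f₂ := LinearMap.id) (g₁ := LinearMap.id)
        (g₂ := counitMap X) (a' := LinearMap.mul k H) (b' := X.actL) (by simp)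
        (counitMap_actL X) u m).trans ?_
      simp
    · intro h m
      simp only [LinearMap.comp_apply]
      generalize Coalgebra.comul (R := k) h = u
      refine (map_map₂ (f₁ := LinearMap.id) (f₂ := LinearMap.id) (g₁ := LinearMap.id)
        (g₂ := counitMap X) (a' := (LinearMap.mul k H).flip) (b' := X.actR) (by simp)
        (counitMap_actR X) u m).trans ?_
      simp
    · intro m
      induction m using TensorProduct.induction_on with
      | zero => simp
      | add _ _ h h' => simp only [map_add, h, h']
      | tmul c t =>
        simp only [map_tmul, LinearMap.comp_apply, LinearEquiv.coe_coe, LinearMap.id_apply]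
        induction Coalgebra.comul (R := k) c with
        | zero => simp
        | add _ _ h h' => simp only [map_add, TensorProduct.add_tmul, h, h']
        | tmul c x => simp
    · intro m
      induction m using TensorProduct.induction_on with
      | zero => simp
      | add _ _ h h' => simp only [map_add, h, h']
      | tmul c t =>
        induction t using TensorProduct.induction_on with
        | zero => simp
        | add _ _ h h' => simp only [TensorProduct.tmul_add, map_add, h, h']
        | tmul c' x =>
          simp only [map_tmul, LinearMap.comp_apply, LinearEquiv.coe_coe, LinearMap.id_apply,
            counitMap, TensorProduct.lid_tmul, map_smul]
          induction X.coactR x with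
          | zero => simp
          | add _ _ h h' => simp only [map_add, smul_add, TensorProduct.tmul_add, h, h']
          | tmul c x => simp [TensorProduct.smul_tmul']⟩

/-- The morphism `(H ⊗̄ X) ⊗̲ Y → H ⊗̄ (X ⊗̲ Y)`, `(h ⊗ x) ⊗ y ↦ h y₍₋₁₎ ⊗ (x ⊗ y₍₀₎)`. -/
def interchange (X Y : HopfBimod k H) :
    Hom (codiag (diag (regular k H) X) Y) (diag (regular k H) (codiag X Y)) :=
  ⟨lift ((map₂ (LinearMap.mul k H) (TensorProduct.mk k X.carrier Y.carrier)).compl₂ Y.coactL), by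
    refine ⟨?_, ?_, ?_, ?_⟩
    · intro h m
      induction m using TensorProduct.induction_on with
      | zero => simp
      | add _ _ h h' => simp only [map_add, h, h']
      | tmul u y =>
        simp only [codiag, diag, regular, lift.tmul, LinearMap.compl₂_apply, LinearMap.comp_apply,
          LinearMap.coe_rTensorHom, LinearMap.rTensor_tmul]
        exact map₂_map₂_left (by simp [mul_assoc]) (by simp) _ _ _
    · intro h m
      induction m using TensorProduct.induction_on with
      | zero => simp
      | add _ _ h h' => simp only [map_add, h, h']
      | tmul u y =>
        simp only [codiag, diag, regular, lift.tmul, LinearMap.compl₂_apply, LinearMap.comp_apply,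
          LinearMap.coe_lTensorHom, LinearMap.lTensor_tmul, Y.coactL_actR]
        exact map₂_map₂_right (by simp [mul_assoc]) (by simp) _ _ _
    · intro m
      induction m using TensorProduct.induction_on with
      | zero => simp
      | add _ _ h h' => simp only [map_add, h, h']
      | tmul u y =>
        simp only [codiag, diag, regular, lift.tmul, LinearMap.compl₂_apply, LinearMap.comp_apply,
          LinearMap.compl₁₂_apply, LinearEquiv.coe_coe]
        rw [map_map₂ (f₁ := Coalgebra.comul) (f₂ := Coalgebra.comul) (g₁ := LinearMap.id)
          (g₂ := LinearMap.id) (a' := map₂ (LinearMap.mul k H) (LinearMap.mul k H))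
          (b' := TensorProduct.mk k X.carrier Y.carrier) (by simp [mul_eq_map₂]) (by simp),
          assoc_map₂, Y.coassocL]
        symm
        exact map_map₂ (f₁ := LinearMap.id) (f₂ := LinearMap.id) (g₁ := LinearMap.id)
          (a := LinearMap.mul k H) (b := TensorProduct.mk k (H ⊗[k] X.carrier) Y.carrier)
          (g₂ := Y.coactL) (a' := LinearMap.mul k H)
          (b' := map₂ (LinearMap.mul k H) (TensorProduct.mk k X.carrier Y.carrier))
          (f := LinearMap.id) (g := lift ((map₂ (LinearMap.mul k H)
            (TensorProduct.mk k X.carrier Y.carrier)).compl₂ Y.coactL))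
          (by simp) (by simp) _ _ |>.trans (by simp)
    · intro m
      induction m using TensorProduct.induction_on with
      | zero => simp
      | add _ _ h h' => simp only [map_add, h, h']
      | tmul u y =>
        simp only [lift.tmul, LinearMap.compl₂_apply, LinearMap.comp_apply,
          LinearMap.compl₁₂_apply, LinearEquiv.coe_coe]
        rw [map_map₂ (f₁ := LinearMap.id) (f₂ := LinearMap.id) (g₁ := X.coactR)
          (g₂ := Y.coactR) (a' := LinearMap.mul k H)
          (b' := map₂ (TensorProduct.mk k X.carrier Y.carrier) (LinearMap.mul k H))
          (by simp) (by simp), assoc_symm_map₂, ← Y.coact_comm, LinearEquiv.symm_apply_apply]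
        symm
        exact map_map₂ (g₁ := LinearMap.id) (g₂ := LinearMap.id) (f₁ := LinearMap.id)
          (b := LinearMap.mul k H) (a := TensorProduct.mk k (H ⊗[k] X.carrier) Y.carrier)
          (f₂ := Y.coactL) (b' := LinearMap.mul k H)
          (a' := map₂ (LinearMap.mul k H) (TensorProduct.mk k X.carrier Y.carrier))
          (f := lift ((map₂ (LinearMap.mul k H)
            (TensorProduct.mk k X.carrier Y.carrier)).compl₂ Y.coactL)) (g := LinearMap.id)
          (by simp) (by simp) _ _ |>.trans (by simp)⟩

/-! ### Extensions and the Yoneda product -/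

/-- An extension of degree `n ≥ 1` of the Hopf bimodule `M` by the Hopf bimodule `N`, that is an
exact sequence of Hopf bimodules
`0 → N → E_{n-1} → ⋯ → E_0 → M → 0`.
It is written as an exact sequence `⋯ → obj (i + 1) → obj i → ⋯ → obj 0 → 0` with
`E_i = obj (i + 1)` for `0 ≤ i < n`, whose ends `obj 0` and `obj (n + 1)` are identified with `M`
and `N` by the isomorphisms `right` and `left`, and which is zero beyond `obj (n + 1)`. -/
structure Extension (M N : HopfBimod k H) (n : ℕ) where
  obj : ℕ → HopfBimod k H
  d : ∀ i, Hom (obj (i + 1)) (obj i)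
  right : Hom (obj 0) M
  left : Hom N (obj (n + 1))
  bijective_right : Function.Bijective right.1
  bijective_left : Function.Bijective left.1
  surjective : Function.Surjective (d 0).1
  exact : ∀ i, Function.Exact (d (i + 1)).1 (d i).1
  subsingleton : ∀ i, n + 1 < i → Subsingleton (obj i).carrier

namespace Extension

/-- There is a morphism of exact sequences from `E` to `E'` which is `β : M → M'` at the right end
and `α : N → N'` at the left end. -/
def Over {M N M' N' : HopfBimod k H} {n : ℕ} (β : Hom M M') (α : Hom N N')
    (E : Extension M N n) (E' : Extension M' N' n) : Prop :=
  ∃ φ : ∀ i, Hom (E.obj i) (E'.obj i),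
    (∀ i, (φ i).comp (E.d i) = (E'.d i).comp (φ (i + 1))) ∧
    E'.right.comp (φ 0) = β.comp E.right ∧
    (φ (n + 1)).comp E.left = E'.left.comp α

theorem Over.refl {n : ℕ} (E : Extension M N n) : Over (Hom.id M) (Hom.id N) E E :=
  ⟨fun _ => Hom.id _, fun _ => rfl, rfl, rfl⟩

/-- The extension obtained from `E` by multiplying the map `E_0 → M` by the sign `u`. -/
def twist {n : ℕ} (u : ℤˣ) (E : Extension M N n) : Extension M N n where
  __ := E
  right := (u : ℤ) • E.right
  bijective_right := by
    rcases Int.units_eq_one_or u with rfl | rfl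
    · simpa using E.bijective_right
    · have := (Equiv.neg M.carrier).bijective.comp E.bijective_right
      have e : (((-1 : ℤˣ) : ℤ) • E.right).1 = -E.right.1 := by simp
      rw [e]
      exact this

variable (B : ℕ → HopfBimod k H) (dB : ∀ i, Hom (B (i + 1)) (B i))

/-- The sequence of objects `A 0, …, A m, B 1, B 2, …`. -/
def spliceObj : ℕ → ℕ → (ℕ → HopfBimod k H) → HopfBimod k H
  | 0, _, A => A 0
  | i + 1, 0, _ => B (i + 1)
  | i + 1, m + 1, A => spliceObj i m (fun j => A (j + 1))

/-- The maps of the spliced sequence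
`⋯ → B 2 → B 1 → A m → ⋯ → A 0`, where `B 1 → A m` is the given map `link`. -/
def spliceD : ∀ (i m : ℕ) (A : ℕ → HopfBimod k H) (_ : ∀ i, Hom (A (i + 1)) (A i))
    (_ : Hom (B 1) (A m)), Hom (spliceObj B (i + 1) m A) (spliceObj B i m A)
  | 0, 0, _, _, link => link
  | 0, _ + 1, _, dA, _ => dA 0
  | i + 1, 0, _, _, _ => dB (i + 1)
  | i + 1, m + 1, A, dA, link => spliceD i m (fun j => A (j + 1)) (fun j => dA (j + 1)) link

/-- The identification of the term of index `m + i + 1` of the spliced sequence with `B (i + 1)`. -/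
def spliceIn (i : ℕ) : ∀ (m : ℕ) (A : ℕ → HopfBimod k H),
    Hom (B (i + 1)) (spliceObj B (i + m + 1) m A)
  | 0, _ => Hom.id _
  | m + 1, A => spliceIn i m (fun j => A (j + 1))

theorem bijective_spliceIn (i : ℕ) : ∀ (m : ℕ) (A : ℕ → HopfBimod k H),
    Function.Bijective (spliceIn B i m A).1
  | 0, _ => Function.bijective_id
  | m + 1, A => bijective_spliceIn i m (fun j => A (j + 1))

theorem subsingleton_spliceObj {n : ℕ} (hB : ∀ i, n + 1 < i → Subsingleton (B i).carrier) :
    ∀ (i m : ℕ) (A : ℕ → HopfBimod k H), m + n + 1 < i → Subsingleton (spliceObj B i m A).carrier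
  | 0, _, _, h => absurd h (by omega)
  | i + 1, 0, _, h => hB _ (by omega)
  | i + 1, m + 1, A, h => subsingleton_spliceObj hB i m _ (by omega)

theorem exact_spliceD (hB : ∀ i, Function.Exact (dB (i + 1)).1 (dB i).1) :
    ∀ (i m : ℕ) (A : ℕ → HopfBimod k H) (dA : ∀ i, Hom (A (i + 1)) (A i)) (link : Hom (B 1) (A m)),
      (∀ i, Function.Exact (dA (i + 1)).1 (dA i).1) →
      Set.range link.1 = Set.range (dA m).1 → Function.Exact (dB 1).1 link.1 →
      Function.Exact (spliceD B dB (i + 1) m A dA link).1 (spliceD B dB i m A dA link).1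
  | 0, 0, _, _, _, _, _, h => h
  | 0, 1, _, _, _, hA, h, _ => fun y => (hA 0 y).trans (by rw [← h]; rfl)
  | 0, _ + 2, _, _, _, hA, _, _ => hA 0
  | i + 1, 0, _, _, _, _, _, _ => hB (i + 1)
  | i + 1, m + 1, A, dA, link, hA, h, h' =>
    exact_spliceD hB i m (fun j => A (j + 1)) (fun j => dA (j + 1)) link
      (fun j => hA (j + 1)) h h'

theorem surjective_spliceD (m : ℕ) (A : ℕ → HopfBimod k H) (dA : ∀ i, Hom (A (i + 1)) (A i))
    (link : Hom (B 1) (A m)) (h : Set.range link.1 = Set.range (dA m).1)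
    (hA : Function.Surjective (dA 0).1) : Function.Surjective (spliceD B dB 0 m A dA link).1 := by
  cases m with
  | zero => exact Set.range_eq_univ.1 (h.trans hA.range_eq)
  | succ m => exact hA

theorem range_link {m n : ℕ} (E : Extension M L m) (F : Extension L N n) :
    Set.range (((E.d m).comp E.left).comp (F.right.comp (F.d 0))).1 = Set.range (E.d m).1 := by
  have h : Function.Surjective (fun x => E.left.1 (F.right.1 ((F.d 0).1 x))) :=
    E.bijective_left.surjective.comp (F.bijective_right.surjective.comp F.surjective)
  exact h.range_comp (E.d m).1

theorem exact_link {m n : ℕ} (E : Extension M L m) (F : Extension L N n) :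
    Function.Exact (F.d 1).1 (((E.d m).comp E.left).comp (F.right.comp (F.d 0))).1 := by
  intro y
  rw [← F.exact 0 y]
  have hinj : Function.Injective (E.d m).1 := by
    rw [injective_iff_map_eq_zero]
    intro a ha
    obtain ⟨b, rfl⟩ := (E.exact m a).1 ha
    have := E.subsingleton (m + 1 + 1) (by omega)
    rw [Subsingleton.elim b 0, map_zero]
  have hinj' : Function.Injective (fun x => (E.d m).1 (E.left.1 (F.right.1 x))) :=
    hinj.comp (E.bijective_left.injective.comp F.bijective_right.injective)
  exact ⟨fun h => hinj' (Eq.trans h (by simp)), fun h => by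
    change (E.d m).1 (E.left.1 (F.right.1 ((F.d 0).1 y))) = 0
    simp [h]⟩

/-- The extension `E ♯ F` of degree `l = m + n` obtained by splicing an extension `E` of `M` by `L`
of degree `m` and an extension `F` of `L` by `N` of degree `n`:
`0 → N → F_{n-1} → ⋯ → F_0 → E_{m-1} → ⋯ → E_0 → M → 0`, where `F_0 → E_{m-1}` is the composition
of `F_0 → L` and `L → E_{m-1}`. -/
def splice {m n l : ℕ} (E : Extension M L m) (F : Extension L N n) (h : n + m = l) :
    Extension M N l where
  obj i := spliceObj F.obj i m E.obj
  d i := spliceD F.obj F.d i m E.obj E.d (((E.d m).comp E.left).comp (F.right.comp (F.d 0)))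
  right := E.right
  left := h ▸ (spliceIn F.obj n m E.obj).comp F.left
  bijective_right := E.bijective_right
  bijective_left := by
    subst h
    exact (bijective_spliceIn F.obj n m E.obj).comp F.bijective_left
  surjective := surjective_spliceD F.obj F.d m E.obj E.d _ (range_link E F) E.surjective
  exact i := exact_spliceD F.obj F.d F.exact i m E.obj E.d _ E.exact (range_link E F)
    (exact_link E F)
  subsingleton i hi := subsingleton_spliceObj F.obj F.subsingleton i m _ (by omega)

variable {B} {dB} in
/-- A pair of morphisms of sequences induces a morphism of the spliced sequences. -/
def spliceMap {B' : ℕ → HopfBimod k H} (ψ : ∀ i, Hom (B i) (B' i)) :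
    ∀ (i m : ℕ) (A A' : ℕ → HopfBimod k H) (_ : ∀ i, Hom (A i) (A' i)),
      Hom (spliceObj B i m A) (spliceObj B' i m A')
  | 0, _, _, _, φ => φ 0
  | i + 1, 0, _, _, _ => ψ (i + 1)
  | i + 1, m + 1, A, A', φ =>
    spliceMap ψ i m (fun j => A (j + 1)) (fun j => A' (j + 1)) (fun j => φ (j + 1))

variable {B} {dB} in
theorem spliceMap_comm {B' : ℕ → HopfBimod k H} {dB' : ∀ i, Hom (B' (i + 1)) (B' i)}
    (ψ : ∀ i, Hom (B i) (B' i)) (hψ : ∀ i, (ψ i).comp (dB i) = (dB' i).comp (ψ (i + 1))) :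
    ∀ (i m : ℕ) (A A' : ℕ → HopfBimod k H) (φ : ∀ i, Hom (A i) (A' i))
      (dA : ∀ i, Hom (A (i + 1)) (A i)) (dA' : ∀ i, Hom (A' (i + 1)) (A' i))
      (_ : ∀ i, (φ i).comp (dA i) = (dA' i).comp (φ (i + 1)))
      (link : Hom (B 1) (A m)) (link' : Hom (B' 1) (A' m))
      (_ : (φ m).comp link = link'.comp (ψ 1)),
      (spliceMap ψ i m A A' φ).comp (spliceD B dB i m A dA link) =
        (spliceD B' dB' i m A' dA' link').comp (spliceMap ψ (i + 1) m A A' φ)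
  | 0, 0, _, _, _, _, _, _, _, _, h => h
  | 0, _ + 1, _, _, _, _, _, hφ, _, _, _ => hφ 0
  | i + 1, 0, _, _, _, _, _, _, _, _, _ => hψ (i + 1)
  | i + 1, m + 1, A, A', φ, dA, dA', hφ, link, link', h =>
    spliceMap_comm ψ hψ i m (fun j => A (j + 1)) (fun j => A' (j + 1)) (fun j => φ (j + 1))
      (fun j => dA (j + 1)) (fun j => dA' (j + 1)) (fun j => hφ (j + 1)) link link' h

variable {B} in
theorem spliceMap_comp_spliceIn {B' : ℕ → HopfBimod k H} (ψ : ∀ i, Hom (B i) (B' i)) (i : ℕ) :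
    ∀ (m : ℕ) (A A' : ℕ → HopfBimod k H) (φ : ∀ i, Hom (A i) (A' i)),
      (spliceMap ψ (i + m + 1) m A A' φ).comp (spliceIn B i m A) =
        (spliceIn B' i m A').comp (ψ (i + 1))
  | 0, _, _, _ => rfl
  | m + 1, A, A', φ => spliceMap_comp_spliceIn ψ i m (fun j => A (j + 1)) (fun j => A' (j + 1))
      (fun j => φ (j + 1))

theorem Over.splice {m n l : ℕ} {E E' : Extension M L m} {F F' : Extension L N n}
    (hE : Over (Hom.id M) (Hom.id L) E E') (hF : Over (Hom.id L) (Hom.id N) F F')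
    (h : n + m = l) :
    Over (Hom.id M) (Hom.id N) (E.splice F h) (E'.splice F' h) := by
  obtain ⟨φ, h₁, h₂, h₃⟩ := hE
  obtain ⟨ψ, h₁', h₂', h₃'⟩ := hF
  subst h
  refine ⟨fun i => spliceMap ψ i m _ _ φ, fun i => spliceMap_comm ψ h₁' i m _ _ φ _ _ h₁ _ _ ?_,
    h₂, ?_⟩
  · apply Subtype.ext
    apply LinearMap.ext
    intro x
    have e₁ := fun z => LinearMap.congr_fun (congrArg Subtype.val (h₁ m)) z
    have e₂ := fun z => LinearMap.congr_fun (congrArg Subtype.val h₃) z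
    have e₃ := fun z => LinearMap.congr_fun (congrArg Subtype.val h₂') z
    have e₄ := fun z => LinearMap.congr_fun (congrArg Subtype.val (h₁' 0)) z
    simp only [Hom.comp, Hom.id, LinearMap.comp_apply, LinearMap.id_apply] at e₁ e₂ e₃ e₄ ⊢
    rw [e₁, e₂, ← e₃, e₄]
  · have e := spliceMap_comp_spliceIn ψ n m _ _ φ
    apply Subtype.ext
    apply LinearMap.ext
    intro x
    have e₁ := LinearMap.congr_fun (congrArg Subtype.val e) (F.left.1 x)
    have e₂ := LinearMap.congr_fun (congrArg Subtype.val h₃') x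
    refine e₁.trans ?_
    exact congrArg (spliceIn F'.obj n m E'.obj).1 e₂

theorem Over.twist {n : ℕ} {E E' : Extension M N n} (h : Over (Hom.id M) (Hom.id N) E E')
    (u : ℤˣ) : Over (Hom.id M) (Hom.id N) (E.twist u) (E'.twist u) := by
  obtain ⟨φ, h₁, h₂, h₃⟩ := h
  refine ⟨φ, h₁, ?_, h₃⟩
  apply Subtype.ext
  apply LinearMap.ext
  intro x
  have e := LinearMap.congr_fun (congrArg Subtype.val h₂) x
  exact congrArg (fun z => (u : ℤ) • z) e

end Extension

/-- `Ext^n(M, N)` for `n ≥ 1`: the set of connected components of the category of extensions of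
degree `n` of `M` by `N`, whose morphisms are the morphisms of exact sequences that are the identity
at both ends. -/
def Ext (M N : HopfBimod k H) (n : ℕ) : Type (max u (v + 1)) :=
  Quot (fun E E' : Extension M N n => E.Over (Hom.id M) (Hom.id N) E')

namespace Ext

/-- The class of an extension. -/
def mk {n : ℕ} (E : Extension M N n) : Ext M N n := Quot.mk _ E

/-- The Yoneda product `x ♯ y`, the class of the splicing of representatives. -/
def yoneda {m n l : ℕ} (h : n + m = l) : Ext M L m → Ext L N n → Ext M N l :=
  Quot.map₂ (fun E F => E.splice F h)
    (fun _ _ _ hF => Extension.Over.splice (Extension.Over.refl _) hF h)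
    (fun _ _ _ hE => Extension.Over.splice hE (Extension.Over.refl _) h)

/-- The product of a class by a sign; `-x` is the inverse of `x` for the Baer sum. -/
def twist {n : ℕ} (u : ℤˣ) : Ext M N n → Ext M N n :=
  Quot.map (fun E => E.twist u) (fun _ _ h => h.twist u)

end Ext

/-! ### The cohomology `H_b` and the cup product -/

/-- `M ⊗̲ H ⊗̲ ⋯ ⊗̲ H` with `n` factors `H`.  The term `Bar_q(M) = M ⊗̲ H^{⊗̲ (q+1)}` of the bar
resolution of `M` is `barObj M (q + 1)`. -/
def barObj (M : HopfBimod k H) : ℕ → HopfBimod k H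
  | 0 => M
  | n + 1 => codiag (barObj M n) (regular k H)

/-- `H ⊗̄ ⋯ ⊗̄ H ⊗̄ N` with `n` factors `H`.  The term `Cob^p(N) = H^{⊗̄ (p+1)} ⊗̄ N` of the cobar
resolution of `N` is `cobObj N (p + 1)`. -/
def cobObj (N : HopfBimod k H) : ℕ → HopfBimod k H
  | 0 => N
  | n + 1 => diag (regular k H) (cobObj N n)

/-- The bar differential
`m ⊗ h_0 ⊗ ⋯ ⊗ h_n ↦ m h_0 ⊗ h_1 ⊗ ⋯ ⊗ h_n + ∑_{i ≥ 1} (-1)^i m ⊗ h_0 ⊗ ⋯ ⊗ h_{i-1} h_i ⊗ ⋯ ⊗ h_n`;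
the last term of this sum is the right action of `h_n`. -/
def barD (M : HopfBimod k H) : ∀ n, Hom (barObj M (n + 1)) (barObj M n)
  | 0 => actHom M
  | n + 1 => codiagMap (barD M n) (Hom.id _) + (-1 : k) ^ (n + 1) • actHom (barObj M (n + 1))

/-- The cobar differential
`h_1 ⊗ ⋯ ⊗ h_n ⊗ x ↦ ∑_i (-1)^{i-1} h_1 ⊗ ⋯ ⊗ Δ(h_i) ⊗ ⋯ ⊗ h_n ⊗ x
  + (-1)^n h_1 ⊗ ⋯ ⊗ h_n ⊗ x₍₋₁₎ ⊗ x₍₀₎`. -/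
def cobD (N : HopfBimod k H) : ∀ n, Hom (cobObj N n) (cobObj N (n + 1))
  | 0 => coactHom N
  | n + 1 =>
    let δ : Hom (cobObj N (n + 1)) (cobObj N (n + 2)) := coactHom (cobObj N (n + 1))
    let d : Hom (cobObj N (n + 1)) (cobObj N (n + 2)) := diagMap (Hom.id (regular k H)) (cobD N n)
    δ - d

/-- Families of elements of the double complex `Hom(Bar_a(M), Cob^s(N))`, `a, s ≥ 0`. -/
abbrev Cochain (M N : HopfBimod k H) : Type v :=
  ∀ a s : ℕ, Hom (barObj M (a + 1)) (cobObj N (s + 1))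

namespace Cochain

/-- The cochains of total degree `n`. -/
def ofDegree (M N : HopfBimod k H) (n : ℕ) : Submodule k (Cochain M N) where
  carrier := {f | ∀ a s, a + s ≠ n → f a s = 0}
  add_mem' hf hg a s h := by simp [hf a s h, hg a s h]
  zero_mem' _ _ _ := rfl
  smul_mem' c f hf a s h := by simp [hf a s h]

/-- The differential of the double complex given by the bar differential. -/
def dBar (f : Cochain M N) : Cochain M N
  | 0, _ => 0
  | a + 1, s => (f a s).comp (barD M (a + 1))

/-- The differential of the double complex given by the cobar differential. -/
def dCob (f : Cochain M N) : Cochain M N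
  | _, 0 => 0
  | a, s + 1 => (cobD N (s + 1)).comp (f a s)

/-- The differential of the total complex. -/
def D (M N : HopfBimod k H) : Cochain M N →ₗ[k] Cochain M N where
  toFun f a s := dBar f a s + (-1 : k) ^ a • dCob f a s
  map_add' f g := by
    funext a s
    apply Subtype.ext
    apply LinearMap.ext
    intro x
    cases a <;> cases s <;> simp [dBar, dCob, Hom.comp] <;> abel
  map_smul' c f := by
    funext a s
    apply Subtype.ext
    apply LinearMap.ext
    intro x
    cases a <;> cases s <;> simp [dBar, dCob, Hom.comp, smul_smul, mul_comm]

/-- The cocycles of degree `n` of the total complex. -/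
def cocycles (M N : HopfBimod k H) (n : ℕ) : Submodule k (Cochain M N) :=
  ofDegree M N n ⊓ LinearMap.ker (D M N)

/-- The coboundaries of degree `n` of the total complex. -/
def coboundaries (M N : HopfBimod k H) : ℕ → Submodule k (Cochain M N)
  | 0 => ⊥
  | n + 1 => (ofDegree M N n).map (D M N)

/-- The morphism `Bar_{a+b}(M) = M ⊗ H^{a+b+1} → (M ⊗ H^{a+1}) ⊗ H^{b+1}`,
`m ⊗ h_1 ⊗ ⋯ ⊗ h_{a+b+1} ↦ m ⊗ h_1 ⊗ ⋯ ⊗ h_a ⊗ 1 ⊗ h_{a+1} ⊗ ⋯ ⊗ h_{a+b+1}`. -/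
def insertBar (M : HopfBimod k H) (a : ℕ) :
    ∀ b, Hom (barObj M (a + b + 1)) (barObj (barObj M (a + 1)) (b + 1))
  | 0 => insertOne (barObj M a)
  | b + 1 => codiagMap (insertBar M a b) (Hom.id _)

/-- The morphism `f ⊗ 1 : X ⊗ H^n → Y ⊗ H^n`. -/
def barMap (f : Hom X Y) : ∀ n, Hom (barObj X n) (barObj Y n)
  | 0 => f
  | n + 1 => codiagMap (barMap f n) (Hom.id _)

/-- The morphism `1 ⊗ f : H^n ⊗ X → H^n ⊗ Y`. -/
def cobMap (f : Hom X Y) : ∀ n, Hom (cobObj X n) (cobObj Y n)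
  | 0 => f
  | n + 1 => diagMap (Hom.id _) (cobMap f n)

/-- The morphism `(H^s ⊗ X) ⊗ H → H^s ⊗ (X ⊗ H)`, `t ⊗ x ⊗ h ↦ t Δ^{(s-1)}(h⁽¹⁾) ⊗ x ⊗ h⁽²⁾`. -/
def interchangeOne (X : HopfBimod k H) :
    ∀ s, Hom (codiag (cobObj X s) (regular k H)) (cobObj (codiag X (regular k H)) s)
  | 0 => Hom.id _
  | s + 1 => (diagMap (Hom.id _) (interchangeOne X s)).comp
      (interchange (cobObj X s) (regular k H))

/-- The morphism `(H^s ⊗ X) ⊗ H^n → H^s ⊗ (X ⊗ H^n)`,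
`t ⊗ x ⊗ h_1 ⊗ ⋯ ⊗ h_n ↦ t Δ^{(s-1)}(h_1⁽¹⁾ ⋯ h_n⁽¹⁾) ⊗ x ⊗ h_1⁽²⁾ ⊗ ⋯ ⊗ h_n⁽²⁾`. -/
def interchangeBar (X : HopfBimod k H) (s : ℕ) :
    ∀ n, Hom (barObj (cobObj X s) n) (cobObj (barObj X n) s)
  | 0 => Hom.id _
  | n + 1 => (interchangeOne (barObj X n) s).comp
      (codiagMap (interchangeBar X s n) (Hom.id _))

/-- The morphism `H^{s+1} ⊗ (H^{r+1} ⊗ N) → H^{r+s+1} ⊗ N` which applies the counit to the first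
factor of `H^{r+1}`. -/
def dropCob (N : HopfBimod k H) (r : ℕ) :
    ∀ s, Hom (cobObj (cobObj N (r + 1)) (s + 1)) (cobObj N (r + s + 1))
  | 0 => dropCounit (cobObj N r)
  | s + 1 => diagMap (Hom.id _) (dropCob N r s)

/-- The cup product, without sign, of `f : Bar_a(M) → Cob^s(L)` and `g : Bar_b(L) → Cob^r(N)`.
When `f` and `g` are identified with the maps
`f' : M ⊗ H^a → H^s ⊗ L`, `f'(m ⊗ t) = (ε ⊗ 1) f(m ⊗ t ⊗ 1)`, and `g' : L ⊗ H^b → H^r ⊗ N`,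
it sends `m ⊗ h_1 ⊗ ⋯ ⊗ h_{a+b}` to
`(1 ⊗ g') (f'(m ⊗ h_1 ⊗ ⋯ ⊗ h_a) · (Δ^{(s-1)}(h_{a+1}⁽¹⁾ ⋯ h_{a+b}⁽¹⁾) ⊗ 1)
  ⊗ h_{a+1}⁽²⁾ ⊗ ⋯ ⊗ h_{a+b}⁽²⁾)`. -/
def cupHom {a b s r : ℕ} (f : Hom (barObj M (a + 1)) (cobObj L (s + 1)))
    (g : Hom (barObj L (b + 1)) (cobObj N (r + 1))) :
    Hom (barObj M (a + b + 1)) (cobObj N (r + s + 1)) :=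
  (dropCob N r s).comp ((cobMap g (s + 1)).comp ((interchangeBar L (s + 1) (b + 1)).comp
    ((barMap f (b + 1)).comp (insertBar M a b))))

/-- The identification of `Hom(Bar_a(M), Cob^s(N))` with `Hom(Bar_a'(M), Cob^s'(N))` when
`a = a'` and `s = s'`. -/
def castHom {a a' s s' : ℕ} (ha : a = a') (hs : s = s')
    (f : Hom (barObj M (a + 1)) (cobObj N (s + 1))) :
    Hom (barObj M (a' + 1)) (cobObj N (s' + 1)) :=
  ha ▸ hs ▸ f

/-- The cup product `f ⌣ g` of cochains: the sum over all components `f_{a,s}` and `g_{b,r}` of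
`(-1)^{s b} f_{a,s} ⌣ g_{b,r}`. -/
def cup (f : Cochain M L) (g : Cochain L N) : Cochain M N := fun a s =>
  ∑ i : Finset.HasAntidiagonal.antidiagonal a, ∑ j : Finset.HasAntidiagonal.antidiagonal s,
    (-1 : k) ^ (j.1.1 * i.1.2) •
      castHom (Finset.HasAntidiagonal.mem_antidiagonal.1 i.2)
        ((Nat.add_comm _ _).trans (Finset.HasAntidiagonal.mem_antidiagonal.1 j.2))
        (cupHom (f i.1.1 j.1.1) (g i.1.2 j.1.2))

end Cochain

set_option maxSynthPendingDepth 6 in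
/-- `H_b^n(M, N)`: the `n`-th cohomology of the total complex of the double complex
`Hom(Bar_•(M), Cob^•(N))`. -/
def Hb (M N : HopfBimod k H) (n : ℕ) : Type v :=
  Cochain.cocycles M N n ⧸ (Cochain.coboundaries M N n).submoduleOf (Cochain.cocycles M N n)

namespace Hb

set_option maxSynthPendingDepth 6 in
instance (M N : HopfBimod k H) (n : ℕ) : AddCommGroup (Hb M N n) :=
  inferInstanceAs (AddCommGroup (Cochain.cocycles M N n ⧸
    (Cochain.coboundaries M N n).submoduleOf (Cochain.cocycles M N n)))

set_option maxSynthPendingDepth 6 in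
instance (M N : HopfBimod k H) (n : ℕ) : Module k (Hb M N n) :=
  inferInstanceAs (Module k (Cochain.cocycles M N n ⧸
    (Cochain.coboundaries M N n).submoduleOf (Cochain.cocycles M N n)))

set_option maxSynthPendingDepth 6 in
/-- The cohomology class of a cocycle. -/
def mk (M N : HopfBimod k H) (n : ℕ) : Cochain.cocycles M N n →ₗ[k] Hb M N n :=
  Submodule.mkQ _

end Hb

end HopfBimod

end

/-!
The object `H` is the unit of a monoidal structure on the category of Hopf bimodules, in two ways:
`H ⊗_H X ≅ X` and `H □_H X ≅ X`.  Graded-commutativity is a form of the Eckmann-Hilton argument: the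
product of two classes is compared with the tensor product of representatives, in which the order
of the two factors does not matter.

**Positive degrees.**  For extensions `E` and `F` of `H` by `H`, of degrees `m` and `n`, the complexes
`H → E_{m-1} → ⋯ → E_0` and `H → F_{n-1} → ⋯ → F_0` have a tensor product over `H`, whose total complex
(`total`) is an extension of `H` by `H`.  It maps to `F ♯ E` by `x ⊗ y ↦ ε(x) y` and
`x ⊗ y ↦ x i⁻¹(y)` (`over_total_splice`), and to `(-1)^{mn} E ♯ F` by `x ⊗ y ↦ x ε(y)` and
`x ⊗ y ↦ ± i⁻¹(x) y` (`over_total_twist`), where `i` is the map from `H` at the left end.  So the two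
classes coincide.  The point to be proved is that the total complex is exact, for which the tensor
product over `H` has to preserve the exactness of `E`: every exact sequence of Hopf bimodules has a
contraction which is linear for the right action of `H` (`Extension.exists_contraction`).  Indeed a `k`-linear map `g` may be replaced
by its average `x ↦ g(x₍₀₎ S(x₍₁₎)) x₍₂₎`, which is right `H`-linear, and the average of a linear map
`g` with `f g f = f` has the same property.  The contraction of `E` is then used to contract the
total complex (`exists_totContraction`).

**Degree zero.**  An endomorphism of `H` is determined by the image of `1`, which is a multiple of
`1` by the counit axiom, so it is a scalar `c` (`Hom.exists_eq_smul_id`).  If `c ≠ 0`, the two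
morphisms which define the products compose to `c` at both ends, and the division by `c` gives a
morphism of extensions (`Ext.mk_eq_of_over_smul`).  If `c = 0`, and `M` and `N` denote the right and
left ends of the middle extension `E`, the extension `E'` receives a
morphism from the sum of `E_{n-1} / N → ⋯ → E_0 → M` and of `N = N`, the extension `E''` has a
morphism to the sum of `N → E_{n-1} → ⋯ → ker(E_0 → M)` and of `M = M`, and the first sum maps to
the second (`Ext.mk_eq_of_over_zero`).

**The cup product.**  The functors `X ↦ X ⊗̲ H` and `X ↦ H ⊗̄ X` are a comonad `B` and a monad `T`,
related by a distributive law `B T → T B`, and the bar and cobar objects are their iterates.  So the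
cochains are families of morphisms `B^{a+1} M → T^{s+1} N`, and most of the argument takes place for
such a `MixedLaw` on a preadditive category.  A cocycle `g` of `H` with values in `H` extends to a
natural family of cocycles of `X` with values in `X`, by cotensoring with `X ≅ H □_H X`
(`natCocycle`).  For a cocycle `f` of `M` with values in `N`, naturality shows that the composites of
`f` with `g` on the two sides coincide up to the sign `(-1)^{pq}` (`MixedLaw.pair_natPairing`).  The
composite `g ∘ f` is homotopic to `f ⌣ g`: both are obtained from `f` by families of morphisms
`B^{b+1} T^{s+1} N → T^{l+1} N` which restrict to `g` on `N`, and two such families are homotopic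
because the objects `T^{l+1} N` are relatively injective (`MixedLaw.exists_pair_eq`).  In the same
way `f ∘ g` is homotopic to `g ⌣ f`, because the objects `B^{n+1} M` are relatively projective
(`MixedLaw.exists_copair_eq`).  Altogether `f ⌣ g` and `(-1)^{pq} g ⌣ f` are cohomologous
(`MixedLaw.exists_cup_comm`).
-/

/-! ### A recursion for contractible complexes -/

section Algebra

/-- Consider a complex with differential `R`, contracted by `S`, and maps `e`, `e'` of its terms with
`R e' = e R` and `e e' = 0`.  Then every family `θ` with `R θ_{s+1} = e θ_s` is of the form
`θ_s = e' h_s + R h_{s+1}`. -/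
theorem exists_contraction_solution {F : ℕ → Type*} [∀ s, AddCommGroup (F s)]
    {R : ∀ s, F (s + 1) → F s} {S : ∀ s, F s → F (s + 1)} {e e' : ∀ s, F s → F s}
    (hR : ∀ s x y, R s (x - y) = R s x - R s y) (hS : ∀ s, S s 0 = 0)
    (he : ∀ s x y, e s (x - y) = e s x - e s y)
    (h₀ : ∀ x, R 0 (S 0 x) = x) (h₁ : ∀ s x, R (s + 1) (S (s + 1) x) = x - S s (R s x))
    (hRe : ∀ s x, R s (e' (s + 1) x) = e s (R s x)) (hee : ∀ s x, e s (e' s x) = 0)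
    {θ : ∀ s, F s} (hθ : ∀ s, R s (θ (s + 1)) = e s (θ s)) :
    ∃ h : ∀ s, F s, ∀ s, θ s = e' s (h s) + R s (h (s + 1)) := by
  -- the recursion `h_0 = 0`, `h_{s+1} = S (θ_s - e' h_s)`
  let h : ∀ s, F s := fun s => Nat.rec 0 (fun s x => S s (θ s - e' s x)) s
  have hs : ∀ s, h (s + 1) = S s (θ s - e' s (h s)) := fun s => rfl
  have key : ∀ s, R s (h (s + 1)) = θ s - e' s (h s) := by
    intro s
    induction s with
    | zero => rw [hs, h₀]
    | succ s ih =>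
      rw [hs (s + 1), h₁, hR, hθ, hRe, ih, he, hee, sub_zero, sub_self, hS, sub_zero]
  exact ⟨h, fun s => by rw [key]; abel⟩

end Algebra

/-! ### Families of morphisms for a comonad, a monad and a distributive law -/

section Formal
open CategoryTheory

variable {C : Type*} [Category C]

/-- The object `F^n X`. -/
@[reducible] def iter (F : C ⥤ C) (X : C) : ℕ → C
  | 0 => X
  | n + 1 => F.obj (iter F X n)

/-- The morphism `F^n f`. -/
def iterMap (F : C ⥤ C) {X Y : C} (f : X ⟶ Y) : ∀ n, iter F X n ⟶ iter F Y n
  | 0 => f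
  | n + 1 => F.map (iterMap F f n)

variable [Preadditive C]

/-- A comonad `B` (without its coassociativity), a monad `T` (without its associativity) and a
distributive law `χ : B T ⟶ T B` compatible with the counit of `B` and the unit of `T`, on a
preadditive category. -/
structure MixedLaw (C : Type*) [Category C] [Preadditive C] where
  B : C ⥤ C
  T : C ⥤ C
  [additiveB : B.Additive]
  [additiveT : T.Additive]
  ε : ∀ X, B.obj X ⟶ X
  Δ : ∀ X, B.obj X ⟶ B.obj (B.obj X)
  η : ∀ X, X ⟶ T.obj X
  μ : ∀ X, T.obj (T.obj X) ⟶ T.obj X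
  χ : ∀ X, B.obj (T.obj X) ⟶ T.obj (B.obj X)
  ε_nat : ∀ {X Y} (f : X ⟶ Y), B.map f ≫ ε Y = ε X ≫ f
  Δ_nat : ∀ {X Y} (f : X ⟶ Y), B.map f ≫ Δ Y = Δ X ≫ B.map (B.map f)
  η_nat : ∀ {X Y} (f : X ⟶ Y), η X ≫ T.map f = f ≫ η Y
  μ_nat : ∀ {X Y} (f : X ⟶ Y), μ X ≫ T.map f = T.map (T.map f) ≫ μ Y
  χ_nat : ∀ {X Y} (f : X ⟶ Y), B.map (T.map f) ≫ χ Y = χ X ≫ T.map (B.map f)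
  Δ_ε : ∀ X, Δ X ≫ ε (B.obj X) = 𝟙 _
  Δ_map_ε : ∀ X, Δ X ≫ B.map (ε X) = 𝟙 _
  η_μ : ∀ X, η (T.obj X) ≫ μ X = 𝟙 _
  map_η_μ : ∀ X, T.map (η X) ≫ μ X = 𝟙 _
  χ_ε : ∀ X, χ X ≫ T.map (ε X) = ε (T.obj X)
  η_χ : ∀ X, B.map (η X) ≫ χ X = η (B.obj X)

attribute [instance] MixedLaw.additiveB MixedLaw.additiveT

theorem iterMap_zero (F : C ⥤ C) [F.Additive] {X Y : C} (n : ℕ) :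
    iterMap F (0 : X ⟶ Y) n = 0 := by
  induction n with
  | zero => rfl
  | succ n ih => rw [iterMap, ih, Functor.map_zero]

theorem iterMap_sub (F : C ⥤ C) [F.Additive] {X Y : C} (f g : X ⟶ Y) (n : ℕ) :
    iterMap F (f - g) n = iterMap F f n - iterMap F g n := by
  induction n with
  | zero => rfl
  | succ n ih => rw [iterMap, ih, Functor.map_sub]; rfl

namespace MixedLaw

variable (L : MixedLaw C)

/-- The bar differential `B^{n+1} M ⟶ B^n M`, with the sign for which the outermost counit is
positive. -/
def barD (M : C) : ∀ n, iter L.B M (n + 1) ⟶ iter L.B M n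
  | 0 => L.ε M
  | n + 1 => L.ε (iter L.B M (n + 1)) - L.B.map (barD M n)

/-- The cobar differential `T^n N ⟶ T^{n+1} N`. -/
def cobD (N : C) : ∀ n, iter L.T N n ⟶ iter L.T N (n + 1)
  | 0 => L.η N
  | n + 1 => L.η (iter L.T N (n + 1)) - L.T.map (cobD N n)

theorem barD_comp_barD (M : C) (n : ℕ) : L.barD M (n + 1) ≫ L.barD M n = 0 := by
  induction n with
  | zero => simp [barD, L.ε_nat]
  | succ n ih =>
    rw [barD, Preadditive.sub_comp, ← L.ε_nat, ← Preadditive.comp_sub (L.B.map (L.barD M (n + 1)))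
      (L.ε _) (L.barD M (n + 1))]
    rw [show L.barD M (n + 1) = L.ε (iter L.B M (n + 1)) - L.B.map (L.barD M n) from rfl,
      sub_sub_cancel, ← Functor.map_comp]
    erw [ih]
    simp

theorem cobD_comp_cobD (N : C) (n : ℕ) : L.cobD N n ≫ L.cobD N (n + 1) = 0 := by
  induction n with
  | zero => simp [cobD, L.η_nat]
  | succ n ih =>
    rw [show L.cobD N (n + 2) = L.η (iter L.T N (n + 2)) - L.T.map (L.cobD N (n + 1)) from rfl,
      Preadditive.comp_sub, ← L.η_nat, ← Preadditive.sub_comp,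
      show L.η (iter L.T N (n + 1)) - L.cobD N (n + 1) = L.T.map (L.cobD N n) by
        rw [cobD]; abel, ← Functor.map_comp, ih, Functor.map_zero]

variable {L}

/-- Precomposition of a family of morphisms with a differential of degree `-1`. -/
def pre {P Q : ℕ → C} (d : ∀ b, P (b + 1) ⟶ P b) (φ : ∀ b l, P b ⟶ Q l) : ∀ b l, P b ⟶ Q l
  | 0, _ => 0
  | b + 1, l => d b ≫ φ b l

/-- Postcomposition of a family of morphisms with a differential of degree `1`. -/
def post {P Q : ℕ → C} (δ : ∀ l, Q l ⟶ Q (l + 1)) (φ : ∀ b l, P b ⟶ Q l) : ∀ b l, P b ⟶ Q l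
  | _, 0 => 0
  | b, l + 1 => φ b l ≫ δ l

section PrePost

variable {P Q : ℕ → C} (d : ∀ b, P (b + 1) ⟶ P b) (δ : ∀ l, Q l ⟶ Q (l + 1))
  (φ ψ : ∀ b l, P b ⟶ Q l)

theorem pre_sub : pre d (φ - ψ) = pre d φ - pre d ψ := by
  funext b l
  cases b <;> simp [pre]

theorem post_sub : post δ (φ - ψ) = post δ φ - post δ ψ := by
  funext b l
  cases l <;> simp [post]

theorem pre_add : pre d (φ + ψ) = pre d φ + pre d ψ := by
  funext b l
  cases b <;> simp [pre]

theorem post_add : post δ (φ + ψ) = post δ φ + post δ ψ := by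
  funext b l
  cases l <;> simp [post]

theorem pre_zero : pre d (0 : ∀ b l, P b ⟶ Q l) = 0 := by
  funext b l
  cases b <;> simp [pre]

theorem post_zero : post δ (0 : ∀ b l, P b ⟶ Q l) = 0 := by
  funext b l
  cases l <;> simp [post]

theorem pre_pre (hd : ∀ b, d (b + 1) ≫ d b = 0) : pre d (pre d φ) = 0 := by
  funext b l
  rcases b with _ | _ | b
  · rfl
  · simp [pre]
  · simp [pre, reassoc_of% hd b]

theorem post_post (hδ : ∀ l, δ l ≫ δ (l + 1) = 0) : post δ (post δ φ) = 0 := by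
  funext b l
  rcases l with _ | _ | l
  · rfl
  · simp [post]
  · simp [post, hδ l]

theorem pre_post : pre d (post δ φ) = post δ (pre d φ) := by
  funext b l
  rcases b with _ | b <;> rcases l with _ | l <;> simp [pre, post]

theorem add_sub_eq_zero (hd : ∀ b, d (b + 1) ≫ d b = 0) (hδ : ∀ l, δ l ≫ δ (l + 1) = 0) :
    post δ (post δ φ - pre d φ) + pre d (post δ φ - pre d φ) = 0 := by
  rw [post_sub, pre_sub, post_post δ φ hδ, pre_pre d φ hd, pre_post]
  abel

end PrePost

variable (L)

/-- The lift of a family of morphisms `x a : B^{a+1} M ⟶ Y` to a family of morphisms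
`B^{n+1} M ⟶ B^{b+1} Y`: the one of indices `n = a + b` and `b` is the comultiplication of the
factor `B` of index `a`, followed by `B^{b+1} (x a)`. -/
def spread {M Y : C} (x : ∀ a, iter L.B M (a + 1) ⟶ Y) :
    ∀ n b, iter L.B M (n + 1) ⟶ iter L.B Y (b + 1)
  | n, 0 => L.Δ _ ≫ L.B.map (x n)
  | 0, _ + 1 => 0
  | n + 1, b + 1 => L.B.map (spread x n b)

/-- The extension of a family of morphisms `y r : X ⟶ T^{r+1} N` to a family of morphisms
`T^{s+1} X ⟶ T^{l+1} N`: the one of indices `s` and `l = r + s` is `T^{s+1} (y r)` followed by a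
multiplication. -/
def collect {X N : C} (y : ∀ r, X ⟶ iter L.T N (r + 1)) :
    ∀ l s, iter L.T X (s + 1) ⟶ iter L.T N (l + 1)
  | l, 0 => L.T.map (y l) ≫ L.μ _
  | 0, _ + 1 => 0
  | l + 1, s + 1 => L.T.map (collect y l s)

theorem spread_comp {M Y Z : C} (x : ∀ a, iter L.B M (a + 1) ⟶ Y) (φ : Y ⟶ Z) :
    ∀ n b, L.spread (fun a => x a ≫ φ) n b = L.spread x n b ≫ iterMap L.B φ (b + 1)
  | n, 0 => by simp [spread, iterMap]
  | 0, b + 1 => by simp [spread]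
  | n + 1, b + 1 => by rw [spread, spread_comp x φ n b, Functor.map_comp]; rfl

theorem comp_collect {X Y N : C} (φ : X ⟶ Y) (y : ∀ r, Y ⟶ iter L.T N (r + 1)) :
    ∀ l s, L.collect (fun r => φ ≫ y r) l s = iterMap L.T φ (s + 1) ≫ L.collect y l s
  | l, 0 => by simp [collect, iterMap]
  | 0, s + 1 => by simp [collect]
  | l + 1, s + 1 => by rw [collect, comp_collect φ y l s, Functor.map_comp]; rfl

theorem spread_add {M Y : C} (x y : ∀ a, iter L.B M (a + 1) ⟶ Y) :
    ∀ n b, L.spread (fun a => x a + y a) n b = L.spread x n b + L.spread y n b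
  | n, 0 => by simp [spread]
  | 0, b + 1 => by simp [spread]
  | n + 1, b + 1 => by rw [spread, spread_add x y n b, Functor.map_add]; rfl

theorem spread_zero {M Y : C} : ∀ n b, L.spread (fun a => (0 : iter L.B M (a + 1) ⟶ Y)) n b = 0
  | n, 0 => by simp [spread]
  | 0, b + 1 => rfl
  | n + 1, b + 1 => by rw [spread, spread_zero n b, Functor.map_zero]

theorem collect_add {X N : C} (x y : ∀ r, X ⟶ iter L.T N (r + 1)) :
    ∀ l s, L.collect (fun r => x r + y r) l s = L.collect x l s + L.collect y l s
  | n, 0 => by simp [collect]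
  | 0, b + 1 => by simp [collect]
  | n + 1, b + 1 => by rw [collect, collect_add x y n b, Functor.map_add]; rfl

theorem collect_zero {X N : C} : ∀ l s,
    L.collect (fun r => (0 : X ⟶ iter L.T N (r + 1))) l s = 0
  | n, 0 => by simp [collect]
  | 0, b + 1 => rfl
  | n + 1, b + 1 => by rw [collect, collect_zero n b, Functor.map_zero]

theorem spread_sum {M Y : C} {ι : Type*} (s : Finset ι) (x : ι → ∀ a, iter L.B M (a + 1) ⟶ Y)
    (n b : ℕ) : L.spread (fun a => ∑ i ∈ s, x i a) n b = ∑ i ∈ s, L.spread (x i) n b := by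
  classical
  induction s using Finset.induction_on with
  | empty => simp [spread_zero]
  | insert i s hi ih => simp only [Finset.sum_insert hi, spread_add, ih]

theorem collect_sum {X N : C} {ι : Type*} (t : Finset ι) (y : ι → ∀ r, X ⟶ iter L.T N (r + 1))
    (l s : ℕ) : L.collect (fun r => ∑ i ∈ t, y i r) l s = ∑ i ∈ t, L.collect (y i) l s := by
  classical
  induction t using Finset.induction_on with
  | empty => simp [collect_zero]
  | insert i s hi ih => simp only [Finset.sum_insert hi, collect_add, ih]

theorem spread_eq_zero {M Y : C} (x : ∀ a, iter L.B M (a + 1) ⟶ Y) :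
    ∀ n b, n < b → L.spread x n b = 0
  | _, 0, h => absurd h (by omega)
  | 0, _ + 1, _ => rfl
  | n + 1, b + 1, h => by rw [spread, spread_eq_zero x n b (by omega), Functor.map_zero]

theorem collect_eq_zero {X N : C} (y : ∀ r, X ⟶ iter L.T N (r + 1)) :
    ∀ l s, l < s → L.collect y l s = 0
  | _, 0, h => absurd h (by omega)
  | 0, _ + 1, _ => rfl
  | n + 1, b + 1, h => by rw [collect, collect_eq_zero y n b (by omega), Functor.map_zero]

/-- The lift of a cochain is a morphism of complexes up to the differential of the cochain. -/
theorem barD_spread {M Y : C} {x x' : ∀ a, iter L.B M (a + 1) ⟶ Y} (h₀ : x' 0 = 0)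
    (h : ∀ a, x' (a + 1) = L.barD M (a + 1) ≫ x a) : ∀ n b,
    L.barD M (n + 1) ≫ L.spread x n b =
      L.spread x (n + 1) (b + 1) ≫ L.barD Y (b + 1) + (-1 : ℤ) ^ b • L.spread x' (n + 1) b
  | n, 0 => by
    have e₁ : L.ε (iter L.B M (n + 1)) ≫ L.Δ (iter L.B M n) =
        L.B.map (L.Δ (iter L.B M n)) ≫ L.ε _ := (L.ε_nat _).symm
    have e₂ := L.Δ_nat (L.barD M n)
    have e₃ : ∀ {Z} (g : _ ⟶ Z), L.Δ (iter L.B M (n + 1)) ≫ L.B.map (L.ε _) ≫ g = g := fun g => by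
      rw [← Category.assoc, L.Δ_map_ε, Category.id_comp]
    have e₄ : L.B.map (L.Δ (iter L.B M n)) ≫ L.B.map (L.B.map (x n)) ≫ L.B.map (L.ε Y) =
        L.B.map (x n) := by
      rw [← Functor.map_comp (L.B) (L.B.map (x n)), L.ε_nat, ← Functor.map_comp, ← Category.assoc,
        L.Δ_ε, Category.id_comp]
    simp only [barD, spread, h, Preadditive.sub_comp, Preadditive.comp_sub, Functor.map_comp,
      Functor.map_sub, pow_zero, one_smul, Category.assoc, L.ε_nat]
    simp only [← Category.assoc, e₁, e₂]
    simp only [Category.assoc, L.ε_nat, e₃, e₄]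
    abel
  | 0, b + 1 => by
    rcases b with _ | b <;> simp [spread, h₀]
  | n + 1, b + 1 => by
    have ih := barD_spread h₀ h n b
    rw [spread, show L.barD M (n + 2) = L.ε (iter L.B M (n + 2)) - L.B.map (L.barD M (n + 1))
      from rfl, Preadditive.sub_comp, ← Functor.map_comp, ih, ← L.ε_nat,
      show L.barD Y (b + 2) = L.ε (iter L.B Y (b + 2)) - L.B.map (L.barD Y (b + 1)) from rfl,
      Preadditive.comp_sub, Functor.map_add, Functor.map_comp, Functor.map_zsmul, pow_succ]
    simp only [spread]
    simp
    abel

/-- The extension of a cochain is a morphism of complexes up to the differential of the cochain. -/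
theorem collect_cobD {X N : C} {y y' : ∀ r, X ⟶ iter L.T N (r + 1)} (h₀ : y' 0 = 0)
    (h : ∀ r, y' (r + 1) = y r ≫ L.cobD N (r + 1)) : ∀ l s,
    L.collect y l s ≫ L.cobD N (l + 1) =
      L.cobD X (s + 1) ≫ L.collect y (l + 1) (s + 1) + (-1 : ℤ) ^ s • L.collect y' (l + 1) s
  | l, 0 => by
    have e₁ : L.μ (iter L.T N l) ≫ L.η (iter L.T N (l + 1)) =
        L.η _ ≫ L.T.map (L.μ (iter L.T N l)) := (L.η_nat _).symm
    have e₂ := L.μ_nat (L.cobD N l)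
    have e₃ : ∀ {Z} (g : _ ⟶ Z), L.T.map (y l) ≫ L.η _ ≫ g = L.η _ ≫ L.T.map (L.T.map (y l)) ≫ g :=
      fun g => by rw [← Category.assoc, ← L.η_nat, Category.assoc]
    simp only [cobD, collect, h, Preadditive.sub_comp, Preadditive.comp_sub, Functor.map_comp,
      Functor.map_sub, pow_zero, one_smul, Category.assoc, e₁, e₂, L.map_η_μ, e₃]
    simp only [← Functor.map_comp, ← Category.assoc, L.η_nat]
    simp only [Functor.map_comp, Category.assoc, L.η_μ, Category.comp_id]
    abel
  | 0, s + 1 => by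
    rcases s with _ | s <;> simp [collect, h₀]
  | l + 1, s + 1 => by
    have ih := collect_cobD h₀ h l s
    rw [collect, show L.cobD N (l + 2) = L.η (iter L.T N (l + 2)) - L.T.map (L.cobD N (l + 1))
      from rfl, Preadditive.comp_sub, ← Functor.map_comp, ih, ← L.η_nat,
      show L.cobD X (s + 2) = L.η (iter L.T X (s + 2)) - L.T.map (L.cobD X (s + 1)) from rfl,
      Preadditive.sub_comp, Functor.map_add, Functor.map_comp, Functor.map_zsmul, pow_succ]
    simp only [collect]
    simp
    abel

end MixedLaw

end Formal

/-! ### The distributive law on iterates and the composition of families -/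

section Formal
open CategoryTheory
variable {C : Type*} [Category C] [Preadditive C]
namespace MixedLaw
variable (L : MixedLaw C)

/-- The morphism `B T^s X ⟶ T^s B X`. -/
def exchOne (X : C) : ∀ s, L.B.obj (iter L.T X s) ⟶ iter L.T (L.B.obj X) s
  | 0 => 𝟙 _
  | s + 1 => L.χ (iter L.T X s) ≫ L.T.map (exchOne X s)

/-- The morphism `B^n T^s X ⟶ T^s B^n X`. -/
def exch (X : C) (s : ℕ) : ∀ n, iter L.B (iter L.T X s) n ⟶ iter L.T (iter L.B X n) s
  | 0 => 𝟙 _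
  | n + 1 => L.B.map (exch X s n) ≫ L.exchOne (iter L.B X n) s

theorem barD_nat {X Y : C} (f : X ⟶ Y) : ∀ n,
    iterMap L.B f (n + 1) ≫ L.barD Y n = L.barD X n ≫ iterMap L.B f n
  | 0 => L.ε_nat f
  | n + 1 => by
    have ih := barD_nat f n
    rw [barD, barD, Preadditive.comp_sub, Preadditive.sub_comp,
      show iterMap L.B f (n + 2) = L.B.map (iterMap L.B f (n + 1)) from rfl, L.ε_nat,
      ← Functor.map_comp, ih, Functor.map_comp]
    rfl

theorem cobD_nat {X Y : C} (f : X ⟶ Y) : ∀ n,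
    iterMap L.T f n ≫ L.cobD Y n = L.cobD X n ≫ iterMap L.T f (n + 1)
  | 0 => (L.η_nat f).symm
  | n + 1 => by
    have ih := cobD_nat f n
    rw [cobD, cobD, Preadditive.comp_sub, Preadditive.sub_comp,
      show iterMap L.T f (n + 2) = L.T.map (iterMap L.T f (n + 1)) from rfl, L.η_nat,
      ← Functor.map_comp, ← ih, Functor.map_comp]
    rfl

theorem exchOne_nat {X Y : C} (f : X ⟶ Y) : ∀ s,
    L.B.map (iterMap L.T f s) ≫ L.exchOne Y s = L.exchOne X s ≫ iterMap L.T (L.B.map f) s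
  | 0 => by simp [exchOne, iterMap]
  | s + 1 => by
    rw [exchOne, exchOne, Category.assoc, iterMap, iterMap, ← Functor.map_comp,
      ← exchOne_nat f s, Functor.map_comp, ← Category.assoc, L.χ_nat, Category.assoc]

theorem exch_nat {X Y : C} (f : X ⟶ Y) (s : ℕ) : ∀ n,
    iterMap L.B (iterMap L.T f s) n ≫ L.exch Y s n = L.exch X s n ≫ iterMap L.T (iterMap L.B f n) s
  | 0 => by simp [exch, iterMap]
  | n + 1 => by
    rw [exch, exch, Category.assoc, iterMap, ← Category.assoc, ← Functor.map_comp, exch_nat f s n,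
      Functor.map_comp, Category.assoc, exchOne_nat]
    rfl

theorem exchOne_ε (X : C) : ∀ s, L.exchOne X s ≫ iterMap L.T (L.ε X) s = L.ε (iter L.T X s)
  | 0 => by simp [exchOne, iterMap]
  | s + 1 => by
    rw [exchOne, iterMap, Category.assoc, ← Functor.map_comp, exchOne_ε X s, L.χ_ε]

theorem exch_barD (X : C) (s : ℕ) : ∀ n,
    L.exch X s (n + 1) ≫ iterMap L.T (L.barD X n) s = L.barD (iter L.T X s) n ≫ L.exch X s n
  | 0 => by simp [exch, exchOne_ε, barD]
  | n + 1 => by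
    have ih := exch_barD X s n
    rw [barD, barD, iterMap_sub, Preadditive.comp_sub, Preadditive.sub_comp, exch, Category.assoc,
      Category.assoc, exchOne_ε, L.ε_nat, ← exchOne_nat, ← Category.assoc, ← Functor.map_comp, ih,
      Functor.map_comp, Category.assoc]
    rfl

theorem exchOne_cobD (X : C) : ∀ s,
    L.B.map (L.cobD X s) ≫ L.exchOne X (s + 1) = L.exchOne X s ≫ L.cobD (L.B.obj X) s
  | 0 => by simp [exchOne, cobD, L.η_χ]
  | s + 1 => by
    have ih := exchOne_cobD X s
    rw [cobD, cobD, Functor.map_sub, Preadditive.comp_sub, Preadditive.sub_comp,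
      show L.exchOne X (s + 2) = L.χ (iter L.T X (s + 1)) ≫ L.T.map (L.exchOne X (s + 1)) from rfl,
      ← Category.assoc, ← Category.assoc, L.η_χ, L.χ_nat, L.η_nat, Category.assoc,
      ← Functor.map_comp, ih, exchOne, Category.assoc, Category.assoc, Functor.map_comp]

theorem exch_cobD (X : C) (s : ℕ) : ∀ n,
    iterMap L.B (L.cobD X s) n ≫ L.exch X (s + 1) n = L.exch X s n ≫ L.cobD (iter L.B X n) s
  | 0 => by simp [exch, iterMap]
  | n + 1 => by
    rw [exch, exch, iterMap, Category.assoc, ← exchOne_cobD, ← Category.assoc, ← Functor.map_comp,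
      exch_cobD X s n, Functor.map_comp, Category.assoc]

theorem exchOne_zero (X : C) : L.exchOne X 0 = 𝟙 _ := rfl

theorem exch_zero (X : C) : ∀ n, L.exch X 0 n = 𝟙 _
  | 0 => rfl
  | n + 1 => by rw [exch, exch_zero X n, exchOne_zero]; simp

variable {L}

section Pairing

variable {M : C} {Y Q : ℕ → C}

variable (L) in
/-- The composition of a family of morphisms `Θ b s l : B^{b+1} (Y s) ⟶ Q l` with the lift of the
family of morphisms `f a s : B^{a+1} M ⟶ Y s`. -/
def pair (S : ℕ) (Θ : ∀ b s l, iter L.B (Y s) (b + 1) ⟶ Q l) (f : ∀ a s, iter L.B M (a + 1) ⟶ Y s)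
    (n l : ℕ) : iter L.B M (n + 1) ⟶ Q l :=
  ∑ b ∈ Finset.range (n + 1), ∑ s ∈ Finset.range S, L.spread (fun a => f a s) n b ≫ Θ b s l

variable (S : ℕ) (Θ Θ' : ∀ b s l, iter L.B (Y s) (b + 1) ⟶ Q l)
  (f f' : ∀ a s, iter L.B M (a + 1) ⟶ Y s)

theorem pair_add_left : L.pair S (Θ + Θ') f = L.pair S Θ f + L.pair S Θ' f := by
  funext n l
  simp [pair, Finset.sum_add_distrib]

theorem pair_sub_left : L.pair S (Θ - Θ') f = L.pair S Θ f - L.pair S Θ' f := by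
  funext n l
  simp [pair, Finset.sum_sub_distrib]

theorem pair_add_right : L.pair S Θ (f + f') = L.pair S Θ f + L.pair S Θ f' := by
  funext n l
  simp only [pair, Pi.add_apply, spread_add, Preadditive.add_comp, Finset.sum_add_distrib]

theorem pair_zero_right : L.pair S Θ (0 : ∀ a s, iter L.B M (a + 1) ⟶ Y s) = 0 := by
  funext n l
  simp [pair, spread_zero]

theorem pair_neg_right : L.pair S Θ (-f) = - L.pair S Θ f := by
  rw [eq_neg_iff_add_eq_zero, ← pair_add_right, neg_add_cancel, pair_zero_right]

theorem pair_sub_right : L.pair S Θ (f - f') = L.pair S Θ f - L.pair S Θ f' := by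
  rw [sub_eq_add_neg, pair_add_right, pair_neg_right, sub_eq_add_neg]

theorem post_pair (δ : ∀ l, Q l ⟶ Q (l + 1)) :
    post δ (L.pair S Θ f) = L.pair S
      (fun b s => post (P := fun _ : ℕ => iter L.B (Y s) (b + 1)) δ (fun _ l => Θ b s l) 0) f := by
  funext n l
  cases l <;> simp [pair, post, Preadditive.sum_comp]

/-- The Leibniz rule for the bar differential. -/
theorem pre_pair : pre (fun n => L.barD M (n + 1)) (L.pair S Θ f) =
    L.pair S (fun b s l => pre (fun b => L.barD (Y s) (b + 1)) (fun b l => Θ b s l) b l) f +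
      L.pair S (fun b s l => (-1 : ℤ) ^ b • Θ b s l) (pre (fun a => L.barD M (a + 1)) f) := by
  funext n l
  rcases n with _ | n
  · simp [pair, pre, spread]
  · have key : ∀ b s, L.barD M (n + 1) ≫ L.spread (fun a => f a s) n b =
        L.spread (fun a => f a s) (n + 1) (b + 1) ≫ L.barD (Y s) (b + 1) +
          (-1 : ℤ) ^ b • L.spread (fun a => pre (fun a => L.barD M (a + 1)) f a s) (n + 1) b :=
      fun b s => L.barD_spread rfl (fun _ => rfl) n b
    have h0 : ∀ s, L.spread (fun a => pre (fun a => L.barD M (a + 1)) f a s) (n + 1) (n + 1) = 0 := by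
      intro s
      have : ∀ m, L.spread (fun a => pre (fun a => L.barD M (a + 1)) f a s) m m = 0 := by
        intro m
        induction m with
        | zero => simp [spread, pre]
        | succ m ih => rw [spread, ih, Functor.map_zero]
      exact this _
    have r₁ : L.pair S (fun b s l => pre (fun b => L.barD (Y s) (b + 1)) (fun b l => Θ b s l) b l)
        f (n + 1) l = ∑ b ∈ Finset.range (n + 1), ∑ s ∈ Finset.range S,
          L.spread (fun a => f a s) (n + 1) (b + 1) ≫ L.barD (Y s) (b + 1) ≫ Θ b s l := by
      rw [pair, Finset.sum_range_succ']
      simp [pre]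
    have r₂ : L.pair S (fun b s l => (-1 : ℤ) ^ b • Θ b s l) (pre (fun a => L.barD M (a + 1)) f)
        (n + 1) l = ∑ b ∈ Finset.range (n + 1), ∑ s ∈ Finset.range S,
          L.spread (fun a => pre (fun a => L.barD M (a + 1)) f a s) (n + 1) b ≫
            ((-1 : ℤ) ^ b • Θ b s l) := by
      rw [pair, Finset.sum_range_succ]
      simp [h0]
    rw [Pi.add_apply, Pi.add_apply, r₁, r₂, pre, pair, Preadditive.comp_sum,
      ← Finset.sum_add_distrib]
    refine Finset.sum_congr rfl fun b _ => ?_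
    rw [Preadditive.comp_sum, ← Finset.sum_add_distrib]
    refine Finset.sum_congr rfl fun s _ => ?_
    rw [← Category.assoc, key, Preadditive.add_comp, Category.assoc, Preadditive.zsmul_comp,
      Preadditive.comp_zsmul]

/-- A cobar differential of `f` can be moved to the family `Θ`.  The hypothesis says that the sum over
`s < S` contains all nonzero terms of both sides. -/
theorem pair_post {δ : ∀ s, Y s ⟶ Y (s + 1)} (hf : ∀ a s, S ≤ s + 1 → f a s = 0) :
    L.pair S Θ (post δ f) =
      L.pair S (fun b s l => iterMap L.B (δ s) (b + 1) ≫ Θ b (s + 1) l) f := by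
  funext n l
  refine Finset.sum_congr rfl fun b _ => ?_
  rcases S with _ | S
  · simp
  · rw [Finset.sum_range_succ', Finset.sum_range_succ]
    have h1 : L.spread (fun a => f a S) n b = 0 := by
      simp only [hf _ S le_rfl, spread_zero]
    have h2 : L.spread (fun a => post δ f a 0) n b = 0 := by
      simp only [post, spread_zero]
    rw [h1, h2, Limits.zero_comp, Limits.zero_comp]
    simp only [post, spread_comp, Category.assoc]

end Pairing

section Copairing

variable {X : ℕ → C} {P : ℕ → C} {N : C}

variable (L) in
/-- The composition of the extension of the family of morphisms `f a r : X a ⟶ T^{r+1} N` with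
a family of morphisms `ψ n r a : P n ⟶ T^{r+1} (X a)`. -/
def copair (A : ℕ) (f : ∀ a r, X a ⟶ iter L.T N (r + 1)) (ψ : ∀ n r a, P n ⟶ iter L.T (X a) (r + 1))
    (n l : ℕ) : P n ⟶ iter L.T N (l + 1) :=
  ∑ a ∈ Finset.range A, ∑ r ∈ Finset.range (l + 1), ψ n r a ≫ L.collect (f a) l r

variable (A : ℕ) (f f' : ∀ a r, X a ⟶ iter L.T N (r + 1))
  (ψ ψ' : ∀ n r a, P n ⟶ iter L.T (X a) (r + 1))

theorem copair_add_left : L.copair A (f + f') ψ = L.copair A f ψ + L.copair A f' ψ := by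
  funext n l
  have : ∀ a r, L.collect (f a + f' a) l r = L.collect (f a) l r + L.collect (f' a) l r :=
    fun a r => L.collect_add (f a) (f' a) l r
  simp only [copair, Pi.add_apply, this, Preadditive.comp_add, Finset.sum_add_distrib]

theorem copair_zero_left : L.copair A (0 : ∀ a r, X a ⟶ iter L.T N (r + 1)) ψ = 0 := by
  funext n l
  have : ∀ a r, L.collect (0 : ∀ r, X a ⟶ iter L.T N (r + 1)) l r = 0 :=
    fun a r => L.collect_zero l r
  simp [copair, this]

theorem copair_neg_left : L.copair A (-f) ψ = - L.copair A f ψ := by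
  rw [eq_neg_iff_add_eq_zero, ← copair_add_left, neg_add_cancel, copair_zero_left]

theorem copair_add_right : L.copair A f (ψ + ψ') = L.copair A f ψ + L.copair A f ψ' := by
  funext n l
  simp [copair, Finset.sum_add_distrib]

theorem copair_sub_right : L.copair A f (ψ - ψ') = L.copair A f ψ - L.copair A f ψ' := by
  funext n l
  simp [copair, Finset.sum_sub_distrib]

theorem pre_copair (d : ∀ n, P (n + 1) ⟶ P n) :
    pre d (L.copair A f ψ) = L.copair A f
      (fun n r a => pre d (Q := fun _ : ℕ => iter L.T (X a) (r + 1)) (fun n _ => ψ n r a) n 0) := by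
  funext n l
  cases n <;> simp [copair, pre, Preadditive.comp_sum]

/-- The Leibniz rule for the cobar differential. -/
theorem post_copair : post (fun l => L.cobD N (l + 1)) (L.copair A f ψ) =
    L.copair A f
      (fun n r a => post (fun r => L.cobD (X a) (r + 1)) (fun n r => ψ n r a) n r) +
      L.copair A (post (fun l => L.cobD N (l + 1)) f) (fun n r a => (-1 : ℤ) ^ r • ψ n r a) := by
  funext n l
  rcases l with _ | l
  · simp [copair, post, collect]
  · have key : ∀ a r, L.collect (f a) l r ≫ L.cobD N (l + 1) =
        L.cobD (X a) (r + 1) ≫ L.collect (f a) (l + 1) (r + 1) +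
          (-1 : ℤ) ^ r • L.collect (post (fun l => L.cobD N (l + 1)) f a) (l + 1) r :=
      fun a r => L.collect_cobD rfl (fun _ => rfl) l r
    have h0 : ∀ a, L.collect (post (fun l => L.cobD N (l + 1)) f a) (l + 1) (l + 1) = 0 := by
      intro a
      have : ∀ m, L.collect (post (fun l => L.cobD N (l + 1)) f a) m m = 0 := by
        intro m
        induction m with
        | zero => simp [collect, post]
        | succ m ih => rw [collect, ih, Functor.map_zero]
      exact this _
    have r₁ : L.copair A f (fun n r a => post (fun r => L.cobD (X a) (r + 1))
        (fun n r => ψ n r a) n r) n (l + 1) = ∑ a ∈ Finset.range A, ∑ r ∈ Finset.range (l + 1),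
          (ψ n r a ≫ L.cobD (X a) (r + 1)) ≫ L.collect (f a) (l + 1) (r + 1) := by
      refine Finset.sum_congr rfl fun a _ => ?_
      rw [Finset.sum_range_succ']
      simp [post]
    have r₂ : L.copair A (post (fun l => L.cobD N (l + 1)) f) (fun n r a => (-1 : ℤ) ^ r • ψ n r a)
        n (l + 1) = ∑ a ∈ Finset.range A, ∑ r ∈ Finset.range (l + 1),
          ((-1 : ℤ) ^ r • ψ n r a) ≫
            L.collect (post (fun l => L.cobD N (l + 1)) f a) (l + 1) r := by
      refine Finset.sum_congr rfl fun a _ => ?_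
      rw [Finset.sum_range_succ]
      simp [h0]
    rw [Pi.add_apply, Pi.add_apply, r₁, r₂, post, copair, Preadditive.sum_comp,
      ← Finset.sum_add_distrib]
    refine Finset.sum_congr rfl fun a _ => ?_
    rw [Preadditive.sum_comp, ← Finset.sum_add_distrib]
    refine Finset.sum_congr rfl fun r _ => ?_
    rw [Category.assoc, key, Preadditive.comp_add, Category.assoc, Preadditive.zsmul_comp,
      Preadditive.comp_zsmul]

/-- A bar differential of `f` can be moved to the family `ψ`.  The hypothesis says that the sum over
`a < A` contains all nonzero terms of both sides. -/
theorem copair_pre {d : ∀ a, X (a + 1) ⟶ X a} (hf : ∀ a r, A ≤ a + 1 → f a r = 0) :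
    L.copair A (pre d f) ψ =
      L.copair A f (fun n r a => ψ n r (a + 1) ≫ iterMap L.T (d a) (r + 1)) := by
  funext n l
  rcases A with _ | A
  · simp [copair]
  · have h1 : ∀ r, L.collect (f A) l r = 0 := by
      intro r
      have : f A = fun r => 0 := funext fun r => hf A r le_rfl
      rw [this, collect_zero]
    have h2 : ∀ r, L.collect (pre d f 0) l r = 0 := by
      intro r
      have : pre d f 0 = fun r => 0 := rfl
      rw [this, collect_zero]
    have h3 : ∀ a r, L.collect (pre d f (a + 1)) l r =
        iterMap L.T (d a) (r + 1) ≫ L.collect (f a) l r := fun a r => L.comp_collect _ _ l r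
    rw [copair, copair, Finset.sum_range_succ', Finset.sum_range_succ _ A]
    refine congrArg₂ _ (Finset.sum_congr rfl fun a _ => Finset.sum_congr rfl fun r _ => ?_) ?_
    · rw [h3, Category.assoc]
    · rw [Finset.sum_eq_zero fun r _ => by rw [h2, Limits.comp_zero],
        Finset.sum_eq_zero fun r _ => by rw [h1, Limits.comp_zero]]

end Copairing

end MixedLaw
end Formal

/-! ### Relative injectivity and relative projectivity -/

section Formal
open CategoryTheory
variable {C : Type*} [Category C] [Preadditive C]
namespace MixedLaw
variable {L : MixedLaw C}

theorem neg_one_pow_smul_smul {A : Type*} [AddCommGroup A] (b : ℕ) (x : A) :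
    (-1 : ℤ) ^ b • (-1 : ℤ) ^ b • x = x := by
  rw [smul_smul, ← mul_pow, neg_one_mul, neg_neg, one_pow, one_smul]

variable (L) in
/-- The cocycle condition on families of morphisms `Θ b s l : B^{b+1} T^{s+1} N ⟶ T^{l+1} N'`, for
which the composition with a cocycle `B^{a+1} M ⟶ T^{s+1} N` is a cocycle. -/
def IsPairing {N N' : C} (Θ : ∀ b s l, iter L.B (iter L.T N (s + 1)) (b + 1) ⟶ iter L.T N' (l + 1)) :
    Prop :=
  ∀ s, (fun b l => (-1 : ℤ) ^ b • (iterMap L.B (L.cobD N (s + 1)) (b + 1) ≫ Θ b (s + 1) l)) =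
    post (fun l => L.cobD N' (l + 1)) (fun b l => Θ b s l) +
      pre (fun b => L.barD (iter L.T N (s + 1)) (b + 1)) (fun b l => Θ b s l)

variable (L) in
/-- The cocycle condition on families of morphisms `ψ n r a : B^{n+1} M' ⟶ T^{r+1} B^{a+1} M`, for
which the composition with a cocycle `B^{a+1} M ⟶ T^{s+1} N` is a cocycle. -/
def IsCopairing {M M' : C}
    (ψ : ∀ n r a, iter L.B M' (n + 1) ⟶ iter L.T (iter L.B M (a + 1)) (r + 1)) : Prop :=
  ∀ a, (fun n r => (-1 : ℤ) ^ r • (ψ n r (a + 1) ≫ iterMap L.T (L.barD M (a + 1)) (r + 1))) =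
    post (fun r => L.cobD (iter L.B M (a + 1)) (r + 1)) (fun n r => ψ n r a) +
      pre (fun n => L.barD M' (n + 1)) (fun n r => ψ n r a)

variable (L) in
/-- The families of morphisms `B^{b+1} T^s N ⟶ T^{l+1} N'`. -/
abbrev ExtFam (N N' : C) (s : ℕ) : Type _ :=
  ∀ b l : ℕ, iter L.B (iter L.T N s) (b + 1) ⟶ iter L.T N' (l + 1)

variable (L) in
/-- The families of morphisms `B^{n+1} M' ⟶ T^{r+1} B^a M`. -/
abbrev LiftFam (M M' : C) (a : ℕ) : Type _ :=
  ∀ n r : ℕ, iter L.B M' (n + 1) ⟶ iter L.T (iter L.B M a) (r + 1)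

/-- The relative injectivity of the objects `T^{l+1} N'`: a cocycle of families of morphisms
`B^{b+1} T^{s+1} N ⟶ T^{l+1} N'` which vanishes on `N` is a coboundary. -/
theorem exists_extension_homotopy {N N' : C}
    {Θ : ∀ b s l, iter L.B (iter L.T N (s + 1)) (b + 1) ⟶ iter L.T N' (l + 1)}
    (hΘ : L.IsPairing Θ)
    (hΘ₀ : ∀ b l, iterMap L.B (L.η N) (b + 1) ≫ Θ b 0 l = 0) :
    ∃ h : ∀ b s l, iter L.B (iter L.T N (s + 1)) (b + 1) ⟶ iter L.T N' (l + 1), ∀ s,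
      (fun b l => Θ b s l) = post (fun l => L.cobD N' (l + 1)) (fun b l => h b s l) -
        pre (fun b => L.barD (iter L.T N (s + 1)) (b + 1)) (fun b l => h b s l) +
          fun b l => (-1 : ℤ) ^ b • (iterMap L.B (L.cobD N (s + 1)) (b + 1) ≫ h b (s + 1) l) := by
  -- the complex of families is the precomposition with the cobar resolution of `N`; it is contracted
  -- by the functor `T`, followed by the multiplication `μ` of the target
  let R : ∀ s, L.ExtFam N N' (s + 1) → L.ExtFam N N' s := fun s φ b l =>
    (-1 : ℤ) ^ b • (iterMap L.B (L.cobD N s) (b + 1) ≫ φ b l)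
  let S : ∀ s, L.ExtFam N N' s → L.ExtFam N N' (s + 1) := fun s φ b l =>
    (-1 : ℤ) ^ b • (L.exch (iter L.T N s) 1 (b + 1) ≫ L.T.map (φ b l) ≫ L.μ (iter L.T N' l))
  let e' : ∀ s, L.ExtFam N N' s → L.ExtFam N N' s := fun s φ => post (fun l => L.cobD N' (l + 1)) φ -
    pre (fun b => L.barD (iter L.T N s) (b + 1)) φ
  let e : ∀ s, L.ExtFam N N' s → L.ExtFam N N' s := fun s φ => post (fun l => L.cobD N' (l + 1)) φ +
    pre (fun b => L.barD (iter L.T N s) (b + 1)) φ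
  -- `Θ` is extended by zero on `N`, which is possible by the hypothesis `hΘ₀`
  let θ : ∀ s, L.ExtFam N N' s := fun s => match s with
    | 0 => 0
    | s + 1 => fun b l => Θ b s l
  have hη : ∀ (s : ℕ) (x : L.ExtFam N N' s) (b l : ℕ), iterMap L.B (L.η (iter L.T N s)) (b + 1) ≫
      L.exch (iter L.T N s) 1 (b + 1) ≫ L.T.map (x b l) ≫ L.μ (iter L.T N' l) = x b l := by
    intro s x b l
    have := L.exch_cobD (iter L.T N s) 0 (b + 1)
    rw [exch_zero, Category.id_comp] at this
    simp only [cobD] at this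
    rw [← Category.assoc, this, ← Category.assoc, L.η_nat, Category.assoc, L.η_μ, Category.comp_id]
  suffices key : ∃ h : ∀ s, L.ExtFam N N' s, ∀ s, θ s = e' s (h s) + R s (h (s + 1)) by
    obtain ⟨h, hh⟩ := key
    exact ⟨fun b s l => h (s + 1) b l, fun s => hh (s + 1)⟩
  refine exists_contraction_solution (S := S) (e := e) ?_ ?_ ?_ ?_ ?_ ?_ ?_ ?_
  · intro s x y
    funext b l
    simp [R, smul_sub]
  · intro s
    funext b l
    simp [S]
  · intro s x y
    simp only [e, pre_sub, post_sub]
    abel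
  · intro x
    funext b l
    simp only [R, S, Preadditive.comp_zsmul, neg_one_pow_smul_smul, cobD]
    exact hη 0 x b l
  · intro s x
    funext b l
    have e₁ : iterMap L.B (L.T.map (L.cobD N s)) (b + 1) ≫ L.exch (iter L.T N (s + 1)) 1 (b + 1) =
        L.exch (iter L.T N s) 1 (b + 1) ≫ L.T.map (iterMap L.B (L.cobD N s) (b + 1)) :=
      L.exch_nat (L.cobD N s) 1 (b + 1)
    simp only [R, S, Preadditive.comp_zsmul, neg_one_pow_smul_smul, Pi.sub_apply, Functor.map_zsmul,
      Preadditive.zsmul_comp]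
    rw [show L.cobD N (s + 1) = L.η _ - L.T.map (L.cobD N s) from rfl, iterMap_sub,
      Preadditive.sub_comp]
    refine congrArg₂ (· - ·) (hη (s + 1) x b l) ?_
    rw [Functor.map_comp, ← Category.assoc (iterMap L.B (L.T.map (L.cobD N s)) (b + 1)), e₁, Category.assoc,
      Category.assoc]
  · intro s x
    simp only [R, e, e']
    funext b l
    have e₁ := L.barD_nat (L.cobD N s)
    rcases b with _ | b <;> rcases l with _ | l <;>
      simp [pre, post, pow_succ, reassoc_of% e₁, smul_sub]
  · intro s x
    exact add_sub_eq_zero _ _ _ (fun b => L.barD_comp_barD _ _) (fun l => L.cobD_comp_cobD _ _)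
  · intro s
    rcases s with _ | s
    · have : e 0 (θ 0) = 0 := by
        simp only [θ, e]
        erw [pre_zero, post_zero]
        simp
      rw [this]
      funext b l
      simp only [R, θ, cobD, hΘ₀, smul_zero]
      rfl
    · exact hΘ s

/-- The relative projectivity of the objects `B^{n+1} M'`: a cocycle of families of morphisms
`B^{n+1} M' ⟶ T^{r+1} B^{a+1} M` which vanishes in `M` is a coboundary. -/
theorem exists_lift_homotopy {M M' : C}
    {ψ : ∀ n r a, iter L.B M' (n + 1) ⟶ iter L.T (iter L.B M (a + 1)) (r + 1)}
    (hψ : L.IsCopairing ψ)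
    (hψ₀ : ∀ n r, ψ n r 0 ≫ iterMap L.T (L.ε M) (r + 1) = 0) :
    ∃ h : ∀ n r a, iter L.B M' (n + 1) ⟶ iter L.T (iter L.B M (a + 1)) (r + 1), ∀ a,
      (fun n r => ψ n r a) = post (fun r => L.cobD (iter L.B M (a + 1)) (r + 1))
          (fun n r => h n r a) - pre (fun n => L.barD M' (n + 1)) (fun n r => h n r a) -
        fun n r => (-1 : ℤ) ^ r • (h n r (a + 1) ≫ iterMap L.T (L.barD M (a + 1)) (r + 1)) := by
  -- the complex of families is the composition with the bar resolution of `M`; it is contracted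
  -- by the functor `B`, preceded by the comultiplication `Δ` of the source
  let R : ∀ a, L.LiftFam M M' (a + 1) → L.LiftFam M M' a := fun a φ n r =>
    -((-1 : ℤ) ^ r • (φ n r ≫ iterMap L.T (L.barD M a) (r + 1)))
  let S : ∀ a, L.LiftFam M M' a → L.LiftFam M M' (a + 1) := fun a φ n r =>
    -((-1 : ℤ) ^ r • (L.Δ (iter L.B M' n) ≫ L.B.map (φ n r) ≫ L.exchOne (iter L.B M a) (r + 1)))
  let e' : ∀ a, L.LiftFam M M' a → L.LiftFam M M' a := fun a φ => post (fun r => L.cobD (iter L.B M a) (r + 1)) φ -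
    pre (fun n => L.barD M' (n + 1)) φ
  let e : ∀ a, L.LiftFam M M' a → L.LiftFam M M' a := fun a φ => -(post (fun r => L.cobD (iter L.B M a) (r + 1)) φ +
    pre (fun n => L.barD M' (n + 1)) φ)
  -- `ψ` is extended by zero to `M`, which is possible by the hypothesis `hψ₀`
  let θ : ∀ a, L.LiftFam M M' a := fun a => match a with
    | 0 => 0
    | a + 1 => fun n r => ψ n r a
  have hε : ∀ (a : ℕ) (x : L.LiftFam M M' a) (n r : ℕ), (L.Δ (iter L.B M' n) ≫ L.B.map (x n r) ≫
      L.exchOne (iter L.B M a) (r + 1)) ≫ iterMap L.T (L.ε (iter L.B M a)) (r + 1) = x n r := by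
    intro a x n r
    rw [Category.assoc, Category.assoc, exchOne_ε, L.ε_nat, ← Category.assoc, L.Δ_ε,
      Category.id_comp]
  suffices key : ∃ h : ∀ s, L.LiftFam M M' s, ∀ s, θ s = e' s (h s) + R s (h (s + 1)) by
    obtain ⟨h, hh⟩ := key
    refine ⟨fun n r a => h (a + 1) n r, fun a => (hh (a + 1)).trans ?_⟩
    rw [sub_eq_add_neg]
    rfl
  refine exists_contraction_solution (S := S) (e := e) ?_ ?_ ?_ ?_ ?_ ?_ ?_ ?_
  · intro s x y
    funext b l
    simp [R, smul_sub]
    abel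
  · intro s
    funext b l
    simp [S]
  · intro s x y
    simp only [e, pre_sub, post_sub]
    abel
  · intro x
    funext n r
    simp only [R, S, Preadditive.neg_comp, Preadditive.zsmul_comp, smul_neg, neg_neg,
      neg_one_pow_smul_smul, barD]
    exact hε 0 x n r
  · intro a x
    funext n r
    simp only [R, S, Preadditive.neg_comp, Preadditive.zsmul_comp, smul_neg, neg_neg,
      neg_one_pow_smul_smul, Pi.sub_apply, Functor.map_zsmul, Functor.map_neg,
      Preadditive.comp_zsmul, Preadditive.comp_neg]
    rw [show L.barD M (a + 1) = L.ε _ - L.B.map (L.barD M a) from rfl, iterMap_sub,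
      Preadditive.comp_sub, hε, Category.assoc, Category.assoc, ← exchOne_nat, Functor.map_comp,
      Category.assoc]
  · intro a x
    simp only [R, e, e']
    funext n r
    have e₁ := L.cobD_nat (L.barD M a)
    rcases n with _ | n <;> rcases r with _ | r <;>
      simp [pre, post, pow_succ, e₁, smul_sub]
  · intro s x
    simp only [e, e', neg_eq_zero]
    exact add_sub_eq_zero _ _ _ (fun b => L.barD_comp_barD _ _) (fun l => L.cobD_comp_cobD _ _)
  · intro a
    rcases a with _ | a
    · have : e 0 (θ 0) = 0 := by
        simp only [θ, e]
        erw [pre_zero, post_zero]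
        simp
      rw [this]
      funext n r
      simp only [R, θ, barD, hψ₀, smul_zero, neg_zero]
      rfl
    · rw [show e (a + 1) (θ (a + 1)) = - _ from rfl, show θ (a + 1) = (fun n r => ψ n r a) from rfl,
        ← hψ a]
      rfl

/-- The composition of a cocycle with a cocycle of families which vanishes on `N` is a coboundary. -/
theorem exists_pair_eq {M N N' : C} (S : ℕ)
    {Θ : ∀ b s l, iter L.B (iter L.T N (s + 1)) (b + 1) ⟶ iter L.T N' (l + 1)}
    (hΘ : L.IsPairing Θ)
    (hΘ₀ : ∀ b l, iterMap L.B (L.η N) (b + 1) ≫ Θ b 0 l = 0)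
    {f : ∀ a s, iter L.B M (a + 1) ⟶ iter L.T N (s + 1)} (hf : ∀ a s, S ≤ s + 1 → f a s = 0)
    (hDf : post (fun s => L.cobD N (s + 1)) f + pre (fun a => L.barD M (a + 1)) f = 0) :
    ∃ h : ∀ n l, iter L.B M (n + 1) ⟶ iter L.T N' (l + 1),
      L.pair S Θ f = post (fun l => L.cobD N' (l + 1)) h - pre (fun n => L.barD M (n + 1)) h := by
  obtain ⟨h, hh⟩ := exists_extension_homotopy hΘ hΘ₀
  refine ⟨L.pair S h f, ?_⟩
  have e₁ : Θ = (fun b s => post (P := fun _ : ℕ => iter L.B (iter L.T N (s + 1)) (b + 1))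
      (fun l => L.cobD N' (l + 1)) (fun _ l => h b s l) 0) -
      (fun b s l => pre (fun b => L.barD (iter L.T N (s + 1)) (b + 1)) (fun b l => h b s l) b l) +
      (fun b s l => iterMap L.B (L.cobD N (s + 1)) (b + 1) ≫ ((-1 : ℤ) ^ b • h b (s + 1) l)) := by
    funext b s l
    refine (congrFun (congrFun (hh s) b) l).trans ?_
    simp only [Pi.add_apply, Pi.sub_apply, Preadditive.comp_zsmul]
    cases l <;> rfl
  have e₂ := pair_post S (fun b s l => (-1 : ℤ) ^ b • h b s l) f
    (δ := fun s => L.cobD N (s + 1)) hf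
  rw [post_pair, pre_pair, e₁, pair_add_left, pair_sub_left,
    eq_neg_of_add_eq_zero_right hDf, pair_neg_right, e₂]
  abel

/-- The composition of a cocycle of families which vanishes in `M` with a cocycle is a coboundary. -/
theorem exists_copair_eq {M M' N : C} (A : ℕ)
    {ψ : ∀ n r a, iter L.B M' (n + 1) ⟶ iter L.T (iter L.B M (a + 1)) (r + 1)}
    (hψ : L.IsCopairing ψ)
    (hψ₀ : ∀ n r, ψ n r 0 ≫ iterMap L.T (L.ε M) (r + 1) = 0)
    {f : ∀ a s, iter L.B M (a + 1) ⟶ iter L.T N (s + 1)} (hf : ∀ a s, A ≤ a + 1 → f a s = 0)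
    (hDf : post (fun s => L.cobD N (s + 1)) f + pre (fun a => L.barD M (a + 1)) f = 0) :
    ∃ h : ∀ n l, iter L.B M' (n + 1) ⟶ iter L.T N (l + 1),
      L.copair A f ψ = post (fun l => L.cobD N (l + 1)) h - pre (fun n => L.barD M' (n + 1)) h := by
  obtain ⟨h, hh⟩ := exists_lift_homotopy hψ hψ₀
  refine ⟨L.copair A f h, ?_⟩
  have e₁ : ψ = (fun n r a => post (fun r => L.cobD (iter L.B M (a + 1)) (r + 1))
        (fun n r => h n r a) n r) -
      (fun n r a => pre (fun n => L.barD M' (n + 1))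
        (Q := fun _ : ℕ => iter L.T (iter L.B M (a + 1)) (r + 1)) (fun n _ => h n r a) n 0) -
      (fun n r a => ((-1 : ℤ) ^ r • h n r (a + 1)) ≫ iterMap L.T (L.barD M (a + 1)) (r + 1)) := by
    funext n r a
    refine (congrFun (congrFun (hh a) n) r).trans ?_
    simp only [Pi.sub_apply, Preadditive.zsmul_comp]
    cases n <;> rfl
  have e₂ := copair_pre A f (fun n r a => (-1 : ℤ) ^ r • h n r a)
    (d := fun a => L.barD M (a + 1)) hf
  rw [post_copair, pre_copair, e₁, copair_sub_right, copair_sub_right,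
    eq_neg_of_add_eq_zero_left hDf, copair_neg_left, e₂]
  abel

end MixedLaw
end Formal

/-! ### The cup product as a composition of families -/

section Formal
open CategoryTheory
variable {C : Type*} [Category C] [Preadditive C]

theorem sum_range_eq_sum_range {A : Type*} [AddCommMonoid A] {f : ℕ → A} {m n : ℕ}
    (hm : ∀ i, m ≤ i → f i = 0) (hn : ∀ i, n ≤ i → f i = 0) :
    ∑ i ∈ Finset.range m, f i = ∑ i ∈ Finset.range n, f i := by
  rcases le_total m n with h | h
  · exact Finset.sum_subset (by simpa using h) fun i _ hi => hm i (by simpa using hi)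
  · exact (Finset.sum_subset (by simpa using h) fun i _ hi => hn i (by simpa using hi)).symm

/-- The Kronecker symbol `F^s X ⟶ F^j X`: the identity for `s = j`, and zero otherwise. -/
def kron (F : C ⥤ C) (X : C) : ∀ s j, iter F X s ⟶ iter F X j
  | 0, 0 => 𝟙 X
  | 0, _ + 1 => 0
  | _ + 1, 0 => 0
  | s + 1, j + 1 => F.map (kron F X s j)

theorem kron_self (F : C ⥤ C) (X : C) : ∀ s, kron F X s s = 𝟙 _
  | 0 => rfl
  | s + 1 => by rw [kron, kron_self F X s, F.map_id]

theorem kron_of_ne (F : C ⥤ C) [F.Additive] (X : C) : ∀ {s j}, s ≠ j → kron F X s j = 0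
  | 0, 0, h => absurd rfl h
  | 0, _ + 1, _ => rfl
  | _ + 1, 0, _ => rfl
  | s + 1, j + 1, h => by rw [kron, kron_of_ne F X (fun e => h (by rw [e])), F.map_zero]

theorem sum_comp_kron (F : C ⥤ C) [F.Additive] (X : C) {Y : C} (f : ∀ s, Y ⟶ iter F X (s + 1))
    {S l : ℕ} (h : S ≤ l → f l = 0) :
    ∑ s ∈ Finset.range S, f s ≫ kron F X (s + 1) (l + 1) = f l := by
  rw [Finset.sum_eq_single l]
  · rw [kron_self, Category.comp_id]
  · intro s _ hs
    rw [kron_of_ne F X (by omega), Limits.comp_zero]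
  · intro hl
    rw [h (by simpa using hl), Limits.zero_comp]

theorem sum_kron_comp (F : C ⥤ C) [F.Additive] (X : C) {Y : C} (f : ∀ s, iter F X (s + 1) ⟶ Y)
    {S l : ℕ} (h : S ≤ l → f l = 0) :
    ∑ s ∈ Finset.range S, kron F X (l + 1) (s + 1) ≫ f s = f l := by
  rw [Finset.sum_eq_single l]
  · rw [kron_self, Category.id_comp]
  · intro s _ hs
    rw [kron_of_ne F X (by omega), Limits.zero_comp]
  · intro hl
    rw [h (by simpa using hl), Limits.comp_zero]

namespace MixedLaw
variable {L : MixedLaw C}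

section IsPairing

variable {M N N' : C} {S : ℕ}
  {Θ : ∀ b s l, iter L.B (iter L.T N (s + 1)) (b + 1) ⟶ iter L.T N' (l + 1)}
  {f : ∀ a s, iter L.B M (a + 1) ⟶ iter L.T N (s + 1)}

theorem IsPairing.pair_cocycle (hΘ : L.IsPairing Θ) (hf : ∀ a s, S ≤ s + 1 → f a s = 0)
    (hDf : post (fun s => L.cobD N (s + 1)) f + pre (fun a => L.barD M (a + 1)) f = 0) :
    post (fun l => L.cobD N' (l + 1)) (L.pair S Θ f) +
      pre (fun n => L.barD M (n + 1)) (L.pair S Θ f) = 0 := by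
  have e₁ : (fun b s => post (P := fun _ : ℕ => iter L.B (iter L.T N (s + 1)) (b + 1))
      (fun l => L.cobD N' (l + 1)) (fun _ l => Θ b s l) 0) +
      (fun b s l => pre (fun b => L.barD (iter L.T N (s + 1)) (b + 1)) (fun b l => Θ b s l) b l) =
      (fun b s l => iterMap L.B (L.cobD N (s + 1)) (b + 1) ≫ ((-1 : ℤ) ^ b • Θ b (s + 1) l)) := by
    funext b s l
    refine Eq.trans ?_ ((congrFun (congrFun (hΘ s) b) l).symm.trans ?_)
    · cases l <;> rfl
    · simp only [Preadditive.comp_zsmul]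
  have e₂ := pair_post S (fun b s l => (-1 : ℤ) ^ b • Θ b s l) f
    (δ := fun s => L.cobD N (s + 1)) hf
  rw [post_pair, pre_pair, ← add_assoc, ← pair_add_left, e₁, eq_neg_of_add_eq_zero_right hDf,
    pair_neg_right, e₂, add_neg_cancel]

/-- The composition of a coboundary with a cocycle of families is a coboundary. -/
theorem IsPairing.pair_coboundary (hΘ : L.IsPairing Θ) (hf : ∀ a s, S ≤ s + 1 → f a s = 0) :
    L.pair S Θ (post (fun s => L.cobD N (s + 1)) f - pre (fun a => L.barD M (a + 1)) f) =
      post (fun l => L.cobD N' (l + 1)) (L.pair S (fun b s l => (-1 : ℤ) ^ b • Θ b s l) f) -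
        pre (fun n => L.barD M (n + 1)) (L.pair S (fun b s l => (-1 : ℤ) ^ b • Θ b s l) f) := by
  have e₁ : (fun b s => post (P := fun _ : ℕ => iter L.B (iter L.T N (s + 1)) (b + 1))
      (fun l => L.cobD N' (l + 1)) (fun _ l => (-1 : ℤ) ^ b • Θ b s l) 0) -
      (fun b s l => pre (fun b => L.barD (iter L.T N (s + 1)) (b + 1))
        (fun b l => (-1 : ℤ) ^ b • Θ b s l) b l) =
      (fun b s l => iterMap L.B (L.cobD N (s + 1)) (b + 1) ≫ Θ b (s + 1) l) := by
    funext b s l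
    have := congrArg (fun z => (-1 : ℤ) ^ b • z) (congrFun (congrFun (hΘ s) b) l)
    simp only [neg_one_pow_smul_smul] at this
    rw [this]
    cases l <;> cases b <;> simp [post, pre, pow_succ, sub_eq_add_neg]
  have e₂ := pair_post S Θ f (δ := fun s => L.cobD N (s + 1)) hf
  rw [post_pair, pre_pair, pair_sub_right, e₂, ← e₁, pair_sub_left]
  simp only [neg_one_pow_smul_smul]
  abel

end IsPairing

variable (L) in
/-- The family of morphisms `B^{b+1} T^{s+1} M ⟶ T^{l+1} N` which defines the cup product with the
family of morphisms `g`. -/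
def cupFam {M N : C} (g : ∀ b r, iter L.B M (b + 1) ⟶ iter L.T N (r + 1)) (b s l : ℕ) :
    iter L.B (iter L.T M (s + 1)) (b + 1) ⟶ iter L.T N (l + 1) :=
  (-1 : ℤ) ^ (s * b) • (L.exch M (s + 1) (b + 1) ≫ L.collect (g b) l s)

variable (L) in
/-- The family of morphisms `B^{n+1} M ⟶ T^{r+1} B^{a+1} N` which defines the cup product of the
family of morphisms `g` with other families. -/
def cocupFam {M N : C} (g : ∀ b r, iter L.B M (b + 1) ⟶ iter L.T N (r + 1)) (n r a : ℕ) :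
    iter L.B M (n + 1) ⟶ iter L.T (iter L.B N (a + 1)) (r + 1) :=
  (-1 : ℤ) ^ (r * a) • (L.spread (fun b => g b r) n a ≫ L.exch N (r + 1) (a + 1))

theorem neg_one_pow_smul_congr {A : Type*} [AddCommGroup A] {a b : ℕ} (h : a % 2 = b % 2) (x : A) :
    (-1 : ℤ) ^ a • x = (-1 : ℤ) ^ b • x := by
  rw [neg_one_pow_eq_pow_mod_two, h, ← neg_one_pow_eq_pow_mod_two]

/-- The composition with a cocycle `g` in the cup product is a cocycle of families. -/
theorem isPairing_cupFam {M N : C} {g : ∀ b r, iter L.B M (b + 1) ⟶ iter L.T N (r + 1)}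
    (hg : post (fun s => L.cobD N (s + 1)) g + pre (fun a => L.barD M (a + 1)) g = 0) :
    L.IsPairing (L.cupFam g) := by
  intro s
  funext b l
  have e₁ : (-1 : ℤ) ^ b • (iterMap L.B (L.cobD M (s + 1)) (b + 1) ≫ L.cupFam g b (s + 1) l) =
      (-1 : ℤ) ^ (s * b) • (L.exch M (s + 1) (b + 1) ≫ L.cobD _ (s + 1) ≫
        L.collect (g b) l (s + 1)) := by
    have := L.exch_cobD M (s + 1) (b + 1)
    rw [cupFam, Preadditive.comp_zsmul, ← Category.assoc, this, Category.assoc, smul_smul, ← pow_add]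
    refine neg_one_pow_smul_congr ?_ _
    rw [show b + (s + 1) * b = s * b + 2 * b by ring, Nat.add_mul_mod_self_left]
  have e₂ : post (fun l => L.cobD N (l + 1)) (fun b l => L.cupFam g b s l) b l =
      (-1 : ℤ) ^ (s * b) • (L.exch M (s + 1) (b + 1) ≫ L.cobD _ (s + 1) ≫
        L.collect (g b) l (s + 1)) + (-1 : ℤ) ^ (s * b + s) • (L.exch M (s + 1) (b + 1) ≫
          L.collect (post (fun s => L.cobD N (s + 1)) g b) l s) := by
    rcases l with _ | l
    · have : L.collect (post (fun s => L.cobD N (s + 1)) g b) 0 s = 0 := by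
        cases s <;> simp [collect, post]
      simp [post, collect, this]
    · have := L.collect_cobD (y := g b) (y' := post (fun s => L.cobD N (s + 1)) g b) rfl
        (fun _ => rfl) l s
      rw [post, cupFam, Preadditive.zsmul_comp, Category.assoc, this, Preadditive.comp_add, smul_add,
        Preadditive.comp_zsmul, smul_smul, ← pow_add]
  have e₃ : pre (fun b => L.barD (iter L.T M (s + 1)) (b + 1)) (fun b l => L.cupFam g b s l) b l =
      (-1 : ℤ) ^ (s * b + s) • (L.exch M (s + 1) (b + 1) ≫
          L.collect (pre (fun a => L.barD M (a + 1)) g b) l s) := by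
    rcases b with _ | b
    · have : L.collect (pre (fun a => L.barD M (a + 1)) g 0) l s = 0 := L.collect_zero l s
      simp [pre, this]
    · have := L.comp_collect (L.barD M (b + 1)) (g b) l s
      rw [pre, cupFam, Preadditive.comp_zsmul, ← Category.assoc, ← exch_barD, Category.assoc, ← this]
      refine neg_one_pow_smul_congr ?_ _
      rw [show s * (b + 1) + s = s * b + 2 * s by ring, Nat.add_mul_mod_self_left]
  have e₄ := L.collect_add (post (fun s => L.cobD N (s + 1)) g b)
    (pre (fun a => L.barD M (a + 1)) g b) l s
  have e₅ : (fun r => post (fun s => L.cobD N (s + 1)) g b r +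
      pre (fun a => L.barD M (a + 1)) g b r) = fun r => 0 := by
    funext r
    exact congrFun (congrFun hg b) r
  rw [e₅, collect_zero] at e₄
  rw [Pi.add_apply, Pi.add_apply, e₁, e₂, e₃, add_assoc (G := _ ⟶ _), left_eq_add, ← smul_add,
    ← Preadditive.comp_add, ← e₄, Limits.comp_zero, smul_zero]

/-- The composition with a cocycle `g` in the cup product is a cocycle of families. -/
theorem isCopairing_cocupFam {M N : C} {g : ∀ b r, iter L.B M (b + 1) ⟶ iter L.T N (r + 1)}
    (hg : post (fun s => L.cobD N (s + 1)) g + pre (fun a => L.barD M (a + 1)) g = 0) :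
    L.IsCopairing (L.cocupFam g) := by
  intro a
  funext n r
  have e₁ : (-1 : ℤ) ^ r • (L.cocupFam g n r (a + 1) ≫ iterMap L.T (L.barD N (a + 1)) (r + 1)) =
      (-1 : ℤ) ^ (r * a) • (L.spread (fun b => g b r) n (a + 1) ≫ L.barD _ (a + 1) ≫
        L.exch N (r + 1) (a + 1)) := by
    rw [cocupFam, Preadditive.zsmul_comp, Category.assoc, exch_barD, smul_smul, ← pow_add]
    refine neg_one_pow_smul_congr ?_ _
    rw [show r + r * (a + 1) = r * a + 2 * r by ring, Nat.add_mul_mod_self_left]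
  have e₂ : pre (fun n => L.barD M (n + 1)) (fun n r => L.cocupFam g n r a) n r =
      (-1 : ℤ) ^ (r * a) • (L.spread (fun b => g b r) n (a + 1) ≫ L.barD _ (a + 1) ≫
        L.exch N (r + 1) (a + 1)) + (-1 : ℤ) ^ (r * a + a) •
          (L.spread (fun b => pre (fun a => L.barD M (a + 1)) g b r) n a ≫
            L.exch N (r + 1) (a + 1)) := by
    rcases n with _ | n
    · have : L.spread (fun b => pre (fun a => L.barD M (a + 1)) g b r) 0 a = 0 := by
        cases a <;> simp [spread, pre]
      rw [this, pre, spread, Limits.zero_comp, Limits.zero_comp, smul_zero, smul_zero, add_zero]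
    · have := L.barD_spread (x := fun b => g b r)
        (x' := fun b => pre (fun a => L.barD M (a + 1)) g b r) rfl (fun _ => rfl) n a
      rw [pre, cocupFam, Preadditive.comp_zsmul, ← Category.assoc, this, Preadditive.add_comp,
        smul_add, Preadditive.zsmul_comp, smul_smul, ← pow_add, Category.assoc]
  have e₃ : post (fun r => L.cobD (iter L.B N (a + 1)) (r + 1)) (fun n r => L.cocupFam g n r a) n r =
      (-1 : ℤ) ^ (r * a + a) • (L.spread (fun b => post (fun s => L.cobD N (s + 1)) g b r) n a ≫
            L.exch N (r + 1) (a + 1)) := by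
    rcases r with _ | r
    · have : L.spread (fun b => post (fun s => L.cobD N (s + 1)) g b 0) n a = 0 := L.spread_zero n a
      rw [this, post, Limits.zero_comp, smul_zero]
    · have := L.spread_comp (fun b => g b r) (L.cobD N (r + 1)) n a
      have e := L.exch_cobD N (r + 1) (a + 1)
      rw [post, cocupFam, Preadditive.zsmul_comp, Category.assoc, ← e, ← Category.assoc, ← this]
      refine neg_one_pow_smul_congr ?_ _
      rw [show (r + 1) * a + a = r * a + 2 * a by ring, Nat.add_mul_mod_self_left]
  have e₄ := L.spread_add (fun b => post (fun s => L.cobD N (s + 1)) g b r)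
    (fun b => pre (fun a => L.barD M (a + 1)) g b r) n a
  have e₅ : (fun b => post (fun s => L.cobD N (s + 1)) g b r +
      pre (fun a => L.barD M (a + 1)) g b r) = fun b => 0 := by
    funext b
    exact congrFun (congrFun hg b) r
  rw [e₅, spread_zero] at e₄
  rw [Pi.add_apply, Pi.add_apply, e₁, e₂, e₃, add_left_comm (G := _ ⟶ _), left_eq_add,
    ← smul_add, ← Preadditive.add_comp, ← e₄, Limits.zero_comp, smul_zero]

/-- The family which defines the cup product with `g` restricts to `g` on `M`. -/
theorem cupFam_zero {M N : C} (g : ∀ b r, iter L.B M (b + 1) ⟶ iter L.T N (r + 1)) (b l : ℕ) :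
    iterMap L.B (L.η M) (b + 1) ≫ L.cupFam g b 0 l = g b l := by
  have := L.exch_cobD M 0 (b + 1)
  rw [exch_zero, Category.id_comp] at this
  simp only [cobD] at this
  simp only [cupFam, zero_mul, pow_zero, one_smul, collect]
  rw [← Category.assoc, this, ← Category.assoc, L.η_nat, Category.assoc, L.η_μ, Category.comp_id]

/-- The family which defines the cup product with `g` induces `g` in `N`. -/
theorem cocupFam_zero {M N : C} (g : ∀ b r, iter L.B M (b + 1) ⟶ iter L.T N (r + 1)) (n r : ℕ) :
    L.cocupFam g n r 0 ≫ iterMap L.T (L.ε N) (r + 1) = g n r := by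
  have := L.exch_barD N (r + 1) 0
  simp only [barD, exch, Category.comp_id] at this
  simp only [cocupFam, mul_zero, pow_zero, one_smul, spread]
  rw [Category.assoc, exch, exch]
  simp only [this, Category.assoc, L.ε_nat]
  rw [← Category.assoc, L.Δ_ε, Category.id_comp]

/-- The cup product of `g` and `f` can be written as a composition of `g` with a family given by `f`,
or as a composition of a family given by `g` with `f`. -/
theorem copair_cocupFam {M N N' : C} {A S : ℕ}
    {g : ∀ b r, iter L.B M (b + 1) ⟶ iter L.T N (r + 1)}
    {f : ∀ b r, iter L.B N (b + 1) ⟶ iter L.T N' (r + 1)} (hf : ∀ a s, A ≤ a → f a s = 0)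
    (hg : ∀ a s, S ≤ s → g a s = 0) :
    L.copair A f (L.cocupFam g) = L.pair S (L.cupFam f) g := by
  funext n l
  have h₁ : ∀ b r, L.cocupFam g n r b ≫ L.collect (f b) l r =
      L.spread (fun a => g a r) n b ≫ L.cupFam f b r l := by
    intro b r
    simp [cocupFam, cupFam]
  have h₂ : ∀ b r, n + 1 ≤ b → L.spread (fun a => g a r) n b = 0 :=
    fun b r h => L.spread_eq_zero _ n b h
  have h₃ : ∀ b r, A ≤ b → L.cupFam f b r l = 0 := by
    intro b r h
    have : f b = fun r => 0 := funext fun r => hf b r h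
    rw [cupFam, this, collect_zero]
    simp
  have h₄ : ∀ b r, S ≤ r → L.spread (fun a => g a r) n b = 0 := by
    intro b r h
    have : (fun a => g a r) = fun a => 0 := funext fun a => hg a r h
    rw [this, spread_zero]
  have h₅ : ∀ b r, l + 1 ≤ r → L.cupFam f b r l = 0 := by
    intro b r h
    rw [cupFam, L.collect_eq_zero _ l r h]
    simp
  simp only [copair, pair, h₁]
  rw [sum_range_eq_sum_range (m := A) (n := n + 1)]
  · refine Finset.sum_congr rfl fun b _ => sum_range_eq_sum_range (fun r h => ?_) fun r h => ?_
    · rw [h₅ b r h, Limits.comp_zero]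
    · rw [h₄ b r h, Limits.zero_comp]
  · intro b h
    exact Finset.sum_eq_zero fun r _ => by rw [h₃ b r h, Limits.comp_zero]
  · intro b h
    exact Finset.sum_eq_zero fun r _ => by rw [h₂ b r h, Limits.zero_comp]

end MixedLaw
end Formal

/-! ### Commutation with natural families of cocycles -/

section Formal
open CategoryTheory
variable {C : Type*} [Category C] [Preadditive C]
namespace MixedLaw
variable {L : MixedLaw C}

theorem post_zsmul {P Q : ℕ → C} (δ : ∀ l, Q l ⟶ Q (l + 1)) (c : ℤ) (φ : ∀ b l, P b ⟶ Q l) :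
    post δ (fun b l => c • φ b l) = fun b l => c • post δ φ b l := by
  funext b l
  cases l <;> simp [post]

theorem pre_zsmul {P Q : ℕ → C} (d : ∀ b, P (b + 1) ⟶ P b) (c : ℤ) (φ : ∀ b l, P b ⟶ Q l) :
    pre d (fun b l => c • φ b l) = fun b l => c • pre d φ b l := by
  funext b l
  cases b <;> simp [pre]

theorem collect_η_kron (N : C) : ∀ l s,
    L.collect (fun r => L.η N ≫ kron L.T N 1 (r + 1)) l s = kron L.T N (s + 1) (l + 1)
  | l, 0 => by
    rw [collect, kron, L.η_nat, Functor.map_comp, Category.assoc, L.map_η_μ, Category.comp_id]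
  | 0, s + 1 => by rw [collect, kron_of_ne _ _ (by omega)]
  | l + 1, s + 1 => by rw [collect, collect_η_kron N l s]; rfl

theorem spread_kron_ε (M : C) : ∀ n b,
    L.spread (fun a => kron L.B M (a + 1) 1 ≫ L.ε M) n b = kron L.B M (n + 1) (b + 1)
  | n, 0 => by
    rw [spread, kron, L.ε_nat, Functor.map_comp, ← Category.assoc, L.Δ_map_ε, Category.id_comp]
  | 0, b + 1 => by rw [spread, kron_of_ne _ _ (by omega)]
  | n + 1, b + 1 => by rw [spread, spread_kron_ε M n b]; rfl

variable (L) in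
/-- A natural family of cocycles of degree `q`. -/
structure NatCocycle (q : ℕ) where
  toFun : ∀ X b r, iter L.B X (b + 1) ⟶ iter L.T X (r + 1)
  nat : ∀ {X Y : C} (φ : X ⟶ Y) b r,
    iterMap L.B φ (b + 1) ≫ toFun Y b r = toFun X b r ≫ iterMap L.T φ (r + 1)
  cocycle : ∀ X, post (fun s => L.cobD X (s + 1)) (toFun X) +
    pre (fun a => L.barD X (a + 1)) (toFun X) = 0
  eq_zero : ∀ X b r, b + r ≠ q → toFun X b r = 0

variable {q : ℕ} (g : L.NatCocycle q)

/-- The composition with a natural family of cocycles on the left, as a family of morphisms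
`B^{b+1} T^{s+1} N ⟶ T^{l+1} N`. -/
def natPairing (N : C) (b s l : ℕ) :
    iter L.B (iter L.T N (s + 1)) (b + 1) ⟶ iter L.T N (l + 1) :=
  (-1 : ℤ) ^ (q * s) • L.copair (X := fun _ => iter L.T N (s + 1))
    (P := fun b => iter L.B (iter L.T N (s + 1)) (b + 1)) 1
    (fun _ r => kron L.T N (s + 1) (r + 1)) (fun b r _ => g.toFun (iter L.T N (s + 1)) b r) b l

/-- The composition with a natural family of cocycles on the right, as a family of morphisms
`B^{n+1} M ⟶ T^{r+1} B^{a+1} M`. -/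
def natCopairing (M : C) (n r a : ℕ) :
    iter L.B M (n + 1) ⟶ iter L.T (iter L.B M (a + 1)) (r + 1) :=
  (-1 : ℤ) ^ (q * a) • L.pair (Y := fun _ => iter L.B M (a + 1))
    (Q := fun r => iter L.T (iter L.B M (a + 1)) (r + 1)) 1
    (fun b _ r => g.toFun (iter L.B M (a + 1)) b r) (fun n _ => kron L.B M (n + 1) (a + 1)) n r

theorem kron_comp_cobD (N : C) (s j : ℕ) :
    kron L.T N s j ≫ L.cobD N j = L.cobD N s ≫ kron L.T N (s + 1) (j + 1) := by
  rcases eq_or_ne s j with rfl | h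
  · rw [kron_self, kron_self, Category.id_comp, Category.comp_id]
  · rw [kron_of_ne _ _ h, kron_of_ne _ _ (by omega), Limits.zero_comp, Limits.comp_zero]

theorem barD_comp_kron (M : C) (s j : ℕ) :
    L.barD M s ≫ kron L.B M s j = kron L.B M (s + 1) (j + 1) ≫ L.barD M j := by
  rcases eq_or_ne s j with rfl | h
  · rw [kron_self, kron_self, Category.id_comp, Category.comp_id]
  · rw [kron_of_ne _ _ h, kron_of_ne _ _ (by omega), Limits.zero_comp, Limits.comp_zero]

theorem isPairing_natPairing (N : C) : L.IsPairing (natPairing g N) := by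
  intro s
  let X := iter L.T N (s + 1)
  have k := post_copair (L := L) (X := fun _ => X) (P := fun b => iter L.B X (b + 1)) 1
    (fun _ r => kron L.T N (s + 1) (r + 1)) (fun b r _ => g.toFun X b r)
  have k' := pre_copair (L := L) (X := fun _ => X) (P := fun b => iter L.B X (b + 1)) 1
    (fun _ r => kron L.T N (s + 1) (r + 1)) (fun b r _ => g.toFun X b r)
    (fun b => L.barD X (b + 1))
  have k₀ : (fun b r _ => post (fun r => L.cobD X (r + 1)) (fun b r => g.toFun X b r) b r) +
      (fun b r _ => pre (fun b => L.barD X (b + 1)) (Q := fun _ : ℕ => iter L.T X (r + 1))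
        (fun b _ => g.toFun X b r) b 0) =
      (0 : ∀ (b r : ℕ) (_ : ℕ), iter L.B X (b + 1) ⟶ iter L.T X (r + 1)) := by
    funext b r a
    refine Eq.trans ?_ (congrFun (congrFun (g.cocycle X) b) r)
    cases b <;> rfl
  have k₁ := copair_add_right (L := L) (X := fun _ => X) (P := fun b => iter L.B X (b + 1)) 1
    (fun _ r => kron L.T N (s + 1) (r + 1))
    (fun b r _ => post (fun r => L.cobD X (r + 1)) (fun b r => g.toFun X b r) b r)
    (fun b r _ => pre (fun b => L.barD X (b + 1)) (Q := fun _ : ℕ => iter L.T X (r + 1))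
        (fun b _ => g.toFun X b r) b 0)
  rw [k₀] at k₁
  have k₂ : L.copair (X := fun _ => X) (P := fun b => iter L.B X (b + 1)) 1
    (fun _ r => kron L.T N (s + 1) (r + 1)) 0 = 0 := by
    funext n l
    simp [copair]
  have key : ∀ b l, post (fun l => L.cobD N (l + 1)) (L.copair (X := fun _ => X)
        (P := fun b => iter L.B X (b + 1)) 1 (fun _ r => kron L.T N (s + 1) (r + 1))
        (fun b r _ => g.toFun X b r)) b l +
      pre (fun b => L.barD X (b + 1)) (L.copair (X := fun _ => X)
        (P := fun b => iter L.B X (b + 1)) 1 (fun _ r => kron L.T N (s + 1) (r + 1))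
        (fun b r _ => g.toFun X b r)) b l =
      L.copair (X := fun _ => X) (P := fun b => iter L.B X (b + 1)) 1
        (post (fun l => L.cobD N (l + 1)) (fun _ r => kron L.T N (s + 1) (r + 1)))
        (fun b r _ => (-1 : ℤ) ^ r • g.toFun X b r) b l := by
    intro b l
    have e₁ := congrFun (congrFun k b) l
    have e₂ := congrFun (congrFun k' b) l
    have e₃ := congrFun (congrFun (k₁.symm.trans k₂) b) l
    rw [Pi.add_apply, Pi.add_apply] at e₁ e₃
    rw [e₁, e₂, add_right_comm]
    refine (congrArg (· + _) e₃).trans ?_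
    rw [Pi.zero_apply, Pi.zero_apply, zero_add]
  funext b l
  have r₁ := congrFun (congrFun (post_zsmul (fun l => L.cobD N (l + 1)) ((-1 : ℤ) ^ (q * s))
    (L.copair (X := fun _ => X) (P := fun b => iter L.B X (b + 1)) 1
      (fun _ r => kron L.T N (s + 1) (r + 1)) (fun b r _ => g.toFun X b r))) b) l
  have r₂ := congrFun (congrFun (pre_zsmul (fun b => L.barD X (b + 1)) ((-1 : ℤ) ^ (q * s))
    (L.copair (X := fun _ => X) (P := fun b => iter L.B X (b + 1)) 1
      (fun _ r => kron L.T N (s + 1) (r + 1)) (fun b r _ => g.toFun X b r))) b) l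
  refine Eq.trans ?_ (congrArg₂ (· + ·) r₁ r₂).symm
  refine Eq.trans ?_ (smul_add _ _ _)
  rw [key, natPairing, copair, copair, Finset.sum_range_one, Finset.sum_range_one,
    Preadditive.comp_zsmul, Preadditive.comp_sum, Finset.smul_sum, Finset.smul_sum, Finset.smul_sum]
  refine Finset.sum_congr rfl fun r _ => ?_
  by_cases hr : b + r = q
  · have e₁ : post (P := fun _ => X) (fun l => L.cobD N (l + 1))
        (fun _ r => kron L.T N (s + 1) (r + 1)) 0 =
        fun r => L.cobD N (s + 1) ≫ kron L.T N (s + 2) (r + 1) := by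
      funext r
      rcases r with _ | r
      · rw [post, kron_of_ne _ _ (by omega), Limits.comp_zero]
      · rw [post, kron_comp_cobD]
    have e₂ := L.comp_collect (L.cobD N (s + 1)) (fun r => kron L.T N (s + 2) (r + 1)) l r
    have e₃ := g.nat (L.cobD N (s + 1)) b r
    rw [e₁]
    refine Eq.trans ?_ (congrArg (fun z => (-1 : ℤ) ^ (q * s) • (((-1 : ℤ) ^ r • g.toFun X b r) ≫ z))
      e₂.symm)
    rw [← Category.assoc, e₃, Category.assoc, Preadditive.zsmul_comp, smul_smul, smul_smul,
      ← pow_add, ← pow_add]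
    refine neg_one_pow_smul_congr ?_ _
    rw [← hr, show b + (b + r) * (s + 1) = (b + r) * s + r + 2 * b by ring,
      Nat.add_mul_mod_self_left]
  · rw [g.eq_zero _ b r hr, g.eq_zero _ b r hr]
    simp

theorem isCopairing_natCopairing (M : C) : L.IsCopairing (natCopairing g M) := by
  intro a
  let X := iter L.B M (a + 1)
  let κ : ∀ n (_ : ℕ), iter L.B M (n + 1) ⟶ X := fun n _ => kron L.B M (n + 1) (a + 1)
  have k := pre_pair (L := L) (Y := fun _ => X) (Q := fun r => iter L.T X (r + 1)) 1
    (fun b _ r => g.toFun X b r) κ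
  have k' := post_pair (L := L) (Y := fun _ => X) (Q := fun r => iter L.T X (r + 1)) 1
    (fun b _ r => g.toFun X b r) κ (fun r => L.cobD X (r + 1))
  have k₀ : (fun b _ => post (P := fun _ : ℕ => iter L.B X (b + 1))
        (fun r => L.cobD X (r + 1)) (fun _ r => g.toFun X b r) 0) +
      (fun b _ r => pre (fun b => L.barD X (b + 1)) (fun b r => g.toFun X b r) b r) =
      (0 : ∀ (b : ℕ) (_ : ℕ) (r : ℕ), iter L.B X (b + 1) ⟶ iter L.T X (r + 1)) := by
    funext b a r
    refine Eq.trans ?_ (congrFun (congrFun (g.cocycle X) b) r)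
    cases r <;> rfl
  have k₁ := pair_add_left (L := L) (Y := fun _ => X) (Q := fun r => iter L.T X (r + 1)) 1
    (fun b _ => post (P := fun _ : ℕ => iter L.B X (b + 1))
        (fun r => L.cobD X (r + 1)) (fun _ r => g.toFun X b r) 0)
    (fun b _ r => pre (fun b => L.barD X (b + 1)) (fun b r => g.toFun X b r) b r) κ
  rw [k₀] at k₁
  have k₂ : L.pair (Y := fun _ => X) (Q := fun r => iter L.T X (r + 1)) 1 0 κ = 0 := by
    funext n l
    simp [pair]
  have key : ∀ n r, post (fun r => L.cobD X (r + 1)) (L.pair (Y := fun _ => X)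
        (Q := fun r => iter L.T X (r + 1)) 1 (fun b _ r => g.toFun X b r) κ) n r +
      pre (fun n => L.barD M (n + 1)) (L.pair (Y := fun _ => X)
        (Q := fun r => iter L.T X (r + 1)) 1 (fun b _ r => g.toFun X b r) κ) n r =
      L.pair (Y := fun _ => X) (Q := fun r => iter L.T X (r + 1)) 1
        (fun b _ r => (-1 : ℤ) ^ b • g.toFun X b r) (pre (fun n => L.barD M (n + 1)) κ) n r := by
    intro n r
    have e₁ := congrFun (congrFun k n) r
    have e₂ := congrFun (congrFun k' n) r
    have e₃ := congrFun (congrFun (k₁.symm.trans k₂) n) r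
    rw [Pi.add_apply, Pi.add_apply] at e₁ e₃
    rw [e₁, e₂, ← add_assoc]
    refine (congrArg (· + _) e₃).trans ?_
    rw [Pi.zero_apply, Pi.zero_apply, zero_add]
  funext n r
  have r₁ := congrFun (congrFun (post_zsmul (fun r => L.cobD X (r + 1)) ((-1 : ℤ) ^ (q * a))
    (L.pair (Y := fun _ => X) (Q := fun r => iter L.T X (r + 1)) 1
      (fun b _ r => g.toFun X b r) κ)) n) r
  have r₂ := congrFun (congrFun (pre_zsmul (fun n => L.barD M (n + 1)) ((-1 : ℤ) ^ (q * a))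
    (L.pair (Y := fun _ => X) (Q := fun r => iter L.T X (r + 1)) 1
      (fun b _ r => g.toFun X b r) κ)) n) r
  refine Eq.trans ?_ (congrArg₂ (· + ·) r₁ r₂).symm
  refine Eq.trans ?_ (smul_add _ _ _)
  rw [key, natCopairing, pair, pair, Preadditive.zsmul_comp, Preadditive.sum_comp, Finset.smul_sum,
    Finset.smul_sum, Finset.smul_sum]
  refine Finset.sum_congr rfl fun b _ => ?_
  rw [Finset.sum_range_one, Finset.sum_range_one]
  by_cases hr : b + r = q
  · have e₁ : (fun n => pre (fun n => L.barD M (n + 1)) κ n 0) =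
        fun n => kron L.B M (n + 1) (a + 2) ≫ L.barD M (a + 1) := by
      funext n
      rcases n with _ | n
      · rw [pre, kron_of_ne _ _ (by omega), Limits.zero_comp]
      · exact L.barD_comp_kron M (n + 1) (a + 1)
    have e₂ := L.spread_comp (fun n => kron L.B M (n + 1) (a + 2)) (L.barD M (a + 1)) n b
    have e₃ := g.nat (L.barD M (a + 1)) b r
    rw [e₁]
    refine Eq.trans ?_ (congrArg (fun z => (-1 : ℤ) ^ (q * a) • (z ≫ ((-1 : ℤ) ^ b • g.toFun X b r)))
      e₂.symm)
    rw [Category.assoc, ← e₃, Category.assoc, Preadditive.comp_zsmul, Preadditive.comp_zsmul,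
      smul_smul, smul_smul, ← pow_add, ← pow_add]
    refine neg_one_pow_smul_congr ?_ _
    rw [← hr, show r + (b + r) * (a + 1) = (b + r) * a + b + 2 * r by ring,
      Nat.add_mul_mod_self_left]
  · rw [g.eq_zero _ b r hr, g.eq_zero _ b r hr]
    simp

/-- The composition with a natural family of cocycles restricts to its value on `N`. -/
theorem natPairing_zero (N : C) (b l : ℕ) :
    iterMap L.B (L.η N) (b + 1) ≫ natPairing g N b 0 l = g.toFun N b l := by
  rw [natPairing, mul_zero, pow_zero, one_smul, copair, Finset.sum_range_one, Preadditive.comp_sum,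
    ← sum_comp_kron L.T N (fun r => g.toFun N b r) (S := l + 1) (l := l) (by omega)]
  refine Finset.sum_congr rfl fun r _ => ?_
  have := L.comp_collect (L.η N) (fun r => kron L.T N 1 (r + 1)) l r
  rw [← Category.assoc, g.nat, Category.assoc]
  exact congrArg _ (this.symm.trans (collect_η_kron N l r))

/-- The composition with a natural family of cocycles induces its value in `M`. -/
theorem natCopairing_zero (M : C) (n r : ℕ) :
    natCopairing g M n r 0 ≫ iterMap L.T (L.ε M) (r + 1) = g.toFun M n r := by
  rw [natCopairing, mul_zero, pow_zero, one_smul, pair, Preadditive.sum_comp,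
    ← sum_kron_comp L.B M (fun b => g.toFun M b r) (S := n + 1) (l := n) (by omega)]
  refine Finset.sum_congr rfl fun b _ => ?_
  have := L.spread_comp (fun a => kron L.B M (a + 1) 1) (L.ε M) n b
  rw [Finset.sum_range_one, Category.assoc, ← g.nat, ← Category.assoc]
  exact congrArg (· ≫ _) (this.symm.trans (spread_kron_ε M n b))

/-- By naturality, the compositions of `f` with a natural family of cocycles on the two sides coincide
up to a sign. -/
theorem pair_natPairing {M N : C} {p S A : ℕ} {f : ∀ a s, iter L.B M (a + 1) ⟶ iter L.T N (s + 1)}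
    (hf : ∀ a s, a + s ≠ p → f a s = 0) (hS : p < S) (hA : p < A) :
    L.pair S (natPairing g N) f =
      fun n l => (-1 : ℤ) ^ (p * q) • L.copair A f (natCopairing g M) n l := by
  funext n l
  have e₁ : ∀ s b, L.spread (fun a => f a s) n b = ∑ a ∈ Finset.range A,
      L.spread (fun a' => kron L.B M (a' + 1) (a + 1)) n b ≫ iterMap L.B (f a s) (b + 1) := by
    intro s b
    rw [show (fun a => f a s) = fun a' => ∑ a ∈ Finset.range A,
      kron L.B M (a' + 1) (a + 1) ≫ f a s from funext fun a' =>
        (sum_kron_comp L.B M (fun a => f a s) (S := A) (l := a') (fun h => hf _ _ (by omega))).symm,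
      spread_sum]
    exact Finset.sum_congr rfl fun a _ => L.spread_comp _ _ n b
  have e₂ : ∀ a r, L.collect (f a) l r = ∑ s ∈ Finset.range S,
      iterMap L.T (f a s) (r + 1) ≫ L.collect (fun j => kron L.T N (s + 1) (j + 1)) l r := by
    intro a r
    have : f a = fun j => ∑ s ∈ Finset.range S, f a s ≫ kron L.T N (s + 1) (j + 1) :=
      funext fun j => (sum_comp_kron L.T N (fun s => f a s) (S := S) (l := j)
        (fun h => hf _ _ (by omega))).symm
    refine (congrArg (fun y => L.collect y l r) this).trans ((L.collect_sum _ _ _ _).trans ?_)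
    exact Finset.sum_congr rfl fun s _ => L.comp_collect _ _ l r
  simp only [pair, copair, natPairing, natCopairing, e₁, e₂, Finset.sum_range_one,
    Preadditive.comp_sum, Preadditive.sum_comp, Preadditive.comp_zsmul, Preadditive.zsmul_comp,
    Finset.smul_sum, Category.assoc]
  -- the two sums run over `(b, s, a, r)` and `(a, r, b, s)` respectively
  have swap : ∀ G : ℕ → ℕ → ℕ → ℕ → (iter L.B M (n + 1) ⟶ iter L.T N (l + 1)),
      ∑ a ∈ Finset.range A, ∑ r ∈ Finset.range (l + 1), ∑ s ∈ Finset.range S,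
        ∑ b ∈ Finset.range (n + 1), G b s r a =
      ∑ b ∈ Finset.range (n + 1), ∑ s ∈ Finset.range S, ∑ r ∈ Finset.range (l + 1),
        ∑ a ∈ Finset.range A, G b s r a := by
    intro G
    rw [Finset.sum_comm]
    simp only [Finset.sum_comm (s := Finset.range A)]
    rw [Finset.sum_comm]
    simp only [Finset.sum_comm (s := Finset.range (l + 1)) (t := Finset.range (n + 1))]
    rw [Finset.sum_comm]
  refine Eq.trans (swap _).symm ?_
  refine Finset.sum_congr rfl fun a _ => Finset.sum_congr rfl fun r _ => Finset.sum_congr rfl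
    fun s _ => Finset.sum_congr rfl fun b _ => ?_
  by_cases h : a + s = p
  · have e₃ := g.nat (f a s) b r
    rw [← Category.assoc (iterMap L.B (f a s) (b + 1)), e₃, Category.assoc, smul_smul, ← pow_add]
    refine neg_one_pow_smul_congr ?_ _
    rw [← h, show (a + s) * q + q * a = q * s + 2 * (a * q) by ring, Nat.add_mul_mod_self_left]
  · rw [hf a s h, iterMap_zero, iterMap_zero]
    simp

/-- The cup product with a natural family of cocycles is graded-commutative up to coboundaries. -/
theorem exists_cup_comm {M N : C} {p S : ℕ}
    {f : ∀ a s, iter L.B M (a + 1) ⟶ iter L.T N (s + 1)} (hf : ∀ a s, a + s ≠ p → f a s = 0)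
    (hDf : post (fun s => L.cobD N (s + 1)) f + pre (fun a => L.barD M (a + 1)) f = 0)
    (hp : p + 2 ≤ S) (hq : q + 2 ≤ S) :
    ∃ h : ∀ n l, iter L.B M (n + 1) ⟶ iter L.T N (l + 1), ∀ n l,
      L.pair S (L.cupFam (g.toFun N)) f n l -
        (-1 : ℤ) ^ (p * q) • L.pair S (L.cupFam f) (g.toFun M) n l =
      post (fun l => L.cobD N (l + 1)) h n l - pre (fun n => L.barD M (n + 1)) h n l := by
  -- `f ⌣ g` is compared with the composite of `f` and `g` on the side of `N`, and `g ⌣ f` with the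
  -- composite on the side of `M`
  have sub₁ : L.IsPairing (L.cupFam (g.toFun N) - natPairing g N) := by
    intro s
    have e₁ := isPairing_cupFam (L := L) (g.cocycle N) s
    have e₂ := isPairing_natPairing g N s
    have e₃ := post_sub (fun l => L.cobD N (l + 1)) (fun b l => L.cupFam (g.toFun N) b s l)
      (fun b l => natPairing g N b s l)
    have e₄ := pre_sub (fun b => L.barD (iter L.T N (s + 1)) (b + 1))
      (fun b l => L.cupFam (g.toFun N) b s l) (fun b l => natPairing g N b s l)
    refine Eq.trans ?_ ((congrArg₂ (· - ·) e₁ e₂).trans ?_)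
    · funext b l
      simp [smul_sub]
    · refine Eq.trans ?_ (congrArg₂ (· + ·) e₃ e₄).symm
      abel
  have sub₂ : L.IsCopairing (natCopairing g M - L.cocupFam (g.toFun M)) := by
    intro a
    have e₁ := isCopairing_cocupFam (L := L) (g.cocycle M) a
    have e₂ := isCopairing_natCopairing g M a
    have e₃ := post_sub (fun r => L.cobD (iter L.B M (a + 1)) (r + 1))
      (fun n r => natCopairing g M n r a) (fun n r => L.cocupFam (g.toFun M) n r a)
    have e₄ := pre_sub (fun n => L.barD M (n + 1))
      (fun n r => natCopairing g M n r a) (fun n r => L.cocupFam (g.toFun M) n r a)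
    refine Eq.trans ?_ ((congrArg₂ (· - ·) e₂ e₁).trans ?_)
    · funext b l
      simp [smul_sub]
    · refine Eq.trans ?_ (congrArg₂ (· + ·) e₃ e₄).symm
      abel
  obtain ⟨h₁, e₁⟩ := exists_pair_eq S sub₁ (f := f)
    (fun b l => by
      rw [Pi.sub_apply, Pi.sub_apply, Pi.sub_apply, Preadditive.comp_sub, cupFam_zero,
        natPairing_zero, sub_self])
    (fun a s h => hf a s (by omega)) hDf
  obtain ⟨h₂, e₂⟩ := exists_copair_eq S sub₂ (f := f)
    (fun n r => by
      rw [Pi.sub_apply, Pi.sub_apply, Pi.sub_apply, Preadditive.sub_comp, cocupFam_zero,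
        natCopairing_zero, sub_self])
    (fun a s h => hf a s (by omega)) hDf
  rw [pair_sub_left, pair_natPairing g hf (S := S) (A := S) (by omega) (by omega)] at e₁
  rw [copair_sub_right, copair_cocupFam (S := S) (fun a s h => hf a s (by omega))
    (fun a s h => g.eq_zero M a s (by omega))] at e₂
  refine ⟨h₁ + fun n l => (-1 : ℤ) ^ (p * q) • h₂ n l, fun n l => ?_⟩
  have f₁ := congrFun (congrFun e₁ n) l
  have f₂ := congrArg (fun z => (-1 : ℤ) ^ (p * q) • z) (congrFun (congrFun e₂ n) l)
  simp only [Pi.sub_apply, smul_sub] at f₁ f₂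
  rw [post_add, pre_add, post_zsmul, pre_zsmul]
  simp only [Pi.add_apply]
  rw [add_sub_add_comm, ← f₁, ← f₂]
  abel

end MixedLaw
end Formal

noncomputable section
namespace HopfBimod
open CategoryTheory

variable {k : Type u} {H : Type v} [Field k] [Ring H] [HopfAlgebra k H]

/-! ### The category of Hopf bimodules and its mixed law -/

@[ext] theorem Hom.ext_apply {M N : HopfBimod k H} {f g : Hom M N} (h : ∀ x, f.1 x = g.1 x) :
    f = g :=
  Subtype.ext (LinearMap.ext h)

instance : Category (HopfBimod k H) where
  Hom M N := Hom M N
  id M := Hom.id M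
  comp f g := Hom.comp g f

instance : Preadditive (HopfBimod k H) where
  homGroup M N := inferInstanceAs (AddCommGroup (Hom M N))
  add_comp _ _ _ f f' g := Hom.ext_apply fun x => map_add g.1 (f.1 x) (f'.1 x)
  comp_add _ _ _ _ _ _ := rfl

/-- Two linear maps on a tensor product agree if they agree on pure tensors. -/
theorem tensor_ext {A B X : Type*} [AddCommGroup A] [AddCommGroup B] [AddCommGroup X] [Module k A]
    [Module k B] [Module k X] {f g : A ⊗[k] B →ₗ[k] X} (h : ∀ a b, f (a ⊗ₜ b) = g (a ⊗ₜ b))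
    (t : A ⊗[k] B) : f t = g t :=
  LinearMap.congr_fun (TensorProduct.ext' h) t

/-- The functor `X ↦ X ⊗̲ H`. -/
def barFunctor : HopfBimod k H ⥤ HopfBimod k H where
  obj X := codiag X (regular k H)
  map f := codiagMap f (Hom.id _)
  map_id _ := Hom.ext_apply fun x => LinearMap.congr_fun TensorProduct.map_id x
  map_comp _ _ := Hom.ext_apply <| tensor_ext fun _ _ => rfl

/-- The functor `X ↦ H ⊗̄ X`. -/
def cobFunctor : HopfBimod k H ⥤ HopfBimod k H where
  obj X := diag (regular k H) X
  map f := diagMap (Hom.id _) f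
  map_id _ := Hom.ext_apply fun x => LinearMap.congr_fun TensorProduct.map_id x
  map_comp _ _ := Hom.ext_apply <| tensor_ext fun _ _ => rfl

instance : (barFunctor (k := k) (H := H)).Additive where
  map_add {_ _ f g} := Hom.ext_apply fun x => LinearMap.congr_fun
    (TensorProduct.map_add_left f.1 g.1 LinearMap.id) x

instance : (cobFunctor (k := k) (H := H)).Additive where
  map_add {_ _ f g} := Hom.ext_apply fun x => LinearMap.congr_fun
    (TensorProduct.map_add_right LinearMap.id f.1 g.1) x

theorem counitMap_coactL (X : HopfBimod k H) (x : X.carrier) : counitMap X (X.coactL x) = x :=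
  X.counit_coactL x

variable (k H) in
/-- The bar comonad `X ↦ X ⊗̲ H` and the cobar monad `X ↦ H ⊗̄ X`, with the interchange law
`(H ⊗̄ X) ⊗̲ H → H ⊗̄ (X ⊗̲ H)`. -/
def mixedLaw : MixedLaw (HopfBimod k H) where
  B := barFunctor
  T := cobFunctor
  ε := actHom
  Δ := insertOne
  η := coactHom
  μ := dropCounit
  χ X := interchange X (regular k H)
  ε_nat {X Y} f := Hom.ext_apply <| tensor_ext fun x h => (f.2.2.1 h x).symm
  Δ_nat {X Y} f := Hom.ext_apply <| tensor_ext fun x h => rfl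
  η_nat {X Y} f := Hom.ext_apply fun x => (f.2.2.2.1 x).symm
  μ_nat {X Y} f := Hom.ext_apply <| tensor_ext fun h t => by
    have : ∀ t, f.1 (counitMap X t) = counitMap Y (map LinearMap.id f.1 t) := fun t =>
      tensor_ext (f := f.1 ∘ₗ counitMap X) (g := counitMap Y ∘ₗ map LinearMap.id f.1)
        (by simp [counitMap]) t
    exact congrArg (h ⊗ₜ[k] ·) (this t)
  χ_nat {X Y} f := Hom.ext_apply <| tensor_ext fun t h => by
    refine Eq.symm ((map_map₂ (f₁ := LinearMap.id) (f₂ := LinearMap.id) (a := LinearMap.mul k H)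
      (a' := LinearMap.mul k H) (b := TensorProduct.mk k X.carrier H)
      (b' := TensorProduct.mk k Y.carrier H) (f := LinearMap.id) (g := map f.1 LinearMap.id)
      (g₁ := f.1) (g₂ := LinearMap.id) (by simp) (by simp) t (Coalgebra.comul h)).trans ?_)
    rw [TensorProduct.map_id, LinearMap.id_apply]
    rfl
  Δ_ε X := Hom.ext_apply <| tensor_ext fun x h => congrArg (x ⊗ₜ[k] ·) (one_mul h)
  Δ_map_ε X := Hom.ext_apply <| tensor_ext fun x h => congrArg (· ⊗ₜ[k] h) (X.one_actR x)
  η_μ X := Hom.ext_apply <| tensor_ext fun h x => by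
    have : ∀ t : H ⊗[k] H, map LinearMap.id (counitMap X) (TensorProduct.assoc k H H X.carrier
        (t ⊗ₜ[k] x)) = TensorProduct.rid k H (map LinearMap.id Coalgebra.counit t) ⊗ₜ[k] x :=
      tensor_ext (f := map LinearMap.id (counitMap X) ∘ₗ
        (TensorProduct.assoc k H H X.carrier).toLinearMap ∘ₗ (TensorProduct.mk k _ _).flip x)
        (g := (TensorProduct.mk k _ _).flip x ∘ₗ (TensorProduct.rid k H).toLinearMap ∘ₗ
          map LinearMap.id Coalgebra.counit)
        (fun a b => by simp [counitMap])
    exact (this _).trans (congrArg (· ⊗ₜ[k] x) ((regular k H).counit_coactR h))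
  map_η_μ X := Hom.ext_apply <| tensor_ext fun h x =>
    congrArg (h ⊗ₜ[k] ·) (counitMap_coactL X x)
  χ_ε X := Hom.ext_apply <| tensor_ext fun t h =>
    bilin_ext (f := (map₂ (LinearMap.mul k H) (TensorProduct.mk k X.carrier H)).compr₂
        (map LinearMap.id (lift X.actR.flip)))
      (g := (map₂ (LinearMap.mul k H).flip X.actR).flip) (by simp) t (Coalgebra.comul h)
  η_χ X := Hom.ext_apply <| tensor_ext fun x h => rfl

end HopfBimod
end

noncomputable section
namespace HopfBimod
open CategoryTheory

variable {k : Type u} {H : Type v} [Field k] [Ring H] [HopfAlgebra k H]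
variable {M N L X Y X' Y' : HopfBimod k H}

/-! ### Structure morphisms of the functor `Y ↦ Y ⊗̄ X` -/

/-- The linear map `(Y ⊗ X) ⊗ H → (Y ⊗ H) ⊗ X`, `(y ⊗ x) ⊗ h ↦ (y ⊗ h⁽¹⁾) ⊗ x h⁽²⁾`. -/
def interchangeRightMap (Y X : HopfBimod k H) :
    (Y.carrier ⊗[k] X.carrier) ⊗[k] H →ₗ[k] (Y.carrier ⊗[k] H) ⊗[k] X.carrier :=
  lift ((map₂ (TensorProduct.mk k Y.carrier H) X.actR.flip).compl₂ Coalgebra.comul)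

theorem coactL_interchangeRightMap (t : Y.carrier ⊗[k] X.carrier) (h : H) :
    (diag (codiag Y (regular k H)) X).coactL (interchangeRightMap Y X (t ⊗ₜ h)) =
      map LinearMap.id (interchangeRightMap Y X)
        ((codiag (diag Y X) (regular k H)).coactL (t ⊗ₜ h)) := by
  have e₁ := map_map₂ (a := TensorProduct.mk k Y.carrier H) (b := X.actR.flip)
    (f := (codiag Y (regular k H)).coactL) (g := LinearMap.id)
    (f₁ := Y.coactL) (f₂ := Coalgebra.comul) (g₁ := LinearMap.id)
    (g₂ := LinearMap.id) (a' := map₂ (LinearMap.mul k H) (TensorProduct.mk k Y.carrier H))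
    (b' := X.actR.flip) (fun _ _ => rfl) (fun _ _ => rfl) t (Coalgebra.comul h)
  have e₂ := map_map₂ (f := LinearMap.id) (g := interchangeRightMap Y X) (a := LinearMap.mul k H)
    (b := TensorProduct.mk k (Y.carrier ⊗[k] X.carrier) H) (f₁ := LinearMap.id)
    (f₂ := LinearMap.id) (g₁ := LinearMap.id) (g₂ := Coalgebra.comul) (a' := LinearMap.mul k H)
    (b' := map₂ (TensorProduct.mk k Y.carrier H) X.actR.flip) (fun _ _ => rfl) (fun _ _ => rfl)
    ((diag Y X).coactL t) (Coalgebra.comul h)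
  refine Eq.trans ?_ e₂.symm
  refine (congrArg (TensorProduct.assoc k H (Y.carrier ⊗[k] H) X.carrier) e₁).trans ?_
  rw [assoc_map₂, show TensorProduct.assoc k H H H
    (map Coalgebra.comul LinearMap.id (Coalgebra.comul h)) = _ from Coalgebra.coassoc_apply h,
    TensorProduct.map_id]
  rfl

theorem coactR_interchangeRightMap (t : Y.carrier ⊗[k] X.carrier) (h : H) :
    (diag (codiag Y (regular k H)) X).coactR (interchangeRightMap Y X (t ⊗ₜ h)) =
      map (interchangeRightMap Y X) LinearMap.id
        ((codiag (diag Y X) (regular k H)).coactR (t ⊗ₜ h)) := by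
  have e₀ : ∀ x h, X.coactR (X.actR.flip x h) =
      map₂ X.actR.flip (LinearMap.mul k H) (X.coactR x) (Coalgebra.comul h) := fun x h =>
    (X.coactR_actR h x).trans <| bilin_ext (f := map₂ X.actR (LinearMap.mul k H).flip)
      (g := (map₂ X.actR.flip (LinearMap.mul k H)).flip) (fun _ _ _ _ => rfl) _ _
  have e₁ := map_map₂ (a := TensorProduct.mk k Y.carrier H) (b := X.actR.flip)
    (f := LinearMap.id) (g := X.coactR)
    (f₁ := LinearMap.id) (f₂ := LinearMap.id) (g₁ := X.coactR)
    (g₂ := Coalgebra.comul) (a' := TensorProduct.mk k Y.carrier H)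
    (b' := map₂ X.actR.flip (LinearMap.mul k H)) (fun _ _ => rfl) e₀ t (Coalgebra.comul h)
  have e₂ := map_map₂ (f := interchangeRightMap Y X) (g := LinearMap.id) (b := LinearMap.mul k H)
    (a := TensorProduct.mk k (Y.carrier ⊗[k] X.carrier) H) (f₁ := LinearMap.id)
    (f₂ := Coalgebra.comul) (g₁ := LinearMap.id) (g₂ := LinearMap.id) (b' := LinearMap.mul k H)
    (a' := map₂ (TensorProduct.mk k Y.carrier H) X.actR.flip) (fun _ _ => rfl) (fun _ _ => rfl)
    ((diag Y X).coactR t) (Coalgebra.comul h)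
  refine Eq.trans ?_ e₂.symm
  refine (congrArg (TensorProduct.assoc k (Y.carrier ⊗[k] H) X.carrier H).symm e₁).trans ?_
  rw [assoc_symm_map₂, show (TensorProduct.assoc k H H H).symm
    (map LinearMap.id Coalgebra.comul (Coalgebra.comul h)) = _
    from Coalgebra.coassoc_symm_apply h, TensorProduct.map_id]
  rfl

theorem interchangeRightMap_actL (h : H) (t : Y.carrier ⊗[k] X.carrier) (h' : H) :
    interchangeRightMap Y X ((diag Y X).actL h t ⊗ₜ h') =
      (diag (codiag Y (regular k H)) X).actL h (interchangeRightMap Y X (t ⊗ₜ h')) :=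
  map₂_map₂_left (a := TensorProduct.mk k Y.carrier H) (b := X.actR.flip) (c := Y.actL)
    (d := X.actL) (a' := TensorProduct.mk k Y.carrier H) (b' := X.actR.flip)
    (c' := (codiag Y (regular k H)).actL) (d' := X.actL)
    (fun _ _ _ => rfl) (fun a x c => (X.act_comm a c x).symm) (Coalgebra.comul h) t
    (Coalgebra.comul h')

theorem interchangeRightMap_actR (h : H) (t : Y.carrier ⊗[k] X.carrier) (h' : H) :
    interchangeRightMap Y X (t ⊗ₜ (h' * h)) =
      (diag (codiag Y (regular k H)) X).actR h (interchangeRightMap Y X (t ⊗ₜ h')) := by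
  have e := Bialgebra.comul_mul (R := k) h' h
  rw [mul_eq_map₂_flip] at e
  refine (congrArg (map₂ (TensorProduct.mk k Y.carrier H) X.actR.flip t) e).trans ?_
  exact map₂_map₂_right (a := TensorProduct.mk k Y.carrier H) (b := X.actR.flip)
    (c := (LinearMap.mul k H).flip) (d := (LinearMap.mul k H).flip)
    (a' := TensorProduct.mk k Y.carrier H) (b' := X.actR.flip)
    (c' := (codiag Y (regular k H)).actR) (d' := X.actR)
    (fun _ _ _ => rfl) (fun a c x => X.mul_actR c a x) (Coalgebra.comul h) (Coalgebra.comul h') t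

/-- The morphism `(Y ⊗̄ X) ⊗̲ H → (Y ⊗̲ H) ⊗̄ X`, `(y ⊗ x) ⊗ h ↦ (y ⊗ h⁽¹⁾) ⊗ x h⁽²⁾`. -/
def interchangeRight (Y X : HopfBimod k H) :
    Hom (codiag (diag Y X) (regular k H)) (diag (codiag Y (regular k H)) X) :=
  ⟨interchangeRightMap Y X, by
    refine ⟨?_, ?_, ?_, ?_⟩
    · intro h m
      induction m using TensorProduct.induction_on with
      | zero => simp only [map_zero]
      | add _ _ h h' => simp only [map_add, h, h']
      | tmul t h' => exact interchangeRightMap_actL h t h'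
    · intro h m
      induction m using TensorProduct.induction_on with
      | zero => simp only [map_zero]
      | add _ _ h h' => simp only [map_add, h, h']
      | tmul t h' => exact interchangeRightMap_actR h t h'
    · intro m
      induction m using TensorProduct.induction_on with
      | zero => simp only [map_zero]
      | add _ _ h h' => simp only [map_add, h, h']
      | tmul t h' => exact coactL_interchangeRightMap t h'
    · intro m
      induction m using TensorProduct.induction_on with
      | zero => simp only [map_zero]
      | add _ _ h h' => simp only [map_add, h, h']
      | tmul t h' => exact coactR_interchangeRightMap t h'⟩

/-- The associativity isomorphism `(X ⊗̄ Y) ⊗̄ Z → X ⊗̄ (Y ⊗̄ Z)`. -/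
def diagAssoc (X Y Z : HopfBimod k H) : Hom (diag (diag X Y) Z) (diag X (diag Y Z)) :=
  ⟨(TensorProduct.assoc k X.carrier Y.carrier Z.carrier).toLinearMap, by
    refine ⟨?_, ?_, ?_, ?_⟩
    · intro h t
      simp only [LinearMap.comp_apply, LinearEquiv.coe_coe]
      have e₁ := fun u : H ⊗[k] H => tensor_ext (f := (map₂ (map₂ X.actL Y.actL ∘ₗ Coalgebra.comul)
        Z.actL).flip t) (g := (map₂ (map₂ X.actL Y.actL) Z.actL).flip t ∘ₗ
          map Coalgebra.comul LinearMap.id) (fun a b => by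
            simp only [LinearMap.flip_apply, LinearMap.comp_apply, map_tmul, map₂_apply_tmul,
              LinearMap.id_apply]) u
      have e₂ := fun (u : H ⊗[k] H) (s) => tensor_ext (f := (map₂ X.actL (map₂ Y.actL Z.actL ∘ₗ
        Coalgebra.comul)).flip s) (g := (map₂ X.actL (map₂ Y.actL Z.actL)).flip s ∘ₗ
          map LinearMap.id Coalgebra.comul) (fun a b => by
            simp only [LinearMap.flip_apply, LinearMap.comp_apply, map_tmul, map₂_apply_tmul,
              LinearMap.id_apply]) u
      simp only [LinearMap.flip_apply, LinearMap.comp_apply] at e₁ e₂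
      rw [e₁, e₂, assoc_map₂]
      exact congrArg (fun z => map₂ X.actL (map₂ Y.actL Z.actL) z _) (Coalgebra.coassoc_apply h)
    · intro h t
      simp only [LinearMap.comp_apply, LinearEquiv.coe_coe]
      have e₁ := fun u : H ⊗[k] H => tensor_ext (f := (map₂ (map₂ X.actR Y.actR ∘ₗ Coalgebra.comul)
        Z.actR).flip t) (g := (map₂ (map₂ X.actR Y.actR) Z.actR).flip t ∘ₗ
          map Coalgebra.comul LinearMap.id) (fun a b => by
            simp only [LinearMap.flip_apply, LinearMap.comp_apply, map_tmul, map₂_apply_tmul,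
              LinearMap.id_apply]) u
      have e₂ := fun (u : H ⊗[k] H) (s) => tensor_ext (f := (map₂ X.actR (map₂ Y.actR Z.actR ∘ₗ
        Coalgebra.comul)).flip s) (g := (map₂ X.actR (map₂ Y.actR Z.actR)).flip s ∘ₗ
          map LinearMap.id Coalgebra.comul) (fun a b => by
            simp only [LinearMap.flip_apply, LinearMap.comp_apply, map_tmul, map₂_apply_tmul,
              LinearMap.id_apply]) u
      simp only [LinearMap.flip_apply, LinearMap.comp_apply] at e₁ e₂
      rw [e₁, e₂, assoc_map₂]
      exact congrArg (fun z => map₂ X.actR (map₂ Y.actR Z.actR) z _) (Coalgebra.coassoc_apply h)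
    · intro t
      refine tensor_ext (f := (diag X (diag Y Z)).coactL ∘ₗ
        (TensorProduct.assoc k X.carrier Y.carrier Z.carrier).toLinearMap)
        (g := map LinearMap.id (TensorProduct.assoc k X.carrier Y.carrier Z.carrier).toLinearMap ∘ₗ
          (diag (diag X Y) Z).coactL) (fun s z => ?_) t
      induction s using TensorProduct.induction_on with
      | zero => simp
      | add _ _ h h' => simp only [TensorProduct.add_tmul, map_add, h, h']
      | tmul x y =>
        simp only [diag, LinearMap.comp_apply, LinearEquiv.coe_coe, TensorProduct.assoc_tmul,
          map_tmul, LinearMap.id_apply]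
        induction X.coactL x with
        | zero => simp
        | add _ _ h h' => simp only [map_add, TensorProduct.add_tmul, h, h']
        | tmul c x => simp
    · intro t
      refine tensor_ext (f := (diag X (diag Y Z)).coactR ∘ₗ
        (TensorProduct.assoc k X.carrier Y.carrier Z.carrier).toLinearMap)
        (g := map (TensorProduct.assoc k X.carrier Y.carrier Z.carrier).toLinearMap LinearMap.id ∘ₗ
          (diag (diag X Y) Z).coactR) (fun s z => ?_) t
      induction s using TensorProduct.induction_on with
      | zero => simp
      | add _ _ h h' => simp only [TensorProduct.add_tmul, map_add, h, h']
      | tmul x y =>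
        simp only [diag, LinearMap.comp_apply, LinearEquiv.coe_coe, TensorProduct.assoc_tmul,
          map_tmul, LinearMap.id_apply]
        induction Z.coactR z with
        | zero => simp
        | add _ _ h h' => simp only [map_add, TensorProduct.tmul_add, h, h']
        | tmul c x => simp⟩

end HopfBimod
end

/-! ### Extension of families of morphisms along a functor -/

section Formal
open CategoryTheory
variable {C : Type*} [Category C] [Preadditive C]
namespace MixedLaw

/-- The structure on an additive functor `D` which extends families of morphisms
`B^{b+1} R ⟶ T^{r+1} R` to families of morphisms `B^{b+1} X ⟶ T^{r+1} X`. -/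
structure Transport (L : MixedLaw C) (R X : C) where
  D : C ⥤ C
  [additive : D.Additive]
  σ : ∀ Y, L.B.obj (D.obj Y) ⟶ D.obj (L.B.obj Y)
  α : ∀ Y, D.obj (L.T.obj Y) ⟶ L.T.obj (D.obj Y)
  ρ : X ⟶ D.obj R
  π : D.obj (L.T.obj R) ⟶ L.T.obj X
  σ_nat : ∀ {Y Y'} (f : Y ⟶ Y'), L.B.map (D.map f) ≫ σ Y' = σ Y ≫ D.map (L.B.map f)
  α_nat : ∀ {Y Y'} (f : Y ⟶ Y'), D.map (L.T.map f) ≫ α Y' = α Y ≫ L.T.map (D.map f)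
  σ_ε : ∀ Y, σ Y ≫ D.map (L.ε Y) = L.ε (D.obj Y)
  η_α : ∀ Y, D.map (L.η Y) ≫ α Y = L.η (D.obj Y)

attribute [instance] Transport.additive

namespace Transport

variable {L : MixedLaw C} {R X X' : C} (t : L.Transport R X)

/-- The morphism `B^n X ⟶ D B^n R`. -/
def split : ∀ n, iter L.B X n ⟶ t.D.obj (iter L.B R n)
  | 0 => t.ρ
  | n + 1 => L.B.map (split n) ≫ t.σ _

theorem barD_split : ∀ n,
    L.barD X n ≫ t.split n = t.split (n + 1) ≫ t.D.map (L.barD R n)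
  | 0 => by
    rw [split, split, barD, barD, Category.assoc, t.σ_ε, L.ε_nat]
    rfl
  | n + 1 => by
    have ih := barD_split n
    rw [show t.split (n + 2) = L.B.map (t.split (n + 1)) ≫ t.σ _ from rfl, barD, barD,
      Preadditive.sub_comp, Functor.map_sub, Preadditive.comp_sub, Category.assoc, Category.assoc,
      t.σ_ε, L.ε_nat, ← t.σ_nat, ← Category.assoc, ← Functor.map_comp, ← ih,
      Functor.map_comp, Category.assoc]
    rfl

/-- The morphism `D T^{r+1} R ⟶ T^{r+1} X`. -/
def apply : ∀ r, t.D.obj (iter L.T R (r + 1)) ⟶ iter L.T X (r + 1)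
  | 0 => t.π
  | r + 1 => t.α _ ≫ L.T.map (apply r)

/-- The failure of the morphisms `apply r` to commute with the cobar differentials. -/
def defect (r : ℕ) : t.D.obj (iter L.T R (r + 1)) ⟶ iter L.T X (r + 2) :=
  t.D.map (L.cobD R (r + 1)) ≫ t.apply (r + 1) - t.apply r ≫ L.cobD X (r + 1)

/-- The units of the monad contribute the same term to both composites. -/
theorem defect_eq (r : ℕ) : t.defect r = t.apply r ≫ L.T.map (L.cobD X r) -
      t.α _ ≫ L.T.map (t.D.map (L.cobD R r) ≫ t.apply r) := by
  have e₁ : t.D.map (L.η (iter L.T R (r + 1))) ≫ t.apply (r + 1) = t.apply r ≫ L.η _ := by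
    rw [apply, ← Category.assoc, t.η_α, L.η_nat]
  have e₂ : t.D.map (L.T.map (L.cobD R r)) ≫ t.apply (r + 1) = t.α _ ≫ L.T.map
        (t.D.map (L.cobD R r) ≫ t.apply r) := by
    rw [apply, ← Category.assoc, t.α_nat, Functor.map_comp, Category.assoc]
  rw [defect, cobD, cobD, Functor.map_sub, Preadditive.sub_comp, Preadditive.comp_sub, e₁, e₂]
  abel

theorem defect_succ (r : ℕ) : t.defect (r + 1) = -(t.α _ ≫ L.T.map (t.defect r)) := by
  rw [defect_eq, show t.apply (r + 1) = t.α _ ≫ L.T.map (t.apply r) from rfl, Category.assoc,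
    ← Functor.map_comp, defect, Functor.map_sub, Preadditive.comp_sub, neg_sub]
  rfl

/-- The family of morphisms `B^{b+1} X ⟶ T^{r+1} X` given by a family of morphisms
`B^{b+1} R ⟶ T^{r+1} R`. -/
def extend (g : ∀ b r, iter L.B R (b + 1) ⟶ iter L.T R (r + 1)) (b r : ℕ) :
    iter L.B X (b + 1) ⟶ iter L.T X (r + 1) :=
  t.split (b + 1) ≫ t.D.map (g b r) ≫ t.apply r

variable (g : ∀ b r, iter L.B R (b + 1) ⟶ iter L.T R (r + 1))

theorem extend_cobD {b r : ℕ} (h : t.split (b + 1) ≫ t.D.map (g b r) ≫ t.defect r = 0) :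
    t.extend g b r ≫ L.cobD X (r + 1) =
      t.split (b + 1) ≫ t.D.map (g b r ≫ L.cobD R (r + 1)) ≫ t.apply (r + 1) := by
  rw [defect, Preadditive.comp_sub, Preadditive.comp_sub, sub_eq_zero] at h
  rw [extend, Functor.map_comp]
  simp only [Category.assoc]
  exact h.symm

theorem barD_extend (b r : ℕ) :
    L.barD X (b + 1) ≫ t.extend g b r =
      t.split (b + 2) ≫ t.D.map (L.barD R (b + 1) ≫ g b r) ≫ t.apply r := by
  rw [extend, ← Category.assoc, barD_split, Functor.map_comp]
  simp only [Category.assoc]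

theorem extend_cocycle
    (hg : post (fun s => L.cobD R (s + 1)) g + pre (fun a => L.barD R (a + 1)) g = 0)
    (h : ∀ b r, t.split (b + 1) ≫ t.D.map (g b r) ≫ t.defect r = 0) :
    post (fun s => L.cobD X (s + 1)) (t.extend g) +
      pre (fun a => L.barD X (a + 1)) (t.extend g) = 0 := by
  funext b r
  have e := congrArg (fun z => t.split (b + 1) ≫ t.D.map z ≫ t.apply r) (congrFun (congrFun hg b) r)
  simp only [Pi.add_apply, Pi.zero_apply, Functor.map_add, Functor.map_zero, Preadditive.comp_add,
    Preadditive.add_comp, Limits.zero_comp, Limits.comp_zero] at e ⊢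
  rw [← e]
  refine congrArg₂ (· + ·) ?_ ?_
  · rcases r with _ | r
    · simp [post]
    · exact t.extend_cobD g (h b r)
  · rcases b with _ | b
    · simp [pre]
    · exact t.barD_extend g b r

section Naturality

variable {t} {t' : L.Transport R X'} {f : X ⟶ X'} {τ : ∀ Y, t.D.obj Y ⟶ t'.D.obj Y}

theorem split_nat (hσ : ∀ Y, L.B.map (τ Y) ≫ t'.σ Y = t.σ Y ≫ τ (L.B.obj Y))
    (hρ : t.ρ ≫ τ R = f ≫ t'.ρ) : ∀ n,
    iterMap L.B f n ≫ t'.split n = t.split n ≫ τ (iter L.B R n)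
  | 0 => hρ.symm
  | n + 1 => by
    have ih := split_nat hσ hρ n
    rw [split, split, iterMap, ← Category.assoc, ← Functor.map_comp, ih, Functor.map_comp,
      Category.assoc, Category.assoc, hσ]

theorem apply_nat (hα : ∀ Y, t.α Y ≫ L.T.map (τ Y) = τ (L.T.obj Y) ≫ t'.α Y)
    (hπ : t.π ≫ L.T.map f = τ (L.T.obj R) ≫ t'.π) : ∀ r,
    τ (iter L.T R (r + 1)) ≫ t'.apply r = t.apply r ≫ iterMap L.T f (r + 1)
  | 0 => hπ.symm
  | r + 1 => by
    have ih := apply_nat hα hπ r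
    rw [apply, apply, iterMap, Category.assoc, ← Functor.map_comp, ← ih, Functor.map_comp,
      ← Category.assoc, ← hα, Category.assoc]

theorem extend_nat (τ_nat : ∀ {Y Y'} (φ : Y ⟶ Y'), t.D.map φ ≫ τ Y' = τ Y ≫ t'.D.map φ)
    (hσ : ∀ Y, L.B.map (τ Y) ≫ t'.σ Y = t.σ Y ≫ τ (L.B.obj Y))
    (hρ : t.ρ ≫ τ R = f ≫ t'.ρ) (hα : ∀ Y, t.α Y ≫ L.T.map (τ Y) = τ (L.T.obj Y) ≫ t'.α Y)
    (hπ : t.π ≫ L.T.map f = τ (L.T.obj R) ≫ t'.π) (b r : ℕ) :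
    iterMap L.B f (b + 1) ≫ t'.extend g b r = t.extend g b r ≫ iterMap L.T f (r + 1) := by
  rw [extend, extend, Category.assoc, Category.assoc, ← apply_nat hα hπ, ← Category.assoc,
    split_nat hσ hρ, Category.assoc, ← Category.assoc (τ _), ← τ_nat, Category.assoc]

end Naturality

end Transport
end MixedLaw
end Formal

noncomputable section
namespace HopfBimod
open CategoryTheory

variable {k : Type u} {H : Type v} [Field k] [Ring H] [HopfAlgebra k H]
variable {M N L X Y X' Y' Z : HopfBimod k H}

/-! ### Extension of the cocycles of `H` to all Hopf bimodules -/

/-- The functor `Y ↦ Y ⊗̄ X`. -/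
def diagFunctor (X : HopfBimod k H) : HopfBimod k H ⥤ HopfBimod k H where
  obj Y := diag Y X
  map f := diagMap f (Hom.id _)
  map_id _ := Hom.ext_apply fun x => LinearMap.congr_fun TensorProduct.map_id x
  map_comp _ _ := Hom.ext_apply <| tensor_ext fun _ _ => rfl

instance (X : HopfBimod k H) : (diagFunctor X).Additive where
  map_add {_ _ f g} := Hom.ext_apply fun x => LinearMap.congr_fun
    (TensorProduct.map_add_left f.1 g.1 LinearMap.id) x

/-- The linear map underlying a morphism. -/
abbrev Hom.toLinearMap (f : X ⟶ Y) : X.carrier →ₗ[k] Y.carrier := Subtype.val (p := (· ∈ homs X Y)) f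

theorem interchangeRight_nat (f : Hom Y Y') (g : Hom X X') :
    (interchangeRight Y' X').comp (codiagMap (diagMap f g) (Hom.id _)) =
      (diagMap (codiagMap f (Hom.id _)) g).comp (interchangeRight Y X) :=
  Hom.ext_apply <| tensor_ext fun t h => by
    refine Eq.symm ((map_map₂ (f₁ := f.1) (f₂ := LinearMap.id) (a := TensorProduct.mk k Y.carrier H)
      (a' := TensorProduct.mk k Y'.carrier H) (b := X.actR.flip)
      (b' := X'.actR.flip) (f := map f.1 LinearMap.id) (g := g.1)
      (g₁ := g.1) (g₂ := LinearMap.id) (by simp) (fun x h => g.2.2.1 h x) t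
      (Coalgebra.comul h)).trans ?_)
    rw [TensorProduct.map_id, LinearMap.id_apply]
    rfl

theorem interchangeRight_actHom (Y X : HopfBimod k H) :
    (diagMap (actHom Y) (Hom.id X)).comp (interchangeRight Y X) = actHom (diag Y X) :=
  Hom.ext_apply <| tensor_ext fun t h =>
    bilin_ext (f := (map₂ (TensorProduct.mk k Y.carrier H) X.actR.flip).compr₂
        (map (lift Y.actR.flip) LinearMap.id))
      (g := (map₂ Y.actR X.actR).flip) (by simp) t (Coalgebra.comul h)

theorem diagAssoc_nat (h : Hom Z Z) (f : Hom Y Y') (g : Hom X X') :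
    (diagAssoc Z Y' X').comp (diagMap (diagMap h f) g) =
      (diagMap h (diagMap f g)).comp (diagAssoc Z Y X) :=
  Hom.ext_apply <| tensor_ext fun t x =>
    tensor_ext (f := ((diagAssoc Z Y' X').comp (diagMap (diagMap h f) g)).1 ∘ₗ
      (TensorProduct.mk k _ _).flip x)
      (g := ((diagMap h (diagMap f g)).comp (diagAssoc Z Y X)).1 ∘ₗ
        (TensorProduct.mk k _ _).flip x) (fun _ _ => rfl) t

/-- The functor `Y ↦ Y ⊗̄ X`, which transports cochains of `H` to cochains of `X ≅ H ⊗̄ X`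
restricted to cotensor products. -/
def transport (X : HopfBimod k H) : (mixedLaw k H).Transport (regular k H) X where
  D := diagFunctor X
  σ Y := interchangeRight Y X
  α Y := diagAssoc (regular k H) Y X
  ρ := coactHom X
  π := (dropCounit X).comp (diagAssoc (regular k H) (regular k H) X)
  σ_nat f := interchangeRight_nat f (Hom.id X)
  α_nat f := diagAssoc_nat (Hom.id _) f (Hom.id X)
  σ_ε Y := interchangeRight_actHom Y X
  η_α _ := rfl

theorem transport_extend_nat (f : Hom X X') (g : ∀ b r, iter (mixedLaw k H).B (regular k H) (b + 1) ⟶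
      iter (mixedLaw k H).T (regular k H) (r + 1)) (b r : ℕ) :
    iterMap (mixedLaw k H).B f (b + 1) ≫ (transport X').extend g b r =
      (transport X).extend g b r ≫ iterMap (mixedLaw k H).T f (r + 1) := by
  refine MixedLaw.Transport.extend_nat (t := transport X) (t' := transport X') g
    (τ := fun Y => diagMap (Hom.id Y) f)
    (fun φ => Hom.ext_apply <| tensor_ext fun _ _ => rfl)
    (fun Y => ?_)
    ((mixedLaw k H).η_nat f)
    (fun Y => ?_) ?_ b r
  · refine (interchangeRight_nat (Hom.id Y) f).trans ?_
    rw [show codiagMap (Hom.id Y) (Hom.id (regular k H)) = Hom.id (codiag Y (regular k H)) from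
      barFunctor.map_id Y]
    rfl
  · refine (diagAssoc_nat (Hom.id (regular k H)) (Hom.id Y) f).symm.trans ?_
    rw [show diagMap (Hom.id (regular k H)) (Hom.id Y) = Hom.id (diag (regular k H) Y) from
      cobFunctor.map_id Y]
    rfl
  · have e : (diagAssoc (regular k H) (regular k H) X').comp
        (diagMap (Hom.id (diag (regular k H) (regular k H))) f) =
        (diagMap (Hom.id _) (diagMap (Hom.id _) f)).comp
          (diagAssoc (regular k H) (regular k H) X) := by
      refine Eq.trans ?_ (diagAssoc_nat (Hom.id (regular k H)) (Hom.id (regular k H)) f)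
      rw [show diagMap (Hom.id (regular k H)) (Hom.id (regular k H)) =
        Hom.id (diag (regular k H) (regular k H)) from cobFunctor.map_id (regular k H)]
    have e' : (diagMap (Hom.id _) f).comp (dropCounit X) =
        (dropCounit X').comp (diagMap (Hom.id _) (diagMap (Hom.id _) f)) :=
      (mixedLaw k H).μ_nat f
    refine (congrArg (fun z => Hom.comp z (diagAssoc (regular k H) (regular k H) X)) e').trans ?_
    exact (congrArg (Hom.comp (dropCounit X')) e).symm

/-- The difference of the two maps `Y ⊗ X → Y ⊗ H ⊗ X` whose equalizer is the cotensor product of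
`Y` and `X`. -/
def cotensorDiff (Y X : HopfBimod k H) :
    Y.carrier ⊗[k] X.carrier →ₗ[k] Y.carrier ⊗[k] (H ⊗[k] X.carrier) :=
  map LinearMap.id X.coactL -
    (TensorProduct.assoc k Y.carrier H X.carrier).toLinearMap ∘ₗ map Y.coactR LinearMap.id

theorem cotensorDiff_apply (Y X : HopfBimod k H) (t : Y.carrier ⊗[k] X.carrier) :
    cotensorDiff Y X t = map LinearMap.id X.coactL t -
      TensorProduct.assoc k Y.carrier H X.carrier (map Y.coactR LinearMap.id t) := rfl

theorem cotensorDiff_interchangeRight (t : Y.carrier ⊗[k] X.carrier) (h : H) :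
    cotensorDiff (codiag Y (regular k H)) X (interchangeRightMap Y X (t ⊗ₜ h)) =
      map₂ (TensorProduct.mk k Y.carrier H) (map₂ (LinearMap.mul k H) X.actR.flip)
        (cotensorDiff Y X t) (map LinearMap.id Coalgebra.comul (Coalgebra.comul (R := k) h)) := by
  have e₀ : ∀ x h, X.coactL (X.actR.flip x h) =
      map₂ (LinearMap.mul k H) X.actR.flip (X.coactL x) (Coalgebra.comul h) := fun x h =>
    (X.coactL_actR h x).trans <| bilin_ext (f := map₂ (LinearMap.mul k H).flip X.actR)
      (g := (map₂ (LinearMap.mul k H) X.actR.flip).flip) (fun _ _ _ _ => rfl) _ _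
  have e₁ := map_map₂ (a := TensorProduct.mk k Y.carrier H) (b := X.actR.flip)
    (f := LinearMap.id) (g := X.coactL)
    (f₁ := LinearMap.id) (f₂ := LinearMap.id) (g₁ := X.coactL)
    (g₂ := Coalgebra.comul) (a' := TensorProduct.mk k Y.carrier H)
    (b' := map₂ (LinearMap.mul k H) X.actR.flip) (fun _ _ => rfl) e₀ t (Coalgebra.comul h)
  have e₂ := map_map₂ (a := TensorProduct.mk k Y.carrier H) (b := X.actR.flip)
    (f := (codiag Y (regular k H)).coactR) (g := LinearMap.id)
    (f₁ := Y.coactR) (f₂ := Coalgebra.comul) (g₁ := LinearMap.id)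
    (g₂ := LinearMap.id) (a' := map₂ (TensorProduct.mk k Y.carrier H) (LinearMap.mul k H))
    (b' := X.actR.flip) (fun _ _ => rfl) (fun _ _ => rfl) t (Coalgebra.comul h)
  have e₃ := (congrArg (TensorProduct.assoc k (Y.carrier ⊗[k] H) H X.carrier) e₂)
  rw [assoc_map₂, show TensorProduct.assoc k H H H
    (map Coalgebra.comul LinearMap.id (Coalgebra.comul h)) = _ from Coalgebra.coassoc_apply h] at e₃
  rw [cotensorDiff_apply Y X t, map_sub, LinearMap.sub_apply]
  exact congrArg₂ (· - ·) e₁ e₃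

/-- The image of `split` lies in the cotensor product. -/
theorem cotensorDiff_split (X : HopfBimod k H) : ∀ n (z : (iter (mixedLaw k H).B X n).carrier),
    cotensorDiff (iter (mixedLaw k H).B (regular k H) n) X
      (Hom.toLinearMap ((transport X).split n) z) = 0
  | 0, x => sub_eq_zero.2 (X.coassocL x).symm
  | n + 1, z => by
    refine tensor_ext (f := cotensorDiff (iter (mixedLaw k H).B (regular k H) (n + 1)) X ∘ₗ
      Hom.toLinearMap ((transport X).split (n + 1))) (g := 0) (fun t h => ?_) z
    refine (cotensorDiff_interchangeRight
      (Hom.toLinearMap ((transport X).split n) t) h).trans ?_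
    rw [cotensorDiff_split X n t, map_zero, LinearMap.zero_apply]
    rfl

theorem cotensorDiff_map (f : Hom Y Y') (t : Y.carrier ⊗[k] X.carrier) :
    cotensorDiff Y' X (map f.1 LinearMap.id t) = map f.1 LinearMap.id (cotensorDiff Y X t) := by
  refine tensor_ext (f := cotensorDiff Y' X ∘ₗ map f.1 LinearMap.id)
    (g := map f.1 LinearMap.id ∘ₗ cotensorDiff Y X) (fun y x => ?_) t
  have e := f.2.2.2.2 y
  simp only [LinearMap.comp_apply, cotensorDiff_apply, map_tmul, LinearMap.id_apply, e, map_sub]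
  congr 1
  induction Y.coactR y with
  | zero => simp
  | add _ _ h h' => simp only [map_add, TensorProduct.add_tmul, h, h']
  | tmul y c => simp

theorem cotensorDiff_assoc (t : (H ⊗[k] Y.carrier) ⊗[k] X.carrier) :
    TensorProduct.assoc k H Y.carrier (H ⊗[k] X.carrier)
        (cotensorDiff (diag (regular k H) Y) X t) =
      map LinearMap.id (cotensorDiff Y X) (TensorProduct.assoc k H Y.carrier X.carrier t) := by
  refine tensor_ext (f := (TensorProduct.assoc k H Y.carrier (H ⊗[k] X.carrier)).toLinearMap ∘ₗ
    cotensorDiff (diag (regular k H) Y) X) (g := map LinearMap.id (cotensorDiff Y X) ∘ₗ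
      (TensorProduct.assoc k H Y.carrier X.carrier).toLinearMap) (fun s x => ?_) t
  induction s using TensorProduct.induction_on with
  | zero => simp
  | add _ _ h h' => simp only [TensorProduct.add_tmul, map_add, h, h']
  | tmul h y =>
    have e : cotensorDiff (diag (regular k H) Y) X ((h ⊗ₜ y) ⊗ₜ x) = (h ⊗ₜ y) ⊗ₜ X.coactL x -
      TensorProduct.assoc k (H ⊗[k] Y.carrier) H X.carrier
        ((TensorProduct.assoc k H Y.carrier H).symm (h ⊗ₜ Y.coactR y) ⊗ₜ x) := rfl
    have e' : cotensorDiff Y X (y ⊗ₜ x) = y ⊗ₜ X.coactL x -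
      TensorProduct.assoc k Y.carrier H X.carrier (Y.coactR y ⊗ₜ x) := rfl
    simp only [LinearMap.comp_apply, LinearEquiv.coe_coe, TensorProduct.assoc_tmul, map_tmul,
      LinearMap.id_apply]
    rw [e, e', map_sub, TensorProduct.tmul_sub, TensorProduct.assoc_tmul]
    congr 1
    induction Y.coactR y with
    | zero => simp
    | add _ _ h h' => simp only [map_add, TensorProduct.add_tmul, TensorProduct.tmul_add, h, h']
    | tmul y c => simp

theorem defect_zero (X : HopfBimod k H) : (transport X).defect 0 =
    (transport X).π ≫ (mixedLaw k H).T.map ((mixedLaw k H).η X) -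
      (show _ ⟶ (mixedLaw k H).T.obj ((mixedLaw k H).T.obj X) from
        (transport X).α (regular k H)) := by
  have e : (transport X).D.map ((mixedLaw k H).cobD (regular k H) 0) ≫ (transport X).apply 0 =
      𝟙 (diag (regular k H) X) := (mixedLaw k H).η_μ X
  rw [MixedLaw.Transport.defect_eq, e]
  refine congrArg (_ - ·) ?_
  exact (congrArg (_ ≫ ·) ((mixedLaw k H).T.map_id _)).trans (Category.comp_id _)

/-- The maps `apply` commute with the cobar differentials on the cotensor product. -/
theorem exists_defect_eq (X : HopfBimod k H) : ∀ r,
    ∃ Ψ : (iter (mixedLaw k H).T (regular k H) (r + 1)).carrier ⊗[k] (H ⊗[k] X.carrier) →ₗ[k]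
      (iter (mixedLaw k H).T X (r + 2)).carrier,
      Hom.toLinearMap ((transport X).defect r) =
        Ψ ∘ₗ cotensorDiff (iter (mixedLaw k H).T (regular k H) (r + 1)) X
  | 0 => by
    refine ⟨map LinearMap.id (counitMap (diag (regular k H) X)) ∘ₗ
      (TensorProduct.assoc k H H (H ⊗[k] X.carrier)).toLinearMap, LinearMap.ext fun t => ?_⟩
    refine (congrArg (fun z => Hom.toLinearMap z t) (defect_zero X)).trans (Eq.symm ?_)
    refine (congrArg (fun z => map LinearMap.id (counitMap (diag (regular k H) X)) z)
      (cotensorDiff_assoc (Y := regular k H) t)).trans ?_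
    refine (LinearMap.congr_fun (TensorProduct.map_comp LinearMap.id
      (counitMap (diag (regular k H) X)) LinearMap.id (cotensorDiff (regular k H) X)) _).symm.trans ?_
    have key : ∀ s : H ⊗[k] X.carrier,
        counitMap (diag (regular k H) X) (cotensorDiff (regular k H) X s) =
          X.coactL (counitMap X s) - s := by
      refine tensor_ext (f := counitMap (diag (regular k H) X) ∘ₗ cotensorDiff (regular k H) X)
        (g := X.coactL ∘ₗ counitMap X - LinearMap.id) fun h x => ?_
      have e : ∀ s : H ⊗[k] H, counitMap (diag (regular k H) X)
          (TensorProduct.assoc k H H X.carrier (s ⊗ₜ x)) =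
          TensorProduct.lid k H (map Coalgebra.counit LinearMap.id s) ⊗ₜ x :=
        tensor_ext (f := counitMap (diag (regular k H) X) ∘ₗ
          (TensorProduct.assoc k H H X.carrier).toLinearMap ∘ₗ (TensorProduct.mk k _ _).flip x)
          (g := (TensorProduct.mk k _ _).flip x ∘ₗ (TensorProduct.lid k H).toLinearMap ∘ₗ
            map Coalgebra.counit LinearMap.id)
          (fun a b => by simp [counitMap, TensorProduct.smul_tmul'])
      have e' : cotensorDiff (regular k H) X (h ⊗ₜ x) = h ⊗ₜ X.coactL x -
        TensorProduct.assoc k H H X.carrier (Coalgebra.comul h ⊗ₜ x) := rfl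
      have e'' : counitMap (diag (regular k H) X) (h ⊗ₜ X.coactL x) =
          Coalgebra.counit (R := k) h • X.coactL x := rfl
      have e₃ : TensorProduct.lid k H (map Coalgebra.counit LinearMap.id
        (Coalgebra.comul (R := k) h)) = h := (regular k H).counit_coactL h
      refine (congrArg (counitMap (diag (regular k H) X)) e').trans ?_
      rw [map_sub, e, e'', e₃]
      refine congrArg (· - _) ?_
      exact (map_smul X.coactL (Coalgebra.counit (R := k) h) x).symm
    refine (LinearMap.congr_fun (congrArg (map LinearMap.id) (LinearMap.ext key :
      counitMap (diag (regular k H) X) ∘ₗ cotensorDiff (regular k H) X =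
        X.coactL ∘ₗ counitMap X - LinearMap.id)) _).trans ?_
    have e : ∀ s : H ⊗[k] (H ⊗[k] X.carrier),
        map (LinearMap.id : H →ₗ[k] H) (X.coactL ∘ₗ counitMap X - LinearMap.id) s =
          map (LinearMap.id : H →ₗ[k] H) X.coactL
            (map (LinearMap.id : H →ₗ[k] H) (counitMap X) s) - s :=
      tensor_ext (f := map (LinearMap.id : H →ₗ[k] H) (X.coactL ∘ₗ counitMap X - LinearMap.id))
        (g := map (LinearMap.id : H →ₗ[k] H) X.coactL ∘ₗ
          map (LinearMap.id : H →ₗ[k] H) (counitMap X) - LinearMap.id)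
        (fun a b => by simp [TensorProduct.tmul_sub])
    exact e _
  | r + 1 => by
    obtain ⟨Ψ, hΨ⟩ := exists_defect_eq X r
    refine ⟨-(map LinearMap.id Ψ ∘ₗ (TensorProduct.assoc k H _ (H ⊗[k] X.carrier)).toLinearMap),
      LinearMap.ext fun t => ?_⟩
    refine (congrArg (fun z => Hom.toLinearMap z t)
      (MixedLaw.Transport.defect_succ (transport X) r)).trans ?_
    refine Eq.trans ?_ (congrArg (fun z => -(map LinearMap.id Ψ z)) (cotensorDiff_assoc t)).symm
    refine congrArg Neg.neg ?_
    refine (LinearMap.congr_fun (congrArg (map LinearMap.id) hΨ) _).trans ?_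
    exact tensor_ext (f := map LinearMap.id
      (Ψ ∘ₗ cotensorDiff (iter (mixedLaw k H).T (regular k H) (r + 1)) X))
      (g := map LinearMap.id Ψ ∘ₗ map LinearMap.id
        (cotensorDiff (iter (mixedLaw k H).T (regular k H) (r + 1)) X)) (fun _ _ => rfl) _

/-- The extension of a cocycle of `H` is a cocycle: the defect vanishes on the cotensor product, which
contains the image of `split` and is preserved by morphisms. -/
theorem transport_cocycle {g : ∀ b r, iter (mixedLaw k H).B (regular k H) (b + 1) ⟶
      iter (mixedLaw k H).T (regular k H) (r + 1)}
    (hg : MixedLaw.post (fun s => (mixedLaw k H).cobD (regular k H) (s + 1)) g +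
      MixedLaw.pre (fun a => (mixedLaw k H).barD (regular k H) (a + 1)) g = 0)
    (X : HopfBimod k H) :
    MixedLaw.post (fun s => (mixedLaw k H).cobD X (s + 1)) ((transport X).extend g) +
      MixedLaw.pre (fun a => (mixedLaw k H).barD X (a + 1)) ((transport X).extend g) = 0 := by
  refine MixedLaw.Transport.extend_cocycle _ _ hg fun b r => ?_
  obtain ⟨Ψ, hΨ⟩ := exists_defect_eq X r
  refine Hom.ext_apply fun z => (LinearMap.congr_fun hΨ _).trans ?_
  refine (congrArg Ψ ((cotensorDiff_map (g b r) _).trans (congrArg _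
    (cotensorDiff_split X (b + 1) z)))).trans ?_
  rw [map_zero, map_zero]
  rfl

/-- For `X = H`, the map `split` is the right coaction. -/
theorem split_regular : ∀ n z, Hom.toLinearMap ((transport (regular k H)).split n) z =
    (iter (mixedLaw k H).B (regular k H) n).coactR z
  | 0, z => rfl
  | n + 1, z => by
    refine tensor_ext (f := Hom.toLinearMap ((transport (regular k H)).split (n + 1)))
      (g := (iter (mixedLaw k H).B (regular k H) (n + 1)).coactR) (fun t h => ?_) z
    exact congrArg (fun w => interchangeRightMap _ (regular k H) (w ⊗ₜ h)) (split_regular n t)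

/-- For `X = H`, the map `apply` is a left inverse of the right coaction. -/
theorem apply_regular : ∀ r z, Hom.toLinearMap ((transport (regular k H)).apply r)
    ((iter (mixedLaw k H).T (regular k H) (r + 1)).coactR z) = z
  | 0, z => by
    refine tensor_ext (f := Hom.toLinearMap ((transport (regular k H)).apply 0) ∘ₗ
      (iter (mixedLaw k H).T (regular k H) 1).coactR) (g := LinearMap.id) (fun h h' => ?_) z
    have e : TensorProduct.assoc k H H H ((TensorProduct.assoc k H H H).symm
      (h ⊗ₜ Coalgebra.comul (R := k) h')) = h ⊗ₜ Coalgebra.comul (R := k) h' :=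
      LinearEquiv.apply_symm_apply _ _
    refine (congrArg (map LinearMap.id (counitMap (regular k H))) e).trans ?_
    exact congrArg (h ⊗ₜ[k] ·) ((regular k H).counit_coactL h')
  | r + 1, z => by
    refine tensor_ext (f := Hom.toLinearMap ((transport (regular k H)).apply (r + 1)) ∘ₗ
      (iter (mixedLaw k H).T (regular k H) (r + 2)).coactR) (g := LinearMap.id) (fun h y => ?_) z
    have e := LinearEquiv.apply_symm_apply (TensorProduct.assoc k H
      (iter (mixedLaw k H).T (regular k H) (r + 1)).carrier H)
      (h ⊗ₜ (iter (mixedLaw k H).T (regular k H) (r + 1)).coactR y)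
    refine (congrArg (map LinearMap.id (Hom.toLinearMap ((transport (regular k H)).apply r)))
      e).trans ?_
    exact congrArg (h ⊗ₜ[k] ·) (apply_regular r y)

theorem extend_regular (g : ∀ b r, iter (mixedLaw k H).B (regular k H) (b + 1) ⟶
    iter (mixedLaw k H).T (regular k H) (r + 1)) (b r : ℕ) :
    (transport (regular k H)).extend g b r = g b r :=
  Hom.ext_apply fun z => by
    refine (congrArg (fun w => Hom.toLinearMap ((transport (regular k H)).apply r)
      (map (Hom.toLinearMap (g b r)) LinearMap.id w)) (split_regular (b + 1) z)).trans ?_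
    refine (congrArg (Hom.toLinearMap ((transport (regular k H)).apply r))
      ((g b r).2.2.2.2 z).symm).trans ?_
    exact apply_regular r _

/-- The natural family of cocycles which extends a cocycle of `H` with values in `H`. -/
def natCocycle {q : ℕ} (g : ∀ b r, iter (mixedLaw k H).B (regular k H) (b + 1) ⟶
    iter (mixedLaw k H).T (regular k H) (r + 1)) (hq : ∀ b r, b + r ≠ q → g b r = 0)
    (hg : MixedLaw.post (fun s => (mixedLaw k H).cobD (regular k H) (s + 1)) g +
      MixedLaw.pre (fun a => (mixedLaw k H).barD (regular k H) (a + 1)) g = 0) :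
    (mixedLaw k H).NatCocycle q where
  toFun X := (transport X).extend g
  nat f b r := transport_extend_nat f g b r
  cocycle X := transport_cocycle hg X
  eq_zero X b r h := by
    rw [MixedLaw.Transport.extend, hq b r h, Functor.map_zero, Limits.zero_comp, Limits.comp_zero]

theorem natCocycle_regular {q : ℕ} (g : ∀ b r, iter (mixedLaw k H).B (regular k H) (b + 1) ⟶
    iter (mixedLaw k H).T (regular k H) (r + 1)) (hq : ∀ b r, b + r ≠ q → g b r = 0)
    (hg : MixedLaw.post (fun s => (mixedLaw k H).cobD (regular k H) (s + 1)) g +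
      MixedLaw.pre (fun a => (mixedLaw k H).barD (regular k H) (a + 1)) g = 0) :
    (natCocycle g hq hg).toFun (regular k H) = g :=
  funext fun b => funext fun r => extend_regular g b r

end HopfBimod
end

noncomputable section
/-! ### The bar and cobar objects as iterates -/

section Formal
open CategoryTheory
variable {C : Type*} [Category C]

/-- A functor preserves the commutative pentagons that occur in the inductions on the number of
factors.  This lemma and the next ones are stated in an arbitrary category, so that the objects
`barObj` and `cobObj` are not unfolded. -/
theorem map_comp_comp_congr {D : Type*} [Category D] (F : C ⥤ D) {P Q R Q' P' : C} {a : P ⟶ Q}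
    {b : Q ⟶ R} {c : R ⟶ P'} {a' : P ⟶ Q'} {b' : Q' ⟶ P'} (h : a ≫ b ≫ c = a' ≫ b') :
    F.map a ≫ F.map b ≫ F.map c = F.map a' ≫ F.map b' := by
  rw [← Functor.map_comp, ← Functor.map_comp, h, Functor.map_comp]

variable [Preadditive C]

namespace MixedLaw

variable (L : MixedLaw C)

theorem spread_right_zero {M Y : C} (x : ∀ a, iter L.B M (a + 1) ⟶ Y) (n : ℕ) :
    L.spread x n 0 = L.Δ _ ≫ L.B.map (x n) := by
  rw [spread]

theorem collect_right_zero {X N : C} (y : ∀ r, X ⟶ iter L.T N (r + 1)) (l : ℕ) :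
    L.collect y l 0 = L.T.map (y l) ≫ L.μ _ := by
  rw [collect]

theorem barD_comparison {P I : C} {d : L.B.obj P ⟶ P} {d' : L.B.obj I ⟶ I} {u : P ⟶ I} {n : ℕ}
    (ih : d ≫ u = (-1 : ℤ) ^ n • (L.B.map u ≫ d')) {x : L.B.obj (L.B.obj P) ⟶ L.B.obj P}
    (hx : x = (-1 : ℤ) ^ (n + 1) • L.ε (L.B.obj P)) :
    (L.B.map d + x) ≫ L.B.map u =
      (-1 : ℤ) ^ (n + 1) • (L.B.map (L.B.map u) ≫ (L.ε (L.B.obj I) - L.B.map d')) := by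
  rw [hx, Preadditive.add_comp, ← Functor.map_comp, ih, Functor.map_zsmul, Functor.map_comp,
    Preadditive.zsmul_comp, ← L.ε_nat, Preadditive.comp_sub, smul_sub, pow_succ]
  simp only [mul_neg, mul_one, neg_smul, sub_neg_eq_add, add_comm]

theorem cobD_comparison {P I : C} {d : P ⟶ L.T.obj P} {d' : I ⟶ L.T.obj I} {u : P ⟶ I}
    (ih : d ≫ L.T.map u = u ≫ d') :
    (L.η (L.T.obj P) - L.T.map d) ≫ L.T.map (L.T.map u) =
      L.T.map u ≫ (L.η (L.T.obj I) - L.T.map d') := by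
  rw [Preadditive.sub_comp, ← Functor.map_comp, ih, Functor.map_comp, L.η_nat,
    Preadditive.comp_sub]

theorem spread_comparison {P I Y : C} (u : P ⟶ I) (x : L.B.obj I ⟶ Y) :
    L.Δ P ≫ L.B.map (L.B.map u ≫ x) ≫ L.B.map (𝟙 Y) =
      L.B.map u ≫ L.Δ I ≫ L.B.map x := by
  rw [CategoryTheory.Functor.map_comp, CategoryTheory.Functor.map_id, Category.comp_id,
    ← Category.assoc, ← L.Δ_nat, Category.assoc]

theorem collect_comparison {X P I : C} (y : X ⟶ L.T.obj P) (u : P ⟶ I) :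
    L.T.map y ≫ L.μ P ≫ L.T.map u = L.T.map (𝟙 X) ≫ L.T.map (y ≫ L.T.map u) ≫ L.μ I := by
  rw [L.μ_nat, CategoryTheory.Functor.map_id, Category.id_comp, CategoryTheory.Functor.map_comp,
    Category.assoc]

theorem exchOne_comparison {X Y P I : C} {i : L.B.obj P ⟶ Y} {v : Y ⟶ I} {u : P ⟶ X}
    {e : L.B.obj X ⟶ I} (ih : i ≫ v = L.B.map u ≫ e) :
    (L.χ P ≫ L.T.map i) ≫ L.T.map v = L.B.map (L.T.map u) ≫ L.χ X ≫ L.T.map e := by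
  rw [Category.assoc, ← Functor.map_comp, ih, Functor.map_comp, ← Category.assoc, ← L.χ_nat,
    Category.assoc]

theorem exch_comparison {P P' P'' Q R R' W W' W'' : C} {i : P ⟶ P'} {c : P' ⟶ P''} {v : P'' ⟶ Q}
    {p : P ⟶ R} {r : R ⟶ R'} {x : R' ⟶ Q}
    (ih : i ≫ c ≫ v = p ≫ r ≫ x) {o : L.B.obj P' ⟶ W} {c' : W ⟶ W'} {o' : L.B.obj P'' ⟶ W'}
    {v' : W' ⟶ W''} {o'' : L.B.obj Q ⟶ W''}
    (h₁ : o ≫ c' = L.B.map c ≫ o') (h₂ : L.B.map v ≫ o'' = o' ≫ v') :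
    (L.B.map i ≫ o) ≫ c' ≫ v' = L.B.map p ≫ L.B.map r ≫ L.B.map x ≫ o'' := by
  have e := congrArg L.B.map ih
  simp only [Functor.map_comp] at e
  calc (L.B.map i ≫ o) ≫ c' ≫ v' = L.B.map i ≫ (o ≫ c') ≫ v' := by simp only [Category.assoc]
    _ = (L.B.map i ≫ L.B.map c ≫ L.B.map v) ≫ o'' := by
      rw [h₁, Category.assoc, ← h₂]; simp only [Category.assoc]
    _ = _ := by rw [e]; simp only [Category.assoc]

end MixedLaw

end Formal

namespace HopfBimod
open CategoryTheory

variable {k : Type u} {H : Type v} [Field k] [Ring H] [HopfAlgebra k H]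

/-- The bar objects are the iterates of the bar comonad. -/
def barIso (M : HopfBimod k H) : ∀ n, barObj M n ≅ iter (mixedLaw k H).B M n
  | 0 => Iso.refl M
  | n + 1 => (mixedLaw k H).B.mapIso (barIso M n)

/-- The cobar objects are the iterates of the cobar monad. -/
def cobIso (N : HopfBimod k H) : ∀ n, cobObj N n ≅ iter (mixedLaw k H).T N n
  | 0 => Iso.refl N
  | n + 1 => (mixedLaw k H).T.mapIso (cobIso N n)

theorem neg_one_pow_smul_eq {A : Type*} [AddCommGroup A] [Module k A] (n : ℕ) (x : A) :
    (-1 : k) ^ n • x = (-1 : ℤ) ^ n • x := by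
  rcases Nat.even_or_odd n with h | h <;> simp [h.neg_one_pow]

theorem barMap_comp {X Y Z : HopfBimod k H} (f : X ⟶ Y) (g : Y ⟶ Z) : ∀ n,
    Cochain.barMap (f ≫ g) n = CategoryStruct.comp (X := barObj X n) (Y := barObj Y n)
      (Z := barObj Z n) (Cochain.barMap f n) (Cochain.barMap g n)
  | 0 => rfl
  | n + 1 => (congrArg (mixedLaw k H).B.map (barMap_comp f g n)).trans
      ((mixedLaw k H).B.map_comp _ _)

/-- The bar differential agrees up to sign with the one of the bar comonad, for which the right
action on the outermost factor has a positive sign. -/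
theorem barD_barIso (M : HopfBimod k H) : ∀ n,
    (HopfBimod.barD M n : barObj M (n + 1) ⟶ barObj M n) ≫ (barIso M n).hom =
      (-1 : ℤ) ^ n • ((barIso M (n + 1)).hom ≫ (mixedLaw k H).barD M n)
  | 0 => by
    rw [pow_zero, one_smul]
    exact ((mixedLaw k H).ε_nat (𝟙 M)).symm
  | n + 1 => (mixedLaw k H).barD_comparison (barD_barIso M n)
      (neg_one_pow_smul_eq (A := Hom _ _) _ _)

theorem cobD_cobIso (N : HopfBimod k H) : ∀ n,
    (HopfBimod.cobD N n : cobObj N n ⟶ cobObj N (n + 1)) ≫ (cobIso N (n + 1)).hom =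
      (cobIso N n).hom ≫ (mixedLaw k H).cobD N n
  | 0 => (mixedLaw k H).η_nat (𝟙 N)
  | n + 1 => (mixedLaw k H).cobD_comparison (cobD_cobIso N n)

theorem insertBar_barIso {M Y : HopfBimod k H} (a : ℕ)
    (x : ∀ a, iter (mixedLaw k H).B M (a + 1) ⟶ Y) : ∀ b,
    (Cochain.insertBar M a b : barObj M (a + b + 1) ⟶ barObj (barObj M (a + 1)) (b + 1)) ≫
      (Cochain.barMap ((barIso M (a + 1)).hom ≫ x a) (b + 1) :
        barObj (barObj M (a + 1)) (b + 1) ⟶ barObj Y (b + 1)) ≫ (barIso Y (b + 1)).hom =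
      (barIso M (a + b + 1)).hom ≫ (mixedLaw k H).spread x (a + b) b
  | 0 => ((mixedLaw k H).spread_comparison (barIso M a).hom (x a)).trans
      (congrArg ((barIso M (a + 1)).hom ≫ ·) ((mixedLaw k H).spread_right_zero x a).symm)
  | b + 1 => map_comp_comp_congr (mixedLaw k H).B (insertBar_barIso a x b)

theorem dropCob_cobIso_zero {X N : HopfBimod k H} (r : ℕ) (y : ∀ r, X ⟶ cobObj N (r + 1)) :
    (Cochain.cobMap (y r) 1 : cobObj X 1 ⟶ cobObj (cobObj N (r + 1)) 1) ≫
      (Cochain.dropCob N r 0 : cobObj (cobObj N (r + 1)) 1 ⟶ cobObj N (r + 1)) ≫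
        (cobIso N (r + 1)).hom =
      (cobIso X 1).hom ≫
        (mixedLaw k H).collect (fun r => y r ≫ (cobIso N (r + 1)).hom) r 0 := by
  rw [MixedLaw.collect_right_zero]
  exact (mixedLaw k H).collect_comparison (y r) (cobIso N r).hom

theorem dropCob_cobIso {X N : HopfBimod k H} (r : ℕ) (y : ∀ r, X ⟶ cobObj N (r + 1)) : ∀ s,
    (Cochain.cobMap (y r) (s + 1) : cobObj X (s + 1) ⟶ cobObj (cobObj N (r + 1)) (s + 1)) ≫
      (Cochain.dropCob N r s : cobObj (cobObj N (r + 1)) (s + 1) ⟶ cobObj N (r + s + 1)) ≫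
        (cobIso N (r + s + 1)).hom =
      (cobIso X (s + 1)).hom ≫
        (mixedLaw k H).collect (fun r => y r ≫ (cobIso N (r + 1)).hom) (r + s) s
  | 0 => dropCob_cobIso_zero r y
  | s + 1 => map_comp_comp_congr (mixedLaw k H).T (dropCob_cobIso r y s)

theorem interchangeOne_cobIso (X : HopfBimod k H) : ∀ s,
    (Cochain.interchangeOne X s :
      (mixedLaw k H).B.obj (cobObj X s) ⟶ cobObj ((mixedLaw k H).B.obj X) s) ≫
        (cobIso ((mixedLaw k H).B.obj X) s).hom =
      (mixedLaw k H).B.map (cobIso X s).hom ≫ (mixedLaw k H).exchOne X s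
  | 0 => congrArg (· ≫ 𝟙 _) ((mixedLaw k H).B.map_id X).symm
  | s + 1 => (mixedLaw k H).exchOne_comparison (interchangeOne_cobIso X s)

theorem iterMap_id {C : Type*} [Category C] (F : C ⥤ C) (X : C) (n : ℕ) :
    iterMap F (𝟙 X) n = 𝟙 _ := by
  induction n with
  | zero => rfl
  | succ n ih => rw [iterMap, ih, F.map_id]

theorem interchangeBar_cobIso (X : HopfBimod k H) (s : ℕ) : ∀ n,
    (Cochain.interchangeBar X s n : barObj (cobObj X s) n ⟶ cobObj (barObj X n) s) ≫
      (cobIso (barObj X n) s).hom ≫ iterMap (mixedLaw k H).T (barIso X n).hom s =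
      (Cochain.barMap (cobIso X s).hom n :
        barObj (cobObj X s) n ⟶ barObj (iter (mixedLaw k H).T X s) n) ≫
        (barIso (iter (mixedLaw k H).T X s) n).hom ≫ (mixedLaw k H).exch X s n
  | 0 => by
    refine (congrArg (fun z => 𝟙 _ ≫ (cobIso X s).hom ≫ z)
      (iterMap_id (mixedLaw k H).T X s)).trans ?_
    exact (Category.id_comp _).trans (congrArg (_ ≫ ·) (Category.id_comp _).symm)
  | n + 1 => (mixedLaw k H).exch_comparison (interchangeBar_cobIso X s n)
      (interchangeOne_cobIso (barObj X n) s) ((mixedLaw k H).exchOne_nat (barIso X n).hom s)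

end HopfBimod
end

noncomputable section
/-! ### Cochains and their cup product in terms of iterates -/

section Formal
open CategoryTheory
variable {C : Type*} [Category C] [Preadditive C]

namespace MixedLaw

variable (L : MixedLaw C)

theorem spread_eq_zero_of {M Y : C} {x : ∀ a, iter L.B M (a + 1) ⟶ Y} {a : ℕ} (h : x a = 0) :
    ∀ b, L.spread x (a + b) b = 0
  | 0 => by rw [spread_right_zero, add_zero, h, Functor.map_zero, Limits.comp_zero]
  | b + 1 => (congrArg L.B.map (spread_eq_zero_of h b)).trans (Functor.map_zero _ _ _)

theorem collect_eq_zero_of {X N : C} {y : ∀ r, X ⟶ iter L.T N (r + 1)} {r : ℕ} (h : y r = 0) :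
    ∀ s, L.collect y (r + s) s = 0
  | 0 => by rw [collect_right_zero, add_zero, h, Functor.map_zero, Limits.zero_comp]
  | s + 1 => (congrArg L.T.map (collect_eq_zero_of h s)).trans (Functor.map_zero _ _ _)

end MixedLaw

end Formal

namespace HopfBimod
open CategoryTheory

variable {k : Type u} {H : Type v} [Field k] [Ring H] [HopfAlgebra k H]

variable {M N L : HopfBimod k H}

variable (M N) in
/-- The identification of the morphisms from a bar object to a cobar object with the morphisms
between the iterates of the bar comonad and of the cobar monad. -/
def formalEquiv (a s : ℕ) : Hom (barObj M a) (cobObj N s) ≃+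
    (iter (mixedLaw k H).B M a ⟶ iter (mixedLaw k H).T N s) where
  toFun f := (barIso M a).inv ≫ (show barObj M a ⟶ cobObj N s from f) ≫ (cobIso N s).hom
  invFun f := ((barIso M a).hom ≫ f ≫ (cobIso N s).inv : barObj M a ⟶ cobObj N s)
  left_inv f := by simp
  right_inv f := by simp
  map_add' f g := (congrArg _ (Preadditive.add_comp (C := HopfBimod k H) _ _ _ _ _ _)).trans
    (Preadditive.comp_add _ _ _ _ _ _)

theorem formalEquiv_neg_one_pow_smul (n a s : ℕ) (f : Hom (barObj M a) (cobObj N s)) :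
    formalEquiv M N a s ((-1 : k) ^ n • f) = (-1 : ℤ) ^ n • formalEquiv M N a s f := by
  exact (congrArg _ (neg_one_pow_smul_eq (A := Hom _ _) n f)).trans (map_zsmul _ _ _)

theorem formalEquiv_comp_cobD (a s : ℕ) (f : Hom (barObj M a) (cobObj N s)) :
    formalEquiv M N a (s + 1) ((HopfBimod.cobD N s).comp f) =
      formalEquiv M N a s f ≫ (mixedLaw k H).cobD N s := by
  change (barIso M a).inv ≫ ((show barObj M a ⟶ cobObj N s from f) ≫
    (show cobObj N s ⟶ cobObj N (s + 1) from HopfBimod.cobD N s)) ≫ (cobIso N (s + 1)).hom =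
    ((barIso M a).inv ≫ (show barObj M a ⟶ cobObj N s from f) ≫ (cobIso N s).hom) ≫ _
  rw [Category.assoc, cobD_cobIso, Category.assoc, Category.assoc]

theorem formalEquiv_comp_barD (a s : ℕ) (f : Hom (barObj M a) (cobObj N s)) :
    formalEquiv M N (a + 1) s (f.comp (HopfBimod.barD M a)) =
      (-1 : ℤ) ^ a • ((mixedLaw k H).barD M a ≫ formalEquiv M N a s f) := by
  have e := barD_barIso M a
  rw [← Iso.eq_comp_inv] at e
  change (barIso M (a + 1)).inv ≫ ((show barObj M (a + 1) ⟶ barObj M a from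
    HopfBimod.barD M a) ≫ (show barObj M a ⟶ cobObj N s from f)) ≫ (cobIso N s).hom = _
  rw [e]
  change _ = (-1 : ℤ) ^ a • ((mixedLaw k H).barD M a ≫
    (barIso M a).inv ≫ (show barObj M a ⟶ cobObj N s from f) ≫ (cobIso N s).hom)
  simp only [Category.assoc, Preadditive.zsmul_comp, Preadditive.comp_zsmul,
    Iso.inv_hom_id_assoc]

/-- The family of morphisms between the iterates of the bar comonad and of the cobar monad that
corresponds to a cochain. -/
def formalCochain (f : Cochain M N) (a s : ℕ) :
    iter (mixedLaw k H).B M (a + 1) ⟶ iter (mixedLaw k H).T N (s + 1) :=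
  formalEquiv M N (a + 1) (s + 1) (f a s)

theorem formalCochain_injective : Function.Injective (formalCochain : Cochain M N → _) :=
  fun _ _ h => funext fun a => funext fun s =>
    (formalEquiv M N (a + 1) (s + 1)).injective (congrFun (congrFun h a) s)

theorem formalCochain_apply_eq_zero {f : Cochain M N} {a s : ℕ} :
    formalCochain f a s = 0 ↔ f a s = 0 :=
  (formalEquiv M N (a + 1) (s + 1)).map_eq_zero_iff

theorem formalCochain_D (f : Cochain M N) (a s : ℕ) :
    formalCochain (Cochain.D M N f) a s = (-1 : ℤ) ^ a •
      (MixedLaw.post (fun s => (mixedLaw k H).cobD N (s + 1)) (formalCochain f) a s +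
        MixedLaw.pre (fun a => (mixedLaw k H).barD M (a + 1)) (formalCochain f) a s) := by
  have e₁ : formalEquiv M N (a + 1) (s + 1) (Cochain.dCob f a s) =
      MixedLaw.post (fun s => (mixedLaw k H).cobD N (s + 1)) (formalCochain f) a s := by
    rcases s with _ | s
    · exact map_zero _
    · exact formalEquiv_comp_cobD _ _ _
  have e₂ : formalEquiv M N (a + 1) (s + 1) (Cochain.dBar f a s) = (-1 : ℤ) ^ a •
      MixedLaw.pre (fun a => (mixedLaw k H).barD M (a + 1)) (formalCochain f) a s := by
    rcases a with _ | a
    · exact (map_zero _).trans (smul_zero _).symm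
    · exact formalEquiv_comp_barD _ _ _
  refine (map_add (formalEquiv M N (a + 1) (s + 1)) _ _).trans ?_
  rw [e₂, formalEquiv_neg_one_pow_smul, e₁, smul_add, add_comm (G := _ ⟶ _)]

theorem D_eq_zero_iff (f : Cochain M N) : Cochain.D M N f = 0 ↔
    MixedLaw.post (fun s => (mixedLaw k H).cobD N (s + 1)) (formalCochain f) +
      MixedLaw.pre (fun a => (mixedLaw k H).barD M (a + 1)) (formalCochain f) = 0 := by
  constructor
  · intro h
    funext a s
    have e := congrArg (fun z => (-1 : ℤ) ^ a • z) (formalCochain_D f a s)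
    simp only [MixedLaw.neg_one_pow_smul_smul] at e
    rw [h, formalCochain_apply_eq_zero.2 rfl, smul_zero] at e
    exact e.symm
  · intro h
    funext a s
    refine formalCochain_apply_eq_zero.1 ?_
    rw [formalCochain_D]
    refine (congrArg _ (congrFun (congrFun h a) s)).trans (smul_zero _)

/-- A cochain which corresponds to a coboundary for the signs of the bar comonad is a
coboundary. -/
theorem exists_D_eq {f : Cochain M N}
    {h : ∀ a s, iter (mixedLaw k H).B M (a + 1) ⟶ iter (mixedLaw k H).T N (s + 1)}
    (hf : ∀ a s, formalCochain f a s =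
      MixedLaw.post (fun s => (mixedLaw k H).cobD N (s + 1)) h a s -
        MixedLaw.pre (fun a => (mixedLaw k H).barD M (a + 1)) h a s) :
    ∃ c, f = Cochain.D M N c := by
  let c : Cochain M N := fun a s =>
    (formalEquiv M N (a + 1) (s + 1)).symm ((-1 : ℤ) ^ a • h a s)
  have hc : formalCochain c = fun a s => (-1 : ℤ) ^ a • h a s :=
    funext fun a => funext fun s => (formalEquiv M N (a + 1) (s + 1)).apply_symm_apply _
  refine ⟨c, formalCochain_injective <| funext fun a => funext fun s => ?_⟩
  rw [formalCochain_D, hc, hf]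
  rcases a with _ | a <;> rcases s with _ | s <;>
    simp [MixedLaw.post, MixedLaw.pre, pow_succ, sub_eq_add_neg, MixedLaw.neg_one_pow_smul_smul]

theorem formalCochain_D_eq (c : Cochain M N) :
    formalCochain (Cochain.D M N c) =
      MixedLaw.post (fun s => (mixedLaw k H).cobD N (s + 1))
        (fun a s => (-1 : ℤ) ^ a • formalCochain c a s) -
      MixedLaw.pre (fun a => (mixedLaw k H).barD M (a + 1))
        (fun a s => (-1 : ℤ) ^ a • formalCochain c a s) := by
  funext a s
  rw [formalCochain_D]
  rcases a with _ | a <;> rcases s with _ | s <;>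
    simp [MixedLaw.post, MixedLaw.pre, pow_succ, sub_eq_add_neg]

/-- The cup product of homogeneous components in terms of the bar comonad and the cobar monad. -/
theorem formalEquiv_cupHom (f : Cochain M L) (g : Cochain L N) (a b s r : ℕ) :
    formalEquiv M N (a + b + 1) (r + s + 1) (Cochain.cupHom (f a s) (g b r)) =
      (mixedLaw k H).spread (fun a => formalCochain f a s) (a + b) b ≫
        (mixedLaw k H).exch L (s + 1) (b + 1) ≫
          (mixedLaw k H).collect (formalCochain g b) (r + s) s := by
  let i : barObj M (a + b + 1) ⟶ barObj (barObj M (a + 1)) (b + 1) := Cochain.insertBar M a b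
  let c : barObj (cobObj L (s + 1)) (b + 1) ⟶ cobObj (barObj L (b + 1)) (s + 1) :=
    Cochain.interchangeBar L (s + 1) (b + 1)
  let t : cobObj (cobObj N (r + 1)) (s + 1) ⟶ cobObj N (r + s + 1) := Cochain.dropCob N r s
  let fm : ∀ {X Y : HopfBimod k H} (_ : X ⟶ Y), barObj X (b + 1) ⟶ barObj Y (b + 1) :=
    fun f => Cochain.barMap f (b + 1)
  let gm : ∀ {X Y : HopfBimod k H} (_ : X ⟶ Y), cobObj X (s + 1) ⟶ cobObj Y (s + 1) :=
    fun f => Cochain.cobMap f (s + 1)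
  let F : barObj M (a + 1) ⟶ cobObj L (s + 1) := f a s
  let G : ∀ r, barObj L (b + 1) ⟶ cobObj N (r + 1) := fun r => g b r
  have h₁ := insertBar_barIso a (fun a => formalCochain f a s) b
  have h₂ := interchangeBar_cobIso L (s + 1) (b + 1)
  have h₃ := dropCob_cobIso r G s
  have h₄ : (fun r => G r ≫ (cobIso N (r + 1)).hom) =
      fun r => (barIso L (b + 1)).hom ≫ formalCochain g b r :=
    funext fun r => (Iso.hom_inv_id_assoc _ _).symm
  have h₅ : (barIso M (a + 1)).hom ≫ formalCochain f a s = F ≫ (cobIso L (s + 1)).hom :=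
    Iso.hom_inv_id_assoc _ _
  rw [h₄, MixedLaw.comp_collect] at h₃
  rw [h₅] at h₁
  change i ≫ fm (F ≫ (cobIso L (s + 1)).hom) ≫ _ = _ at h₁
  have h₆ : fm (F ≫ (cobIso L (s + 1)).hom) = fm F ≫ fm (cobIso L (s + 1)).hom :=
    barMap_comp F (cobIso L (s + 1)).hom (b + 1)
  rw [h₆] at h₁
  change c ≫ _ = fm (cobIso L (s + 1)).hom ≫ _ at h₂
  change gm (G r) ≫ t ≫ _ = _ at h₃
  change (barIso M (a + b + 1)).inv ≫ ((((i ≫ fm F) ≫ c) ≫ gm (G r)) ≫ t) ≫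
    (cobIso N (r + s + 1)).hom = _
  rw [Iso.inv_comp_eq, ← Category.assoc (barIso M (a + b + 1)).hom, ← h₁]
  simp only [Category.assoc]
  rw [h₃]
  have h₇ := congrArg (· ≫ (mixedLaw k H).collect (formalCochain g b) (r + s) s) h₂
  simp only [Category.assoc] at h₇
  rw [h₇]

theorem formalEquiv_castHom {a a' s s' : ℕ} (ha : a = a') (hs : s = s')
    (f : Hom (barObj M (a + 1)) (cobObj N (s + 1)))
    {x : ∀ a s, iter (mixedLaw k H).B M (a + 1) ⟶ iter (mixedLaw k H).T N (s + 1)}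
    (h : formalEquiv M N (a + 1) (s + 1) f = x a s) :
    formalEquiv M N (a' + 1) (s' + 1) (Cochain.castHom ha hs f) = x a' s' := by
  subst ha hs
  exact h

/-- The cup product of cochains in terms of the bar comonad and the cobar monad. -/
theorem formalCochain_cup (f : Cochain M L) (g : Cochain L N) {S : ℕ}
    (hS : ∀ a s, S ≤ s → f a s = 0) :
    formalCochain (Cochain.cup f g) =
      (mixedLaw k H).pair S ((mixedLaw k H).cupFam (formalCochain g)) (formalCochain f) := by
  funext n l
  have e : formalCochain (Cochain.cup f g) n l =
      ∑ i ∈ Finset.HasAntidiagonal.antidiagonal n, ∑ j ∈ Finset.HasAntidiagonal.antidiagonal l,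
        (mixedLaw k H).spread (fun a => formalCochain f a j.1) n i.2 ≫
          (mixedLaw k H).cupFam (formalCochain g) i.2 j.1 l := by
    refine Eq.trans ?_ (Finset.sum_coe_sort _ _)
    refine (map_sum (formalEquiv M N (n + 1) (l + 1)) _ _).trans
      (Finset.sum_congr rfl fun i _ => ?_)
    refine Eq.trans ?_ (Finset.sum_coe_sort _ _)
    refine (map_sum (formalEquiv M N (n + 1) (l + 1)) _ _).trans
      (Finset.sum_congr rfl fun j _ => ?_)
    rw [formalEquiv_neg_one_pow_smul, MixedLaw.cupFam, Preadditive.comp_zsmul]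
    refine congrArg _ (formalEquiv_castHom (x := fun n l =>
      (mixedLaw k H).spread (fun a => formalCochain f a j.1.1) n i.1.2 ≫
        (mixedLaw k H).exch L (j.1.1 + 1) (i.1.2 + 1) ≫
          (mixedLaw k H).collect (formalCochain g i.1.2) l j.1.1) _ _ _
      (formalEquiv_cupHom f g i.1.1 i.1.2 j.1.1 j.1.2))
  rw [e, MixedLaw.pair, Finset.Nat.sum_antidiagonal_eq_sum_range_succ_mk, ← Finset.sum_range_reflect]
  refine Finset.sum_congr rfl fun b hb => ?_
  rw [Finset.Nat.sum_antidiagonal_eq_sum_range_succ_mk]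
  have : n - (n.succ - 1 - b) = b := by have := Finset.mem_range.1 hb; omega
  rw [this]
  refine sum_range_eq_sum_range (fun s h => ?_) fun s h => ?_
  · rw [MixedLaw.cupFam, (mixedLaw k H).collect_eq_zero _ l s h, Limits.comp_zero, smul_zero,
      Limits.comp_zero]
  · have : (fun a => formalCochain f a s) = fun a => 0 :=
      funext fun a => formalCochain_apply_eq_zero.2 (hS a s h)
    rw [this, MixedLaw.spread_zero, Limits.zero_comp]

theorem formalCochain_eq_zero_of_ofDegree {f : Cochain M N} {n : ℕ}
    (hf : f ∈ Cochain.ofDegree M N n) (a s : ℕ) (h : a + s ≠ n) : formalCochain f a s = 0 :=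
  formalCochain_apply_eq_zero.2 (hf a s h)

namespace Cochain

theorem cup_mem_ofDegree {f : Cochain M L} {g : Cochain L N} {p q : ℕ}
    (hf : f ∈ ofDegree M L p) (hg : g ∈ ofDegree L N q) : cup f g ∈ ofDegree M N (p + q) := by
  intro a s h
  refine Finset.sum_eq_zero fun i _ => Finset.sum_eq_zero fun j _ => ?_
  have hi := Finset.HasAntidiagonal.mem_antidiagonal.1 i.2
  have hj := Finset.HasAntidiagonal.mem_antidiagonal.1 j.2
  have h0 : cupHom (f i.1.1 j.1.1) (g i.1.2 j.1.2) = 0 := by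
    refine (formalEquiv M N _ _).map_eq_zero_iff.1 ?_
    rw [formalEquiv_cupHom f g]
    rcases ne_or_eq (i.1.2 + j.1.2) q with e | e
    · rw [MixedLaw.collect_eq_zero_of _ (formalCochain_apply_eq_zero.2 (hg _ _ e)),
        Limits.comp_zero, Limits.comp_zero]
    · rw [MixedLaw.spread_eq_zero_of _ (formalCochain_apply_eq_zero.2 (hf _ _ (by omega))),
        Limits.zero_comp]
  have h1 : ∀ {a a' s s' : ℕ} (ha : a = a') (hs : s = s'),
      castHom (M := M) (N := N) ha hs 0 = 0 := by
    rintro _ _ _ _ rfl rfl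
    rfl
  rw [h0, h1, smul_zero]

end Cochain

end HopfBimod
end

noncomputable section
namespace HopfBimod
open CategoryTheory

variable {k : Type u} {H : Type v} [Field k] [Ring H] [HopfAlgebra k H]
  {M N L X Y : HopfBimod k H}

/-! ### The product on cohomology -/

namespace Cochain

theorem barMap_add (f g : Hom X Y) : ∀ n, barMap (f + g) n = barMap f n + barMap g n
  | 0 => rfl
  | n + 1 => (congrArg (codiagMap · (Hom.id _)) (barMap_add f g n)).trans <|
      Subtype.ext (TensorProduct.map_add_left _ _ _)

theorem barMap_smul (c : k) (f : Hom X Y) : ∀ n, barMap (c • f) n = c • barMap f n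
  | 0 => rfl
  | n + 1 => (congrArg (codiagMap · (Hom.id _)) (barMap_smul c f n)).trans <|
      Subtype.ext (TensorProduct.map_smul_left _ _ _)

theorem cobMap_add (f g : Hom X Y) : ∀ n, cobMap (f + g) n = cobMap f n + cobMap g n
  | 0 => rfl
  | n + 1 => (congrArg (diagMap (Hom.id _)) (cobMap_add f g n)).trans <|
      Subtype.ext (TensorProduct.map_add_right _ _ _)

theorem cobMap_smul (c : k) (f : Hom X Y) : ∀ n, cobMap (c • f) n = c • cobMap f n
  | 0 => rfl
  | n + 1 => (congrArg (diagMap (Hom.id _)) (cobMap_smul c f n)).trans <|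
      Subtype.ext (TensorProduct.map_smul_right _ _ _)

section

variable {a b s r a' s' : ℕ} (f f' : Hom (barObj M (a + 1)) (cobObj L (s + 1)))
  (g g' : Hom (barObj L (b + 1)) (cobObj N (r + 1))) (c : k)

theorem cupHom_add_left : cupHom (f + f') g = cupHom f g + cupHom f' g := by
  rw [cupHom, barMap_add]
  refine Hom.ext_apply fun x => ?_
  simp [Hom.comp, cupHom]

theorem cupHom_smul_left : cupHom (c • f) g = c • cupHom f g := by
  rw [cupHom, barMap_smul]
  refine Hom.ext_apply fun x => ?_
  simp [Hom.comp, cupHom]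

theorem cupHom_add_right : cupHom f (g + g') = cupHom f g + cupHom f g' := by
  rw [cupHom, cobMap_add]
  refine Hom.ext_apply fun x => ?_
  simp [Hom.comp, cupHom]

theorem cupHom_smul_right : cupHom f (c • g) = c • cupHom f g := by
  rw [cupHom, cobMap_smul]
  refine Hom.ext_apply fun x => ?_
  simp [Hom.comp, cupHom]

variable (ha : a = a') (hs : s = s')

theorem castHom_add : castHom ha hs (f + f') = castHom ha hs f + castHom ha hs f' := by
  subst ha hs
  rfl

theorem castHom_smul : castHom ha hs (c • f) = c • castHom ha hs f := by
  subst ha hs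
  rfl

end

theorem cup_add_left (f f' : Cochain M L) (g : Cochain L N) :
    cup (f + f') g = cup f g + cup f' g := by
  funext a s
  simp only [cup, Pi.add_apply, cupHom_add_left, castHom_add, smul_add, Finset.sum_add_distrib]

theorem cup_add_right (f : Cochain M L) (g g' : Cochain L N) :
    cup f (g + g') = cup f g + cup f g' := by
  funext a s
  simp only [cup, Pi.add_apply, cupHom_add_right, castHom_add, smul_add, Finset.sum_add_distrib]

theorem cup_smul_left (c : k) (f : Cochain M L) (g : Cochain L N) :
    cup (c • f) g = c • cup f g := by
  funext a s
  simp only [cup, Pi.smul_apply, cupHom_smul_left, castHom_smul, Finset.smul_sum, smul_comm c]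

theorem cup_smul_right (c : k) (f : Cochain M L) (g : Cochain L N) :
    cup f (c • g) = c • cup f g := by
  funext a s
  simp only [cup, Pi.smul_apply, cupHom_smul_right, castHom_smul, Finset.smul_sum, smul_comm c]

theorem cup_mem_cocycles {p q l : ℕ} (h : p + q = l) {f : Cochain M L} {g : Cochain L N}
    (hf : f ∈ cocycles M L p) (hg : g ∈ cocycles L N q) : cup f g ∈ cocycles M N l := by
  subst h
  refine ⟨cup_mem_ofDegree hf.1 hg.1, LinearMap.mem_ker.2 ((D_eq_zero_iff _).2 ?_)⟩
  have hS : ∀ a s, p + 2 ≤ s + 1 → formalCochain f a s = 0 := fun a s h =>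
    formalCochain_eq_zero_of_ofDegree hf.1 a s (by omega)
  rw [formalCochain_cup f g (S := p + 2) fun a s h => hf.1 a s (by omega)]
  exact (MixedLaw.isPairing_cupFam ((D_eq_zero_iff g).1 (LinearMap.mem_ker.1 hg.2))).pair_cocycle hS
    ((D_eq_zero_iff f).1 (LinearMap.mem_ker.1 hf.2))

/-- A homogeneous cochain in the image of the differential is the differential of a homogeneous
cochain. -/
theorem mem_coboundaries {n : ℕ} {f c : Cochain M N} (hf : f ∈ ofDegree M N n)
    (h : f = D M N c) : f ∈ coboundaries M N n := by
  rcases n with _ | n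
  · refine (Submodule.mem_bot k).2 (funext fun a => funext fun s => ?_)
    rcases Nat.eq_zero_or_pos (a + s) with e | e
    · obtain ⟨rfl, rfl⟩ : a = 0 ∧ s = 0 := by omega
      rw [h]
      exact (zero_add _).trans (smul_zero _)
    · exact hf a s (by omega)
  · let c' : Cochain M N := fun a s => if a + s = n then c a s else 0
    refine ⟨c', fun a s e => if_neg e, funext fun a => funext fun s => ?_⟩
    by_cases e : a + s = n + 1
    · rw [h]
      have e₁ : dBar c' a s = dBar c a s := by
        rcases a with _ | a
        · rfl
        · simp only [dBar, c', if_pos (show a + s = n by omega)]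
      have e₂ : dCob c' a s = dCob c a s := by
        rcases s with _ | s
        · rfl
        · simp only [dCob, c', if_pos (show a + s = n by omega)]
      simp only [D, LinearMap.coe_mk, AddHom.coe_mk, e₁, e₂]
    · rw [hf a s e]
      have e₁ : dBar c' a s = 0 := by
        rcases a with _ | a
        · rfl
        · simp only [dBar, c', if_neg (show a + s ≠ n by omega)]
          rfl
      have e₂ : dCob c' a s = 0 := by
        rcases s with _ | s
        · rfl
        · simp only [dCob, c', if_neg (show a + s ≠ n by omega)]
          exact Hom.ext_apply fun x => map_zero (HopfBimod.cobD N (s + 1)).1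
      simp only [D, LinearMap.coe_mk, AddHom.coe_mk, e₁, e₂, smul_zero, add_zero]

theorem cup_mem_coboundaries_left {p q : ℕ} {f : Cochain M L} {g : Cochain L N}
    (hf : f ∈ cocycles M L p) (hf' : f ∈ coboundaries M L p) (hg : g ∈ cocycles L N q) :
    cup f g ∈ coboundaries M N (p + q) := by
  rcases p with _ | p
  · obtain rfl := (Submodule.mem_bot k).1 hf'
    have : cup (0 : Cochain M L) g = 0 := by
      have := cup_smul_left (0 : k) (0 : Cochain M L) g
      rwa [zero_smul, zero_smul] at this
    rw [this]
    exact Submodule.zero_mem _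
  · obtain ⟨c, hc, rfl⟩ := hf'
    have hS : ∀ a s, p + 2 ≤ s + 1 → (-1 : ℤ) ^ a • formalCochain c a s = 0 := fun a s h => by
      rw [formalCochain_eq_zero_of_ofDegree hc a s (by omega), smul_zero]
    have e := (MixedLaw.isPairing_cupFam
      ((D_eq_zero_iff g).1 (LinearMap.mem_ker.1 hg.2))).pair_coboundary hS
    rw [← formalCochain_D_eq, ← formalCochain_cup _ g (S := p + 2) fun a s h =>
      hf.1 a s (by omega)] at e
    obtain ⟨c', hc'⟩ := exists_D_eq fun a s => congrFun (congrFun e a) s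
    exact mem_coboundaries (cup_mem_ofDegree hf.1 hg.1) hc'

/-- The cup product of cocycles, as a bilinear map. -/
def cupCocycles (p q : ℕ) :
    cocycles M L p →ₗ[k] cocycles L N q →ₗ[k] cocycles M N (p + q) :=
  LinearMap.mk₂ k (fun f g => ⟨cup f.1 g.1, cup_mem_cocycles rfl f.2 g.2⟩)
    (fun _ _ _ => Subtype.ext (cup_add_left _ _ _)) (fun _ _ _ => Subtype.ext (cup_smul_left _ _ _))
    (fun _ _ _ => Subtype.ext (cup_add_right _ _ _))
    (fun _ _ _ => Subtype.ext (cup_smul_right _ _ _))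

/-- The cup product of cocycles on `H` is graded-commutative up to a coboundary. -/
theorem cup_sub_cup_mem_coboundaries {p q : ℕ}
    {f g : Cochain (regular k H) (regular k H)} (hf : f ∈ cocycles _ _ p)
    (hg : g ∈ cocycles _ _ q) :
    cup f g - (-1 : k) ^ (p * q) • cup g f ∈ coboundaries _ _ (p + q) := by
  have hf' := (D_eq_zero_iff f).1 (LinearMap.mem_ker.1 hf.2)
  have hg' := (D_eq_zero_iff g).1 (LinearMap.mem_ker.1 hg.2)
  obtain ⟨h, hh⟩ := MixedLaw.exists_cup_comm (natCocycle (formalCochain g)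
    (fun a s => formalCochain_eq_zero_of_ofDegree hg.1 a s) hg')
    (fun a s => formalCochain_eq_zero_of_ofDegree hf.1 a s) hf' (S := p + q + 2) (by omega)
    (by omega)
  rw [natCocycle_regular, ← formalCochain_cup f g fun a s h => hf.1 a s (by omega),
    ← formalCochain_cup g f fun a s h => hg.1 a s (by omega)] at hh
  have e : ∀ a s, formalCochain (cup f g - (-1 : k) ^ (p * q) • cup g f) a s =
      formalCochain (cup f g) a s - (-1 : ℤ) ^ (p * q) • formalCochain (cup g f) a s := fun a s =>
    (map_sub (formalEquiv (regular k H) (regular k H) (a + 1) (s + 1)) _ _).trans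
      (congrArg _ (formalEquiv_neg_one_pow_smul _ _ _ _))
  obtain ⟨c', hc'⟩ := exists_D_eq fun a s => (e a s).trans (hh a s)
  refine mem_coboundaries (Submodule.sub_mem _ (cup_mem_ofDegree hf.1 hg.1)
    (Submodule.smul_mem _ _ ?_)) hc'
  rw [add_comm]
  exact cup_mem_ofDegree hg.1 hf.1

theorem cup_mem_coboundaries_right {p q : ℕ} {f g : Cochain (regular k H) (regular k H)}
    (hf : f ∈ cocycles _ _ p) (hg : g ∈ cocycles _ _ q) (hg' : g ∈ coboundaries _ _ q) :
    cup f g ∈ coboundaries _ _ (p + q) := by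
  have := cup_mem_coboundaries_left hg hg' hf
  rw [add_comm] at this
  simpa using Submodule.add_mem _ (cup_sub_cup_mem_coboundaries hf hg)
    (Submodule.smul_mem _ ((-1 : k) ^ (p * q)) this)

end Cochain

namespace Hb

set_option maxSynthPendingDepth 6 in
theorem mk_surjective (n : ℕ) : Function.Surjective (mk M N n) :=
  Submodule.mkQ_surjective _

set_option maxSynthPendingDepth 6 in
theorem mk_eq_mk {n : ℕ} {f g : Cochain.cocycles M N n}
    (h : f.1 - g.1 ∈ Cochain.coboundaries M N n) : mk M N n f = mk M N n g :=
  (Submodule.Quotient.eq _).2 h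

set_option maxSynthPendingDepth 6 in
theorem exists_lift {n : ℕ} {A : Type*} [AddCommGroup A] [Module k A]
    (φ : Cochain.cocycles M N n →ₗ[k] A)
    (h : ∀ f : Cochain.cocycles M N n, f.1 ∈ Cochain.coboundaries M N n → φ f = 0) :
    ∃ ψ : Hb M N n →ₗ[k] A, ∀ f, ψ (mk M N n f) = φ f :=
  ⟨Submodule.liftQ ((Cochain.coboundaries M N n).submoduleOf (Cochain.cocycles M N n)) φ h,
    fun _ => rfl⟩

/-- The cup product of cochains induces a bilinear product on the cohomology of `H`. -/
theorem exists_cup {p q l : ℕ} (h : p + q = l) :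
    ∃ cup : Hb (regular k H) (regular k H) p →ₗ[k] Hb (regular k H) (regular k H) q →ₗ[k]
        Hb (regular k H) (regular k H) l, ∀ f g,
      cup (mk _ _ p f) (mk _ _ q g) =
        mk _ _ l ⟨Cochain.cup f.1 g.1, Cochain.cup_mem_cocycles h f.2 g.2⟩ := by
  subst h
  let B := (Cochain.cupCocycles p q (M := regular k H) (L := regular k H)
    (N := regular k H)).compr₂ (mk _ _ (p + q))
  have hB : ∀ f g, Cochain.cup f.1 g.1 ∈ Cochain.coboundaries (regular k H) (regular k H) (p + q) →
      B f g = 0 := fun f g h =>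
    (mk_eq_mk (g := 0) ((sub_zero (Cochain.cup f.1 g.1)).symm ▸ h)).trans (map_zero _)
  obtain ⟨B₁, h₁⟩ := exists_lift B fun f hf => LinearMap.ext fun g =>
    hB f g (Cochain.cup_mem_coboundaries_left f.2 hf g.2)
  obtain ⟨B₂, h₂⟩ := exists_lift B₁.flip fun g hg => LinearMap.ext fun x => by
    obtain ⟨f, rfl⟩ := mk_surjective p x
    rw [LinearMap.flip_apply, h₁]
    exact hB f g (Cochain.cup_mem_coboundaries_right f.2 g.2 hg)
  refine ⟨B₂.flip, fun f g => ?_⟩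
  rw [LinearMap.flip_apply, h₂, LinearMap.flip_apply, h₁]
  rfl

variable (k H) in
/-- The cup product of cochains induces a graded-commutative product on the cohomology of `H`. -/
theorem exists_comm_cup :
    ∃ cup : ∀ p q l : ℕ, p + q = l → Hb (regular k H) (regular k H) p →ₗ[k]
        Hb (regular k H) (regular k H) q →ₗ[k] Hb (regular k H) (regular k H) l,
      (∀ (p q l : ℕ) (h : p + q = l)
        (f : Cochain.cocycles (regular k H) (regular k H) p)
        (g : Cochain.cocycles (regular k H) (regular k H) q),
        ∃ hfg : Cochain.cup f.1 g.1 ∈ Cochain.cocycles (regular k H) (regular k H) l,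
          cup p q l h (mk _ _ p f) (mk _ _ q g) = mk _ _ l ⟨_, hfg⟩) ∧
      ∀ (p q l : ℕ) (h : p + q = l) (h' : q + p = l) (x : Hb (regular k H) (regular k H) p)
        (y : Hb (regular k H) (regular k H) q),
        cup q p l h' y x = (-1 : k) ^ (p * q) • cup p q l h x y := by
  choose cup hcup using fun (p q l : ℕ) (h : p + q = l) => exists_cup (k := k) (H := H) h
  refine ⟨cup, fun p q l h f g => ⟨_, hcup p q l h f g⟩, fun p q l h h' x y => ?_⟩
  obtain ⟨f, rfl⟩ := mk_surjective p x
  obtain ⟨g, rfl⟩ := mk_surjective q y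
  rw [hcup, hcup, ← map_smul]
  refine mk_eq_mk ?_
  subst h'
  rw [mul_comm]
  exact Cochain.cup_sub_cup_mem_coboundaries g.2 f.2

end Hb


/-! ### Right linear contractions of exact sequences -/

section Average

variable {M N X Y Z : HopfBimod k H}

variable (X) in
/-- The map `X ⊗ H → X ⊗ H`, `x ⊗ h ↦ x φ(h⁽¹⁾) ⊗ h⁽²⁾`. -/
def galois (φ : H →ₗ[k] H) : X.carrier ⊗[k] H →ₗ[k] X.carrier ⊗[k] H :=
  map (lift X.actR.flip ∘ₗ map LinearMap.id φ) LinearMap.id ∘ₗ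
    (TensorProduct.assoc k X.carrier H H).symm.toLinearMap ∘ₗ map LinearMap.id Coalgebra.comul

theorem galois_tmul (φ : H →ₗ[k] H) (x : X.carrier) (h : H) :
    galois X φ (x ⊗ₜ h) = map (X.actR.flip x ∘ₗ φ) LinearMap.id (Coalgebra.comul h) := by
  simp only [galois, LinearMap.comp_apply, map_tmul, LinearMap.id_apply]
  exact tensor_ext (f := map (lift X.actR.flip ∘ₗ map LinearMap.id φ) LinearMap.id ∘ₗ
    (TensorProduct.assoc k X.carrier H H).symm.toLinearMap ∘ₗ TensorProduct.mk k _ _ x)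
    (g := map (X.actR.flip x ∘ₗ φ) LinearMap.id) (fun a b => by simp) _

theorem galois_galois (φ ψ : H →ₗ[k] H) (t : X.carrier ⊗[k] H) :
    galois X φ (galois X ψ t) =
      galois X (LinearMap.mul' k H ∘ₗ map ψ φ ∘ₗ Coalgebra.comul) t := by
  refine tensor_ext (f := galois X φ ∘ₗ galois X ψ) (fun x h => ?_) t
  rw [LinearMap.comp_apply, galois_tmul, galois_tmul]
  have e := Coalgebra.coassoc_apply (R := k) h
  let Ψ : H ⊗[k] (H ⊗[k] H) →ₗ[k] X.carrier ⊗[k] H :=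
    map (X.actR.flip x ∘ₗ LinearMap.mul' k H ∘ₗ map ψ φ) LinearMap.id ∘ₗ
      (TensorProduct.assoc k H H H).symm.toLinearMap
  have e₁ : ∀ t, galois X φ (map (X.actR.flip x ∘ₗ ψ) LinearMap.id t) =
      Ψ (map LinearMap.id Coalgebra.comul t) :=
    tensor_ext (f := galois X φ ∘ₗ map (X.actR.flip x ∘ₗ ψ) LinearMap.id)
      (g := Ψ ∘ₗ map LinearMap.id Coalgebra.comul) fun a b => by
        simp only [LinearMap.comp_apply, map_tmul, galois_tmul, LinearMap.id_apply, Ψ]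
        exact tensor_ext (f := map (X.actR.flip (X.actR.flip x (ψ a)) ∘ₗ φ) LinearMap.id)
          (g := Ψ ∘ₗ TensorProduct.mk k _ _ a) (fun p q => by simp [Ψ, X.mul_actR]) _
  have e₂ : ∀ t, Ψ (TensorProduct.assoc k H H H (map Coalgebra.comul LinearMap.id t)) =
      map (X.actR.flip x ∘ₗ LinearMap.mul' k H ∘ₗ map ψ φ ∘ₗ Coalgebra.comul) LinearMap.id t :=
    tensor_ext (f := Ψ ∘ₗ (TensorProduct.assoc k H H H).toLinearMap ∘ₗ
      map Coalgebra.comul LinearMap.id) fun a b => by simp [Ψ]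
  rw [e₁, ← e₂]
  exact congrArg Ψ e.symm

theorem galois_counit (t : X.carrier ⊗[k] H) :
    galois X (Algebra.linearMap k H ∘ₗ Coalgebra.counit) t = t := by
  refine tensor_ext (f := galois X _) (g := LinearMap.id) (fun x h => ?_) t
  rw [galois_tmul]
  have e : map Coalgebra.counit LinearMap.id (Coalgebra.comul (R := k) h) = 1 ⊗ₜ[k] h :=
    Coalgebra.rTensor_counit_comul h
  have := congrArg (map (X.actR.flip x ∘ₗ Algebra.linearMap k H) LinearMap.id) e
  rw [← LinearMap.comp_apply, ← map_comp, LinearMap.comp_id] at this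
  refine this.trans ?_
  simp [X.one_actR]

theorem galois_antipode_galois (t : X.carrier ⊗[k] H) :
    galois X (HopfAlgebra.antipode k) (galois X LinearMap.id t) = t := by
  rw [galois_galois]
  exact (congrArg (galois X · t) HopfAlgebra.mul_antipode_lTensor_comul).trans (galois_counit t)

theorem galois_galois_antipode (t : X.carrier ⊗[k] H) :
    galois X LinearMap.id (galois X (HopfAlgebra.antipode k) t) = t := by
  rw [galois_galois]
  exact (congrArg (galois X · t) HopfAlgebra.mul_antipode_rTensor_comul).trans (galois_counit t)

variable (X) in
/-- The map `X → X ⊗ H`, `x ↦ x₍₀₎ S(x₍₁₎) ⊗ x₍₂₎`. -/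
def cleave : X.carrier →ₗ[k] X.carrier ⊗[k] H :=
  galois X (HopfAlgebra.antipode k) ∘ₗ X.coactR

/-- The map `cleave X` is right `H`-linear, because the Galois map intertwines the action on the
second factor of `X ⊗ H` with the diagonal one. -/
theorem cleave_actR (h : H) (x : X.carrier) :
    cleave X (X.actR h x) = map LinearMap.id (LinearMap.mulRight k h) (cleave X x) := by
  have e : ∀ t : X.carrier ⊗[k] H, galois X LinearMap.id
      (map LinearMap.id (LinearMap.mulRight k h) t) =
      map₂ X.actR (LinearMap.mul k H).flip (Coalgebra.comul h) (galois X LinearMap.id t) :=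
    tensor_ext (f := galois X LinearMap.id ∘ₗ map LinearMap.id (LinearMap.mulRight k h))
      (g := map₂ X.actR (LinearMap.mul k H).flip (Coalgebra.comul h) ∘ₗ galois X LinearMap.id)
      fun x a => by
        simp only [LinearMap.comp_apply, map_tmul, galois_tmul, LinearMap.id_apply,
          LinearMap.mulRight_apply, Bialgebra.comul_mul]
        exact bilin_ext (f := (LinearMap.mul k (H ⊗[k] H)).compr₂
            (map (X.actR.flip x ∘ₗ LinearMap.id) LinearMap.id))
          (g := ((map₂ X.actR (LinearMap.mul k H).flip).compl₂
            (map (X.actR.flip x ∘ₗ LinearMap.id) LinearMap.id)).flip)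
          (fun a b c d => by simp [X.mul_actR]) _ _
  rw [cleave, LinearMap.comp_apply, X.coactR_actR, ← galois_galois_antipode (X.coactR x), ← e,
    galois_antipode_galois]
  rfl

theorem cleave_nat (f : Hom X Y) (x : X.carrier) :
    cleave Y (f.1 x) = map f.1 LinearMap.id (cleave X x) := by
  have e : ∀ t : X.carrier ⊗[k] H, galois Y (HopfAlgebra.antipode k) (map f.1 LinearMap.id t) =
      map f.1 LinearMap.id (galois X (HopfAlgebra.antipode k) t) :=
    tensor_ext (f := galois Y (HopfAlgebra.antipode k) ∘ₗ map f.1 LinearMap.id)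
      (g := map f.1 LinearMap.id ∘ₗ galois X (HopfAlgebra.antipode k)) fun x a => by
        simp only [LinearMap.comp_apply, map_tmul, galois_tmul, LinearMap.id_apply]
        exact tensor_ext (f := map (Y.actR.flip (f.1 x) ∘ₗ HopfAlgebra.antipode k) LinearMap.id)
          (g := map f.1 LinearMap.id ∘ₗ
            map (X.actR.flip x ∘ₗ HopfAlgebra.antipode k) LinearMap.id)
          (fun a b => by simp [f.2.2.1]) _
  rw [cleave, LinearMap.comp_apply, f.2.2.2.2, e]
  rfl

/-- The identity `x₍₀₎ S(x₍₁₎) x₍₂₎ = x`. -/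
theorem actR_cleave (x : X.carrier) : lift X.actR.flip (cleave X x) = x := by
  have e : ∀ t : X.carrier ⊗[k] H, TensorProduct.rid k X.carrier
      (map LinearMap.id Coalgebra.counit (galois X LinearMap.id t)) = lift X.actR.flip t :=
    tensor_ext (f := (TensorProduct.rid k X.carrier).toLinearMap ∘ₗ
      map LinearMap.id Coalgebra.counit ∘ₗ galois X LinearMap.id) fun x h => by
        have e₁ := congrArg (X.actR.flip x) ((regular k H).counit_coactR h)
        simp only [LinearMap.comp_apply, galois_tmul, lift.tmul]
        refine Eq.trans ?_ e₁
        exact tensor_ext (f := (TensorProduct.rid k X.carrier).toLinearMap ∘ₗ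
          map LinearMap.id Coalgebra.counit ∘ₗ map (X.actR.flip x ∘ₗ LinearMap.id) LinearMap.id)
          (g := X.actR.flip x ∘ₗ (TensorProduct.rid k H).toLinearMap ∘ₗ
            map LinearMap.id Coalgebra.counit) (fun a b => by simp) _
  rw [← e, cleave, LinearMap.comp_apply, galois_galois_antipode, X.counit_coactR]

/-- The average `x ↦ g(x₍₀₎ S(x₍₁₎)) x₍₂₎` of a linear map. -/
def average (g : X.carrier →ₗ[k] Y.carrier) : X.carrier →ₗ[k] Y.carrier :=
  lift Y.actR.flip ∘ₗ map g LinearMap.id ∘ₗ cleave X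

theorem average_actR (g : X.carrier →ₗ[k] Y.carrier) (h : H) (x : X.carrier) :
    average g (X.actR h x) = Y.actR h (average g x) := by
  simp only [average, LinearMap.comp_apply, cleave_actR]
  exact tensor_ext (f := lift Y.actR.flip ∘ₗ map g LinearMap.id ∘ₗ
      map LinearMap.id (LinearMap.mulRight k h))
    (g := Y.actR h ∘ₗ lift Y.actR.flip ∘ₗ map g LinearMap.id) (fun a b => by simp [Y.mul_actR]) _

theorem average_comp_hom (g : Y.carrier →ₗ[k] Z.carrier) (f : Hom X Y) :
    average (g ∘ₗ f.1) = average g ∘ₗ f.1 := by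
  ext x
  simp only [average, LinearMap.comp_apply, cleave_nat]
  exact tensor_ext (f := lift Z.actR.flip ∘ₗ map (g ∘ₗ f.1) LinearMap.id)
    (g := lift Z.actR.flip ∘ₗ map g LinearMap.id ∘ₗ map f.1 LinearMap.id) (fun a b => by simp) _

theorem hom_comp_average (f : Hom Y Z) (g : X.carrier →ₗ[k] Y.carrier) :
    average (f.1 ∘ₗ g) = f.1 ∘ₗ average g := by
  ext x
  simp only [average, LinearMap.comp_apply]
  exact tensor_ext (f := lift Z.actR.flip ∘ₗ map (f.1 ∘ₗ g) LinearMap.id)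
    (g := f.1 ∘ₗ lift Y.actR.flip ∘ₗ map g LinearMap.id) (fun a b => by simp [f.2.2.1]) _

theorem average_hom (f : Hom X Y) : average f.1 = f.1 := by
  have := average_comp_hom LinearMap.id f
  rw [LinearMap.id_comp] at this
  rw [this]
  ext x
  simp [average, actR_cleave]

/-- A morphism has a right `H`-linear generalized inverse. -/
theorem Hom.exists_generalized_inverse (f : Hom X Y) : ∃ g : Y.carrier →ₗ[k] X.carrier,
    (∀ h y, g (Y.actR h y) = X.actR h (g y)) ∧ ∀ x, f.1 (g (f.1 x)) = f.1 x := by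
  -- a `k`-linear generalized inverse is averaged
  obtain ⟨s, hs⟩ := f.1.rangeRestrict.exists_rightInverse_of_surjective f.1.range_rangeRestrict
  obtain ⟨p, hp⟩ := f.1.range.subtype.exists_leftInverse_of_injective f.1.range.ker_subtype
  let g := s ∘ₗ p
  have hg : f.1 ∘ₗ g ∘ₗ f.1 = f.1 := by
    ext x
    have h₁ : p (f.1 x) = f.1.rangeRestrict x := LinearMap.congr_fun hp (f.1.rangeRestrict x)
    have h₂ := congrArg Subtype.val (LinearMap.congr_fun hs (f.1.rangeRestrict x))
    simpa [g, h₁] using h₂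
  refine ⟨average g, average_actR g, fun x => ?_⟩
  have := hom_comp_average f (g ∘ₗ f.1)
  rw [hg, average_hom, average_comp_hom] at this
  exact (LinearMap.congr_fun this x).symm

/-- An exact sequence of Hopf bimodules has a right `H`-linear contraction. -/
theorem Extension.exists_contraction {n : ℕ} (E : Extension M N n) :
    ∃ s : ∀ i, (E.obj i).carrier →ₗ[k] (E.obj (i + 1)).carrier,
      (∀ i h x, s i ((E.obj i).actR h x) = (E.obj (i + 1)).actR h (s i x)) ∧
      (∀ x, (E.d 0).1 (s 0 x) = x) ∧
      ∀ i x, (E.d (i + 1)).1 (s (i + 1) x) + s i ((E.d i).1 x) = x := by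
  choose g hg hg' using fun i => (E.d i).exists_generalized_inverse
  -- the recursion `s_{i+1} = g_{i+1} (1 - s_i d_i)`
  let s : ∀ i, (E.obj i).carrier →ₗ[k] (E.obj (i + 1)).carrier := fun i =>
    Nat.rec (g 0) (fun i si => g (i + 1) ∘ₗ (LinearMap.id - si ∘ₗ (E.d i).1)) i
  have hs : ∀ i x, s (i + 1) x = g (i + 1) (x - s i ((E.d i).1 x)) := fun _ _ => rfl
  have h₀ : ∀ x, (E.d 0).1 (s 0 x) = x := fun x => by
    obtain ⟨y, rfl⟩ := E.surjective x
    exact hg' 0 y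
  have h₁ : ∀ i x, (E.d (i + 1)).1 (s (i + 1) x) + s i ((E.d i).1 x) = x := by
    intro i
    induction i with
    | zero =>
      intro x
      obtain ⟨y, hy⟩ := (E.exact 0 (x - s 0 ((E.d 0).1 x))).1 (by rw [map_sub, h₀, sub_self])
      rw [hs, ← hy, hg', hy, sub_add_cancel]
    | succ i ih =>
      intro x
      have e := ih ((E.d (i + 1)).1 x)
      rw [(E.exact i).apply_apply_eq_zero, map_zero, add_zero] at e
      obtain ⟨y, hy⟩ := (E.exact (i + 1) (x - s (i + 1) ((E.d (i + 1)).1 x))).1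
        (by rw [map_sub, e, sub_self])
      rw [hs, ← hy, hg', hy, sub_add_cancel]
  refine ⟨s, fun i => ?_, h₀, h₁⟩
  induction i with
  | zero => exact hg 0
  | succ i ih =>
    intro h x
    rw [hs, hs, (E.d i).2.2.1, ih, ← map_sub, hg]

end Average


/-! ### Quotients, direct sums and tensor products over `H` -/

section Span

/-- Two linear maps agree if they agree on the ranges of a jointly spanning family. -/
theorem linearMap_ext_span {ι P Q : Type*} {A : ι → Type*} [AddCommGroup P] [AddCommGroup Q]
    [Module k P] [Module k Q] [∀ i, AddCommGroup (A i)] [∀ i, Module k (A i)]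
    {f : ∀ i, A i →ₗ[k] P} (hf : ⨆ i, LinearMap.range (f i) = ⊤) {g g' : P →ₗ[k] Q}
    (h : ∀ i x, g (f i x) = g' (f i x)) (p : P) : g p = g' p := by
  have : ⨆ i, LinearMap.range (f i) ≤ LinearMap.eqLocus g g' := iSup_le fun i => by
    rintro _ ⟨x, rfl⟩
    exact h i x
  rw [hf] at this
  exact this (Submodule.mem_top : p ∈ ⊤)

/-- Operations on a vector space which are compatible with those of a jointly spanning family of
Hopf bimodules make it a Hopf bimodule. -/
abbrev ofSpan {ι : Type*} (X : ι → HopfBimod k H) (P : Type v) [AddCommGroup P] [Module k P]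
    (f : ∀ i, (X i).carrier →ₗ[k] P) (hf : ⨆ i, LinearMap.range (f i) = ⊤)
    (actL actR : H →ₗ[k] P →ₗ[k] P) (coactL : P →ₗ[k] H ⊗[k] P) (coactR : P →ₗ[k] P ⊗[k] H)
    (h₁ : ∀ i h x, actL h (f i x) = f i ((X i).actL h x))
    (h₂ : ∀ i h x, actR h (f i x) = f i ((X i).actR h x))
    (h₃ : ∀ i x, coactL (f i x) = map LinearMap.id (f i) ((X i).coactL x))
    (h₄ : ∀ i x, coactR (f i x) = map (f i) LinearMap.id ((X i).coactR x)) : HopfBimod k H where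
  carrier := P
  actL := actL
  actR := actR
  coactL := coactL
  coactR := coactR
  one_actL := linearMap_ext_span hf (g' := LinearMap.id) fun i x => by simp [h₁, (X i).one_actL]
  mul_actL a b := linearMap_ext_span hf (g' := actL a ∘ₗ actL b) fun i x => by
    simp [h₁, (X i).mul_actL]
  one_actR := linearMap_ext_span hf (g' := LinearMap.id) fun i x => by simp [h₂, (X i).one_actR]
  mul_actR a b := linearMap_ext_span hf (g' := actR b ∘ₗ actR a) fun i x => by
    simp [h₂, (X i).mul_actR]
  act_comm a b := linearMap_ext_span hf (g := actL a ∘ₗ actR b) (g' := actR b ∘ₗ actL a)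
    fun i x => by simp [h₁, h₂, (X i).act_comm]
  counit_coactL := linearMap_ext_span hf (g := (TensorProduct.lid k P).toLinearMap ∘ₗ
      map Coalgebra.counit LinearMap.id ∘ₗ coactL) (g' := LinearMap.id) fun i x => by
    simp only [LinearMap.comp_apply, h₃, LinearMap.id_apply]
    conv_rhs => rw [← (X i).counit_coactL x]
    exact tensor_ext (f := (TensorProduct.lid k P).toLinearMap ∘ₗ
      map Coalgebra.counit LinearMap.id ∘ₗ map LinearMap.id (f i))
      (g := f i ∘ₗ (TensorProduct.lid k _).toLinearMap ∘ₗ map Coalgebra.counit LinearMap.id)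
      (fun a b => by simp) _
  coassocL := linearMap_ext_span hf (g := (TensorProduct.assoc k H H P).toLinearMap ∘ₗ
      map Coalgebra.comul LinearMap.id ∘ₗ coactL) (g' := map LinearMap.id coactL ∘ₗ coactL)
      fun i x => by
    simp only [LinearMap.comp_apply, h₃]
    refine Eq.trans (b := map LinearMap.id (map LinearMap.id (f i)) (TensorProduct.assoc k H H _
      (map Coalgebra.comul LinearMap.id ((X i).coactL x)))) ?_ ?_
    · refine tensor_ext (f := (TensorProduct.assoc k H H P).toLinearMap ∘ₗ
        map Coalgebra.comul LinearMap.id ∘ₗ map LinearMap.id (f i))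
        (g := map LinearMap.id (map LinearMap.id (f i)) ∘ₗ
          (TensorProduct.assoc k H H _).toLinearMap ∘ₗ map Coalgebra.comul LinearMap.id)
        (fun a b => ?_) _
      simp only [LinearMap.comp_apply, map_tmul, LinearMap.id_apply]
      exact tensor_ext (f := (TensorProduct.assoc k H H P).toLinearMap ∘ₗ
        (TensorProduct.mk k (H ⊗[k] H) P).flip (f i b))
        (g := map (LinearMap.id : H →ₗ[k] H) (map (LinearMap.id : H →ₗ[k] H) (f i)) ∘ₗ
          (TensorProduct.assoc k H H (X i).carrier).toLinearMap ∘ₗ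
            (TensorProduct.mk k (H ⊗[k] H) (X i).carrier).flip b)
        (fun a b => by simp) _
    · rw [(X i).coassocL]
      exact tensor_ext (f := map (LinearMap.id : H →ₗ[k] H)
          (map (LinearMap.id : H →ₗ[k] H) (f i)) ∘ₗ map LinearMap.id (X i).coactL)
        (g := map LinearMap.id coactL ∘ₗ map LinearMap.id (f i))
        (fun a b => by simp [h₃]) _
  counit_coactR := linearMap_ext_span hf (g := (TensorProduct.rid k P).toLinearMap ∘ₗ
      map LinearMap.id Coalgebra.counit ∘ₗ coactR) (g' := LinearMap.id) fun i x => by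
    simp only [LinearMap.comp_apply, h₄, LinearMap.id_apply]
    conv_rhs => rw [← (X i).counit_coactR x]
    exact tensor_ext (f := (TensorProduct.rid k P).toLinearMap ∘ₗ
      map LinearMap.id Coalgebra.counit ∘ₗ map (f i) LinearMap.id)
      (g := f i ∘ₗ (TensorProduct.rid k _).toLinearMap ∘ₗ map LinearMap.id Coalgebra.counit)
      (fun a b => by simp) _
  coassocR := linearMap_ext_span hf (g := (TensorProduct.assoc k P H H).toLinearMap ∘ₗ
      map coactR LinearMap.id ∘ₗ coactR) (g' := map LinearMap.id Coalgebra.comul ∘ₗ coactR)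
      fun i x => by
    simp only [LinearMap.comp_apply, h₄]
    refine Eq.trans (b := map (f i) LinearMap.id (TensorProduct.assoc k _ H H
      (map (X i).coactR LinearMap.id ((X i).coactR x)))) ?_ ?_
    · refine tensor_ext (f := (TensorProduct.assoc k P H H).toLinearMap ∘ₗ
        map coactR LinearMap.id ∘ₗ map (f i) LinearMap.id)
        (g := map (f i) LinearMap.id ∘ₗ (TensorProduct.assoc k _ H H).toLinearMap ∘ₗ
          map (X i).coactR LinearMap.id) (fun a b => ?_) _
      simp only [LinearMap.comp_apply, map_tmul, LinearMap.id_apply, h₄]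
      exact tensor_ext (f := (TensorProduct.assoc k P H H).toLinearMap ∘ₗ
        (TensorProduct.mk k _ _).flip b ∘ₗ map (f i) LinearMap.id)
        (g := map (f i) LinearMap.id ∘ₗ (TensorProduct.assoc k _ H H).toLinearMap ∘ₗ
          (TensorProduct.mk k _ _).flip b) (fun a b => by simp) _
    · rw [(X i).coassocR]
      exact tensor_ext (f := map (f i) LinearMap.id ∘ₗ map LinearMap.id Coalgebra.comul)
        (g := map LinearMap.id Coalgebra.comul ∘ₗ map (f i) LinearMap.id) (fun a b => by simp) _
  coact_comm := linearMap_ext_span hf (g := (TensorProduct.assoc k H P H).toLinearMap ∘ₗ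
      map coactL LinearMap.id ∘ₗ coactR) (g' := map LinearMap.id coactR ∘ₗ coactL) fun i x => by
    simp only [LinearMap.comp_apply, h₃, h₄]
    refine Eq.trans (b := map LinearMap.id (map (f i) LinearMap.id) (TensorProduct.assoc k H _ H
      (map (X i).coactL LinearMap.id ((X i).coactR x)))) ?_ ?_
    · refine tensor_ext (f := (TensorProduct.assoc k H P H).toLinearMap ∘ₗ
        map coactL LinearMap.id ∘ₗ map (f i) LinearMap.id)
        (g := map LinearMap.id (map (f i) LinearMap.id) ∘ₗ
          (TensorProduct.assoc k H _ H).toLinearMap ∘ₗ map (X i).coactL LinearMap.id)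
        (fun a b => ?_) _
      simp only [LinearMap.comp_apply, map_tmul, LinearMap.id_apply, h₃]
      exact tensor_ext (f := (TensorProduct.assoc k H P H).toLinearMap ∘ₗ
        (TensorProduct.mk k _ _).flip b ∘ₗ map LinearMap.id (f i))
        (g := map LinearMap.id (map (f i) LinearMap.id) ∘ₗ
          (TensorProduct.assoc k H _ H).toLinearMap ∘ₗ (TensorProduct.mk k _ _).flip b)
        (fun a b => by simp) _
    · rw [(X i).coact_comm]
      exact tensor_ext (f := map (LinearMap.id : H →ₗ[k] H)
          (map (f i) (LinearMap.id : H →ₗ[k] H)) ∘ₗ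
        map LinearMap.id (X i).coactR) (g := map LinearMap.id coactR ∘ₗ map LinearMap.id (f i))
        (fun a b => by simp [h₄]) _
  coactL_actL h := linearMap_ext_span hf (g := coactL ∘ₗ actL h)
      (g' := map₂ (LinearMap.mul k H) actL (Coalgebra.comul h) ∘ₗ coactL) fun i x => by
    simp only [LinearMap.comp_apply, h₁, h₃, (X i).coactL_actL]
    exact bilin_ext (f := (map₂ (LinearMap.mul k H) (X i).actL).compr₂ (map LinearMap.id (f i)))
      (g := (map₂ (LinearMap.mul k H) actL).compl₂ (map LinearMap.id (f i))) (by simp [h₁]) _ _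
  coactL_actR h := linearMap_ext_span hf (g := coactL ∘ₗ actR h)
      (g' := map₂ (LinearMap.mul k H).flip actR (Coalgebra.comul h) ∘ₗ coactL) fun i x => by
    simp only [LinearMap.comp_apply, h₂, h₃, (X i).coactL_actR]
    exact bilin_ext (f := (map₂ (LinearMap.mul k H).flip (X i).actR).compr₂ (map LinearMap.id (f i)))
      (g := (map₂ (LinearMap.mul k H).flip actR).compl₂ (map LinearMap.id (f i))) (by simp [h₂]) _ _
  coactR_actL h := linearMap_ext_span hf (g := coactR ∘ₗ actL h)
      (g' := map₂ actL (LinearMap.mul k H) (Coalgebra.comul h) ∘ₗ coactR) fun i x => by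
    simp only [LinearMap.comp_apply, h₁, h₄, (X i).coactR_actL]
    exact bilin_ext (f := (map₂ (X i).actL (LinearMap.mul k H)).compr₂ (map (f i) LinearMap.id))
      (g := (map₂ actL (LinearMap.mul k H)).compl₂ (map (f i) LinearMap.id)) (by simp [h₁]) _ _
  coactR_actR h := linearMap_ext_span hf (g := coactR ∘ₗ actR h)
      (g' := map₂ actR (LinearMap.mul k H).flip (Coalgebra.comul h) ∘ₗ coactR) fun i x => by
    simp only [LinearMap.comp_apply, h₂, h₄, (X i).coactR_actR]
    exact bilin_ext (f := (map₂ (X i).actR (LinearMap.mul k H).flip).compr₂ (map (f i) LinearMap.id))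
      (g := (map₂ actR (LinearMap.mul k H).flip).compl₂ (map (f i) LinearMap.id)) (by simp [h₂]) _ _

/-- A linear map which yields morphisms after composition with a jointly spanning family of
morphisms is a morphism. -/
theorem mem_homs_of_span {ι : Type*} {X : ι → HopfBimod k H} {P Y : HopfBimod k H}
    {f : ∀ i, Hom (X i) P} (hf : ⨆ i, LinearMap.range (f i).1 = ⊤)
    {g : P.carrier →ₗ[k] Y.carrier} (hg : ∀ i, g ∘ₗ (f i).1 ∈ homs (X i) Y) : g ∈ homs P Y := by
  refine ⟨fun h => linearMap_ext_span hf (g := g ∘ₗ P.actL h) (g' := Y.actL h ∘ₗ g) fun i x => ?_,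
    fun h => linearMap_ext_span hf (g := g ∘ₗ P.actR h) (g' := Y.actR h ∘ₗ g) fun i x => ?_,
    linearMap_ext_span hf (g := Y.coactL ∘ₗ g) (g' := map LinearMap.id g ∘ₗ P.coactL)
      fun i x => ?_,
    linearMap_ext_span hf (g := Y.coactR ∘ₗ g) (g' := map g LinearMap.id ∘ₗ P.coactR)
      fun i x => ?_⟩
  · rw [LinearMap.comp_apply, ← (f i).2.1]
    exact (hg i).1 h x
  · rw [LinearMap.comp_apply, ← (f i).2.2.1]
    exact (hg i).2.1 h x
  · rw [LinearMap.comp_apply, LinearMap.comp_apply, (f i).2.2.2.1]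
    exact ((hg i).2.2.1 x).trans (LinearMap.congr_fun (map_comp LinearMap.id g LinearMap.id _) _)
  · rw [LinearMap.comp_apply, LinearMap.comp_apply, (f i).2.2.2.2]
    exact ((hg i).2.2.2 x).trans (LinearMap.congr_fun (map_comp g LinearMap.id _ LinearMap.id) _)

end Span

section Quotient

/-- A subspace of a Hopf bimodule by which the quotient is a Hopf bimodule. -/
structure IsSub (X : HopfBimod k H) (R : Submodule k X.carrier) : Prop where
  actL : ∀ h, ∀ r ∈ R, X.actL h r ∈ R
  actR : ∀ h, ∀ r ∈ R, X.actR h r ∈ R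
  coactL : ∀ r ∈ R, map LinearMap.id R.mkQ (X.coactL r) = 0
  coactR : ∀ r ∈ R, map R.mkQ LinearMap.id (X.coactR r) = 0

variable {X Y Z : HopfBimod k H} {R : Submodule k X.carrier}

/-- The quotient of a Hopf bimodule by a subspace which is stable under the operations. -/
def quot (X : HopfBimod k H) (R : Submodule k X.carrier) (hR : IsSub X R) : HopfBimod k H :=
  ofSpan (fun _ : Unit => X) (X.carrier ⧸ R) (fun _ => R.mkQ)
    (by rw [iSup_const, Submodule.range_mkQ])
    { toFun := fun h => R.mapQ R (X.actL h) fun r hr => hR.actL h r hr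
      map_add' := fun a b => by ext x; simp
      map_smul' := fun c a => by ext x; simp }
    { toFun := fun h => R.mapQ R (X.actR h) fun r hr => hR.actR h r hr
      map_add' := fun a b => by ext x; simp
      map_smul' := fun c a => by ext x; simp }
    (R.liftQ (map LinearMap.id R.mkQ ∘ₗ X.coactL) fun r hr => hR.coactL r hr)
    (R.liftQ (map R.mkQ LinearMap.id ∘ₗ X.coactR) fun r hr => hR.coactR r hr)
    (fun _ _ _ => rfl) (fun _ _ _ => rfl) (fun _ _ => rfl) (fun _ _ => rfl)

/-- The projection onto a quotient. -/
def quotMk (hR : IsSub X R) : Hom X (quot X R hR) :=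
  ⟨R.mkQ, fun _ _ => rfl, fun _ _ => rfl, fun _ => rfl, fun _ => rfl⟩

theorem quotMk_surjective (hR : IsSub X R) : Function.Surjective (quotMk hR).1 :=
  R.mkQ_surjective

theorem quotMk_eq_zero (hR : IsSub X R) {x : X.carrier} : (quotMk hR).1 x = 0 ↔ x ∈ R :=
  Submodule.Quotient.mk_eq_zero R

/-- The linear map on a quotient induced by a linear map which vanishes on the subspace. -/
def quotLift (hR : IsSub X R) {P : Type*} [AddCommGroup P] [Module k P] (f : X.carrier →ₗ[k] P)
    (hf : ∀ r ∈ R, f r = 0) : (quot X R hR).carrier →ₗ[k] P :=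
  R.liftQ f hf

/-- The morphism on a quotient induced by a morphism which vanishes on the subspace. -/
def quotDesc (hR : IsSub X R) (f : Hom X Y) (hf : ∀ r ∈ R, f.1 r = 0) : Hom (quot X R hR) Y :=
  ⟨quotLift hR f.1 hf, mem_homs_of_span (f := fun _ : Unit => quotMk hR)
    ((iSup_const).trans R.range_mkQ) fun _ => f.2⟩

/-- The range of a morphism is stable under the operations. -/
theorem isSub_range (f : Hom Y X) : IsSub X (LinearMap.range f.1) where
  actL := by
    rintro h _ ⟨y, rfl⟩
    exact ⟨Y.actL h y, f.2.1 h y⟩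
  actR := by
    rintro h _ ⟨y, rfl⟩
    exact ⟨Y.actR h y, f.2.2.1 h y⟩
  coactL := by
    rintro _ ⟨y, rfl⟩
    rw [f.2.2.2.1]
    exact tensor_ext (f := map (LinearMap.id : H →ₗ[k] H) (LinearMap.range f.1).mkQ ∘ₗ
        map (LinearMap.id : H →ₗ[k] H) f.1) (g := 0) (fun a b => (congrArg (a ⊗ₜ[k] ·) ((Submodule.Quotient.mk_eq_zero _).2
        (LinearMap.mem_range_self f.1 b))).trans (TensorProduct.tmul_zero _ _)) _
  coactR := by
    rintro _ ⟨y, rfl⟩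
    rw [f.2.2.2.2]
    exact tensor_ext (f := map (LinearMap.range f.1).mkQ (LinearMap.id : H →ₗ[k] H) ∘ₗ
        map f.1 (LinearMap.id : H →ₗ[k] H)) (g := 0) (fun a b => (congrArg (· ⊗ₜ[k] b) ((Submodule.Quotient.mk_eq_zero _).2
        (LinearMap.mem_range_self f.1 a))).trans (TensorProduct.zero_tmul _ _)) _

end Quotient

section Sum

variable {ι : Type} [DecidableEq ι] {X : ι → HopfBimod k H} {Y : HopfBimod k H}

/-- The direct sum of a family of Hopf bimodules. -/
def dsum (X : ι → HopfBimod k H) : HopfBimod k H :=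
  ofSpan X (DirectSum ι fun i => (X i).carrier) (DirectSum.lof k ι fun i => (X i).carrier)
    (DFinsupp.iSup_range_lsingle)
    { toFun := fun h => DirectSum.lmap fun i => (X i).actL h
      map_add' := fun a b => by ext i x; simp [DirectSum.lmap_lof]
      map_smul' := fun c a => by ext i x; simp [DirectSum.lmap_lof] }
    { toFun := fun h => DirectSum.lmap fun i => (X i).actR h
      map_add' := fun a b => by ext i x; simp [DirectSum.lmap_lof]
      map_smul' := fun c a => by ext i x; simp [DirectSum.lmap_lof] }
    (DirectSum.toModule k ι _ fun i =>
      map LinearMap.id (DirectSum.lof k ι (fun i => (X i).carrier) i) ∘ₗ (X i).coactL)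
    (DirectSum.toModule k ι _ fun i =>
      map (DirectSum.lof k ι (fun i => (X i).carrier) i) LinearMap.id ∘ₗ (X i).coactR)
    (fun i h x => by simp [DirectSum.lmap_lof]) (fun i h x => by simp [DirectSum.lmap_lof])
    (fun i x => by simp) (fun i x => by simp)

/-- The inclusion of a summand. -/
def inc (X : ι → HopfBimod k H) (i : ι) : Hom (X i) (dsum X) :=
  ⟨DirectSum.lof k ι (fun i => (X i).carrier) i,
    fun h x => (DirectSum.lmap_lof (fun i => (X i).actL h) i x).symm,
    fun h x => (DirectSum.lmap_lof (fun i => (X i).actR h) i x).symm,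
    fun x => DirectSum.toModule_lof k (φ := fun i =>
      map LinearMap.id (DirectSum.lof k ι (fun i => (X i).carrier) i) ∘ₗ (X i).coactL) i x,
    fun x => DirectSum.toModule_lof k (φ := fun i =>
      map (DirectSum.lof k ι (fun i => (X i).carrier) i) LinearMap.id ∘ₗ (X i).coactR) i x⟩

/-- The linear map on a direct sum with the given restrictions to the summands. -/
def dsumLift {P : Type*} [AddCommGroup P] [Module k P] (f : ∀ i, (X i).carrier →ₗ[k] P) :
    (dsum X).carrier →ₗ[k] P :=
  DirectSum.toModule k ι P f

theorem dsumLift_inc {P : Type*} [AddCommGroup P] [Module k P]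
    (f : ∀ i, (X i).carrier →ₗ[k] P) (i : ι) (x : (X i).carrier) :
    dsumLift f ((inc X i).1 x) = f i x :=
  DirectSum.toModule_lof k (φ := f) i x

theorem iSup_range_inc : ⨆ i, LinearMap.range (inc X i).1 = ⊤ := by
  have : ⨆ i, LinearMap.range (DirectSum.lof k ι (fun i => (X i).carrier) i) = ⊤ :=
    DFinsupp.iSup_range_lsingle
  exact this

theorem dsum_ext {P : Type*} [AddCommGroup P] [Module k P] {f g : (dsum X).carrier →ₗ[k] P}
    (h : ∀ i x, f ((inc X i).1 x) = g ((inc X i).1 x)) (x : (dsum X).carrier) : f x = g x :=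
  linearMap_ext_span (f := fun i => (inc X i).1) iSup_range_inc h x

/-- The morphism on a direct sum with the given restrictions to the summands. -/
def dsumDesc (f : ∀ i, Hom (X i) Y) : Hom (dsum X) Y :=
  ⟨dsumLift fun i => (f i).1, mem_homs_of_span (f := inc X) iSup_range_inc fun i => by
    rw [show dsumLift (fun i => (f i).1) ∘ₗ (inc X i).1 = (f i).1 from
      LinearMap.ext (dsumLift_inc (fun i => (f i).1) i)]
    exact (f i).2⟩

theorem dsumDesc_inc (f : ∀ i, Hom (X i) Y) (i : ι) (x : (X i).carrier) :
    (dsumDesc f).1 ((inc X i).1 x) = (f i).1 x :=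
  dsumLift_inc _ i x

end Sum

section Tensor

variable {X Y Z X' Y' : HopfBimod k H}

/-- The left action `H ⊗̲ Y → Y`, `h ⊗ y ↦ h y`. -/
def actLHom (Y : HopfBimod k H) : Hom (codiag (regular k H) Y) Y :=
  ⟨lift Y.actL, fun h => tensor_ext (f := lift Y.actL ∘ₗ (codiag (regular k H) Y).actL h)
      (g := Y.actL h ∘ₗ lift Y.actL) fun a y => Y.mul_actL h a y,
    fun h => tensor_ext (f := lift Y.actL ∘ₗ (codiag (regular k H) Y).actR h)
      (g := Y.actR h ∘ₗ lift Y.actL) fun a y => Y.act_comm a h y,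
    tensor_ext (f := Y.coactL ∘ₗ lift Y.actL)
      (g := map LinearMap.id (lift Y.actL) ∘ₗ (codiag (regular k H) Y).coactL) fun a y =>
        (Y.coactL_actL a y).trans <| bilin_ext (f := map₂ (LinearMap.mul k H) Y.actL)
          (g := (map₂ (LinearMap.mul k H) (TensorProduct.mk k H Y.carrier)).compr₂
            (map LinearMap.id (lift Y.actL))) (fun _ _ _ _ => rfl) _ _,
    tensor_ext (f := Y.coactR ∘ₗ lift Y.actL)
      (g := map (lift Y.actL) LinearMap.id ∘ₗ (codiag (regular k H) Y).coactR) fun a y =>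
        (Y.coactR_actL a y).trans <| bilin_ext (f := map₂ Y.actL (LinearMap.mul k H))
          (g := (map₂ (TensorProduct.mk k H Y.carrier) (LinearMap.mul k H)).compr₂
            (map (lift Y.actL) LinearMap.id)) (fun _ _ _ _ => rfl) _ _⟩

variable (X Y Z) in
/-- The associativity isomorphism of `⊗̲`. -/
def codiagAssoc : Hom (codiag (codiag X Y) Z) (codiag X (codiag Y Z)) :=
  ⟨(TensorProduct.assoc k X.carrier Y.carrier Z.carrier).toLinearMap, by
    have ext : ∀ {P : Type v} [AddCommGroup P] [Module k P]
        (f g : (X.carrier ⊗[k] Y.carrier) ⊗[k] Z.carrier →ₗ[k] P),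
        (∀ x y z, f ((x ⊗ₜ y) ⊗ₜ z) = g ((x ⊗ₜ y) ⊗ₜ z)) → ∀ t, f t = g t := fun f g h t => by
      rw [TensorProduct.ext_threefold h]
    refine ⟨fun h => ext (((TensorProduct.assoc k X.carrier Y.carrier Z.carrier).toLinearMap) ∘ₗ
        (codiag (codiag X Y) Z).actL h) ((codiag X (codiag Y Z)).actL h ∘ₗ
          (TensorProduct.assoc k X.carrier Y.carrier Z.carrier).toLinearMap) fun _ _ _ => rfl,
      fun h => ext ((TensorProduct.assoc k X.carrier Y.carrier Z.carrier).toLinearMap ∘ₗ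
        (codiag (codiag X Y) Z).actR h) ((codiag X (codiag Y Z)).actR h ∘ₗ
          (TensorProduct.assoc k X.carrier Y.carrier Z.carrier).toLinearMap) fun _ _ _ => rfl,
      ext ((codiag X (codiag Y Z)).coactL ∘ₗ
          (TensorProduct.assoc k X.carrier Y.carrier Z.carrier).toLinearMap)
        (map LinearMap.id (TensorProduct.assoc k X.carrier Y.carrier Z.carrier).toLinearMap ∘ₗ
          (codiag (codiag X Y) Z).coactL) fun x y z => ?_,
      ext ((codiag X (codiag Y Z)).coactR ∘ₗ
          (TensorProduct.assoc k X.carrier Y.carrier Z.carrier).toLinearMap)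
        (map (TensorProduct.assoc k X.carrier Y.carrier Z.carrier).toLinearMap LinearMap.id ∘ₗ
          (codiag (codiag X Y) Z).coactR) fun x y z => ?_⟩
    · refine Eq.symm <| (map_map₂ (f₁ := LinearMap.id) (f₂ := LinearMap.id) (g₁ := LinearMap.id)
        (g₂ := LinearMap.id) (a' := LinearMap.mul k H)
        (b' := (TensorProduct.mk k (X.carrier ⊗[k] Y.carrier) Z.carrier).compr₂
          (TensorProduct.assoc k X.carrier Y.carrier Z.carrier).toLinearMap)
        (fun _ _ => rfl) (fun _ _ => rfl) _ _).trans ?_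
      rw [map_id, map_id, LinearMap.id_apply, LinearMap.id_apply]
      exact map₂_map₂_left (a' := LinearMap.mul k H)
        (b' := TensorProduct.mk k Y.carrier Z.carrier) (c' := LinearMap.mul k H)
        (d' := TensorProduct.mk k X.carrier (Y.carrier ⊗[k] Z.carrier))
        (fun a b c => mul_assoc a b c) (fun _ _ _ => rfl) _ _ _
    · refine Eq.symm <| (map_map₂ (f₁ := LinearMap.id) (f₂ := LinearMap.id) (g₁ := LinearMap.id)
        (g₂ := LinearMap.id) (b' := LinearMap.mul k H)
        (a' := (TensorProduct.mk k (X.carrier ⊗[k] Y.carrier) Z.carrier).compr₂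
          (TensorProduct.assoc k X.carrier Y.carrier Z.carrier).toLinearMap)
        (fun _ _ => rfl) (fun _ _ => rfl) _ _).trans ?_
      rw [map_id, map_id, LinearMap.id_apply, LinearMap.id_apply]
      exact map₂_map₂_left (b' := LinearMap.mul k H)
        (a' := TensorProduct.mk k Y.carrier Z.carrier) (d' := LinearMap.mul k H)
        (c' := TensorProduct.mk k X.carrier (Y.carrier ⊗[k] Z.carrier))
        (fun _ _ _ => rfl) (fun a b c => mul_assoc a b c) _ _ _⟩

variable (X Y) in
/-- The morphism `X ⊗̲ H ⊗̲ Y → X ⊗̲ Y`, `x ⊗ h ⊗ y ↦ x h ⊗ y - x ⊗ h y`. -/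
def balanceHom : Hom (codiag (codiag X (regular k H)) Y) (codiag X Y) :=
  codiagMap (actHom X) (Hom.id Y) -
    (codiagMap (Hom.id X) (actLHom Y)).comp (codiagAssoc X (regular k H) Y)

theorem balanceHom_tmul (x : X.carrier) (h : H) (y : Y.carrier) :
    (balanceHom X Y).1 ((x ⊗ₜ h) ⊗ₜ y) = X.actR h x ⊗ₜ y - x ⊗ₜ Y.actL h y :=
  rfl

variable (X Y) in
/-- The tensor product `X ⊗_H Y`, with the codiagonal coactions. -/
def ten : HopfBimod k H :=
  quot (codiag X Y) _ (isSub_range (balanceHom X Y))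

/-- The pure tensors of `X ⊗_H Y`, as a bilinear map. -/
def tm : X.carrier →ₗ[k] Y.carrier →ₗ[k] (ten X Y).carrier :=
  (TensorProduct.mk k X.carrier Y.carrier).compr₂ (quotMk (isSub_range (balanceHom X Y))).1

theorem tm_actR (x : X.carrier) (h : H) (y : Y.carrier) :
    (tm (X.actR h x) y : (ten X Y).carrier) = tm x (Y.actL h y) := by
  refine sub_eq_zero.1 ((map_sub (quotMk (isSub_range (balanceHom X Y))).1 _ _).symm.trans ?_)
  exact (quotMk_eq_zero _).2 ⟨_, balanceHom_tmul x h y⟩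

theorem ten_ext {P : Type*} [AddCommGroup P] [Module k P] {f g : (ten X Y).carrier →ₗ[k] P}
    (h : ∀ x y, f (tm x y) = g (tm x y)) (t : (ten X Y).carrier) : f t = g t := by
  obtain ⟨t, rfl⟩ := quotMk_surjective _ t
  exact tensor_ext (f := f ∘ₗ (quotMk (isSub_range (balanceHom X Y))).1)
    (g := g ∘ₗ (quotMk (isSub_range (balanceHom X Y))).1) h t

theorem balanced {P : Type*} [AddCommGroup P] [Module k P]
    (f : X.carrier ⊗[k] Y.carrier →ₗ[k] P)
    (hf : ∀ x h y, f (X.actR h x ⊗ₜ y) = f (x ⊗ₜ Y.actL h y)) :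
    ∀ r ∈ LinearMap.range (balanceHom X Y).1, f r = 0 := by
  rintro _ ⟨t, rfl⟩
  refine tensor_ext (f := f ∘ₗ (balanceHom X Y).1) (g := 0) (fun t y => ?_) t
  refine tensor_ext (f := f ∘ₗ (balanceHom X Y).1 ∘ₗ (TensorProduct.mk k _ _).flip y) (g := 0)
    (fun x h => ?_) t
  exact (congrArg f (balanceHom_tmul x h y)).trans (by rw [map_sub, hf, sub_self]; rfl)

/-- The linear map on `X ⊗_H Y` induced by a balanced bilinear map. -/
def tenLift {P : Type*} [AddCommGroup P] [Module k P] (f : X.carrier →ₗ[k] Y.carrier →ₗ[k] P)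
    (hf : ∀ x h y, f (X.actR h x) y = f x (Y.actL h y)) : (ten X Y).carrier →ₗ[k] P :=
  quotLift _ (lift f) (balanced _ hf)

/-- The morphism on `X ⊗_H Y` induced by a balanced morphism. -/
def tenDesc (f : Hom (codiag X Y) Z)
    (hf : ∀ x h y, f.1 (X.actR h x ⊗ₜ y) = f.1 (x ⊗ₜ Y.actL h y)) : Hom (ten X Y) Z :=
  quotDesc _ f (balanced _ hf)

/-- The morphism `f ⊗ g : X ⊗_H Y → X' ⊗_H Y'`. -/
def tenMap (f : Hom X X') (g : Hom Y Y') : Hom (ten X Y) (ten X' Y') :=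
  tenDesc ((quotMk (isSub_range (balanceHom X' Y'))).comp (codiagMap f g)) fun x h y => by
    have := tm_actR (f.1 x) h (g.1 y)
    rw [← f.2.2.1, ← g.2.1] at this
    exact this

/-- The morphism `X ⊗_H Y → X`, `x ⊗ y ↦ x ρ(y)`. -/
def tenActR (X : HopfBimod k H) (ρ : Hom Y (regular k H)) : Hom (ten X Y) X :=
  tenDesc ((actHom X).comp (codiagMap (Hom.id X) ρ)) fun x h y =>
    (X.mul_actR h (ρ.1 y) x).symm.trans (congrArg (X.actR · x) (ρ.2.1 h y).symm)

/-- The morphism `X ⊗_H Y → Y`, `x ⊗ y ↦ ε(x) y`. -/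
def tenActL (ε : Hom X (regular k H)) (Y : HopfBimod k H) : Hom (ten X Y) Y :=
  tenDesc ((actLHom Y).comp (codiagMap ε (Hom.id Y))) fun x h y =>
    (congrArg (Y.actL · y) (ε.2.2.1 h x)).trans (Y.mul_actL (ε.1 x) h y)

end Tensor


/-! ### The total complex of the tensor product of two extensions -/

section Lift

variable {X Y Z : HopfBimod k H}

/-- A linear map whose composition with an injective morphism is a morphism is a morphism. -/
theorem mem_homs_of_injective {g : X.carrier →ₗ[k] Y.carrier} (f : Hom Y Z)
    (hf : Function.Injective f.1) (h : f.1 ∘ₗ g ∈ homs X Z) : g ∈ homs X Y := by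
  obtain ⟨h₁, h₂, h₃, h₄⟩ := h
  refine ⟨fun a x => hf ?_, fun a x => hf ?_, fun x => ?_, fun x => ?_⟩
  · exact (h₁ a x).trans (f.2.1 a _).symm
  · exact (h₂ a x).trans (f.2.2.1 a _).symm
  · refine Module.Flat.lTensor_preserves_injective_linearMap (M := H) f.1 hf ?_
    refine (f.2.2.2.1 (g x)).symm.trans ((h₃ x).trans ?_)
    exact LinearMap.congr_fun (map_comp LinearMap.id f.1 LinearMap.id g) _
  · refine Module.Flat.rTensor_preserves_injective_linearMap (M := H) f.1 hf ?_
    refine (f.2.2.2.2 (g x)).symm.trans ((h₄ x).trans ?_)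
    exact LinearMap.congr_fun (map_comp f.1 LinearMap.id g LinearMap.id) _

/-- The inverse of a bijective morphism. -/
def Hom.inv (f : Hom X Y) (hf : Function.Bijective f.1) : Hom Y X :=
  ⟨(LinearEquiv.ofBijective f.1 hf).symm.toLinearMap, mem_homs_of_injective f hf.1 <| by
    rw [show f.1 ∘ₗ (LinearEquiv.ofBijective f.1 hf).symm.toLinearMap = LinearMap.id from
      LinearMap.ext fun x => (LinearEquiv.ofBijective f.1 hf).apply_symm_apply x]
    exact (Hom.id Y).2⟩

theorem Hom.apply_inv (f : Hom X Y) (hf : Function.Bijective f.1) (y : Y.carrier) :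
    f.1 ((f.inv hf).1 y) = y :=
  (LinearEquiv.ofBijective f.1 hf).apply_symm_apply y

theorem Hom.inv_apply (f : Hom X Y) (hf : Function.Bijective f.1) (x : X.carrier) :
    (f.inv hf).1 (f.1 x) = x :=
  (LinearEquiv.ofBijective f.1 hf).symm_apply_apply x

end Lift

namespace Extension

variable {M N : HopfBimod k H} {m n : ℕ}

/-- The map `E_0 → M` of an extension, extended by zero to the other terms. -/
def augm (E : Extension M N m) : ∀ i, Hom (E.obj i) M
  | 1 => E.right.comp (E.d 0)
  | _ => 0

theorem augm_d (E : Extension M N m) (i : ℕ) (x : (E.obj (i + 1)).carrier) :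
    (E.augm i).1 ((E.d i).1 x) = 0 :=
  match i with
  | 0 => rfl
  | 1 => (congrArg E.right.1 ((E.exact 0).apply_apply_eq_zero x)).trans (map_zero _)
  | _ + 2 => rfl

/-- The inverse of the isomorphism of `N` with the leftmost term of an extension, extended by zero to
the other terms. -/
def coaugm (E : Extension M N m) (i : ℕ) : Hom (E.obj i) N :=
  if h : i = m + 1 then h ▸ E.left.inv E.bijective_left else 0

theorem coaugm_self (E : Extension M N m) :
    E.coaugm (m + 1) = E.left.inv E.bijective_left :=
  dif_pos rfl

theorem coaugm_of_ne (E : Extension M N m) {i : ℕ} (h : i ≠ m + 1) : E.coaugm i = 0 :=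
  dif_neg h

theorem coaugm_left (E : Extension M N m) (c : N.carrier) :
    (E.coaugm (m + 1)).1 (E.left.1 c) = c := by
  rw [coaugm_self, Hom.inv_apply]

theorem left_coaugm (E : Extension M N m) (x : (E.obj (m + 1)).carrier) :
    E.left.1 ((E.coaugm (m + 1)).1 x) = x := by
  rw [coaugm_self, Hom.apply_inv]

theorem coaugm_d (E : Extension M N m) (i : ℕ) (x : (E.obj (i + 1)).carrier) :
    (E.coaugm i).1 ((E.d i).1 x) = 0 := by
  by_cases h : i = m + 1
  · have := E.subsingleton (i + 1) (by omega)
    rw [Subsingleton.elim x 0, map_zero, map_zero]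
  · rw [coaugm_of_ne E h]
    rfl

end Extension

open Extension

section Total

variable {m n : ℕ} (E : Extension (regular k H) (regular k H) m)
  (F : Extension (regular k H) (regular k H) n)

/-- The terms of the total complex of the tensor product over `H` of two extensions of `H` by `H`:
`H` in degree `0`, and the sum of the `E_i ⊗_H F_j` with `i, j ≥ 1` and `i + j = l + 2` in
degree `l + 1`. -/
def totObj : ℕ → HopfBimod k H
  | 0 => regular k H
  | l + 1 => dsum fun p : {p : ℕ × ℕ // p.1 + p.2 = l} =>
      ten (E.obj (p.1.1 + 1)) (F.obj (p.1.2 + 1))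

/-- The inclusion of the summand `E_{i+1} ⊗_H F_{j+1}`, `i + j = l`. -/
def sumInc {i j l : ℕ} (h : i + j = l) :
    Hom (ten (E.obj (i + 1)) (F.obj (j + 1))) (totObj E F (l + 1)) :=
  inc (fun p : {p : ℕ × ℕ // p.1 + p.2 = l} => ten (E.obj (p.1.1 + 1)) (F.obj (p.1.2 + 1)))
    ⟨(i, j), h⟩

/-- The inclusion of `E_i ⊗_H F_j` in the total complex, which is zero unless `i, j ≥ 1` and
`i + j = l + 2`. -/
def totInc : ∀ i j l, Hom (ten (E.obj i) (F.obj j)) (totObj E F (l + 1))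
  | i + 1, j + 1, l =>
    if h : i + j = l then sumInc E F h else 0
  | 0, _, _ => 0
  | _ + 1, 0, _ => 0

theorem totInc_succ {i j l : ℕ} (h : i + j = l) : totInc E F (i + 1) (j + 1) l = sumInc E F h :=
  dif_pos h

theorem totInc_of_ne {i j l : ℕ} (h : i + j ≠ l + 2) : totInc E F i j l = 0 :=
  match i, j, h with
  | _ + 1, _ + 1, h => dif_neg (by omega)
  | 0, _, _ => rfl
  | _ + 1, 0, _ => rfl

theorem totInc_zero_right (i l : ℕ) : totInc E F i 0 l = 0 := by
  cases i <;> rfl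

/-- The pure tensors of the total complex. -/
def tg (i j l : ℕ) (x : (E.obj i).carrier) (y : (F.obj j).carrier) :
    (totObj E F (l + 1)).carrier :=
  (totInc E F i j l).1 (tm x y)

variable {E F}

theorem tg_zero_left (j l : ℕ) (x : (E.obj 0).carrier) (y : (F.obj j).carrier) :
    tg E F 0 j l x y = 0 :=
  rfl

theorem tg_zero_right (i l : ℕ) (x : (E.obj i).carrier) (y : (F.obj 0).carrier) :
    tg E F i 0 l x y = 0 := by
  rw [tg, totInc_zero_right]
  rfl

theorem tg_add_left (i j l : ℕ) (x x' : (E.obj i).carrier) (y : (F.obj j).carrier) :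
    tg E F i j l (x + x') y = tg E F i j l x y + tg E F i j l x' y := by
  simp only [tg, map_add, LinearMap.add_apply]

theorem tg_add_right (i j l : ℕ) (x : (E.obj i).carrier) (y y' : (F.obj j).carrier) :
    tg E F i j l x (y + y') = tg E F i j l x y + tg E F i j l x y' := by
  simp only [tg, map_add]

theorem tg_zero (i j l : ℕ) (x : (E.obj i).carrier) : tg E F i j l x 0 = 0 := by
  simp only [tg, map_zero]

theorem zero_tg (i j l : ℕ) (y : (F.obj j).carrier) : tg E F i j l 0 y = 0 := by
  simp only [tg, map_zero, LinearMap.zero_apply]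

theorem tg_actR (i j l : ℕ) (x : (E.obj i).carrier) (h : H) (y : (F.obj j).carrier) :
    tg E F i j l ((E.obj i).actR h x) y = tg E F i j l x ((F.obj j).actL h y) :=
  congrArg (totInc E F i j l).1 (tm_actR x h y)

/-- Linear maps on a positive term of the total complex are determined by their values on pure
tensors. -/
theorem tot_ext {P : Type*} [AddCommGroup P] [Module k P] {l : ℕ}
    {f g : (totObj E F (l + 1)).carrier →ₗ[k] P}
    (h : ∀ i j (_ : i + j = l) x y, f (tg E F (i + 1) (j + 1) l x y) =
      g (tg E F (i + 1) (j + 1) l x y))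
    (t : (totObj E F (l + 1)).carrier) : f t = g t := by
  have h' : ∀ i j (h : i + j = l) t, f ((sumInc E F h).1 t) = g ((sumInc E F h).1 t) :=
    fun i j hij => ten_ext (f := f ∘ₗ (sumInc E F hij).1) (g := g ∘ₗ (sumInc E F hij).1)
      fun x y => by
        have := h i j hij x y
        rw [tg, totInc_succ E F hij] at this
        exact this
  refine dsum_ext (X := fun p : {p : ℕ × ℕ // p.1 + p.2 = l} =>
    ten (E.obj (p.1.1 + 1)) (F.obj (p.1.2 + 1))) (f := f) (g := g) (fun p => ?_) t
  obtain ⟨⟨i, j⟩, hij⟩ := p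
  exact h' i j hij

/-- The linear map on a positive term of the total complex with the given values on pure tensors. -/
def totLift {P : Type*} [AddCommGroup P] [Module k P] (l : ℕ)
    (f : ∀ i j, (ten (E.obj (i + 1)) (F.obj (j + 1))).carrier →ₗ[k] P) :
    (totObj E F (l + 1)).carrier →ₗ[k] P :=
  dsumLift fun p => f p.1.1 p.1.2

theorem totLift_tg {P : Type*} [AddCommGroup P] [Module k P] {l : ℕ}
    (f : ∀ i j, (ten (E.obj (i + 1)) (F.obj (j + 1))).carrier →ₗ[k] P) {i j : ℕ} (h : i + j = l)
    (x : (E.obj (i + 1)).carrier) (y : (F.obj (j + 1)).carrier) :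
    totLift l f (tg E F (i + 1) (j + 1) l x y) = f i j (tm x y) := by
  rw [tg, totInc_succ E F h]
  exact dsumLift_inc (X := fun p : {p : ℕ × ℕ // p.1 + p.2 = l} =>
    ten (E.obj (p.1.1 + 1)) (F.obj (p.1.2 + 1))) (fun p => f p.1.1 p.1.2) ⟨(i, j), h⟩ _

/-- The morphism on a positive term of the total complex with the given values on pure tensors. -/
def totDesc {Y : HopfBimod k H} (l : ℕ)
    (f : ∀ i j, Hom (ten (E.obj (i + 1)) (F.obj (j + 1))) Y) : Hom (totObj E F (l + 1)) Y :=
  dsumDesc fun p => f p.1.1 p.1.2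

theorem totDesc_tg {Y : HopfBimod k H} {l : ℕ}
    (f : ∀ i j, Hom (ten (E.obj (i + 1)) (F.obj (j + 1))) Y) {i j : ℕ} (h : i + j = l)
    (x : (E.obj (i + 1)).carrier) (y : (F.obj (j + 1)).carrier) :
    (totDesc l f).1 (tg E F (i + 1) (j + 1) l x y) = (f i j).1 (tm x y) :=
  totLift_tg (fun i j => (f i j).1) h x y

variable (E F) in
/-- The morphism `E_i ⊗_H F_j → H`, `x ⊗ y ↦ ε(x) ε(y)`. -/
def totAugm (i j : ℕ) : Hom (ten (E.obj i) (F.obj j)) (regular k H) :=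
  (tenActL (E.augm i) (regular k H)).comp (tenMap (Hom.id _) (F.augm j))

variable (E F) in
/-- The restriction of the differential of the total complex to `E_{i+1} ⊗_H F_{j+1}`. -/
def totTerm (l i j : ℕ) : Hom (ten (E.obj (i + 1)) (F.obj (j + 1))) (totObj E F (l + 1)) :=
  (totInc E F i (j + 1) l).comp (tenMap (E.d i) (Hom.id _)) +
    (-1 : k) ^ i • (totInc E F (i + 1) j l).comp (tenMap (Hom.id _) (F.d j))

variable (E F) in
/-- The differential `x ⊗ y ↦ d x ⊗ y + (-1)^i x ⊗ d y` of the total complex, and the map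
`x ⊗ y ↦ ε(x) ε(y)` in degree `0`. -/
def totD : ∀ l, Hom (totObj E F (l + 1)) (totObj E F l)
  | 0 => totDesc 0 fun i j => totAugm E F (i + 1) (j + 1)
  | l + 1 => totDesc (l + 1) (totTerm E F l)

theorem totD_zero (x : (E.obj 1).carrier) (y : (F.obj 1).carrier) :
    (totD E F 0).1 (tg E F 1 1 0 x y) = ((E.augm 1).1 x * (F.augm 1).1 y : H) :=
  totDesc_tg (fun i j => totAugm E F (i + 1) (j + 1)) (i := 0) (j := 0) rfl x y

theorem totD_succ (i j l : ℕ) (x : (E.obj (i + 1)).carrier) (y : (F.obj (j + 1)).carrier) :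
    (totD E F (l + 1)).1 (tg E F (i + 1) (j + 1) (l + 1) x y) =
      tg E F i (j + 1) l ((E.d i).1 x) y + (-1 : k) ^ i • tg E F (i + 1) j l x ((F.d j).1 y) := by
  by_cases h : i + j = l + 1
  · exact totDesc_tg (totTerm E F l) h x y
  · simp only [tg]
    rw [totInc_of_ne E F (show i + 1 + (j + 1) ≠ l + 1 + 2 by omega),
      totInc_of_ne E F (show i + (j + 1) ≠ l + 2 by omega),
      totInc_of_ne E F (show i + 1 + j ≠ l + 2 by omega)]
    exact (map_zero _).trans (by simp)

theorem totD_totD_zero (t : (totObj E F 2).carrier) :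
    (totD E F 0).1 ((totD E F 1).1 t) = 0 := by
  refine tot_ext (f := (totD E F 0).1 ∘ₗ (totD E F 1).1) (g := 0) (fun i j h x y => ?_) t
  change (totD E F 0).1 ((totD E F 1).1 _) = 0
  rw [totD_succ, map_add, map_smul]
  obtain ⟨rfl, rfl⟩ | ⟨rfl, rfl⟩ : (i = 0 ∧ j = 1) ∨ (i = 1 ∧ j = 0) := by omega
  · rw [tg_zero_left, map_zero, zero_add]
    refine (congrArg ((-1 : k) ^ 0 • ·) ((totD_zero _ _).trans ?_)).trans (smul_zero _)
    rw [F.augm_d]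
    exact mul_zero (M₀ := H) _
  · rw [tg_zero_right, map_zero, smul_zero, add_zero]
    refine (totD_zero _ _).trans ?_
    rw [E.augm_d]
    exact zero_mul (M₀ := H) _

theorem totD_totD_succ (l : ℕ) (t : (totObj E F (l + 3)).carrier) :
    (totD E F (l + 1)).1 ((totD E F (l + 2)).1 t) = 0 := by
  refine tot_ext (f := (totD E F (l + 1)).1 ∘ₗ (totD E F (l + 2)).1) (g := 0)
    (fun i j h x y => ?_) t
  change (totD E F (l + 1)).1 ((totD E F (l + 2)).1 _) = 0
  have hE := fun i x => (E.exact i).apply_apply_eq_zero x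
  have hF := fun i x => (F.exact i).apply_apply_eq_zero x
  rw [totD_succ, map_add, map_smul]
  cases i with
  | zero =>
    rw [tg_zero_left, map_zero, zero_add]
    cases j with
    | zero => omega
    | succ j => rw [totD_succ, tg_zero_left, hF, tg_zero, smul_zero, add_zero, smul_zero]
  | succ i =>
    rw [totD_succ, hE, zero_tg]
    cases j with
    | zero => simp only [tg_zero_right, map_zero, smul_zero, add_zero]
    | succ j =>
      rw [totD_succ, hF, tg_zero, pow_succ]
      simp

end Total


/-! ### Exactness of the total complex -/

open Extension

section TotalExact

variable {m n : ℕ} {E : Extension (regular k H) (regular k H) m}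
  {F : Extension (regular k H) (regular k H) n}

theorem Extension.right_inv_mul (E : Extension (regular k H) (regular k H) m) (a b : H) :
    (E.right.inv E.bijective_right).1 (a * b : H) =
      (E.obj 0).actR b ((E.right.inv E.bijective_right).1 a) :=
  (E.right.inv E.bijective_right).2.2.1 b a

/-- The total complex has a contraction.  With contractions `s` of `E`, right `H`-linear, and `s'` of
`F`, and `u` in `E_0` with `ε(u) = 1`, it sends `x ⊗ y` to `s(x) ⊗ y + u ⊗ s'(ε(x) y)`; here the map
`x ↦ ε(x)` is zero outside of `E_0`. -/
theorem exists_totContraction (E : Extension (regular k H) (regular k H) m)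
    (F : Extension (regular k H) (regular k H) n) :
    ∃ s : ∀ l, (totObj E F l).carrier →ₗ[k] (totObj E F (l + 1)).carrier,
      (∀ x, (totD E F 0).1 (s 0 x) = x) ∧
      ∀ l x, (totD E F (l + 1)).1 (s (l + 1) x) + s l ((totD E F l).1 x) = x := by
  obtain ⟨s, hs, hs₀, hs₁⟩ := E.exists_contraction
  obtain ⟨s', -, hs₀', hs₁'⟩ := F.exists_contraction
  let e : H →ₗ[k] (E.obj 0).carrier := (E.right.inv E.bijective_right).1
  let e' : H →ₗ[k] (F.obj 0).carrier := (F.right.inv F.bijective_right).1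
  let u : (E.obj 1).carrier := s 0 (e 1)
  have hu : ∀ a : H, (E.obj 1).actR a u = s 0 (e a) := fun a => by
    rw [← hs]
    refine congrArg (s 0) ((E.right_inv_mul 1 a).symm.trans ?_)
    rw [one_mul]
  have hu' : ∀ x, (E.obj 1).actR ((E.augm 1).1 x) u = s 0 ((E.d 0).1 x) := fun x => by
    rw [hu]
    exact congrArg (s 0) (E.right.inv_apply E.bijective_right _)
  have hu₁ : (E.augm 1).1 u = (1 : H) :=
    (congrArg E.right.1 (hs₀ _)).trans (E.right.apply_inv E.bijective_right _)
  let b : ∀ l i j, (E.obj (i + 1)).carrier →ₗ[k] (F.obj (j + 1)).carrier →ₗ[k]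
      (totObj E F (l + 2)).carrier := fun l i j =>
    ((tm.compr₂ (totInc E F (i + 2) (j + 1) (l + 1)).1).comp (s (i + 1))) +
      ((F.obj (j + 1)).actL.compr₂ ((totInc E F 1 (j + 2) (l + 1)).1 ∘ₗ tm u ∘ₗ s' (j + 1))).comp
        (E.augm (i + 1)).1
  have hb : ∀ l i j x y, b l i j x y = tg E F (i + 2) (j + 1) (l + 1) (s (i + 1) x) y +
      tg E F 1 (j + 2) (l + 1) u (s' (j + 1) ((F.obj (j + 1)).actL ((E.augm (i + 1)).1 x) y)) :=
    fun _ _ _ _ _ => rfl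
  have hb' : ∀ l i j x h y, b l i j ((E.obj (i + 1)).actR h x) y =
      b l i j x ((F.obj (j + 1)).actL h y) := fun l i j x h y => by
    rw [hb, hb, hs, tg_actR, (E.augm (i + 1)).2.2.1, ← (F.obj (j + 1)).mul_actL]
    rfl
  let t : ∀ l, (totObj E F l).carrier →ₗ[k] (totObj E F (l + 1)).carrier
    | 0 => (totInc E F 1 1 0).1 ∘ₗ tm u ∘ₗ s' 0 ∘ₗ e'
    | l + 1 => totLift l fun i j => tenLift (b l i j) (hb' l i j)
  have ht₀ : ∀ a : H, t 0 a = tg E F 1 1 0 u (s' 0 (e' a)) := fun _ => rfl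
  have ht₁ : ∀ l i j x y, t (l + 1) (tg E F (i + 1) (j + 1) l x y) =
      tg E F (i + 2) (j + 1) (l + 1) (s (i + 1) x) y +
        tg E F 1 (j + 2) (l + 1) u
          (s' (j + 1) ((F.obj (j + 1)).actL ((E.augm (i + 1)).1 x) y)) := fun l i j x y => by
    by_cases h : i + j = l
    · exact totLift_tg (fun i j => tenLift (b l i j) (hb' l i j)) h x y
    · have h₁ : tg E F (i + 1) (j + 1) l x y = 0 := by
        rw [tg, totInc_of_ne E F (by omega)]
        rfl
      have h₂ : tg E F (i + 2) (j + 1) (l + 1) (s (i + 1) x) y = 0 := by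
        rw [tg, totInc_of_ne E F (by omega)]
        rfl
      rw [h₁, h₂, map_zero, zero_add]
      by_cases hi : i = 0
      · rw [tg, totInc_of_ne E F (by omega)]
        rfl
      · obtain ⟨i, rfl⟩ := Nat.exists_eq_succ_of_ne_zero hi
        have h₃ : (F.obj (j + 1)).actL ((E.augm (i + 1 + 1)).1 x) y = 0 :=
          (congrArg (fun a => (F.obj (j + 1)).actL a y) rfl).trans
            (LinearMap.congr_fun (map_zero (F.obj (j + 1)).actL) y)
        rw [h₃, map_zero, tg_zero]
  refine ⟨t, fun a => ?_, fun l => ?_⟩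
  · refine (congrArg (totD E F 0).1 (ht₀ a)).trans ((totD_zero _ _).trans ?_)
    rw [hu₁]
    refine (one_mul (M := H) _).trans ?_
    exact (congrArg F.right.1 (hs₀' _)).trans (F.right.apply_inv F.bijective_right _)
  · refine tot_ext (f := (totD E F (l + 1)).1 ∘ₗ t (l + 1) + t l ∘ₗ (totD E F l).1)
      (g := LinearMap.id) fun i j hij x y => ?_
    change (totD E F (l + 1)).1 (t (l + 1) _) + t l ((totD E F l).1 _) = tg E F _ _ _ x y
    have hS : ∀ z : (F.obj (j + 1)).carrier, tg E F 1 (j + 1) l u ((F.d (j + 1)).1 (s' (j + 1) z)) =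
        tg E F 1 (j + 1) l u z - tg E F 1 (j + 1) l u (s' j ((F.d j).1 z)) := fun z => by
      rw [eq_sub_iff_add_eq, ← tg_add_right, hs₁']
    -- in degree `i = 0` the homotopy `s` yields `x - u ε(x)` instead of `x`
    have hX : ∀ x : (E.obj 1).carrier, tg E F 1 (j + 1) l ((E.d 1).1 (s 1 x)) y =
        tg E F 1 (j + 1) l x y - tg E F 1 (j + 1) l u ((F.obj (j + 1)).actL ((E.augm 1).1 x) y) :=
      fun x => by
        rw [← tg_actR, hu', eq_sub_iff_add_eq, ← tg_add_left, hs₁]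
    have hX' : ∀ i (x : (E.obj (i + 2)).carrier),
        tg E F (i + 2) (j + 1) l ((E.d (i + 2)).1 (s (i + 2) x)) y =
        tg E F (i + 2) (j + 1) l x y - tg E F (i + 2) (j + 1) l (s (i + 1) ((E.d (i + 1)).1 x)) y :=
      fun i x => by
        rw [eq_sub_iff_add_eq, ← tg_add_left, hs₁]
    have hact : ∀ {i j} (x : (E.obj (i + 2)).carrier) (y : (F.obj j).carrier),
        (F.obj j).actL ((E.augm (i + 2)).1 x) y = 0 := fun {i j} x y =>
      (congrArg (fun a => (F.obj j).actL a y) rfl).trans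
        (LinearMap.congr_fun (map_zero (F.obj j).actL) y)
    have hact' : ∀ {i j} (x : (E.obj (i + 1)).carrier) (y : (F.obj j).carrier),
        (F.obj j).actL ((E.augm i).1 ((E.d i).1 x)) y = 0 := fun {i j} x y => by
      rw [E.augm_d]
      exact LinearMap.congr_fun (map_zero (F.obj j).actL) y
    rw [ht₁, map_add, totD_succ (i + 1) j, totD_succ 0 (j + 1), tg_zero_left, zero_add, pow_zero,
      one_smul, hS, (F.d j).2.1]
    cases l with
    | zero =>
      obtain ⟨rfl, rfl⟩ : i = 0 ∧ j = 0 := by omega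
      have h₀ : t 0 ((totD E F 0).1 (tg E F 1 1 0 x y)) =
          tg E F 1 1 0 u (s' 0 ((F.obj 0).actL ((E.augm 1).1 x) ((F.d 0).1 y))) := by
        refine (congrArg (t 0) (totD_zero x y)).trans ((ht₀ _).trans ?_)
        refine congrArg (fun z => tg E F 1 1 0 u (s' 0 z)) ?_
        refine ((F.right.inv F.bijective_right).2.1 _ _).trans ?_
        exact congrArg _ (F.right.inv_apply F.bijective_right _)
      rw [hX, h₀, tg_zero_right, smul_zero]
      abel
    | succ l =>
      rw [totD_succ, map_add, map_smul]
      cases i with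
      | zero =>
        cases j with
        | zero => omega
        | succ j =>
          rw [hX, ht₁, tg_zero_left, map_zero, pow_zero, one_smul,
            show ((-1 : k) ^ (0 + 1)) = -1 from pow_one _, neg_one_smul]
          abel
      | succ i =>
        rw [hX', ht₁, hact, hact', hact, map_zero, map_zero, tg_zero, tg_zero]
        cases j with
        | zero =>
          rw [tg_zero_right, tg_zero_right, map_zero, smul_zero, smul_zero]
          abel
        | succ j =>
          rw [ht₁, hact, map_zero, tg_zero, pow_succ _ (i + 1), mul_neg_one, neg_smul]
          abel_nf

variable (E F) in
/-- The morphism `x ⊗ y ↦ left⁻¹(x) left⁻¹(y)` from `E_{i+1} ⊗_H F_{j+1}` to `H`, which is zero unless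
`i = m` and `j = n`. -/
def totCoaugm (i j : ℕ) : Hom (ten (E.obj (i + 1)) (F.obj (j + 1))) (regular k H) :=
  (tenActL (E.coaugm (i + 1)) (regular k H)).comp (tenMap (Hom.id _) (F.coaugm (j + 1)))

theorem totCoaugm_tm (i j : ℕ) (x : (E.obj (i + 1)).carrier) (y : (F.obj (j + 1)).carrier) :
    (totCoaugm E F i j).1 (tm x y) =
      ((E.coaugm (i + 1)).1 x * (F.coaugm (j + 1)).1 y : H) :=
  rfl

theorem totDesc_totCoaugm (a b : H) : (totDesc (m + n) (totCoaugm E F)).1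
    (tg E F (m + 1) (n + 1) (m + n) (E.left.1 a) (F.left.1 b)) = (a * b : H) := by
  refine (totDesc_tg (totCoaugm E F) rfl _ _).trans ((totCoaugm_tm _ _ _ _).trans ?_)
  rw [coaugm_left, coaugm_left]

theorem tg_left_mul (a b : H) :
    tg E F (m + 1) (n + 1) (m + n) (E.left.1 1) (F.left.1 (a * b : H)) =
      tg E F (m + 1) (n + 1) (m + n) (E.left.1 a) (F.left.1 b) := by
  refine (congrArg (tg E F (m + 1) (n + 1) (m + n) (E.left.1 1)) (F.left.2.1 a b)).trans ?_
  rw [← tg_actR, ← E.left.2.2.1]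
  exact congrArg (fun c : H => tg E F (m + 1) (n + 1) (m + n) (E.left.1 c) (F.left.1 b)) (one_mul a)

theorem tg_eq_zero {i j l : ℕ} (h : m + 1 < i ∨ n + 1 < j) (x : (E.obj i).carrier)
    (y : (F.obj j).carrier) : tg E F i j l x y = 0 := by
  rcases h with h | h
  · have := E.subsingleton i h
    rw [Subsingleton.elim x 0, zero_tg]
  · have := F.subsingleton j h
    rw [Subsingleton.elim y 0, tg_zero]

theorem tg_totCoaugm (t : (totObj E F (m + n + 1)).carrier) :
    tg E F (m + 1) (n + 1) (m + n) (E.left.1 1)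
      (F.left.1 ((totDesc (m + n) (totCoaugm E F)).1 t)) = t := by
  refine tot_ext (f := (totInc E F (m + 1) (n + 1) (m + n)).1 ∘ₗ tm (E.left.1 1) ∘ₗ F.left.1 ∘ₗ
    (totDesc (m + n) (totCoaugm E F)).1) (g := LinearMap.id) (fun i j h x y => ?_) t
  change tg E F (m + 1) (n + 1) (m + n) (E.left.1 1)
      (F.left.1 ((totDesc (m + n) (totCoaugm E F)).1 _)) = _
  by_cases hij : m + 1 < i + 1 ∨ n + 1 < j + 1
  · rw [tg_eq_zero hij, map_zero, map_zero, tg_zero]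
    rfl
  · obtain ⟨rfl, rfl⟩ : i = m ∧ j = n := by omega
    rw [← E.left_coaugm x, ← F.left_coaugm y, totDesc_totCoaugm]
    exact tg_left_mul _ _

theorem bijective_totDesc_totCoaugm : Function.Bijective (totDesc (m + n) (totCoaugm E F)).1 := by
  refine ⟨fun t t' h => ?_, fun a => ⟨tg E F (m + 1) (n + 1) (m + n) (E.left.1 1) (F.left.1 a), ?_⟩⟩
  · rw [← tg_totCoaugm t, h, tg_totCoaugm]
  · exact (totDesc_totCoaugm 1 a).trans (one_mul (M := H) a)

variable (E F) in
/-- The total complex of the tensor product over `H` of two extensions of `H` by `H`, as an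
extension of `H` by `H`. -/
def total : Extension (regular k H) (regular k H) (m + n) where
  obj := totObj E F
  d := totD E F
  right := Hom.id _
  left := (totDesc (m + n) (totCoaugm E F)).inv bijective_totDesc_totCoaugm
  bijective_right := Function.bijective_id
  bijective_left := (LinearEquiv.ofBijective _ bijective_totDesc_totCoaugm).symm.bijective
  surjective x := by
    obtain ⟨s, hs, -⟩ := exists_totContraction E F
    exact ⟨_, hs x⟩
  exact i := by
    obtain ⟨s, -, hs⟩ := exists_totContraction E F
    refine fun x => ⟨fun hx => ⟨s (i + 1) x, ?_⟩, ?_⟩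
    · have := hs i x
      rwa [hx, map_zero, add_zero] at this
    · rintro ⟨x, rfl⟩
      cases i with
      | zero => exact totD_totD_zero x
      | succ i => exact totD_totD_succ i x
  subsingleton i hi := by
    obtain ⟨i, rfl⟩ := Nat.exists_eq_succ_of_ne_zero (show i ≠ 0 by omega)
    have : ∀ t : (totObj E F (i + 1)).carrier, t = 0 :=
      tot_ext (f := LinearMap.id) (g := 0) fun a b h x y => tg_eq_zero (by omega) x y
    exact ⟨fun t t' => (this t).trans (this t').symm⟩

theorem total_left (a : H) :
    (total E F).left.1 a = tg E F (m + 1) (n + 1) (m + n) (E.left.1 1) (F.left.1 a) := by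
  rw [← tg_totCoaugm ((total E F).left.1 a)]
  exact congrArg (fun a => tg E F (m + 1) (n + 1) (m + n) (E.left.1 1) (F.left.1 a))
    (Hom.apply_inv _ bijective_totDesc_totCoaugm a)

end TotalExact


/-! ### Morphisms into a spliced sequence -/

namespace Extension

section SpliceTerms

variable (B : ℕ → HopfBimod k H)

/-- The identification of the term of index `j` of `A` with the term of index `l` of the spliced
sequence `A 0, …, A m, B 1, B 2, …` if `j = l ≤ m`, and zero otherwise. -/
def spliceInA : ∀ (j l m : ℕ) (A : ℕ → HopfBimod k H), Hom (A j) (spliceObj B l m A)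
  | 0, 0, _, _ => Hom.id _
  | 0, _ + 1, _, _ => 0
  | _ + 1, 0, _, _ => 0
  | _ + 1, _ + 1, 0, _ => 0
  | j + 1, l + 1, m + 1, A => spliceInA j l m fun i => A (i + 1)

/-- The identity of `B i` if `i = l`, and zero otherwise. -/
def kronecker (i l : ℕ) : Hom (B i) (B l) :=
  if h : i = l then h ▸ Hom.id (B i) else 0

theorem kronecker_self (i : ℕ) : kronecker B i i = Hom.id (B i) :=
  dif_pos rfl

theorem kronecker_of_ne {i l : ℕ} (h : i ≠ l) : kronecker B i l = 0 :=
  dif_neg h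

/-- The identification of the term of index `i + 1` of `B` with the term of index `l` of the spliced
sequence `A 0, …, A m, B 1, B 2, …` if `l = m + i + 1`, and zero otherwise. -/
def spliceInB : ∀ (i l m : ℕ) (A : ℕ → HopfBimod k H), Hom (B (i + 1)) (spliceObj B l m A)
  | _, 0, _, _ => 0
  | i, l + 1, 0, _ => kronecker B (i + 1) (l + 1)
  | i, l + 1, m + 1, A => spliceInB i l m fun i => A (i + 1)

theorem spliceInA_of_lt {m : ℕ} : ∀ (j l : ℕ) (A : ℕ → HopfBimod k H) (_ : m < j),
    spliceInA B j l m A = 0 := by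
  induction m with
  | zero =>
    intro j l A h
    obtain ⟨j, rfl⟩ := Nat.exists_eq_succ_of_ne_zero h.ne'
    cases l <;> rfl
  | succ m ih =>
    intro j l A h
    obtain ⟨j, rfl⟩ := Nat.exists_eq_succ_of_ne_zero (show j ≠ 0 by omega)
    cases l with
    | zero => rfl
    | succ l => exact ih j l _ (by omega)

theorem spliceInB_zero (i m : ℕ) (A : ℕ → HopfBimod k H) : spliceInB B i 0 m A = 0 := by
  cases m <;> rfl

theorem spliceInB_spliceIn (i : ℕ) : ∀ (m : ℕ) (A : ℕ → HopfBimod k H),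
    spliceInB B i (i + m + 1) m A = spliceIn B i m A
  | 0, _ => kronecker_self B (i + 1)
  | m + 1, A => spliceInB_spliceIn i m fun i => A (i + 1)

variable {B} (dB : ∀ i, Hom (B (i + 1)) (B i))

theorem spliceD_spliceInA : ∀ (j l m : ℕ) (A : ℕ → HopfBimod k H)
    (dA : ∀ i, Hom (A (i + 1)) (A i)) (link : Hom (B 1) (A m)) (_ : j < m),
    (spliceD B dB l m A dA link).comp (spliceInA B (j + 1) (l + 1) m A) =
      (spliceInA B j l m A).comp (dA j)
  | _, _, 0, _, _, _, h => absurd h (by omega)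
  | 0, 0, _ + 1, _, _, _, _ => rfl
  | _ + 1, 0, _ + 1, _, dA, _, _ => Hom.ext_apply fun _ => map_zero (dA 0).1
  | 0, l + 1, m + 1, A, dA, link, _ =>
    Hom.ext_apply fun _ =>
      map_zero (spliceD B dB l m (fun j => A (j + 1)) (fun j => dA (j + 1)) link).1
  | j + 1, l + 1, m + 1, A, dA, link, h =>
    spliceD_spliceInA j l m (fun i => A (i + 1)) (fun i => dA (i + 1)) link (by omega)

theorem kronecker_comp (i l : ℕ) :
    (dB l).comp (kronecker B (i + 1) (l + 1)) = (kronecker B i l).comp (dB i) := by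
  by_cases h : i = l
  · subst h
    rw [kronecker_self, kronecker_self]
    rfl
  · rw [kronecker_of_ne B h, kronecker_of_ne B (by omega)]
    exact Hom.ext_apply fun _ => map_zero (dB l).1

theorem spliceD_spliceInB : ∀ (i l m : ℕ) (A : ℕ → HopfBimod k H)
    (dA : ∀ i, Hom (A (i + 1)) (A i)) (link : Hom (B 1) (A m)),
    (spliceD B dB l m A dA link).comp (spliceInB B (i + 1) (l + 1) m A) =
      (spliceInB B i l m A).comp (dB (i + 1))
  | i, 0, 0, _, _, link => by
    change link.comp (kronecker B (i + 2) 1) = _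
    rw [kronecker_of_ne B (by omega)]
    exact Hom.ext_apply fun _ => map_zero link.1
  | i, 0, m + 1, A, dA, _ => by
    change (dA 0).comp (spliceInB B (i + 1) 0 m fun i => A (i + 1)) = _
    rw [spliceInB_zero]
    exact Hom.ext_apply fun _ => map_zero (dA 0).1
  | i, l + 1, 0, _, _, _ => kronecker_comp dB (i + 1) (l + 1)
  | i, l + 1, m + 1, A, dA, link =>
    spliceD_spliceInB i l m (fun i => A (i + 1)) (fun i => dA (i + 1)) link

theorem spliceD_spliceInB_zero : ∀ (l m : ℕ) (A : ℕ → HopfBimod k H)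
    (dA : ∀ i, Hom (A (i + 1)) (A i)) (link : Hom (B 1) (A m)),
    (spliceD B dB l m A dA link).comp (spliceInB B 0 (l + 1) m A) =
      (spliceInA B m l m A).comp link
  | 0, 0, _, _, link => by
    change link.comp (kronecker B 1 1) = _
    rw [kronecker_self]
    rfl
  | 0, m + 1, A, dA, _ => by
    change (dA 0).comp (spliceInB B 0 0 m fun i => A (i + 1)) = _
    rw [spliceInB_zero]
    exact Hom.ext_apply fun _ => map_zero (dA 0).1
  | l + 1, 0, _, _, _ => by
    change (dB (l + 1)).comp (kronecker B 1 (l + 2)) = _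
    rw [kronecker_of_ne B (by omega)]
    exact Hom.ext_apply fun _ => map_zero (dB (l + 1)).1
  | l + 1, m + 1, A, dA, link =>
    spliceD_spliceInB_zero l m (fun i => A (i + 1)) (fun i => dA (i + 1)) link

end SpliceTerms

end Extension


/-! ### Comparison of the total complex with the Yoneda products -/

theorem Hom.congr_apply {X Y : HopfBimod k H} {f g : Hom X Y} (h : f = g) (x : X.carrier) :
    f.1 x = g.1 x :=
  h ▸ rfl

open Extension

theorem Extension.splice_left {M L N : HopfBimod k H} {m n l : ℕ} (E : Extension M L m)
    (F : Extension L N n) (h : n + m = l) :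
    (E.splice F h).left = (spliceInB F.obj n (l + 1) m E.obj).comp F.left := by
  subst h
  rw [spliceInB_spliceIn]
  rfl

theorem actL_zero (X : HopfBimod k H) (x : X.carrier) : X.actL 0 x = 0 := by
  rw [map_zero, LinearMap.zero_apply]

theorem actR_zero (X : HopfBimod k H) (x : X.carrier) : X.actR 0 x = 0 := by
  rw [map_zero, LinearMap.zero_apply]

section TotalMaps

variable {m n : ℕ} (E : Extension (regular k H) (regular k H) m)
  (F : Extension (regular k H) (regular k H) n)

theorem Extension.coaugm_apply_of_ne (E : Extension (regular k H) (regular k H) m) {i : ℕ}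
    (h : i ≠ m + 1) (x : (E.obj i).carrier) : (E.coaugm i).1 x = (0 : H) :=
  Hom.congr_apply (E.coaugm_of_ne h) x

theorem Extension.augm_apply_of_ne (E : Extension (regular k H) (regular k H) m) :
    ∀ {i : ℕ} (_ : i ≠ 1) (x : (E.obj i).carrier), (E.augm i).1 x = (0 : H)
  | 0, _, _ => rfl
  | _ + 2, _, _ => rfl

theorem Extension.augm_d_apply (E : Extension (regular k H) (regular k H) m) (i : ℕ)
    (x : (E.obj (i + 1)).carrier) : (E.augm i).1 ((E.d i).1 x) = (0 : H) :=
  E.augm_d i x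

theorem Extension.coaugm_d_apply (E : Extension (regular k H) (regular k H) m) (i : ℕ)
    (x : (E.obj (i + 1)).carrier) : (E.coaugm i).1 ((E.d i).1 x) = (0 : H) :=
  E.coaugm_d i x

/-- The morphism from `E_{i+1} ⊗_H F_{j+1}` to the term of degree `l + 1` of `F ♯ E`, which is
`x ⊗ y ↦ x left⁻¹(y)` if `j = n`, `x ⊗ y ↦ ε(x) y` if `i = 0`, and zero otherwise. -/
def totTermA (l i j : ℕ) :
    Hom (ten (E.obj (i + 1)) (F.obj (j + 1))) (spliceObj E.obj (l + 1) n F.obj) :=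
  (spliceInB E.obj i (l + 1) n F.obj).comp (tenActR (E.obj (i + 1)) (F.coaugm (j + 1))) +
    (spliceInA E.obj (j + 1) (l + 1) n F.obj).comp (tenActL (E.augm (i + 1)) (F.obj (j + 1)))

theorem totTermA_tm (l i j : ℕ) (x : (E.obj (i + 1)).carrier) (y : (F.obj (j + 1)).carrier) :
    (totTermA E F l i j).1 (tm x y) =
      (spliceInB E.obj i (l + 1) n F.obj).1
        ((E.obj (i + 1)).actR ((F.coaugm (j + 1)).1 y) x) +
      (spliceInA E.obj (j + 1) (l + 1) n F.obj).1
        ((F.obj (j + 1)).actL ((E.augm (i + 1)).1 x) y) :=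
  rfl

/-- The total complex maps to `F ♯ E`. -/
theorem over_total_splice (hm : 1 ≤ m) (hn : 1 ≤ n) :
    Over (Hom.id _) (Hom.id _) (total E F) (F.splice E rfl) := by
  let φ : ∀ l, Hom (totObj E F l) (spliceObj E.obj l n F.obj)
    | 0 => F.right.inv F.bijective_right
    | l + 1 => totDesc l (totTermA E F l)
  have hφ : ∀ {l i j} (_ : i + j = l) x y, (φ (l + 1)).1 (tg E F (i + 1) (j + 1) l x y) =
      (spliceInB E.obj i (l + 1) n F.obj).1 ((E.obj (i + 1)).actR ((F.coaugm (j + 1)).1 y) x) +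
      (spliceInA E.obj (j + 1) (l + 1) n F.obj).1
        ((F.obj (j + 1)).actL ((E.augm (i + 1)).1 x) y) :=
    fun {l i j} h x y => (totDesc_tg (totTermA E F l) h x y).trans (totTermA_tm E F l i j x y)
  let δ : ∀ l, Hom (spliceObj E.obj (l + 1) n F.obj) (spliceObj E.obj l n F.obj) := fun l =>
    (F.splice E rfl).d l
  have hA : ∀ {l j} (_ : j < n) z, (δ l).1 ((spliceInA E.obj (j + 1) (l + 1) n F.obj).1 z) =
      (spliceInA E.obj j l n F.obj).1 ((F.d j).1 z) := fun {l j} h z =>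
    Hom.congr_apply (spliceD_spliceInA E.d j l n F.obj F.d _ h) z
  have hB : ∀ l i z, (δ l).1 ((spliceInB E.obj (i + 1) (l + 1) n F.obj).1 z) =
      (spliceInB E.obj i l n F.obj).1 ((E.d (i + 1)).1 z) := fun l i z =>
    Hom.congr_apply (spliceD_spliceInB E.d i l n F.obj F.d _) z
  have hB₀ : ∀ l z, (δ l).1 ((spliceInB E.obj 0 (l + 1) n F.obj).1 z) =
      (spliceInA E.obj n l n F.obj).1 ((F.d n).1 (F.left.1 ((E.augm 1).1 z))) := fun l z =>
    Hom.congr_apply (spliceD_spliceInB_zero E.d l n F.obj F.d _) z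
  have hA' : ∀ {l j} (_ : n < j) z, (spliceInA E.obj j (l + 1) n F.obj).1 z = 0 :=
    fun {l j} h z => Hom.congr_apply (spliceInA_of_lt E.obj j (l + 1) F.obj h) z
  have hL : ∀ (c : H) x, F.left.1 ((E.augm 1).1 ((E.obj 1).actR c x)) =
      (F.obj (n + 1)).actL ((E.augm 1).1 x) (F.left.1 c) := fun c x => by
    rw [(E.augm 1).2.2.1]
    exact F.left.2.1 _ _
  refine ⟨φ, fun l => Hom.ext_apply ?_, Hom.ext_apply fun a => F.right.apply_inv _ a,
    Hom.ext_apply fun a => ?_⟩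
  · refine tot_ext (f := (φ l).1 ∘ₗ (totD E F l).1) (g := (δ l).1 ∘ₗ (φ (l + 1)).1)
      fun i j hij x y => ?_
    change (φ l).1 ((totD E F l).1 _) = (δ l).1 ((φ (l + 1)).1 _)
    rw [hφ hij, map_add]
    cases l with
    | zero =>
      obtain ⟨rfl, rfl⟩ : i = 0 ∧ j = 0 := by omega
      rw [F.coaugm_apply_of_ne (by omega), actR_zero, map_zero, map_zero]
      refine Eq.trans ?_ (zero_add _).symm
      rw [hA (by omega)]
      refine (congrArg (φ 0).1 (totD_zero x y)).trans ?_
      refine ((F.right.inv F.bijective_right).2.1 _ _).trans ?_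
      refine (congrArg _ (F.right.inv_apply F.bijective_right _)).trans ?_
      exact ((F.d 0).2.1 _ _).symm
    | succ l =>
      have hAz : ∀ z, (δ (l + 1)).1 ((spliceInA E.obj (j + 1) (l + 1 + 1) n F.obj).1 z) =
          if j < n then (spliceInA E.obj j (l + 1) n F.obj).1 ((F.d j).1 z) else 0 := fun z => by
        split_ifs with h
        · exact hA h z
        · rw [hA' (by omega), map_zero]
      rw [totD_succ, map_add, map_smul, hAz, (F.d j).2.1]
      cases i with
      | zero =>
        obtain ⟨j, rfl⟩ := Nat.exists_eq_succ_of_ne_zero (show j ≠ 0 by omega)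
        rw [tg_zero_left, map_zero, zero_add, pow_zero, one_smul, hφ (by omega), hB₀,
          F.coaugm_d_apply, actR_zero, map_zero, zero_add]
        rcases lt_trichotomy (j + 1) n with h | h | h
        · rw [if_pos h, F.coaugm_apply_of_ne (by omega), actR_zero, map_zero]
          refine (zero_add _).symm.trans (congrArg (· + _) ?_)
          rw [show F.left.1 (0 : H) = 0 from map_zero F.left.1, map_zero, map_zero]
        · subst h
          rw [if_neg (lt_irrefl _), add_zero, hL, F.left_coaugm, (F.d (j + 1)).2.1]
        · have := F.subsingleton (j + 2) (by omega)
          rw [if_neg h.not_gt, Subsingleton.elim y 0]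
          simp only [map_zero, LinearMap.zero_apply, add_zero]
      | succ i =>
        rw [E.augm_apply_of_ne (by omega), actL_zero, map_zero, ite_self, hφ (by omega), hB,
          E.augm_d_apply, actL_zero, map_zero, add_zero, (E.d (i + 1)).2.2.1]
        cases j with
        | zero => rw [tg_zero_right, map_zero, smul_zero]
        | succ j =>
          rw [hφ (by omega), F.coaugm_d_apply, actR_zero, E.augm_apply_of_ne (by omega), actL_zero,
            map_zero, map_zero, zero_add, smul_zero]
  · have h₁ : (E.obj (m + 1)).actR a (E.left.1 (1 : H)) = E.left.1 a :=
      (E.left.2.2.1 a (1 : H)).symm.trans (congrArg E.left.1 (one_mul (M := H) a))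
    refine (congrArg (φ (m + n + 1)).1 (total_left a)).trans ((hφ rfl _ _).trans ?_)
    rw [F.coaugm_left, h₁, E.augm_apply_of_ne (by omega), actL_zero, map_zero, add_zero,
      splice_left]
    rfl

/-- The morphism from `E_{i+1} ⊗_H F_{j+1}` to the term of degree `l + 1` of `E ♯ F`, which is
`x ⊗ y ↦ x ε(y)` if `j = 0`, `x ⊗ y ↦ (-1)^{m j} left⁻¹(x) y` if `i = m`, and zero otherwise. -/
def totTermB (l i j : ℕ) :
    Hom (ten (E.obj (i + 1)) (F.obj (j + 1))) (spliceObj F.obj (l + 1) m E.obj) :=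
  (spliceInA F.obj (i + 1) (l + 1) m E.obj).comp (tenActR (E.obj (i + 1)) (F.augm (j + 1))) +
    (-1 : k) ^ (m * j) •
      (spliceInB F.obj j (l + 1) m E.obj).comp (tenActL (E.coaugm (i + 1)) (F.obj (j + 1)))

theorem totTermB_tm (l i j : ℕ) (x : (E.obj (i + 1)).carrier) (y : (F.obj (j + 1)).carrier) :
    (totTermB E F l i j).1 (tm x y) =
      (spliceInA F.obj (i + 1) (l + 1) m E.obj).1
        ((E.obj (i + 1)).actR ((F.augm (j + 1)).1 y) x) +
      (-1 : k) ^ (m * j) • (spliceInB F.obj j (l + 1) m E.obj).1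
        ((F.obj (j + 1)).actL ((E.coaugm (i + 1)).1 x) y) :=
  rfl

/-- A morphism of exact sequences which is the identity at the right end and a sign at the left end is,
after multiplication by the sign, a morphism of extensions to the twisted extension. -/
theorem Extension.over_twist {M N : HopfBimod k H} {l : ℕ} {T E : Extension M N l} (p : ℕ)
    (φ : ∀ i, Hom (T.obj i) (E.obj i)) (h : ∀ i, (φ i).comp (T.d i) = (E.d i).comp (φ (i + 1)))
    (h₀ : ∀ x, E.right.1 ((φ 0).1 x) = T.right.1 x)
    (h₁ : ∀ y, (φ (l + 1)).1 (T.left.1 y) = (-1 : k) ^ p • E.left.1 y) :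
    Over (Hom.id M) (Hom.id N) T (E.twist ((-1) ^ p)) := by
  have e : (-1 : k) ^ p * (-1 : k) ^ p = 1 := by rw [← mul_pow, neg_one_mul, neg_neg, one_pow]
  refine ⟨fun i => (-1 : k) ^ p • φ i, fun i => Hom.ext_apply fun x => ?_,
    Hom.ext_apply fun x => ?_, Hom.ext_apply fun y => ?_⟩
  · have := congrArg ((-1 : k) ^ p • ·) (Hom.congr_apply (h i) x)
    exact this.trans (map_smul (E.d i).1 _ _).symm
  · change (((-1) ^ p : ℤˣ) : ℤ) • E.right.1 ((-1 : k) ^ p • (φ 0).1 x) = T.right.1 x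
    rw [map_smul, h₀, ← Int.cast_smul_eq_zsmul k, smul_smul]
    push_cast
    rw [e, one_smul]
  · change (-1 : k) ^ p • (φ (l + 1)).1 (T.left.1 y) = E.left.1 y
    rw [h₁, smul_smul, e, one_smul]

/-- The total complex maps to `(-1)^{mn} E ♯ F`. -/
theorem over_total_twist (hm : 1 ≤ m) (hn : 1 ≤ n) (h : n + m = m + n) :
    Over (Hom.id _) (Hom.id _) (total E F) ((E.splice F h).twist ((-1) ^ (m * n))) := by
  let φ : ∀ l, Hom (totObj E F l) (spliceObj F.obj l m E.obj)
    | 0 => E.right.inv E.bijective_right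
    | l + 1 => totDesc l (totTermB E F l)
  have hφ : ∀ {l i j} (_ : i + j = l) x y, (φ (l + 1)).1 (tg E F (i + 1) (j + 1) l x y) =
      (spliceInA F.obj (i + 1) (l + 1) m E.obj).1
        ((E.obj (i + 1)).actR ((F.augm (j + 1)).1 y) x) +
      (-1 : k) ^ (m * j) • (spliceInB F.obj j (l + 1) m E.obj).1
        ((F.obj (j + 1)).actL ((E.coaugm (i + 1)).1 x) y) :=
    fun {l i j} h x y => (totDesc_tg (totTermB E F l) h x y).trans (totTermB_tm E F l i j x y)
  let δ : ∀ l, Hom (spliceObj F.obj (l + 1) m E.obj) (spliceObj F.obj l m E.obj) := fun l =>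
    (E.splice F h).d l
  have hA : ∀ {l i} (_ : i < m) z, (δ l).1 ((spliceInA F.obj (i + 1) (l + 1) m E.obj).1 z) =
      (spliceInA F.obj i l m E.obj).1 ((E.d i).1 z) := fun {l i} h z =>
    Hom.congr_apply (spliceD_spliceInA F.d i l m E.obj E.d _ h) z
  have hB : ∀ l j z, (δ l).1 ((spliceInB F.obj (j + 1) (l + 1) m E.obj).1 z) =
      (spliceInB F.obj j l m E.obj).1 ((F.d (j + 1)).1 z) := fun l j z =>
    Hom.congr_apply (spliceD_spliceInB F.d j l m E.obj E.d _) z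
  have hB₀ : ∀ l z, (δ l).1 ((spliceInB F.obj 0 (l + 1) m E.obj).1 z) =
      (spliceInA F.obj m l m E.obj).1 ((E.d m).1 (E.left.1 ((F.augm 1).1 z))) := fun l z =>
    Hom.congr_apply (spliceD_spliceInB_zero F.d l m E.obj E.d _) z
  have hA' : ∀ {l i} (_ : m < i) z, (spliceInA F.obj i (l + 1) m E.obj).1 z = 0 :=
    fun {l i} h z => Hom.congr_apply (spliceInA_of_lt F.obj i (l + 1) E.obj h) z
  have hL : ∀ (c : H) y, E.left.1 ((F.augm 1).1 ((F.obj 1).actL c y)) =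
      (E.obj (m + 1)).actR ((F.augm 1).1 y) (E.left.1 c) := fun c y => by
    rw [(F.augm 1).2.1]
    exact E.left.2.2.1 ((F.augm 1).1 y) c
  refine over_twist (m * n) φ (fun l => Hom.ext_apply ?_) (fun a => E.right.apply_inv _ a)
    fun a => ?_
  · refine tot_ext (f := (φ l).1 ∘ₗ (totD E F l).1) (g := (δ l).1 ∘ₗ (φ (l + 1)).1)
      fun i j hij x y => ?_
    change (φ l).1 ((totD E F l).1 _) = (δ l).1 ((φ (l + 1)).1 _)
    rw [hφ hij, map_add]
    cases l with
    | zero =>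
      obtain ⟨rfl, rfl⟩ : i = 0 ∧ j = 0 := by omega
      rw [E.coaugm_apply_of_ne (by omega), actL_zero, map_zero, smul_zero, map_zero]
      refine Eq.trans ?_ (add_zero _).symm
      rw [hA (by omega)]
      refine (congrArg (φ 0).1 (totD_zero x y)).trans ?_
      refine ((E.right.inv E.bijective_right).2.2.1 ((F.augm 1).1 y) _).trans ?_
      refine (congrArg _ (E.right.inv_apply E.bijective_right _)).trans ?_
      exact ((E.d 0).2.2.1 _ _).symm
    | succ l =>
      have hAz : ∀ z, (δ (l + 1)).1 ((spliceInA F.obj (i + 1) (l + 1 + 1) m E.obj).1 z) =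
          if i < m then (spliceInA F.obj i (l + 1) m E.obj).1 ((E.d i).1 z) else 0 := fun z => by
        split_ifs with h
        · exact hA h z
        · rw [hA' (by omega), map_zero]
      rw [totD_succ, map_add, map_smul, map_smul, hAz, (E.d i).2.2.1]
      cases j with
      | zero =>
        obtain ⟨i, rfl⟩ := Nat.exists_eq_succ_of_ne_zero (show i ≠ 0 by omega)
        rw [tg_zero_right, map_zero, smul_zero, add_zero, hφ (by omega), hB₀,
          E.coaugm_d_apply, actL_zero, map_zero, smul_zero, add_zero, mul_zero, pow_zero, one_smul]
        rcases lt_trichotomy (i + 1) m with h | h | h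
        · rw [if_pos h, E.coaugm_apply_of_ne (by omega), actL_zero, map_zero]
          refine (add_zero _).symm.trans (congrArg (_ + ·) ?_)
          rw [show E.left.1 (0 : H) = 0 from map_zero E.left.1, map_zero, map_zero]
        · subst h
          refine Eq.trans ?_ (congrArg (· + _) (if_neg (lt_irrefl _))).symm
          refine Eq.trans ?_ (zero_add _).symm
          rw [hL, E.left_coaugm, (E.d (i + 1)).2.2.1]
        · have := E.subsingleton (i + 2) (by omega)
          rw [if_neg h.not_gt, Subsingleton.elim x 0]
          simp only [map_zero, LinearMap.zero_apply, zero_add]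
      | succ j =>
        rw [F.augm_apply_of_ne (by omega), actR_zero, map_zero, ite_self, zero_add,
          hφ (by omega : i + j = l), hB, F.augm_d_apply, actR_zero, map_zero, zero_add,
          (F.d (j + 1)).2.1]
        have h₁ : (φ (l + 1)).1 (tg E F i (j + 1 + 1) l ((E.d i).1 x) y) = 0 := by
          cases i with
          | zero => rw [tg_zero_left, map_zero]
          | succ i =>
            rw [hφ (by omega), E.coaugm_d_apply, actL_zero, F.augm_apply_of_ne (by omega),
              actR_zero, map_zero, map_zero, zero_add, smul_zero]
        rw [h₁, zero_add, smul_smul]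
        -- the signs agree because only the terms with `i = m` contribute
        by_cases hi : i = m
        · rw [← pow_add, show i + m * j = m * (j + 1) by rw [hi, mul_add_one, add_comm]]
        · rw [E.coaugm_apply_of_ne (by omega), actL_zero, map_zero, smul_zero, smul_zero]
  · have h₁ : (F.obj (n + 1)).actL (1 : H) (F.left.1 a) = F.left.1 a := (F.obj (n + 1)).one_actL _
    refine (congrArg (φ (m + n + 1)).1 (total_left a)).trans ((hφ rfl _ _).trans ?_)
    rw [E.coaugm_left, h₁, F.augm_apply_of_ne (by omega), actR_zero, map_zero, zero_add,
      splice_left]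
    rfl

theorem Ext.mk_splice (hm : 1 ≤ m) (hn : 1 ≤ n) :
    Ext.mk (F.splice E (rfl : m + n = m + n)) =
      Ext.mk ((E.splice F (Nat.add_comm n m)).twist ((-1) ^ (m * n))) :=
  (Quot.sound (over_total_splice E F hm hn)).symm.trans
    (Quot.sound (over_total_twist E F hm hn (Nat.add_comm n m)))

theorem Ext.yoneda_comm (hm : 1 ≤ m) (hn : 1 ≤ n) (x : Ext (regular k H) (regular k H) m)
    (y : Ext (regular k H) (regular k H) n) :
    Ext.yoneda (rfl : m + n = m + n) y x =
      Ext.twist ((-1) ^ (m * n)) (Ext.yoneda (Nat.add_comm n m) x y) := by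
  induction x using Quot.ind with
  | mk E =>
    induction y using Quot.ind with
    | mk F => exact Ext.mk_splice E F hm hn

end TotalMaps


/-! ### Direct sums of exact sequences -/

section Biprod

variable {X Y Z : HopfBimod k H}

/-- The family indexed by the booleans with the values `X` and `Y`. -/
def pair (X Y : HopfBimod k H) : Bool → HopfBimod k H
  | false => X
  | true => Y

/-- The direct sum of two Hopf bimodules. -/
def biprod (X Y : HopfBimod k H) : HopfBimod k H := dsum (pair X Y)

/-- The inclusion of the first summand. -/
def inl (X Y : HopfBimod k H) : Hom X (biprod X Y) := inc (pair X Y) false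

/-- The inclusion of the second summand. -/
def inr (X Y : HopfBimod k H) : Hom Y (biprod X Y) := inc (pair X Y) true

/-- The morphism on a direct sum with the given restrictions to the summands. -/
def biprodDesc (f : Hom X Z) (g : Hom Y Z) : Hom (biprod X Y) Z :=
  dsumDesc (X := pair X Y) fun b => match b with
    | false => f
    | true => g

theorem biprodDesc_inl (f : Hom X Z) (g : Hom Y Z) (x : X.carrier) :
    (biprodDesc f g).1 ((inl X Y).1 x) = f.1 x :=
  dsumDesc_inc (X := pair X Y) _ false x

theorem biprodDesc_inr (f : Hom X Z) (g : Hom Y Z) (y : Y.carrier) :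
    (biprodDesc f g).1 ((inr X Y).1 y) = g.1 y :=
  dsumDesc_inc (X := pair X Y) _ true y

/-- The first projection. -/
def fst (X Y : HopfBimod k H) : Hom (biprod X Y) X := biprodDesc (Hom.id X) 0

/-- The second projection. -/
def snd (X Y : HopfBimod k H) : Hom (biprod X Y) Y := biprodDesc 0 (Hom.id Y)

theorem fst_inl (x : X.carrier) : (fst X Y).1 ((inl X Y).1 x) = x := biprodDesc_inl _ _ x

theorem fst_inr (y : Y.carrier) : (fst X Y).1 ((inr X Y).1 y) = 0 := biprodDesc_inr _ _ y

theorem snd_inl (x : X.carrier) : (snd X Y).1 ((inl X Y).1 x) = 0 := biprodDesc_inl _ _ x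

theorem snd_inr (y : Y.carrier) : (snd X Y).1 ((inr X Y).1 y) = y := biprodDesc_inr _ _ y

theorem exists_inl_add_inr (t : (biprod X Y).carrier) :
    ∃ x y, t = (inl X Y).1 x + (inr X Y).1 y := by
  refine ⟨(fst X Y).1 t, (snd X Y).1 t, ?_⟩
  refine dsum_ext (X := pair X Y) (f := LinearMap.id)
    (g := (inl X Y).1 ∘ₗ (fst X Y).1 + (inr X Y).1 ∘ₗ (snd X Y).1) (fun b x => ?_) t
  have h₁ : ∀ x : X.carrier, (inl X Y).1 x = (inl X Y).1 ((fst X Y).1 ((inl X Y).1 x)) +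
      (inr X Y).1 ((snd X Y).1 ((inl X Y).1 x)) := fun x => by
    rw [fst_inl, snd_inl, map_zero, add_zero]
  have h₂ : ∀ y : Y.carrier, (inr X Y).1 y = (inl X Y).1 ((fst X Y).1 ((inr X Y).1 y)) +
      (inr X Y).1 ((snd X Y).1 ((inr X Y).1 y)) := fun y => by
    rw [fst_inr, snd_inr, map_zero, zero_add]
  cases b with
  | false => exact h₁ x
  | true => exact h₂ x

theorem bijective_fst (X Y : HopfBimod k H) [Subsingleton Y.carrier] :
    Function.Bijective (fst X Y).1 := by
  refine ⟨fun t t' h => ?_, fun x => ⟨_, fst_inl x⟩⟩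
  obtain ⟨x, y, rfl⟩ := exists_inl_add_inr t
  obtain ⟨x', y', rfl⟩ := exists_inl_add_inr t'
  simp only [map_add, fst_inl, fst_inr, add_zero] at h
  rw [h, Subsingleton.elim y y']

theorem bijective_inr (X Y : HopfBimod k H) [Subsingleton X.carrier] :
    Function.Bijective (inr X Y).1 := by
  refine ⟨fun y y' h => ?_, fun t => ?_⟩
  · have := congrArg (snd _ _).1 h
    rwa [snd_inr, snd_inr] at this
  · obtain ⟨x, y, rfl⟩ := exists_inl_add_inr t
    exact ⟨y, by rw [Subsingleton.elim x 0, map_zero, zero_add]⟩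

theorem subsingleton_biprod (X Y : HopfBimod k H) [Subsingleton X.carrier]
    [Subsingleton Y.carrier] : Subsingleton (biprod X Y).carrier := by
  refine ⟨fun t t' => ?_⟩
  obtain ⟨x, y, rfl⟩ := exists_inl_add_inr t
  obtain ⟨x', y', rfl⟩ := exists_inl_add_inr t'
  rw [Subsingleton.elim x x', Subsingleton.elim y y']

theorem biprodDesc_add (f : Hom X Z) (g : Hom Y Z) (x : X.carrier) (y : Y.carrier) :
    (biprodDesc f g).1 ((inl X Y).1 x + (inr X Y).1 y) = f.1 x + g.1 y := by
  rw [map_add, biprodDesc_inl, biprodDesc_inr]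

theorem inl_add_inr_eq_zero {x : X.carrier} {y : Y.carrier}
    (h : (inl X Y).1 x + (inr X Y).1 y = 0) : x = 0 ∧ y = 0 := by
  have h₁ := congrArg (fst X Y).1 h
  have h₂ := congrArg (snd X Y).1 h
  rw [map_add, fst_inl, fst_inr, add_zero, map_zero] at h₁
  rw [map_add, snd_inl, snd_inr, zero_add, map_zero] at h₂
  exact ⟨h₁, h₂⟩

variable (k H) in
/-- The zero Hopf bimodule. -/
def zeroObj : HopfBimod k H where
  carrier := PUnit
  actL := 0
  actR := 0
  coactL := 0
  coactR := 0
  one_actL _ := rfl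
  mul_actL _ _ _ := rfl
  one_actR _ := rfl
  mul_actR _ _ _ := rfl
  act_comm _ _ _ := rfl
  counit_coactL _ := rfl
  coassocL _ := by simp
  counit_coactR _ := rfl
  coassocR _ := by simp
  coact_comm _ := by simp
  coactL_actL _ _ := by simp
  coactL_actR _ _ := by simp
  coactR_actL _ _ := by simp
  coactR_actR _ _ := by simp

instance : Subsingleton (zeroObj k H).carrier := inferInstanceAs (Subsingleton PUnit)

end Biprod

/-- An exact sequence `⋯ → X_1 → X_0 → 0` of Hopf bimodules. -/
structure ExactSeq (k : Type u) (H : Type v) [Field k] [Ring H] [HopfAlgebra k H] where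
  obj : ℕ → HopfBimod k H
  d : ∀ i, Hom (obj (i + 1)) (obj i)
  surjective : Function.Surjective (d 0).1
  exact : ∀ i, Function.Exact (d (i + 1)).1 (d i).1

namespace ExactSeq

/-- The direct sum of two exact sequences. -/
def sum (A B : ExactSeq k H) : ExactSeq k H where
  obj i := biprod (A.obj i) (B.obj i)
  d i := biprodDesc ((inl _ _).comp (A.d i)) ((inr _ _).comp (B.d i))
  surjective t := by
    obtain ⟨x, y, rfl⟩ := exists_inl_add_inr t
    obtain ⟨x, rfl⟩ := A.surjective x
    obtain ⟨y, rfl⟩ := B.surjective y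
    exact ⟨_, biprodDesc_add _ _ x y⟩
  exact i t := by
    constructor
    · intro h
      obtain ⟨x, y, rfl⟩ := exists_inl_add_inr t
      rw [biprodDesc_add] at h
      obtain ⟨h₁, h₂⟩ := inl_add_inr_eq_zero h
      obtain ⟨x, rfl⟩ := (A.exact i x).1 h₁
      obtain ⟨y, rfl⟩ := (B.exact i y).1 h₂
      exact ⟨_, biprodDesc_add _ _ x y⟩
    · rintro ⟨t, rfl⟩
      obtain ⟨x, y, rfl⟩ := exists_inl_add_inr t
      rw [biprodDesc_add]
      refine (biprodDesc_add _ _ _ _).trans ?_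
      change (inl _ _).1 ((A.d i).1 ((A.d (i + 1)).1 x)) +
        (inr _ _).1 ((B.d i).1 ((B.d (i + 1)).1 y)) = 0
      rw [(A.exact i).apply_apply_eq_zero, (B.exact i).apply_apply_eq_zero, map_zero, map_zero,
        add_zero]

theorem sum_d_inl (A B : ExactSeq k H) (i : ℕ) (x : (A.obj (i + 1)).carrier) :
    ((A.sum B).d i).1 ((inl _ _).1 x) = (inl _ _).1 ((A.d i).1 x) :=
  biprodDesc_inl _ _ x

theorem sum_d_inr (A B : ExactSeq k H) (i : ℕ) (y : (B.obj (i + 1)).carrier) :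
    ((A.sum B).d i).1 ((inr _ _).1 y) = (inr _ _).1 ((B.d i).1 y) :=
  biprodDesc_inr _ _ y

end ExactSeq

namespace Extension

open ExactSeq

variable {M N : HopfBimod k H} {n : ℕ}

/-- The extension of `M` by `N` which is the sum of an exact sequence ending with `M`, of length `n`,
and of an exact sequence starting with `N`, which is zero in degree `0`. -/
def ofSum (A B : ExactSeq k H) (α : Hom (A.obj 0) M) (β : Hom N (B.obj (n + 1)))
    (hα : Function.Bijective α.1) (hβ : Function.Bijective β.1)
    (hA : ∀ i, n < i → Subsingleton (A.obj i).carrier) (hB₀ : Subsingleton (B.obj 0).carrier)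
    (hB : ∀ i, n + 1 < i → Subsingleton (B.obj i).carrier) : Extension M N n where
  obj := (A.sum B).obj
  d := (A.sum B).d
  right := α.comp (fst _ _)
  left := (inr _ _).comp β
  bijective_right := hα.comp (bijective_fst _ _)
  bijective_left :=
    have := hA (n + 1) n.lt_succ_self
    (bijective_inr (A.obj (n + 1)) (B.obj (n + 1))).comp hβ
  surjective := (A.sum B).surjective
  exact := (A.sum B).exact
  subsingleton i hi := by
    have := hA i (by omega)
    have := hB i hi
    exact subsingleton_biprod _ _

variable {A B : ExactSeq k H} {α : Hom (A.obj 0) M} {β : Hom N (B.obj (n + 1))}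
    {hα : Function.Bijective α.1} {hβ : Function.Bijective β.1}
    {hA : ∀ i, n < i → Subsingleton (A.obj i).carrier} {hB₀ : Subsingleton (B.obj 0).carrier}
    {hB : ∀ i, n + 1 < i → Subsingleton (B.obj i).carrier}

theorem over_ofSum_left (E : Extension M N n) (a : ∀ i, Hom (A.obj i) (E.obj i))
    (b : ∀ i, Hom (B.obj i) (E.obj i)) (ha : ∀ i, (a i).comp (A.d i) = (E.d i).comp (a (i + 1)))
    (hb : ∀ i, (b i).comp (B.d i) = (E.d i).comp (b (i + 1))) (ha₀ : E.right.comp (a 0) = α)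
    (hbn : (b (n + 1)).comp β = E.left) :
    Over (Hom.id M) (Hom.id N) (ofSum A B α β hα hβ hA hB₀ hB) E := by
  refine ⟨fun i => biprodDesc (a i) (b i), fun i => Hom.ext_apply fun t => ?_,
    Hom.ext_apply fun t => ?_, Hom.ext_apply fun y => ?_⟩
  · obtain ⟨x, y, rfl⟩ := exists_inl_add_inr t
    have h₁ : ((A.sum B).d i).1 ((inl _ _).1 x + (inr _ _).1 y) =
        (inl _ _).1 ((A.d i).1 x) + (inr _ _).1 ((B.d i).1 y) := biprodDesc_add _ _ x y
    refine (congrArg (biprodDesc (a i) (b i)).1 h₁).trans ((biprodDesc_add _ _ _ _).trans ?_)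
    refine Eq.trans ?_ (congrArg (E.d i).1 (biprodDesc_add (a (i + 1)) (b (i + 1)) x y)).symm
    rw [map_add]
    exact congrArg₂ (· + ·) (Hom.congr_apply (ha i) x) (Hom.congr_apply (hb i) y)
  · obtain ⟨x, y, rfl⟩ := exists_inl_add_inr t
    change E.right.1 ((biprodDesc (a 0) (b 0)).1 _) = α.1 ((fst _ _).1 _)
    rw [Subsingleton.elim y 0, map_zero, add_zero, biprodDesc_inl, fst_inl, ← ha₀]
    rfl
  · exact (biprodDesc_inr _ _ _).trans (Hom.congr_apply hbn y)

theorem over_ofSum_right (E : Extension M N n) (a : ∀ i, Hom (E.obj i) (A.obj i))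
    (b : ∀ i, Hom (E.obj i) (B.obj i)) (ha : ∀ i, (a i).comp (E.d i) = (A.d i).comp (a (i + 1)))
    (hb : ∀ i, (b i).comp (E.d i) = (B.d i).comp (b (i + 1))) (ha₀ : α.comp (a 0) = E.right)
    (hbn : (b (n + 1)).comp E.left = β) :
    Over (Hom.id M) (Hom.id N) E (ofSum A B α β hα hβ hA hB₀ hB) := by
  refine ⟨fun i => (inl _ _).comp (a i) + (inr _ _).comp (b i), fun i => Hom.ext_apply fun x => ?_,
    Hom.ext_apply fun x => ?_, Hom.ext_apply fun y => ?_⟩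
  · refine Eq.trans ?_ (biprodDesc_add _ _ _ _).symm
    exact congrArg₂ (· + ·) (congrArg (inl _ _).1 (Hom.congr_apply (ha i) x))
      (congrArg (inr _ _).1 (Hom.congr_apply (hb i) x))
  · change α.1 ((fst _ _).1 ((inl _ _).1 _ + (inr _ _).1 _)) = _
    rw [map_add, fst_inl, fst_inr, add_zero]
    exact Hom.congr_apply ha₀ x
  · have := hA (n + 1) (by omega)
    change (inl _ _).1 ((a (n + 1)).1 (E.left.1 y)) + (inr _ _).1 ((b (n + 1)).1 (E.left.1 y)) =
      (inr _ _).1 (β.1 y)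
    rw [Subsingleton.elim ((a (n + 1)).1 (E.left.1 y)) 0, map_zero, zero_add, ← hbn]
    rfl

end Extension


/-! ### The products with an endomorphism of `H` -/

section ZeroProduct

variable {M N X Y Z : HopfBimod k H}

theorem Hom.comp_zero' (f : Hom Y Z) : f.comp (0 : Hom X Y) = 0 :=
  Hom.ext_apply fun _ => map_zero f.1

theorem Hom.comp_eq_zero {f : Hom X Y} {g : Hom Y Z} (h : Function.Exact f.1 g.1) :
    g.comp f = 0 :=
  Hom.ext_apply fun x => h.apply_apply_eq_zero x

/-- The objects of the sequence `X = X` in degrees `p + 1` and `p`. -/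
def discObj (X : HopfBimod k H) : ℕ → ℕ → HopfBimod k H
  | 0, 0 => X
  | 0, 1 => X
  | 0, _ + 2 => zeroObj k H
  | _ + 1, 0 => zeroObj k H
  | p + 1, i + 1 => discObj X p i

/-- The maps of the sequence `X = X` in degrees `p + 1` and `p`. -/
def discD (X : HopfBimod k H) : ∀ p i, Hom (discObj X p (i + 1)) (discObj X p i)
  | 0, 0 => Hom.id X
  | 0, _ + 1 => 0
  | _ + 1, 0 => 0
  | p + 1, i + 1 => discD X p i

theorem discD_surjective (X : HopfBimod k H) : ∀ p, Function.Surjective (discD X p 0).1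
  | 0 => Function.surjective_id
  | _ + 1 => fun y => ⟨0, Subsingleton.elim (α := (zeroObj k H).carrier) _ y⟩

theorem discD_exact (X : HopfBimod k H) :
    ∀ p i, Function.Exact (discD X p (i + 1)).1 (discD X p i).1
  | 0, 0 => fun _ => ⟨fun h => ⟨0, Eq.symm h⟩, fun ⟨_, h⟩ => Eq.symm h⟩
  | 0, _ + 1 => fun x => ⟨fun _ => ⟨0, Subsingleton.elim (α := (zeroObj k H).carrier) _ x⟩,
      fun _ => rfl⟩
  | p + 1, 0 => fun x => ⟨fun _ => discD_surjective X p x, fun _ => rfl⟩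
  | p + 1, i + 1 => discD_exact X p i

/-- The exact sequence `X = X` in degrees `p + 1` and `p`. -/
def disc (X : HopfBimod k H) (p : ℕ) : ExactSeq k H where
  obj := discObj X p
  d := discD X p
  surjective := discD_surjective X p
  exact := discD_exact X p

theorem subsingleton_discObj (X : HopfBimod k H) :
    ∀ p i, p + 1 < i → Subsingleton (discObj X p i).carrier
  | 0, 0, h => absurd h (by omega)
  | 0, 1, h => absurd h (by omega)
  | 0, _ + 2, _ => inferInstanceAs (Subsingleton (zeroObj k H).carrier)
  | _ + 1, 0, h => absurd h (by omega)
  | p + 1, i + 1, h => subsingleton_discObj X p i (by omega)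

/-- The isomorphism of `X` with the term of degree `p + 1` of `disc X p`. -/
def discIn (X : HopfBimod k H) : ∀ p, Hom X (discObj X p (p + 1))
  | 0 => Hom.id X
  | p + 1 => discIn X p

theorem bijective_discIn (X : HopfBimod k H) : ∀ p, Function.Bijective (discIn X p).1
  | 0 => Function.bijective_id
  | p + 1 => bijective_discIn X p

/-- The morphism from `disc X p` to a sequence `Y` with the given component of degree `p + 1`. -/
def discDesc (X : HopfBimod k H) : ∀ (p : ℕ) (Y : ℕ → HopfBimod k H)
    (_ : ∀ i, Hom (Y (i + 1)) (Y i)) (_ : Hom X (Y (p + 1))) (i : ℕ), Hom (discObj X p i) (Y i)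
  | 0, _, d, f, 0 => (d 0).comp f
  | 0, _, _, f, 1 => f
  | 0, _, _, _, _ + 2 => 0
  | _ + 1, _, _, _, 0 => 0
  | p + 1, Y, d, f, i + 1 => discDesc X p (fun i => Y (i + 1)) (fun i => d (i + 1)) f i

theorem discDesc_comm (X : HopfBimod k H) : ∀ (p : ℕ) (Y : ℕ → HopfBimod k H)
    (d : ∀ i, Hom (Y (i + 1)) (Y i)) (_ : ∀ i, (d i).comp (d (i + 1)) = 0)
    (f : Hom X (Y (p + 1))) (i : ℕ),
    (discDesc X p Y d f i).comp (discD X p i) = (d i).comp (discDesc X p Y d f (i + 1))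
  | 0, _, _, _, _, 0 => rfl
  | 0, _, d, _, f, 1 => (Hom.comp_zero' f).trans (Hom.comp_zero' (d 1)).symm
  | 0, _, d, _, _, i + 2 => (Hom.comp_zero' _).trans (Hom.comp_zero' (d (i + 2))).symm
  | 1, _, _, hd, f, 0 => Hom.ext_apply fun x => (Hom.congr_apply (hd 0) (f.1 x)).symm
  | _ + 2, _, d, _, _, 0 => (Hom.comp_zero' _).trans (Hom.comp_zero' (d 0)).symm
  | p + 1, Y, d, hd, f, i + 1 =>
    discDesc_comm X p (fun i => Y (i + 1)) (fun i => d (i + 1)) (fun i => hd (i + 1)) f i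

theorem discDesc_discIn (X : HopfBimod k H) : ∀ (p : ℕ) (Y : ℕ → HopfBimod k H)
    (d : ∀ i, Hom (Y (i + 1)) (Y i)) (f : Hom X (Y (p + 1))),
    (discDesc X p Y d f (p + 1)).comp (discIn X p) = f
  | 0, _, _, _ => rfl
  | p + 1, Y, d, f => discDesc_discIn X p (fun i => Y (i + 1)) (fun i => d (i + 1)) f

/-- The morphism from a sequence `Y` to `disc X 0` with the given component of degree `0`. -/
def discLift {Y : ℕ → HopfBimod k H} (d : ∀ i, Hom (Y (i + 1)) (Y i)) (f : Hom (Y 0) X) :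
    ∀ i, Hom (Y i) (discObj X 0 i)
  | 0 => f
  | 1 => f.comp (d 0)
  | _ + 2 => 0

theorem discLift_comm {Y : ℕ → HopfBimod k H} (d : ∀ i, Hom (Y (i + 1)) (Y i))
    (hd : (d 0).comp (d 1) = 0) (f : Hom (Y 0) X) :
    ∀ i, (discLift d f i).comp (d i) = (discD X 0 i).comp (discLift d f (i + 1))
  | 0 => rfl
  | 1 => Hom.ext_apply fun x => (congrArg f.1 (Hom.congr_apply hd x)).trans (map_zero f.1)
  | _ + 2 => rfl

/-- The objects of the sequence `X_n / d(X_{n+1}) → X_{n-1} → ⋯ → X_0`. -/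
def truncObj : ∀ (_ : ℕ) (X : ℕ → HopfBimod k H) (_ : ∀ i, Hom (X (i + 1)) (X i)),
    ℕ → HopfBimod k H
  | 0, X, d, 0 => quot (X 0) _ (isSub_range (d 0))
  | 0, _, _, _ + 1 => zeroObj k H
  | _ + 1, X, _, 0 => X 0
  | n + 1, X, d, i + 1 => truncObj n (fun i => X (i + 1)) (fun i => d (i + 1)) i

/-- The morphism from `X_n / d(X_{n+1}) → X_{n-1} → ⋯ → X_0` to a sequence `Y` induced by a morphism
`f` from `X` to `Y` with `f_n d = 0`. -/
def truncDesc : ∀ (n : ℕ) (X Y : ℕ → HopfBimod k H) (d : ∀ i, Hom (X (i + 1)) (X i))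
    (f : ∀ i, Hom (X i) (Y i)) (_ : (f n).comp (d n) = 0) (i : ℕ), Hom (truncObj n X d i) (Y i)
  | 0, _, _, d, f, h, 0 => quotDesc (isSub_range (d 0)) (f 0) <| by
      rintro _ ⟨x, rfl⟩
      exact Hom.congr_apply h x
  | 0, _, _, _, _, _, _ + 1 => 0
  | _ + 1, _, _, _, f, _, 0 => f 0
  | n + 1, X, Y, d, f, h, i + 1 => truncDesc n (fun i => X (i + 1)) (fun i => Y (i + 1))
      (fun i => d (i + 1)) (fun i => f (i + 1)) h i

/-- The maps of the sequence `X_n / d(X_{n+1}) → X_{n-1} → ⋯ → X_0`. -/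
def truncD : ∀ (n : ℕ) (X : ℕ → HopfBimod k H) (d : ∀ i, Hom (X (i + 1)) (X i))
    (_ : ∀ i, (d i).comp (d (i + 1)) = 0) (i : ℕ), Hom (truncObj n X d (i + 1)) (truncObj n X d i)
  | 0, _, _, _, _ => 0
  | 1, X, d, hd, 0 => quotDesc (isSub_range (d 1)) (d 0) <| by
      rintro _ ⟨x, rfl⟩
      exact Hom.congr_apply (hd 0) x
  | _ + 2, _, d, _, 0 => d 0
  | n + 1, X, d, hd, i + 1 =>
    truncD n (fun i => X (i + 1)) (fun i => d (i + 1)) (fun i => hd (i + 1)) i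

theorem truncD_succ (n : ℕ) (X : ℕ → HopfBimod k H) (d : ∀ i, Hom (X (i + 1)) (X i))
    (hd : ∀ i, (d i).comp (d (i + 1)) = 0) (i : ℕ) : truncD (n + 1) X d hd (i + 1) =
      truncD n (fun i => X (i + 1)) (fun i => d (i + 1)) (fun i => hd (i + 1)) i := by
  cases n <;> rfl

theorem truncD_exact : ∀ (n : ℕ) (X : ℕ → HopfBimod k H) (d : ∀ i, Hom (X (i + 1)) (X i))
    (hd : ∀ i, (d i).comp (d (i + 1)) = 0) (_ : ∀ i, Function.Exact (d (i + 1)).1 (d i).1) (i : ℕ),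
    Function.Exact (truncD n X d hd (i + 1)).1 (truncD n X d hd i).1
  | 0, _, _, _, _, _ => fun x =>
    ⟨fun _ => ⟨0, Subsingleton.elim (α := (zeroObj k H).carrier) _ x⟩, fun _ => rfl⟩
  | 1, X, d, hd, he, 0 => fun x => by
    obtain ⟨x, rfl⟩ := quotMk_surjective (isSub_range (d 1)) x
    refine ⟨fun h => ⟨0, Eq.symm ((quotMk_eq_zero _).2 ((he 0 x).1 h))⟩, ?_⟩
    rintro ⟨y, h⟩
    exact (he 0 x).2 ((quotMk_eq_zero (isSub_range (d 1))).1 h.symm)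
  | 2, X, d, hd, he, 0 => fun x => by
    refine (he 0 x).trans ⟨?_, ?_⟩
    · rintro ⟨y, rfl⟩
      exact ⟨(quotMk (isSub_range (d 2))).1 y, rfl⟩
    · rintro ⟨y, rfl⟩
      obtain ⟨y, rfl⟩ := quotMk_surjective (isSub_range (d 2)) y
      exact ⟨y, rfl⟩
  | _ + 3, _, _, _, he, 0 => he 0
  | n + 1, X, d, hd, he, i + 1 => by
    rw [truncD_succ, truncD_succ]
    exact truncD_exact n (fun i => X (i + 1)) (fun i => d (i + 1)) (fun i => hd (i + 1))
      (fun i => he (i + 1)) i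

theorem truncD_surjective : ∀ (n : ℕ) (X : ℕ → HopfBimod k H) (d : ∀ i, Hom (X (i + 1)) (X i))
    (hd : ∀ i, (d i).comp (d (i + 1)) = 0) (_ : Function.Surjective (d 0).1),
    Function.Surjective (truncD (n + 1) X d hd 0).1
  | 0, X, d, _, h => fun y => by
    obtain ⟨x, rfl⟩ := h y
    exact ⟨(quotMk (isSub_range (d 1))).1 x, rfl⟩
  | _ + 1, _, _, _, h => h

theorem subsingleton_truncObj : ∀ (n : ℕ) (X : ℕ → HopfBimod k H)
    (d : ∀ i, Hom (X (i + 1)) (X i)) (i : ℕ) (_ : n < i), Subsingleton (truncObj n X d i).carrier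
  | 0, _, _, 0, h => absurd h (by omega)
  | 0, _, _, _ + 1, _ => inferInstanceAs (Subsingleton (zeroObj k H).carrier)
  | _ + 1, _, _, 0, h => absurd h (by omega)
  | n + 1, X, d, i + 1, h =>
    subsingleton_truncObj n (fun i => X (i + 1)) (fun i => d (i + 1)) i (by omega)

theorem truncDesc_comm : ∀ (n : ℕ) (X Y : ℕ → HopfBimod k H) (d : ∀ i, Hom (X (i + 1)) (X i))
    (d' : ∀ i, Hom (Y (i + 1)) (Y i)) (hd : ∀ i, (d i).comp (d (i + 1)) = 0)
    (f : ∀ i, Hom (X i) (Y i)) (h : (f n).comp (d n) = 0)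
    (_ : ∀ i, (f i).comp (d i) = (d' i).comp (f (i + 1))) (i : ℕ),
    (truncDesc n X Y d f h i).comp (truncD n X d hd i) =
      (d' i).comp (truncDesc n X Y d f h (i + 1))
  | 0, _, _, _, d', _, _, _, _, i => (Hom.comp_zero' _).trans (Hom.comp_zero' (d' i)).symm
  | 1, X, _, d, _, _, _, _, hf, 0 => Hom.ext_apply fun x => by
    obtain ⟨x, rfl⟩ := quotMk_surjective (isSub_range (d 1)) x
    exact Hom.congr_apply (hf 0) x
  | _ + 2, _, _, _, _, _, _, _, hf, 0 => hf 0
  | n + 1, X, Y, d, d', hd, f, h, hf, i + 1 => by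
    rw [truncD_succ]
    exact truncDesc_comm n (fun i => X (i + 1)) (fun i => Y (i + 1)) (fun i => d (i + 1))
      (fun i => d' (i + 1)) (fun i => hd (i + 1)) (fun i => f (i + 1)) h (fun i => hf (i + 1)) i

open Extension

variable {n : ℕ}

theorem Extension.d_comp_d (E : Extension M N n) (i : ℕ) : (E.d i).comp (E.d (i + 1)) = 0 :=
  Hom.comp_eq_zero (E.exact i)

/-- The exact sequence `E_{n-1} / N → E_{n-2} → ⋯ → M` obtained from an extension of degree `n`. -/
def Extension.trunc (E : Extension M N (n + 1)) : ExactSeq k H where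
  obj := truncObj (n + 1) E.obj E.d
  d := truncD (n + 1) E.obj E.d E.d_comp_d
  surjective := truncD_surjective n E.obj E.d E.d_comp_d E.surjective
  exact := truncD_exact (n + 1) E.obj E.d E.d_comp_d E.exact

/-- The objects of the exact sequence `⋯ → E_2 → E_1 → ker(E_0 → M)`, in which the kernel is
realized as the cokernel of `E_2 → E_1`. -/
def Extension.tailObj (E : Extension M N n) : ℕ → HopfBimod k H
  | 0 => zeroObj k H
  | 1 => quot (E.obj 2) _ (isSub_range (E.d 2))
  | i + 2 => E.obj (i + 2)

/-- The exact sequence `⋯ → E_2 → E_1 → ker(E_0 → M)`. -/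
def Extension.tail (E : Extension M N n) : ExactSeq k H where
  obj := E.tailObj
  d
    | 0 => 0
    | 1 => quotMk (isSub_range (E.d 2))
    | i + 2 => E.d (i + 2)
  surjective y := ⟨0, Subsingleton.elim (α := (zeroObj k H).carrier) _ y⟩
  exact
    | 0 => fun y => ⟨fun _ => quotMk_surjective _ y, fun _ => rfl⟩
    | 1 => fun _ => quotMk_eq_zero _
    | i + 2 => E.exact (i + 2)

/-- The inclusion of the kernel of `E_0 → M`. -/
def Extension.kerInc (E : Extension M N n) : Hom (E.tailObj 1) (E.obj 1) :=
  quotDesc (isSub_range (E.d 2)) (E.d 1) <| by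
    rintro _ ⟨x, rfl⟩
    exact (E.exact 1).apply_apply_eq_zero x

theorem Extension.kerInc_injective (E : Extension M N n) : Function.Injective E.kerInc.1 := by
  rw [injective_iff_map_eq_zero]
  intro x h
  obtain ⟨x, rfl⟩ := quotMk_surjective (isSub_range (E.d 2)) x
  exact (quotMk_eq_zero _).2 ((E.exact 1 x).1 h)

/-- A morphism lifts through an injective morphism whose range contains its values. -/
theorem Hom.exists_lift (ι : Hom Y Z) (hι : Function.Injective ι.1) (f : Hom X Z)
    (h : ∀ x, ∃ y, ι.1 y = f.1 x) : ∃ g : Hom X Y, ι.comp g = f := by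
  let e := LinearEquiv.ofInjective ι.1 hι
  let g : X.carrier →ₗ[k] Y.carrier :=
    e.symm.toLinearMap ∘ₗ f.1.codRestrict (LinearMap.range ι.1) h
  have hg : ι.1 ∘ₗ g = f.1 := LinearMap.ext fun x =>
    congrArg Subtype.val (e.apply_symm_apply (f.1.codRestrict (LinearMap.range ι.1) h x))
  exact ⟨⟨g, mem_homs_of_injective ι hι (hg ▸ f.2)⟩, Subtype.ext hg⟩

/-- The direct sum of `E_{n-1} / N → ⋯ → E_0 → M` and of `N = N` in the two leftmost degrees. -/
def Extension.splitLeft (E : Extension M N (n + 1)) : Extension M N (n + 1) :=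
  ofSum E.trunc (disc N (n + 1)) E.right (discIn N (n + 1)) E.bijective_right
    (bijective_discIn N (n + 1)) (subsingleton_truncObj (n + 1) E.obj E.d)
    (inferInstanceAs (Subsingleton (zeroObj k H).carrier)) (subsingleton_discObj N (n + 1))

/-- The direct sum of `N → ⋯ → E_1 → ker(E_0 → M)` and of `M = M` in the two rightmost degrees. -/
def Extension.splitRight (E : Extension M N (n + 1)) : Extension M N (n + 1) :=
  ofSum (disc M 0) E.tail (Hom.id M) E.left Function.bijective_id E.bijective_left
    (fun i hi => subsingleton_discObj M 0 i (by omega))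
    (inferInstanceAs (Subsingleton (zeroObj k H).carrier))
    (fun i hi => by
      obtain ⟨i, rfl⟩ : ∃ j, i = j + 2 := ⟨i - 2, by omega⟩
      exact E.subsingleton (i + 2) hi)

/-- A morphism from `E` to `E'` which is zero on `N` factors through `E_{n-1} / N`, and the map
`N → E'_{n-1}` provides the component on the summand `N = N`. -/
theorem Extension.over_splitLeft {E E' : Extension M N (n + 1)} (h : Over (Hom.id M) 0 E E') :
    Over (Hom.id M) (Hom.id N) E.splitLeft E' := by
  obtain ⟨f, hf, hf₀, hfn⟩ := h
  have hz : f (n + 2) = 0 := Hom.ext_apply fun x => by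
    obtain ⟨y, rfl⟩ := E.bijective_left.surjective x
    exact (Hom.congr_apply hfn y).trans (map_zero E'.left.1)
  have hz' : (f (n + 1)).comp (E.d (n + 1)) = 0 := by
    rw [hf, hz]
    exact Hom.comp_zero' _
  exact over_ofSum_left E' (truncDesc (n + 1) E.obj E'.obj E.d f hz')
    (discDesc N (n + 1) E'.obj E'.d E'.left)
    (truncDesc_comm (n + 1) E.obj E'.obj E.d E'.d E.d_comp_d f hz' hf)
    (discDesc_comm N (n + 1) E'.obj E'.d E'.d_comp_d E'.left) hf₀
    (discDesc_discIn N (n + 1) E'.obj E'.d E'.left)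

/-- A morphism from `E'` to `E` which is zero on `M` has its values in `ker(E_0 → M)` in degree `0`, and
the map `E'_0 → M` provides the component in the summand `M = M`. -/
theorem Extension.over_splitRight {E E' : Extension M N (n + 1)} (h : Over 0 (Hom.id N) E' E) :
    Over (Hom.id M) (Hom.id N) E' E.splitRight := by
  obtain ⟨g, hg, hg₀, hgn⟩ := h
  have hz : g 0 = 0 := Hom.ext_apply fun x => E.bijective_right.injective <|
    (Hom.congr_apply hg₀ x).trans (map_zero E.right.1).symm
  obtain ⟨g₁, hg₁⟩ := E.kerInc.exists_lift E.kerInc_injective (g 1) fun x => by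
    obtain ⟨y, hy⟩ := (E.exact 0 ((g 1).1 x)).1 <|
      (Hom.congr_apply (hg 0) x).symm.trans (Hom.congr_apply hz _)
    exact ⟨(quotMk (isSub_range (E.d 2))).1 y, hy⟩
  let b : ∀ i, Hom (E'.obj i) (E.tailObj i)
    | 0 => 0
    | 1 => g₁
    | i + 2 => g (i + 2)
  have hb : ∀ i, (b i).comp (E'.d i) = (E.tail.d i).comp (b (i + 1))
    | 0 => Hom.ext_apply fun x => rfl
    | 1 => Hom.ext_apply fun x => E.kerInc_injective <|
        (Hom.congr_apply hg₁ _).trans (Hom.congr_apply (hg 1) x)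
    | i + 2 => hg (i + 2)
  exact over_ofSum_right E' (discLift E'.d E'.right) b
    (discLift_comm E'.d (E'.d_comp_d 0) E'.right) hb rfl hgn

theorem Extension.over_splitLeft_splitRight (E : Extension M N (n + 1)) :
    Over (Hom.id M) (Hom.id N) E.splitLeft E.splitRight := by
  have ha := discLift_comm E.trunc.d (Hom.comp_eq_zero (E.trunc.exact 0)) (X := M) E.right
  have hb := discDesc_comm N (n + 1) E.tail.obj E.tail.d
    (fun i => Hom.comp_eq_zero (E.tail.exact i)) E.left
  refine over_ofSum_left E.splitRight (fun i => (inl _ _).comp (discLift E.trunc.d E.right i))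
    (fun i => (inr _ _).comp (discDesc N (n + 1) E.tail.obj E.tail.d E.left i))
    (fun i => Hom.ext_apply fun x => ?_) (fun i => Hom.ext_apply fun y => ?_)
    (Hom.ext_apply fun x => fst_inl _)
    (congrArg (Hom.comp (inr _ _)) (discDesc_discIn N (n + 1) E.tail.obj E.tail.d E.left))
  · exact (congrArg (inl _ _).1 (Hom.congr_apply (ha i) x)).trans
      (ExactSeq.sum_d_inl (disc M 0) E.tail i _).symm
  · exact (congrArg (inr _ _).1 (Hom.congr_apply (hb i) y)).trans
      (ExactSeq.sum_d_inr (disc M 0) E.tail i _).symm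

/-- If `E` maps to `E'` by the identity of `M` and zero on `N`, and `E''` maps to `E` by zero on `M`
and the identity of `N`, then `E'` and `E''` have the same class. -/
theorem Ext.mk_eq_of_over_zero {E E' E'' : Extension M N (n + 1)} (h' : Over (Hom.id M) 0 E E')
    (h'' : Over 0 (Hom.id N) E'' E) : Ext.mk E' = Ext.mk E'' :=
  (Quot.sound (over_splitLeft h')).symm.trans
    ((Quot.sound E.over_splitLeft_splitRight).trans (Quot.sound (over_splitRight h'')).symm)

/-- If `E` maps to `E'` by the identity of `M` and a nonzero scalar `c` on `N`, and `E''` maps to `E`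
by `c` on `M` and the identity of `N`, then `E'` and `E''` have the same class. -/
theorem Ext.mk_eq_of_over_smul {E E' E'' : Extension M N n} {c : k} (hc : c ≠ 0)
    (h' : Over (Hom.id M) (c • Hom.id N) E E') (h'' : Over (c • Hom.id M) (Hom.id N) E'' E) :
    Ext.mk E' = Ext.mk E'' := by
  obtain ⟨f, hf, hf₀, hfn⟩ := h'
  obtain ⟨g, hg, hg₀, hgn⟩ := h''
  refine (Quot.sound ⟨fun i => c⁻¹ • (f i).comp (g i), fun i => Hom.ext_apply fun x => ?_,
    Hom.ext_apply fun x => ?_, Hom.ext_apply fun y => ?_⟩).symm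
  · change c⁻¹ • (f i).1 ((g i).1 ((E''.d i).1 x)) =
      (E'.d i).1 (c⁻¹ • (f (i + 1)).1 ((g (i + 1)).1 x))
    rw [map_smul]
    refine congrArg (c⁻¹ • ·) ?_
    exact (congrArg (f i).1 (Hom.congr_apply (hg i) x)).trans (Hom.congr_apply (hf i) _)
  · change E'.right.1 (c⁻¹ • (f 0).1 ((g 0).1 x)) = E''.right.1 x
    have h₁ : E.right.1 ((g 0).1 x) = c • E''.right.1 x := Hom.congr_apply hg₀ x
    have h₂ : E'.right.1 ((f 0).1 ((g 0).1 x)) = E.right.1 ((g 0).1 x) :=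
      Hom.congr_apply hf₀ ((g 0).1 x)
    rw [map_smul, h₂, h₁, inv_smul_smul₀ hc]
  · change c⁻¹ • (f (n + 1)).1 ((g (n + 1)).1 (E''.left.1 y)) = E'.left.1 y
    have h₁ : (g (n + 1)).1 (E''.left.1 y) = E.left.1 y := Hom.congr_apply hgn y
    have h₂ : (f (n + 1)).1 (E.left.1 y) = E'.left.1 (c • y) := Hom.congr_apply hfn y
    rw [h₁, h₂, map_smul, inv_smul_smul₀ hc]

/-- The endomorphisms of the Hopf bimodule `H` commute. -/
theorem Hom.comp_comm_regular (φ ψ : Hom (regular k H) (regular k H)) :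
    φ.comp ψ = ψ.comp φ := by
  have h₁ : ∀ (χ : Hom (regular k H) (regular k H)) (a : H), χ.1 a = (a * χ.1 (1 : H) : H) :=
    fun χ a => (congrArg χ.1 (mul_one (M := H) a)).symm.trans (χ.2.1 a (1 : H))
  refine Hom.ext_apply fun a => ?_
  change φ.1 (ψ.1 a) = ψ.1 (φ.1 a)
  rw [h₁ φ (ψ.1 a), h₁ φ a]
  exact (ψ.2.2.1 (φ.1 (1 : H)) a).symm

/-- The endomorphisms of the Hopf bimodule `H` are the multiplications by the scalars: the image `c`
of `1` satisfies `Δ(c) = 1 ⊗ c`, so that `c = ε(c) 1`. -/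
theorem Hom.exists_eq_smul_id (φ : Hom (regular k H) (regular k H)) :
    ∃ c : k, φ = c • Hom.id (regular k H) := by
  let c : H := φ.1 (1 : H)
  have h₁ : Coalgebra.comul (R := k) c = 1 ⊗ₜ[k] c := by
    refine (φ.2.2.2.1 (1 : H)).trans ?_
    rw [show (regular k H).coactL (1 : H) = (1 : H) ⊗ₜ[k] (1 : H) from Bialgebra.comul_one]
    rfl
  have h₂ : c = Coalgebra.counit (R := k) c • (1 : H) := by
    have := (regular k H).counit_coactR c
    rw [show (regular k H).coactR c = (1 : H) ⊗ₜ[k] c from h₁] at this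
    exact this.symm.trans (TensorProduct.rid_tmul _ _)
  refine ⟨Coalgebra.counit (R := k) c, Hom.ext_apply fun a => ?_⟩
  have h₃ : φ.1 a = (a * c : H) :=
    (congrArg φ.1 (mul_one (M := H) a)).symm.trans (φ.2.1 a (1 : H))
  refine (h₃.trans (congrArg (fun b : H => a * b) h₂)).trans ?_
  exact (mul_smul_comm _ a (1 : H)).trans (congrArg _ (mul_one (M := H) a))

/-- The two products of an endomorphism of `H` and of the class of an extension coincide. -/
theorem Ext.mk_eq_of_over {n : ℕ} (hn : 1 ≤ n) (φ : Hom (regular k H) (regular k H))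
    {E E' E'' : Extension (regular k H) (regular k H) n} (h' : Over (Hom.id _) φ E E')
    (h'' : Over φ (Hom.id _) E'' E) : Ext.mk E' = Ext.mk E'' := by
  obtain ⟨c, rfl⟩ := φ.exists_eq_smul_id
  obtain ⟨n, rfl⟩ := Nat.exists_eq_succ_of_ne_zero (show n ≠ 0 by omega)
  by_cases hc : c = 0
  · rw [hc, zero_smul] at h' h''
    exact Ext.mk_eq_of_over_zero h' h''
  · exact Ext.mk_eq_of_over_smul hc h' h''

end ZeroProduct

end HopfBimod
end

theorem mainTheorem3 {k : Type u} {H : Type v} [Field k] [Ring H] [HopfAlgebra k H] :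
    -- `F ♯ E` and `(-1)^{mn} E ♯ F` have the same class
    (∀ m n : ℕ, 1 ≤ m → 1 ≤ n →
      ∀ (E : HopfBimod.Extension (HopfBimod.regular k H) (HopfBimod.regular k H) m)
        (F : HopfBimod.Extension (HopfBimod.regular k H) (HopfBimod.regular k H) n),
        HopfBimod.Ext.mk (F.splice E (rfl : m + n = m + n)) =
          HopfBimod.Ext.mk ((E.splice F (Nat.add_comm n m)).twist ((-1) ^ (m * n)))) ∧
    -- the Yoneda product is graded-commutative in positive degrees
    (∀ m n : ℕ, 1 ≤ m → 1 ≤ n →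
      ∀ (x : HopfBimod.Ext (HopfBimod.regular k H) (HopfBimod.regular k H) m)
        (y : HopfBimod.Ext (HopfBimod.regular k H) (HopfBimod.regular k H) n),
        HopfBimod.Ext.yoneda (rfl : m + n = m + n) y x =
          HopfBimod.Ext.twist ((-1) ^ (m * n)) (HopfBimod.Ext.yoneda (Nat.add_comm n m) x y)) ∧
    -- the elements of degree `0` commute with each other
    (∀ φ ψ : HopfBimod.Hom (HopfBimod.regular k H) (HopfBimod.regular k H),
      φ.comp ψ = ψ.comp φ) ∧
    -- the two products of an element of degree `0` and an element of degree `n` coincide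
    (∀ n : ℕ, 1 ≤ n → ∀ (φ : HopfBimod.Hom (HopfBimod.regular k H) (HopfBimod.regular k H))
      (E E' E'' : HopfBimod.Extension (HopfBimod.regular k H) (HopfBimod.regular k H) n),
      HopfBimod.Extension.Over (HopfBimod.Hom.id _) φ E E' →
      HopfBimod.Extension.Over φ (HopfBimod.Hom.id _) E'' E →
      HopfBimod.Ext.mk E' = HopfBimod.Ext.mk E'') ∧
    -- the cup product of cochains induces a graded-commutative product on cohomology
    ∃ cup : ∀ p q l : ℕ, p + q = l →
        HopfBimod.Hb (HopfBimod.regular k H) (HopfBimod.regular k H) p →ₗ[k]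
        HopfBimod.Hb (HopfBimod.regular k H) (HopfBimod.regular k H) q →ₗ[k]
        HopfBimod.Hb (HopfBimod.regular k H) (HopfBimod.regular k H) l,
      (∀ (p q l : ℕ) (h : p + q = l)
        (f : HopfBimod.Cochain.cocycles (HopfBimod.regular k H) (HopfBimod.regular k H) p)
        (g : HopfBimod.Cochain.cocycles (HopfBimod.regular k H) (HopfBimod.regular k H) q),
        ∃ hfg : HopfBimod.Cochain.cup f.1 g.1 ∈
            HopfBimod.Cochain.cocycles (HopfBimod.regular k H) (HopfBimod.regular k H) l,
          cup p q l h (HopfBimod.Hb.mk _ _ p f) (HopfBimod.Hb.mk _ _ q g) =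
            HopfBimod.Hb.mk _ _ l ⟨_, hfg⟩) ∧
      ∀ (p q l : ℕ) (h : p + q = l) (h' : q + p = l)
        (x : HopfBimod.Hb (HopfBimod.regular k H) (HopfBimod.regular k H) p)
        (y : HopfBimod.Hb (HopfBimod.regular k H) (HopfBimod.regular k H) q),
        cup q p l h' y x = (-1 : k) ^ (p * q) • cup p q l h x y := by
  exact ⟨fun m n hm hn E F => HopfBimod.Ext.mk_splice E F hm hn,
    fun m n hm hn x y => HopfBimod.Ext.yoneda_comm hm hn x y,
    HopfBimod.Hom.comp_comm_regular,
    fun n hn φ E E' E'' h' h'' => HopfBimod.Ext.mk_eq_of_over hn φ h' h'',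
    HopfBimod.Hb.exists_comm_cup k H⟩
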